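/- Let $k$ be a field of characteristic $0$, let $\Lambda=k[[\hbar]]$ with $\hbar$ in degree $0$, and let all gradings be by $\mathbb Z$, with the Koszul sign rule. **Parameter rings.** A *parameter ring* is a differential graded, graded commutative $\Lambda$-algebra $A$ (unital, with a $\Lambda$-linear differential of degree $+1$) with a two-sided ideal $\mathfrak m_A$ such that $A/\mathfrak m_A=k$, $\mathfrak m_A$ is nilpotent, $A$ is a finitely generated $\Lambda$-module, and $1$ is not exact. A morphism is a $\Lambda$-linear morphism of differential graded algebras with $f(\mathfrak m_A)\subseteq\mathfrak m_B$. Let $k[u,v]$ be the algebra of polynomial differential forms on the line ($|u|=0$, $v=du$). For parameter rings, $f,g:A\to B$ are *homotopic* if there is a morphism $H:A\to B\otimes_k k[u,v]$ of differential graded $\Lambda$-algebras which sends $\mathfrak m_A$ into $\mathfrak m_B\otimes k[u,v]$ and has values $f$ at $(u,v)=(0,0)$ and $g$ at $(u,v)=(1,0)$. A *complete parameter ring* is a tower of parameter rings $A_n$ ($n\ge 0$) with $\mathfrak m_{A_n}^{n+1}=0$ and surjective morphisms $A_{n+1}\to A_n$ with kernel $\mathfrak m_{A_{n+1}}^{n+1}$;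 we write $A=\lim A_n$ and $A_n=A/\mathfrak m_A^{n+1}$. Morphisms and homotopies between complete parameter rings are compatible families of morphisms and homotopies between the $A_n$. **Backgrounds.** A *background* $B=(P,N,m,\varphi)$ consists of: a graded associative unital $\Lambda$-algebra $P$ without $\hbar$-torsion such that $P/\hbar P$ is graded commutative; a graded left $P$-module $N$ without $\hbar$-torsion; an element $m\in P^1$ with $m^2=0$; and an element $\varphi\in N^0$ (the vacuum) with $m\varphi=0$. We assume that $N/P\varphi$ has no $\hbar$-torsion. Let $[-,-]$ denote the graded commutator; then $[-,-]/\hbar$ is a well defined bracket on $P$, which we extend to $P\otimes_\Lambda A$ with the Koszul sign. **The functors.** For a parameter ring $A$ let $QM_B(A)$ be the set of $\pi\in(P\otimes_\Lambda\mathfrak m_A)^0$, taken inside $P\otimes_\Lambda A$, that solve the quantum master equation $$\bigl(e^{\pi/\hbar}\,m\,e^{-\pi/\hbar}-\hbar\,e^{\pi/\hbar}\,d(e^{-\pi/\hbar})\bigr)\varphi=0\quad\text{in } N\otimes_\Lambda A,$$ where the expression in brackets means the (finite) sum $\sum_{j\ge0}\frac1{j!}\mathrm{ad}_\pi^j(m)+\sum_{j\ge0}\frac1{(j+1)!}\mathrm{ad}_\pi^j(d\pi)$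 with $\mathrm{ad}_\pi=[\pi,-]/\hbar$ and with $d$ the differential of $A$. Two solutions $\pi_0,\pi_1$ are homotopic if there is a solution of the same equation in $P\otimes_\Lambda(\mathfrak m_A\otimes k[u,v])$ of degree $0$ whose values at $(0,0)$ and $(1,0)$ are $\pi_0$ and $\pi_1$. $QFT_B(A)$ is the quotient of $QM_B(A)$ by the equivalence relation generated by homotopy. For a complete parameter ring $A$ put $QM_B(A)=\lim QM_B(A_n)$ and $QFT_B(A)=\lim QFT_B(A_n)$. **Homology.** For $i\in\mathbb Z$ let $E_i=k\oplus k\epsilon$ with $\epsilon^2=0$, $|\epsilon|=-i$, $\hbar$ acting as $0$, and zero differential. The set $QFT_B(E_i)$ is a $k$-vector space under addition and scaling of solutions; put $H(B)=T_{QFT_B}=\bigoplus_i QFT_B(E_i)$, the elements of the $i$-th summand having degree $i$. **Homotopy representability.** For a complete parameter ring $R$ and $\Pi\in QM_B(R)$, the functor $QFT_B$ is *homotopy represented* by $(R,\Pi)$ if homotopic morphisms of complete parameter rings induce the same map on $QFT_B$, and if for every complete parameter ring $A$, and likewise for every parameter ring $A$ (where a morphism $R\to A$ with $\mathfrak m_A^{n+1}=0$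 means a morphism $R/\mathfrak m_R^{n+1}\to A$), every element of $QFT_B(A)$ is $\tau_*[\Pi]$ for some morphism $\tau:R\to A$, and $\tau_*[\Pi]=\tau'_*[\Pi]$ if and only if $\tau$ and $\tau'$ are homotopic. **Theorem.** Suppose that $H(B)$ is finite dimensional, and let $\xi_1,\dots,\xi_r$ be a basis of $H(B)$ with $\xi_j$ homogeneous of degree $d_j$. Let $k[[\hbar]][[t_1,\dots,t_r]]$ be the graded commutative power series algebra on variables $t_j$ of degree $-d_j$ (even variables commute, odd ones anticommute), with maximal ideal $\mathfrak m_R$ generated by $\hbar,t_1,\dots,t_r$. Then there are a $\Lambda$-linear derivation $\delta$ of degree $1$ on $k[[\hbar]][[t_1,\dots,t_r]]$ with $\delta^2=0$ and $\delta(\mathfrak m_R)\subseteq\mathfrak m_R^2$, making it a complete parameter ring $R=(k[[\hbar]][[t_1,\dots,t_r]],\delta)$ whose $n$-th term is the quotient by $\mathfrak m_R^{n+1}$, and a solution $\Pi\in QM_B(R)$, such that $QFT_B$ is homotopy represented by $(R,\Pi)$. Moreover the $t_j$ are dual to the $\xi_j$ with respect to $\Pi$: for each $j$, the morphism $\theta_j:R\to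 E_{d_j}$ with $t_l\mapsto\delta_{lj}\,\epsilon$ (Kronecker delta) satisfies $\theta_{j*}[\Pi]=\xi_j$. -/

import Mathlib

open scoped TensorProduct DirectSum Polynomial

universe u v w

noncomputable section

namespace QBackground

/-- The ground ring `Λ = k[[ħ]]`. -/
abbrev Lam (k : Type u) [Field k] : Type u := PowerSeries k

/-- The element `ħ` of `Λ`. -/
abbrev hbar (k : Type u) [Field k] : Lam k := PowerSeries.X

/-- The sign `(-1)^i`. -/
def sgn (i : ℤ) : ℤ := (i.negOnePow : ℤ)

theorem sgn_zero : sgn 0 = 1 := by simp [sgn]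

theorem sgn_add (i j : ℤ) : sgn (i + j) = sgn i * sgn j := by
  simp [sgn, Int.negOnePow_add]

theorem sgn_succ (i : ℤ) : sgn (i + 1) = - sgn i := by
  simp [sgn, Int.negOnePow_succ]

theorem sgn_pred (i : ℤ) : sgn (i - 1) = - sgn i := by
  rw [eq_neg_iff_add_eq_zero, ← neg_eq_iff_add_eq_zero, ← sgn_succ, sub_add_cancel]

theorem sgn_mul_self (i : ℤ) : sgn i * sgn i = 1 := by
  simp [sgn, ← Units.val_mul, Int.units_mul_self]

section Weights

variable {R : Type u} {M : Type v} [CommRing R] [AddCommGroup M] [Module R M]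

/-- On a graded module `M = ⨁ i, gr i`, the linear map that multiplies `gr i` by the integer
`c i`. -/
def weight {gr : ℤ → Submodule R M} (h : DirectSum.IsInternal gr) (c : ℤ → ℤ) : M →ₗ[R] M :=
  DirectSum.coeLinearMap gr ∘ₗ DirectSum.lmap (fun i => c i • LinearMap.id) ∘ₗ
    (LinearEquiv.ofBijective (DirectSum.coeLinearMap gr) h).symm.toLinearMap

theorem weight_of_mem {gr : ℤ → Submodule R M} (h : DirectSum.IsInternal gr) (c : ℤ → ℤ)
    {i : ℤ} {x : M} (hx : x ∈ gr i) : weight h c x = c i • x := by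
  have h1 : (LinearEquiv.ofBijective (DirectSum.coeLinearMap gr) h).symm x
      = DirectSum.lof R ℤ (fun i => gr i) i ⟨x, hx⟩ := by
    rw [LinearEquiv.symm_apply_eq]
    exact (DirectSum.coeLinearMap_lof gr i ⟨x, hx⟩).symm
  simp only [weight, LinearMap.comp_apply, LinearEquiv.coe_coe, h1, DirectSum.lmap_lof]
  rw [DirectSum.coeLinearMap_lof]
  simp

theorem graded_ind {gr : ℤ → Submodule R M} (h : DirectSum.IsInternal gr) {p : M → Prop}
    (h0 : p 0) (hadd : ∀ x y, p x → p y → p (x + y)) (hmem : ∀ i, ∀ x ∈ gr i, p x) (x : M) :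
    p x := by
  have hx : x ∈ ⨆ i, gr i := by rw [h.submodule_iSup_eq_top]; trivial
  exact Submodule.iSup_induction gr (motive := p) hx hmem h0 hadd

/-- The parity involution: `(-1)^i` on `gr i`. -/
def parity {gr : ℤ → Submodule R M} (h : DirectSum.IsInternal gr) : M →ₗ[R] M := weight h sgn

/-- The projection to the part of even degree. -/
def evenPart {gr : ℤ → Submodule R M} (h : DirectSum.IsInternal gr) : M →ₗ[R] M :=
  weight h (fun i => if Even i then 1 else 0)

/-- The projection to the part of odd degree. -/
def oddPart {gr : ℤ → Submodule R M} (h : DirectSum.IsInternal gr) : M →ₗ[R] M :=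
  weight h (fun i => if Even i then 0 else 1)

theorem parity_of_mem {gr : ℤ → Submodule R M} (h : DirectSum.IsInternal gr)
    {i : ℤ} {x : M} (hx : x ∈ gr i) : parity h x = sgn i • x := weight_of_mem h _ hx

end Weights

/-- A differential graded, graded commutative, associative, unital `k[[ħ]]`-algebra
(the differential of `k[[ħ]]` is zero, so `d` is `k[[ħ]]`-linear). -/
structure DGAlg (k : Type u) [Field k] : Type (u + 1) where
  carrier : Type u
  [ring : Ring carrier]
  [algebra : Algebra (Lam k) carrier]
  gr : ℤ → Submodule (Lam k) carrier
  gr_internal : DirectSum.IsInternal gr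
  one_mem : (1 : carrier) ∈ gr 0
  mul_mem : ∀ {i j : ℤ} {a b : carrier}, a ∈ gr i → b ∈ gr j → a * b ∈ gr (i + j)
  gcomm : ∀ {i j : ℤ} {a b : carrier}, a ∈ gr i → b ∈ gr j → a * b = sgn (i * j) • (b * a)
  d : carrier →ₗ[Lam k] carrier
  d_mem : ∀ {i : ℤ} {a : carrier}, a ∈ gr i → d a ∈ gr (i + 1)
  leibniz : ∀ {i : ℤ} {a : carrier}, a ∈ gr i → ∀ b, d (a * b) = d a * b + sgn i • (a * d b)
  d_d : ∀ a, d (d a) = 0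

attribute [instance] DGAlg.ring DGAlg.algebra

namespace DGAlg

variable {k : Type u} [Field k]

/-- The parity involution of a differential graded algebra. -/
abbrev par (A : DGAlg k) : A.carrier →ₗ[Lam k] A.carrier := parity A.gr_internal

theorem par_mul (A : DGAlg k) (a b : A.carrier) : A.par (a * b) = A.par a * A.par b := by
  refine graded_ind A.gr_internal (p := fun a => A.par (a * b) = A.par a * A.par b)
    (by simp) (fun x y hx hy => by simp [add_mul, hx, hy]) (fun i a ha => ?_) a
  refine graded_ind A.gr_internal (p := fun b => A.par (a * b) = A.par a * A.par b)
    (by simp) (fun x y hx hy => by simp [mul_add, hx, hy]) (fun j b hb => ?_) b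
  rw [par, parity_of_mem _ ha, parity_of_mem _ hb, parity_of_mem _ (A.mul_mem ha hb)]
  rw [sgn_add, mul_smul, smul_mul_assoc, mul_smul_comm]

theorem par_one (A : DGAlg k) : A.par 1 = 1 := by
  rw [par, parity_of_mem _ A.one_mem, sgn_zero, one_smul]

theorem par_par (A : DGAlg k) (a : A.carrier) : A.par (A.par a) = a := by
  refine graded_ind A.gr_internal (p := fun a => A.par (A.par a) = a)
    (by simp) (fun x y hx hy => by simp [hx, hy]) (fun i a ha => ?_) a
  rw [par, parity_of_mem _ ha, map_zsmul, parity_of_mem _ ha, smul_smul,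
    sgn_mul_self, one_smul]

theorem par_d (A : DGAlg k) (a : A.carrier) : A.par (A.d a) = - A.d (A.par a) := by
  refine graded_ind A.gr_internal (p := fun a => A.par (A.d a) = - A.d (A.par a))
    (by simp) (fun x y hx hy => by simp [hx, hy]; abel) (fun i a ha => ?_) a
  rw [par, parity_of_mem _ ha, parity_of_mem _ (A.d_mem ha), sgn_succ, map_zsmul, neg_smul]

theorem leibniz' (A : DGAlg k) (a b : A.carrier) :
    A.d (a * b) = A.d a * b + A.par a * A.d b := by
  refine graded_ind A.gr_internal (p := fun a => A.d (a * b) = A.d a * b + A.par a * A.d b)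
    (by simp) (fun x y hx hy => by simp [add_mul, hx, hy]; abel) (fun i a ha => ?_) a
  rw [A.leibniz ha, par, parity_of_mem _ ha, smul_mul_assoc]

/-- The parity involution as an algebra map. -/
def parHom (A : DGAlg k) : A.carrier →ₐ[Lam k] A.carrier :=
  AlgHom.ofLinearMap A.par A.par_one A.par_mul


/-- The underlying module of `A ⊗ k[u, v]`, where `deg u = 0` and `deg v = 1`: the pair
`(a, b)` of polynomials in `u` with coefficients in `A` stands for `a(u) + b(u) v`. -/
def PolyForm (A : DGAlg k) : Type u := A.carrier[X] × A.carrier[X]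

namespace PolyForm

variable {A : DGAlg k}

instance : AddCommGroup (PolyForm A) := inferInstanceAs (AddCommGroup (A.carrier[X] × A.carrier[X]))

instance : Module (Lam k) (PolyForm A) :=
  inferInstanceAs (Module (Lam k) (A.carrier[X] × A.carrier[X]))

@[ext] theorem ext {x y : PolyForm A} (h1 : x.1 = y.1) (h2 : x.2 = y.2) : x = y := Prod.ext h1 h2

@[simp] theorem fst_add (x y : PolyForm A) : (x + y).1 = x.1 + y.1 := rfl
@[simp] theorem snd_add (x y : PolyForm A) : (x + y).2 = x.2 + y.2 := rfl
@[simp] theorem fst_zero : (0 : PolyForm A).1 = 0 := rfl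
@[simp] theorem snd_zero : (0 : PolyForm A).2 = 0 := rfl
@[simp] theorem fst_smul (c : Lam k) (x : PolyForm A) : (c • x).1 = c • x.1 := rfl
@[simp] theorem snd_smul (c : Lam k) (x : PolyForm A) : (c • x).2 = c • x.2 := rfl
@[simp] theorem fst_zsmul (c : ℤ) (x : PolyForm A) : (c • x).1 = c • x.1 := rfl
@[simp] theorem snd_zsmul (c : ℤ) (x : PolyForm A) : (c • x).2 = c • x.2 := rfl

/-- The parity involution of `A`, applied to the coefficients of a polynomial. -/
def parPoly (A : DGAlg k) : A.carrier[X] →ₐ[Lam k] A.carrier[X] := Polynomial.mapAlgHom A.parHom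

@[simp] theorem coeff_parPoly (p : A.carrier[X]) (n : ℕ) :
    (parPoly A p).coeff n = A.par (p.coeff n) := by
  simp [parPoly, parHom]

/-- `(a + b v) (a' + b' v) = a a' + (a b' + b σ(a')) v`, with `σ` the parity involution: this is
`v a' = (-1)^|a'| a' v` and `v^2 = 0`. -/
instance : Mul (PolyForm A) := ⟨fun x y => (x.1 * y.1, x.1 * y.2 + x.2 * parPoly A y.1)⟩

instance : One (PolyForm A) := ⟨(1, 0)⟩

@[simp] theorem fst_mul (x y : PolyForm A) : (x * y).1 = x.1 * y.1 := rfl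
@[simp] theorem snd_mul (x y : PolyForm A) : (x * y).2 = x.1 * y.2 + x.2 * parPoly A y.1 := rfl
@[simp] theorem fst_one : (1 : PolyForm A).1 = 1 := rfl
@[simp] theorem snd_one : (1 : PolyForm A).2 = 0 := rfl

instance : Ring (PolyForm A) where
  __ := (inferInstance : AddCommGroup (PolyForm A))
  mul_assoc x y z := by
    ext1
    · simp [mul_assoc]
    · simp [mul_add, add_mul, mul_assoc, add_assoc]
  one_mul x := by ext1 <;> simp
  mul_one x := by ext1 <;> simp
  left_distrib x y z := by
    ext1
    · simp [mul_add]
    · simp [mul_add]; abel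
  right_distrib x y z := by
    ext1
    · simp [add_mul]
    · simp [add_mul]; abel
  zero_mul x := by ext1 <;> simp
  mul_zero x := by ext1 <;> simp

instance : Algebra (Lam k) (PolyForm A) :=
  Algebra.ofModule (fun r x y => by ext1 <;> simp) (fun r x y => by ext1 <;> simp)

/-- The element `a u^n + b u^n v`. -/
def mono (n : ℕ) (a b : A.carrier) : PolyForm A := (Polynomial.monomial n a, Polynomial.monomial n b)

/-- The elements of degree `i`: `a(u) + b(u) v` with the coefficients of `a` in degree `i`, and
those of `b` in degree `i - 1`. -/
def gr (A : DGAlg k) (i : ℤ) : Submodule (Lam k) (PolyForm A) where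
  carrier := {x | ∀ n, x.1.coeff n ∈ A.gr i ∧ x.2.coeff n ∈ A.gr (i - 1)}
  add_mem' hx hy n := by
    simpa using ⟨add_mem (hx n).1 (hy n).1, add_mem (hx n).2 (hy n).2⟩
  zero_mem' n := by simp
  smul_mem' c x hx n := by
    simpa using ⟨Submodule.smul_mem _ c (hx n).1, Submodule.smul_mem _ c (hx n).2⟩

theorem mem_gr {i : ℤ} {x : PolyForm A} :
    x ∈ gr A i ↔ ∀ n, x.1.coeff n ∈ A.gr i ∧ x.2.coeff n ∈ A.gr (i - 1) := Iff.rfl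

/-- The coefficientwise differential of `A`. -/
def dPoly (A : DGAlg k) : A.carrier[X] →ₗ[Lam k] A.carrier[X] :=
  have h : ∀ (p : A.carrier[X]) (n : ℕ),
      (p.sum fun n a => Polynomial.monomial n (A.d a)).coeff n = A.d (p.coeff n) := fun p n => by
    simp +contextual [Polynomial.sum_def, Polynomial.coeff_monomial]
  { toFun := fun p => p.sum fun n a => Polynomial.monomial n (A.d a)
    map_add' := fun p q => by ext n; simp only [Polynomial.coeff_add, h, map_add]
    map_smul' := fun c p => by
      ext n; simp only [Polynomial.coeff_smul, h, map_smul, RingHom.id_apply] }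

@[simp] theorem coeff_dPoly (p : A.carrier[X]) (n : ℕ) : (dPoly A p).coeff n = A.d (p.coeff n) := by
  simp +contextual [dPoly, Polynomial.sum_def, Polynomial.coeff_monomial]

/-- The derivative with respect to `u`. -/
def deriv (A : DGAlg k) : A.carrier[X] →ₗ[Lam k] A.carrier[X] :=
  Polynomial.derivative.restrictScalars (Lam k)

theorem coeff_deriv (p : A.carrier[X]) (n : ℕ) :
    (deriv A p).coeff n = p.coeff (n + 1) * (n + 1) := Polynomial.coeff_derivative p n

theorem deriv_mul (p q : A.carrier[X]) : deriv A (p * q) = deriv A p * q + p * deriv A q :=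
  Polynomial.derivative_mul

/-- The differential `d (a + b v) = d_A a + (d_A b + σ(∂a/∂u)) v`: that is, `d_A` on the
coefficients, `d u = v`, `d v = 0`, and the sign `(-1)^|a|` for moving `d` past `a`. -/
def diff (A : DGAlg k) : PolyForm A →ₗ[Lam k] PolyForm A :=
  LinearMap.prod (dPoly A ∘ₗ LinearMap.fst _ _ _)
    (dPoly A ∘ₗ LinearMap.snd _ _ _ +
      (parPoly A).toLinearMap ∘ₗ deriv A ∘ₗ LinearMap.fst _ _ _)

@[simp] theorem fst_diff (x : PolyForm A) : (diff A x).1 = dPoly A x.1 := rfl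
@[simp] theorem snd_diff (x : PolyForm A) :
    (diff A x).2 = dPoly A x.2 + parPoly A (deriv A x.1) := rfl

theorem dPoly_mul (p q : A.carrier[X]) :
    dPoly A (p * q) = dPoly A p * q + parPoly A p * dPoly A q := by
  ext n
  simp [Polynomial.coeff_mul, leibniz', Finset.sum_add_distrib]

theorem dPoly_dPoly (p : A.carrier[X]) : dPoly A (dPoly A p) = 0 := by
  ext n; simp [A.d_d]

theorem parPoly_parPoly (p : A.carrier[X]) : parPoly A (parPoly A p) = p := by
  ext n; simp [par_par]

theorem dPoly_parPoly (p : A.carrier[X]) : parPoly A (dPoly A p) = - dPoly A (parPoly A p) := by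
  ext n; simp [par_d]

theorem deriv_parPoly (p : A.carrier[X]) : deriv A (parPoly A p) = parPoly A (deriv A p) := by
  ext n
  simp only [coeff_deriv, coeff_parPoly]
  rw [← Nat.cast_succ, ← nsmul_eq_mul', ← nsmul_eq_mul', map_nsmul]

theorem deriv_dPoly (p : A.carrier[X]) : deriv A (dPoly A p) = dPoly A (deriv A p) := by
  ext n
  simp only [coeff_deriv, coeff_dPoly]
  rw [← Nat.cast_succ, ← nsmul_eq_mul', ← nsmul_eq_mul', map_nsmul]

theorem diff_diff (x : PolyForm A) : diff A (diff A x) = 0 := by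
  ext1
  · simp [dPoly_dPoly]
  · simp [dPoly_dPoly, deriv_dPoly, dPoly_parPoly]

theorem parPoly_of_gr {i : ℤ} {p : A.carrier[X]} (h : ∀ n, p.coeff n ∈ A.gr i) :
    parPoly A p = sgn i • p := by
  ext n
  simp only [coeff_parPoly, Polynomial.coeff_smul]
  exact parity_of_mem _ (h n)

theorem diff_mul {i : ℤ} {x : PolyForm A} (hx : x ∈ gr A i) (y : PolyForm A) :
    diff A (x * y) = diff A x * y + sgn i • (x * diff A y) := by
  have h1 : parPoly A x.1 = sgn i • x.1 := parPoly_of_gr fun n => (hx n).1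
  have h2 : parPoly A x.2 = -(sgn i • x.2) := by
    rw [parPoly_of_gr fun n => (hx n).2, sgn_pred, neg_smul]
  ext1
  · simp only [fst_diff, fst_mul, dPoly_mul, h1, fst_add, fst_zsmul, smul_mul_assoc]
  · simp only [snd_diff, fst_mul, snd_mul, map_add, dPoly_mul, deriv_mul, map_mul, h1, h2,
      snd_add, fst_diff, snd_zsmul, smul_add, mul_add, add_mul, dPoly_parPoly,
      smul_mul_assoc, neg_mul, mul_neg, smul_neg]
    abel

theorem mul_mem_gr {i j : ℤ} {x y : PolyForm A} (hx : x ∈ gr A i) (hy : y ∈ gr A j) :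
    x * y ∈ gr A (i + j) := by
  intro n
  constructor
  · simp only [fst_mul, Polynomial.coeff_mul]
    exact sum_mem fun c _ => A.mul_mem (hx _).1 (hy _).1
  · simp only [snd_mul, Polynomial.coeff_add, Polynomial.coeff_mul, coeff_parPoly]
    refine add_mem (sum_mem fun c _ => ?_) (sum_mem fun c _ => ?_)
    · rw [add_sub_assoc]; exact A.mul_mem (hx _).1 (hy _).2
    · rw [par, parity_of_mem _ (hy _).1, mul_smul_comm, add_sub_right_comm]
      exact zsmul_mem (A.mul_mem (hx _).2 (hy _).1) _

theorem mul_comm_gr {i j : ℤ} {p q : A.carrier[X]} (hp : ∀ n, p.coeff n ∈ A.gr i)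
    (hq : ∀ n, q.coeff n ∈ A.gr j) : p * q = sgn (i * j) • (q * p) := by
  ext n
  rw [Polynomial.coeff_smul, Polynomial.coeff_mul, Polynomial.coeff_mul,
    ← Finset.Nat.sum_antidiagonal_swap, Finset.smul_sum]
  exact Finset.sum_congr rfl fun c _ => A.gcomm (hp _) (hq _)

theorem gcomm_gr {i j : ℤ} {x y : PolyForm A} (hx : x ∈ gr A i) (hy : y ∈ gr A j) :
    x * y = sgn (i * j) • (y * x) := by
  have hx1 : parPoly A x.1 = sgn i • x.1 := parPoly_of_gr fun n => (hx n).1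
  have hy1 : parPoly A y.1 = sgn j • y.1 := parPoly_of_gr fun n => (hy n).1
  have e1 : sgn (i * (j - 1)) = sgn (i * j) * sgn i := by
    rw [mul_sub, mul_one, sub_eq_add_neg, sgn_add]
    congr 1
    simp [sgn]
  have e2 : sgn ((i - 1) * j) * sgn j = sgn (i * j) := by
    rw [← sgn_add]; ring_nf
  ext1
  · exact mul_comm_gr (fun n => (hx n).1) (fun n => (hy n).1)
  · simp only [snd_mul, snd_zsmul, hx1, hy1, mul_smul_comm, smul_add]
    rw [mul_comm_gr (fun n => (hx n).1) (fun n => (hy n).2),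
      mul_comm_gr (fun n => (hx n).2) (fun n => (hy n).1), e1, smul_smul, smul_smul,
      mul_comm (sgn j), e2]
    abel

/-- The inclusion `a ↦ a(u)`. -/
def inl (A : DGAlg k) : A.carrier[X] →ₗ[Lam k] PolyForm A := LinearMap.inl _ _ _

/-- The inclusion `b ↦ b(u) v`. -/
def inr (A : DGAlg k) : A.carrier[X] →ₗ[Lam k] PolyForm A := LinearMap.inr _ _ _

@[simp] theorem fst_inl (p : A.carrier[X]) : (inl A p).1 = p := rfl
@[simp] theorem snd_inl (p : A.carrier[X]) : (inl A p).2 = 0 := rfl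
@[simp] theorem fst_inr (p : A.carrier[X]) : (inr A p).1 = 0 := rfl
@[simp] theorem snd_inr (p : A.carrier[X]) : (inr A p).2 = p := rfl

theorem gr_internal (A : DGAlg k) : DirectSum.IsInternal (gr A) := by
  refine DirectSum.isInternal_submodule_of_iSupIndep_of_iSup_eq_top ?_ ?_
  · rw [iSupIndep_def]
    intro i
    rw [Submodule.disjoint_def]
    intro x hx hx'
    let pr : ℤ → A.carrier →ₗ[Lam k] A.carrier :=
      fun s => weight A.gr_internal (fun j => if j = s then 1 else 0)
    have h1 : ∀ n, pr i (x.1.coeff n) = 0 ∧ pr (i - 1) (x.2.coeff n) = 0 := by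
      intro n
      refine Submodule.iSup_induction _ (motive := fun x : PolyForm A =>
        pr i (x.1.coeff n) = 0 ∧ pr (i - 1) (x.2.coeff n) = 0) hx' ?_ (by simp) ?_
      · intro j y hy
        by_cases hj : j = i
        · subst hj; simp_all
        · simp only [hj, ne_eq, not_false_eq_true, iSup_pos] at hy
          have hj' : ¬ (j - 1 = i - 1) := by omega
          simp only [pr]
          rw [weight_of_mem _ _ (hy n).1, weight_of_mem _ _ (hy n).2]
          simp [hj]
      · intro y z hy hz
        simp [hy.1, hy.2, hz.1, hz.2]
    ext n
    · have := (h1 n).1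
      simp only [pr] at this
      rw [weight_of_mem _ _ (hx n).1] at this
      simpa using this
    · have := (h1 n).2
      simp only [pr] at this
      rw [weight_of_mem _ _ (hx n).2] at this
      simpa using this
  · rw [eq_top_iff]
    rintro x -
    have hx : x = inl A x.1 + inr A x.2 := by ext1 <;> simp
    have h1 : ∀ p : A.carrier[X], inl A p ∈ iSup (gr A) := by
      intro p
      induction p using Polynomial.induction_on' with
      | add p q hp hq => rw [map_add]; exact add_mem hp hq
      | monomial n a =>
        refine graded_ind A.gr_internal
          (p := fun a => inl A (Polynomial.monomial n a) ∈ iSup (gr A)) ?_ ?_ ?_ a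
        · simp
        · intro x y hx hy
          rw [map_add, map_add]; exact add_mem hx hy
        · intro i x hx
          refine Submodule.mem_iSup_of_mem (i) fun l => ?_
          simp only [fst_inl, snd_inl, Polynomial.coeff_monomial, Polynomial.coeff_zero]
          split <;> simp_all
    have h2 : ∀ p : A.carrier[X], inr A p ∈ iSup (gr A) := by
      intro p
      induction p using Polynomial.induction_on' with
      | add p q hp hq => rw [map_add]; exact add_mem hp hq
      | monomial n a =>
        refine graded_ind A.gr_internal
          (p := fun a => inr A (Polynomial.monomial n a) ∈ iSup (gr A)) ?_ ?_ ?_ a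
        · simp
        · intro x y hx hy
          rw [map_add, map_add]; exact add_mem hx hy
        · intro i x hx
          refine Submodule.mem_iSup_of_mem (i + 1) fun l => ?_
          simp only [fst_inr, snd_inr, Polynomial.coeff_monomial, Polynomial.coeff_zero,
            add_sub_cancel_right]
          split <;> simp_all
    rw [hx]
    exact add_mem (h1 _) (h2 _)

end PolyForm

/-- The differential graded algebra `A ⊗ k[u, v]`, with `deg u = 0`, `deg v = 1`, `d u = v`: the
polynomial forms on the interval with coefficients in `A`. -/
def forms (A : DGAlg k) : DGAlg k where
  carrier := PolyForm A
  gr := PolyForm.gr A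
  gr_internal := PolyForm.gr_internal A
  one_mem n := by
    simp only [PolyForm.fst_one, PolyForm.snd_one, Polynomial.coeff_one, Polynomial.coeff_zero]
    split <;> simp [A.one_mem]
  mul_mem := PolyForm.mul_mem_gr
  gcomm := PolyForm.gcomm_gr
  d := PolyForm.diff A
  d_mem {i x} hx n := by
    refine ⟨?_, ?_⟩
    · simpa using A.d_mem (hx n).1
    · simp only [PolyForm.snd_diff, Polynomial.coeff_add, PolyForm.coeff_dPoly, PolyForm.coeff_parPoly, PolyForm.coeff_deriv,
        add_sub_cancel_right]
      refine add_mem (by simpa using A.d_mem (hx n).2) ?_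
      have h : x.1.coeff (n + 1) * ((n : A.carrier) + 1) ∈ A.gr i := by
        rw [← Nat.cast_succ, ← nsmul_eq_mul']
        exact nsmul_mem (hx _).1 _
      rw [par, parity_of_mem _ h]
      exact zsmul_mem h _
  leibniz := PolyForm.diff_mul
  d_d := PolyForm.diff_diff


/-- The forms `a(u) + b(u) v` with coefficients in a submodule `I` of `A`. -/
def formsSub (A : DGAlg k) (I : Submodule (Lam k) A.carrier) :
    Submodule (Lam k) A.forms.carrier where
  carrier := {x : PolyForm A | ∀ n, x.1.coeff n ∈ I ∧ x.2.coeff n ∈ I}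
  add_mem' {x y : PolyForm A} hx hy n := by
    simpa using ⟨add_mem (hx n).1 (hy n).1, add_mem (hx n).2 (hy n).2⟩
  zero_mem' n := by
    change (0 : A.carrier[X]).coeff n ∈ I ∧ (0 : A.carrier[X]).coeff n ∈ I
    simp
  smul_mem' c (x : PolyForm A) hx n := by
    simpa using ⟨Submodule.smul_mem _ c (hx n).1, Submodule.smul_mem _ c (hx n).2⟩

/-- Evaluation of forms at the point `(u, v) = (s, 0)` of the interval. -/
def ev (A : DGAlg k) (s : A.carrier) : A.forms.carrier →ₗ[Lam k] A.carrier :=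
  (Polynomial.leval s).restrictScalars (Lam k) ∘ₗ LinearMap.fst (Lam k) A.carrier[X] A.carrier[X]

theorem ev_apply (A : DGAlg k) (s : A.carrier) (x : PolyForm A) : A.ev s x = x.1.eval s := rfl

/-- Morphisms of differential graded `k[[ħ]]`-algebras. -/
structure Hom (A B : DGAlg k) where
  toAlgHom : A.carrier →ₐ[Lam k] B.carrier
  map_gr : ∀ {i : ℤ} {a : A.carrier}, a ∈ A.gr i → toAlgHom a ∈ B.gr i
  map_d : ∀ a, toAlgHom (A.d a) = B.d (toAlgHom a)

theorem Hom.map_par {A B : DGAlg k} (f : Hom A B) (a : A.carrier) :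
    f.toAlgHom (A.par a) = B.par (f.toAlgHom a) := by
  refine graded_ind A.gr_internal (p := fun a => f.toAlgHom (A.par a) = B.par (f.toAlgHom a))
    (by simp) (fun x y hx hy => by simp [hx, hy]) (fun i a ha => ?_) a
  rw [par, parity_of_mem _ ha, par, parity_of_mem _ (f.map_gr ha), map_zsmul]

/-- The constant forms. -/
def constHom (A : DGAlg k) : Hom A A.forms where
  toAlgHom := AlgHom.ofLinearMap
    (PolyForm.inl A ∘ₗ (Polynomial.CAlgHom (R := Lam k) (A := A.carrier)).toLinearMap)
    (by apply PolyForm.ext <;> simp [forms, PolyForm.inl] <;> rfl)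
    (fun x y => by
      apply PolyForm.ext
      · exact Polynomial.C_mul
      · change (0 : A.carrier[X]) = Polynomial.C x * 0 + 0 * _
        simp)
  map_gr {i a} ha n := by
    change (Polynomial.C a).coeff n ∈ A.gr i ∧ (0 : A.carrier[X]).coeff n ∈ A.gr (i - 1)
    rw [Polynomial.coeff_C]
    split <;> simp [ha]
  map_d a := by
    apply PolyForm.ext
    · change Polynomial.C (A.d a) = PolyForm.dPoly A (Polynomial.C a)
      ext n
      rw [PolyForm.coeff_dPoly, Polynomial.coeff_C, Polynomial.coeff_C]
      split <;> simp
    · change (0 : A.carrier[X]) = PolyForm.dPoly A 0 +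
        PolyForm.parPoly A (PolyForm.deriv A (Polynomial.C a))
      simp [PolyForm.deriv]

/-- A morphism `A → B` induces a morphism `A ⊗ k[u, v] → B ⊗ k[u, v]`. -/
def Hom.forms {A B : DGAlg k} (f : Hom A B) : Hom A.forms B.forms where
  toAlgHom := AlgHom.ofLinearMap
    (LinearMap.prodMap (Polynomial.mapAlgHom f.toAlgHom).toLinearMap
      (Polynomial.mapAlgHom f.toAlgHom).toLinearMap)
    (by
      apply PolyForm.ext
      · exact map_one (Polynomial.mapAlgHom f.toAlgHom)
      · exact map_zero (Polynomial.mapAlgHom f.toAlgHom))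
    (fun x y => by
      have h : ∀ p : A.carrier[X], Polynomial.mapAlgHom f.toAlgHom (PolyForm.parPoly A p) =
          PolyForm.parPoly B (Polynomial.mapAlgHom f.toAlgHom p) := fun p => by
        ext n; simp [f.map_par]
      apply PolyForm.ext
      · exact map_mul (Polynomial.mapAlgHom f.toAlgHom) _ _
      · change Polynomial.mapAlgHom f.toAlgHom (x.1 * y.2 + x.2 * PolyForm.parPoly A y.1) =
          Polynomial.mapAlgHom f.toAlgHom x.1 * Polynomial.mapAlgHom f.toAlgHom y.2 +
          Polynomial.mapAlgHom f.toAlgHom x.2 *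
            PolyForm.parPoly B (Polynomial.mapAlgHom f.toAlgHom y.1)
        rw [map_add, map_mul, map_mul, h])
  map_gr {i} x hx n := by
    change (Polynomial.mapAlgHom f.toAlgHom x.1).coeff n ∈ B.gr i ∧
      (Polynomial.mapAlgHom f.toAlgHom x.2).coeff n ∈ B.gr (i - 1)
    simpa using ⟨f.map_gr (hx n).1, f.map_gr (hx n).2⟩
  map_d x := by
    apply PolyForm.ext
    · change Polynomial.mapAlgHom f.toAlgHom (PolyForm.dPoly A x.1) =
        PolyForm.dPoly B (Polynomial.mapAlgHom f.toAlgHom x.1)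
      ext n; simp [f.map_d]
    · change Polynomial.mapAlgHom f.toAlgHom (PolyForm.dPoly A x.2 +
          PolyForm.parPoly A (PolyForm.deriv A x.1)) =
        PolyForm.dPoly B (Polynomial.mapAlgHom f.toAlgHom x.2) +
          PolyForm.parPoly B (PolyForm.deriv B (Polynomial.mapAlgHom f.toAlgHom x.1))
      ext n
      simp [f.map_d, f.map_par, PolyForm.coeff_deriv]

theorem Hom.ev_forms {A B : DGAlg k} (f : Hom A B) (s : ℤ) (x : A.forms.carrier) :
    B.ev s (f.forms.toAlgHom x) = f.toAlgHom (A.ev s x) := by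
  change (Polynomial.map (f.toAlgHom : A.carrier →+* B.carrier) x.1).eval (s : B.carrier) =
    f.toAlgHom (x.1.eval (s : A.carrier))
  rw [show (s : B.carrier) = (f.toAlgHom : A.carrier →+* B.carrier) s by simp,
    Polynomial.eval_map, Polynomial.eval₂_hom]
  rfl

end DGAlg

/-- A parameter ring: a differential graded Artin local `k[[ħ]]`-algebra with residue field `k` in
which the class of `1` in homology is not zero. -/
structure ParamRing (k : Type u) [Field k] extends DGAlg k where
  /-- The maximal ideal. -/
  maxIdeal : Submodule (Lam k) carrier
  mul_mem_left : ∀ (a : carrier) {x : carrier}, x ∈ maxIdeal → a * x ∈ maxIdeal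
  mul_mem_right : ∀ (a : carrier) {x : carrier}, x ∈ maxIdeal → x * a ∈ maxIdeal
  residue : ∀ a : carrier, ∃! c : k, a - algebraMap (Lam k) carrier (PowerSeries.C c) ∈ maxIdeal
  nilpotent : ∃ n : ℕ, maxIdeal ^ n = ⊥
  finite : Module.Finite (Lam k) carrier
  one_not_exact : ∀ x : carrier, d x ≠ 1

namespace ParamRing

variable {k : Type u} [Field k]

/-- Morphisms of parameter rings: local morphisms of differential graded `k[[ħ]]`-algebras. -/
structure Hom (A B : ParamRing k) extends DGAlg.Hom A.toDGAlg B.toDGAlg where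
  map_max : ∀ {a : A.carrier}, a ∈ A.maxIdeal → toAlgHom a ∈ B.maxIdeal

/-- A homotopy between two morphisms `f, g : A → B` of parameter rings: a morphism
`A → B ⊗ k[u, v]` which maps the maximal ideal of `A` to forms with coefficients in the maximal
ideal of `B`, and which is `f` at `(0, 0)` and `g` at `(1, 0)`. -/
structure Homotopy {A B : ParamRing k} (f g : Hom A B) extends
    DGAlg.Hom A.toDGAlg B.toDGAlg.forms where
  map_max : ∀ {a : A.carrier}, a ∈ A.maxIdeal → toAlgHom a ∈ B.toDGAlg.formsSub B.maxIdeal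
  ev_zero : ∀ a, B.toDGAlg.ev 0 (toAlgHom a) = f.toAlgHom a
  ev_one : ∀ a, B.toDGAlg.ev 1 (toAlgHom a) = g.toAlgHom a

end ParamRing

/-- A background `(P, N, m, φ)`.  Freeness of `P` and `N` over `k[[ħ]]` is only used, and only
required, in the form that `P` and `N` have no `ħ`-torsion. -/
structure Background (k : Type u) [Field k] where
  P : Type v
  [ringP : Ring P]
  [algebraP : Algebra (Lam k) P]
  grP : ℤ → Submodule (Lam k) P
  grP_internal : DirectSum.IsInternal grP
  one_mem : (1 : P) ∈ grP 0
  mul_mem : ∀ {i j : ℤ} {p q : P}, p ∈ grP i → q ∈ grP j → p * q ∈ grP (i + j)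
  torsionFreeP : ∀ p : P, hbar k • p = 0 → p = 0
  /-- `P / ħ P` is graded commutative. -/
  classical_limit : ∀ {i j : ℤ} {p q : P}, p ∈ grP i → q ∈ grP j →
    ∃ c : P, p * q - sgn (i * j) • (q * p) = hbar k • c
  N : Type w
  [addCommGroupN : AddCommGroup N]
  [lamModuleN : Module (Lam k) N]
  [moduleN : Module P N]
  [towerN : IsScalarTower (Lam k) P N]
  grN : ℤ → Submodule (Lam k) N
  grN_internal : DirectSum.IsInternal grN
  smul_mem : ∀ {i j : ℤ} {p : P} {n : N}, p ∈ grP i → n ∈ grN j → p • n ∈ grN (i + j)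
  torsionFreeN : ∀ n : N, hbar k • n = 0 → n = 0
  /-- The structure. -/
  m : P
  m_mem : m ∈ grP 1
  m_sq : m * m = 0
  /-- The vacuum. -/
  φ : N
  φ_mem : φ ∈ grN 0
  m_φ : m • φ = 0

attribute [instance] Background.ringP Background.algebraP Background.addCommGroupN
  Background.lamModuleN Background.moduleN Background.towerN

namespace Background

variable {k : Type u} [Field k] (B : Background.{u, v, w} k)

/-- The graded commutator `[p, q] = p q - (-1)^(|p| |q|) q p` in `P`. -/
def comm : B.P →ₗ[Lam k] B.P →ₗ[Lam k] B.P :=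
  LinearMap.mk₂ (Lam k)
    (fun p q => p * q - (q * evenPart B.grP_internal p +
      parity B.grP_internal q * oddPart B.grP_internal p))
    (fun x y z => by simp [add_mul, mul_add]; abel)
    (fun c x y => by simp [smul_sub, smul_add])
    (fun x y z => by simp [add_mul, mul_add]; abel)
    (fun c x y => by simp [smul_sub, smul_add])

theorem comm_apply {i j : ℤ} {p q : B.P} (hp : p ∈ B.grP i) (hq : q ∈ B.grP j) :
    B.comm p q = p * q - sgn (i * j) • (q * p) := by
  simp only [comm, LinearMap.mk₂_apply, evenPart, oddPart, parity]
  rw [weight_of_mem _ _ hp, weight_of_mem _ _ hp, weight_of_mem _ _ hq]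
  rcases Int.even_or_odd i with hi | hi
  · have : sgn (i * j) = 1 := by simp [sgn, Int.negOnePow_even _ (hi.mul_right j)]
    simp [hi, this]
  · have : sgn (i * j) = sgn j := by
      rcases Int.even_or_odd j with hj | hj
      · simp [sgn, Int.negOnePow_even _ (hj.mul_left i), Int.negOnePow_even _ hj]
      · simp [sgn, Int.negOnePow_odd _ (hi.mul hj), Int.negOnePow_odd _ hj]
    simp only [Int.not_even_iff_odd.2 hi, if_false, zero_smul, mul_zero, zero_add, one_smul, this,
      smul_mul_assoc]

theorem exists_bracket (p q : B.P) : ∃ c : B.P, hbar k • c = B.comm p q := by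
  refine graded_ind B.grP_internal (p := fun p => ∃ c : B.P, hbar k • c = B.comm p q)
    ⟨0, by simp⟩ ?_ (fun i p hp => ?_) p
  · rintro x y ⟨c, hc⟩ ⟨d, hd⟩
    exact ⟨c + d, by simp [hc, hd]⟩
  · refine graded_ind B.grP_internal (p := fun q => ∃ c : B.P, hbar k • c = B.comm p q)
      ⟨0, by simp⟩ ?_ (fun j q hq => ?_) q
    · rintro x y ⟨c, hc⟩ ⟨d, hd⟩
      exact ⟨c + d, by simp [hc, hd]⟩
    · obtain ⟨c, hc⟩ := B.classical_limit hp hq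
      exact ⟨c, by rw [B.comm_apply hp hq, hc]⟩

theorem hbar_injective {x y : B.P} (h : hbar k • x = hbar k • y) : x = y :=
  sub_eq_zero.1 (B.torsionFreeP _ (by rw [smul_sub, h, sub_self]))

/-- The element `c` of `P` with `ħ c = [p, q]`, which is unique. -/
def bracketFun (p q : B.P) : B.P := (B.exists_bracket p q).choose

theorem hbar_smul_bracketFun (p q : B.P) : hbar k • B.bracketFun p q = B.comm p q :=
  (B.exists_bracket p q).choose_spec

/-- The bracket `[p, q] / ħ` of `P`. -/
def bracket : B.P →ₗ[Lam k] B.P →ₗ[Lam k] B.P :=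
  LinearMap.mk₂ (Lam k) B.bracketFun
    (fun x y z => B.hbar_injective (by simp [hbar_smul_bracketFun]))
    (fun c x y => B.hbar_injective (by
      rw [smul_comm (hbar k) c]; simp [hbar_smul_bracketFun]))
    (fun x y z => B.hbar_injective (by simp [hbar_smul_bracketFun]))
    (fun c x y => B.hbar_injective (by
      rw [smul_comm (hbar k) c]; simp [hbar_smul_bracketFun]))

variable (A : DGAlg k)

/-- The extension of the bracket `[-, -] / ħ` to `P ⊗ A`, that is
`[p ⊗ a, q ⊗ b] / ħ = (-1)^(|a| |q|) ([p, q] / ħ) ⊗ a b`. -/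
def bracketT : B.P ⊗[Lam k] A.carrier →ₗ[Lam k] B.P ⊗[Lam k] A.carrier →ₗ[Lam k]
    B.P ⊗[Lam k] A.carrier :=
  TensorProduct.map₂ (B.bracket.compl₂ (evenPart B.grP_internal))
      (LinearMap.mul (Lam k) A.carrier) +
    TensorProduct.map₂ (B.bracket.compl₂ (oddPart B.grP_internal))
      (LinearMap.mul (Lam k) A.carrier ∘ₗ A.par)

/-- The differential of `P ⊗ A`, that is `d (p ⊗ a) = (-1)^|p| p ⊗ d a`. -/
def diffT : B.P ⊗[Lam k] A.carrier →ₗ[Lam k] B.P ⊗[Lam k] A.carrier :=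
  TensorProduct.map (parity B.grP_internal) A.d

/-- The action on the vacuum, `P ⊗ A → N ⊗ A`, `p ⊗ a ↦ p φ ⊗ a`. -/
def actT : B.P ⊗[Lam k] A.carrier →ₗ[Lam k] B.N ⊗[Lam k] A.carrier :=
  LinearMap.rTensor A.carrier ((LinearMap.toSpanSingleton B.P B.N B.φ).restrictScalars (Lam k))

/-- For an ideal `I` of `A`, the degree zero part of `P ⊗ I`, as a submodule of `P ⊗ A`. -/
def degZero (I : Submodule (Lam k) A.carrier) : Submodule (Lam k) (B.P ⊗[Lam k] A.carrier) :=
  Submodule.span (Lam k) {x | ∃ (i : ℤ) (p : B.P) (a : A.carrier),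
    p ∈ B.grP i ∧ a ∈ A.gr (-i) ∧ a ∈ I ∧ p ⊗ₜ[Lam k] a = x}

/-- The sum of the terms with `j < n` of the expansion
`exp (π/ħ) m exp (-π/ħ) - ħ exp (π/ħ) d (exp (-π/ħ)) =
  ∑ j, (1 / j!) ad^j (m) + ∑ j, (1 / (j+1)!) ad^j (d π)`, where `ad = [π, -] / ħ`. -/
def masterSum (n : ℕ) (π : B.P ⊗[Lam k] A.carrier) : B.P ⊗[Lam k] A.carrier :=
  ∑ j ∈ Finset.range n,
    ((PowerSeries.C ((j.factorial : k)⁻¹) : Lam k) •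
        ((B.bracketT A π) ^ j) (B.m ⊗ₜ[Lam k] (1 : A.carrier)) +
      (PowerSeries.C (((j + 1).factorial : k)⁻¹) : Lam k) •
        ((B.bracketT A π) ^ j) (B.diffT A π))

/-- Solutions `π ∈ (P ⊗ I)^0` of the quantum master equation
`(exp (π/ħ) m exp (-π/ħ) - ħ exp (π/ħ) d (exp (-π/ħ))) φ = 0`, for a nilpotent ideal `I` of `A`.
The expansion is a finite sum since `I` is nilpotent: the equation is the vanishing of its
partial sums from some point on. -/
def solutions (I : Submodule (Lam k) A.carrier) : Set (B.P ⊗[Lam k] A.carrier) :=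
  {π | π ∈ B.degZero A I ∧ ∀ᶠ n in Filter.atTop, B.actT A (B.masterSum A n π) = 0}

section Functoriality

variable {A} {A' : DGAlg k} (f : DGAlg.Hom A A')

/-- The map `P ⊗ A → P ⊗ A'` induced by a linear map `A → A'`. -/
abbrev push {M M' : Type u} [AddCommGroup M] [Module (Lam k) M] [AddCommGroup M']
    [Module (Lam k) M'] (f : M →ₗ[Lam k] M') : B.P ⊗[Lam k] M →ₗ[Lam k] B.P ⊗[Lam k] M' :=
  LinearMap.lTensor B.P f

theorem push_bracketT (x y : B.P ⊗[Lam k] A.carrier) :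
    B.push f.toAlgHom.toLinearMap (B.bracketT A x y) =
      B.bracketT A' (B.push f.toAlgHom.toLinearMap x) (B.push f.toAlgHom.toLinearMap y) := by
  induction x with
  | zero => simp
  | add x x' hx hx' => simp only [map_add, LinearMap.add_apply, hx, hx']
  | tmul p a =>
    induction y with
    | zero => simp
    | add y y' hy hy' => simp only [map_add, hy, hy']
    | tmul q b => simp [bracketT, f.map_par]

theorem push_diffT (x : B.P ⊗[Lam k] A.carrier) :
    B.push f.toAlgHom.toLinearMap (B.diffT A x) =
      B.diffT A' (B.push f.toAlgHom.toLinearMap x) := by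
  induction x with
  | zero => simp
  | add x x' hx hx' => simp only [map_add, hx, hx']
  | tmul p a => simp [diffT, f.map_d]

theorem push_bracketT_pow (j : ℕ) (x y : B.P ⊗[Lam k] A.carrier) :
    B.push f.toAlgHom.toLinearMap (((B.bracketT A x) ^ j) y) =
      ((B.bracketT A' (B.push f.toAlgHom.toLinearMap x)) ^ j)
        (B.push f.toAlgHom.toLinearMap y) := by
  induction j with
  | zero => simp
  | succ j ih =>
    rw [pow_succ', pow_succ', Module.End.mul_apply, Module.End.mul_apply, push_bracketT, ih]

theorem push_masterSum (n : ℕ) (π : B.P ⊗[Lam k] A.carrier) :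
    B.push f.toAlgHom.toLinearMap (B.masterSum A n π) =
      B.masterSum A' n (B.push f.toAlgHom.toLinearMap π) := by
  simp only [masterSum, map_sum, map_add, map_smul, push_bracketT_pow, push_diffT]
  simp

theorem push_actT (x : B.P ⊗[Lam k] A.carrier) :
    LinearMap.lTensor B.N f.toAlgHom.toLinearMap (B.actT A x) =
      B.actT A' (B.push f.toAlgHom.toLinearMap x) := by
  induction x with
  | zero => simp
  | add x x' hx hx' => simp only [map_add, hx, hx']
  | tmul p a => simp [actT]

theorem push_degZero {I : Submodule (Lam k) A.carrier} {I' : Submodule (Lam k) A'.carrier}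
    (hI : ∀ a ∈ I, f.toAlgHom a ∈ I') {x : B.P ⊗[Lam k] A.carrier} (hx : x ∈ B.degZero A I) :
    B.push f.toAlgHom.toLinearMap x ∈ B.degZero A' I' := by
  induction hx using Submodule.span_induction with
  | mem x h =>
    obtain ⟨i, p, a, hp, ha, haI, rfl⟩ := h
    exact Submodule.subset_span ⟨i, p, f.toAlgHom a, hp, f.map_gr ha, hI a haI, by simp⟩
  | zero => simp
  | add x y _ _ hx hy => rw [map_add]; exact add_mem hx hy
  | smul c x _ hx => rw [map_smul]; exact Submodule.smul_mem _ c hx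

theorem push_solutions {I : Submodule (Lam k) A.carrier} {I' : Submodule (Lam k) A'.carrier}
    (hI : ∀ a ∈ I, f.toAlgHom a ∈ I') {x : B.P ⊗[Lam k] A.carrier} (hx : x ∈ B.solutions A I) :
    B.push f.toAlgHom.toLinearMap x ∈ B.solutions A' I' := by
  refine ⟨B.push_degZero f hI hx.1, hx.2.mono fun n hn => ?_⟩
  rw [← push_masterSum, ← push_actT, hn, map_zero]

end Functoriality

/-- The functor `QM_B` on parameter rings. -/
def QM (A : ParamRing k) : Type (max u v) := B.solutions A.toDGAlg A.maxIdeal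

/-- Homotopy of solutions of the quantum master equation over a parameter ring `A`: there is a
solution over `A ⊗ k[u, v]`, with coefficients in the maximal ideal of `A`, which is `x` at `(0, 0)`
and `y` at `(1, 0)`. -/
def Homotopic (A : ParamRing k) (x y : B.QM A) : Prop :=
  ∃ ξ ∈ B.solutions A.toDGAlg.forms (A.toDGAlg.formsSub A.maxIdeal),
    B.push (A.toDGAlg.ev 0) ξ = x.1 ∧ B.push (A.toDGAlg.ev 1) ξ = y.1

/-- The functor `QFT_B` on parameter rings: the quotient of `QM_B` by homotopy. -/
def QFT (A : ParamRing k) : Type (max u v) := Quot (B.Homotopic A)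

variable {A₁ A₂ A₃ A₄ : ParamRing k}

/-- The action of `QM_B` on morphisms. -/
def QM.map (f : ParamRing.Hom A₁ A₂) (x : B.QM A₁) : B.QM A₂ :=
  ⟨B.push f.toAlgHom.toLinearMap x.1,
    B.push_solutions f.toHom (fun _ h => f.map_max h) x.2⟩

theorem QM.map_homotopic (f : ParamRing.Hom A₁ A₂) {x y : B.QM A₁} (h : B.Homotopic A₁ x y) :
    B.Homotopic A₂ (QM.map B f x) (QM.map B f y) := by
  obtain ⟨ξ, hξ, h0, h1⟩ := h
  have key : ∀ s : ℤ, B.push (A₂.toDGAlg.ev s) (B.push f.toHom.forms.toAlgHom.toLinearMap ξ) =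
      B.push f.toAlgHom.toLinearMap (B.push (A₁.toDGAlg.ev s) ξ) := fun s => by
    rw [push, push, push, push, ← LinearMap.comp_apply, ← LinearMap.comp_apply,
      ← LinearMap.lTensor_comp, ← LinearMap.lTensor_comp]
    congr 2
    ext x
    exact f.toHom.ev_forms s x
  have hmax : ∀ a ∈ A₁.toDGAlg.formsSub A₁.maxIdeal,
      f.toHom.forms.toAlgHom a ∈ A₂.toDGAlg.formsSub A₂.maxIdeal := fun a ha n => by
    have := ha n
    change (Polynomial.mapAlgHom f.toAlgHom a.1).coeff n ∈ A₂.maxIdeal ∧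
      (Polynomial.mapAlgHom f.toAlgHom a.2).coeff n ∈ A₂.maxIdeal
    simpa using ⟨f.map_max this.1, f.map_max this.2⟩
  have h0' := key 0
  have h1' := key 1
  rw [Int.cast_zero, Int.cast_zero, h0] at h0'
  rw [Int.cast_one, Int.cast_one, h1] at h1'
  exact ⟨_, B.push_solutions f.toHom.forms hmax hξ, h0', h1'⟩

/-- The action of `QFT_B` on morphisms. -/
def QFT.map (f : ParamRing.Hom A₁ A₂) : B.QFT A₁ → B.QFT A₂ :=
  Quot.map (QM.map B f) fun _ _ h => QM.map_homotopic B f h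

theorem QM.map_square {f : ParamRing.Hom A₁ A₂} {g : ParamRing.Hom A₂ A₄}
    {f' : ParamRing.Hom A₁ A₃} {g' : ParamRing.Hom A₃ A₄}
    (h : ∀ a, g.toAlgHom (f.toAlgHom a) = g'.toAlgHom (f'.toAlgHom a)) (x : B.QM A₁) :
    QM.map B g (QM.map B f x) = QM.map B g' (QM.map B f' x) := by
  apply Subtype.ext
  simp only [QM.map, push]
  rw [← LinearMap.comp_apply, ← LinearMap.comp_apply, ← LinearMap.lTensor_comp,
    ← LinearMap.lTensor_comp]
  congr 2
  ext a
  exact h a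

theorem QFT.map_square {f : ParamRing.Hom A₁ A₂} {g : ParamRing.Hom A₂ A₄}
    {f' : ParamRing.Hom A₁ A₃} {g' : ParamRing.Hom A₃ A₄}
    (h : ∀ a, g.toAlgHom (f.toAlgHom a) = g'.toAlgHom (f'.toAlgHom a)) (x : B.QFT A₁) :
    QFT.map B g (QFT.map B f x) = QFT.map B g' (QFT.map B f' x) := by
  induction x using Quot.ind with
  | mk x => exact congrArg (Quot.mk _) (QM.map_square B h x)

end Background

/-- The algebra `k[ε]/ε²`, on which `ħ` acts as zero. -/
def Eps (k : Type u) [Field k] : Type u := DualNumber k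

namespace Eps

variable (k : Type u) [Field k]

instance : CommRing (Eps k) := inferInstanceAs (CommRing (DualNumber k))

instance : Algebra (Lam k) (Eps k) :=
  RingHom.toAlgebra ((TrivSqZeroExt.inlHom k k).comp PowerSeries.constantCoeff)

/-- The element `ε`. -/
def eps : Eps k := (DualNumber.eps : DualNumber k)

variable {k}

/-- The constant part. -/
def fst (x : Eps k) : k := TrivSqZeroExt.fst x

/-- The coefficient of `ε`. -/
def snd (x : Eps k) : k := TrivSqZeroExt.snd x

@[ext] theorem ext {x y : Eps k} (h1 : fst x = fst y) (h2 : snd x = snd y) : x = y :=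
  TrivSqZeroExt.ext h1 h2

@[simp] theorem fst_zero : fst (0 : Eps k) = 0 := rfl
@[simp] theorem snd_zero : snd (0 : Eps k) = 0 := rfl
@[simp] theorem fst_one : fst (1 : Eps k) = 1 := rfl
@[simp] theorem snd_one : snd (1 : Eps k) = 0 := rfl
@[simp] theorem fst_add (x y : Eps k) : fst (x + y) = fst x + fst y := rfl
@[simp] theorem snd_add (x y : Eps k) : snd (x + y) = snd x + snd y := rfl
@[simp] theorem fst_sub (x y : Eps k) : fst (x - y) = fst x - fst y := rfl
@[simp] theorem snd_sub (x y : Eps k) : snd (x - y) = snd x - snd y := rfl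
@[simp] theorem fst_zsmul (c : ℤ) (x : Eps k) : fst (c • x) = c • fst x :=
  TrivSqZeroExt.fst_smul c x
@[simp] theorem snd_zsmul (c : ℤ) (x : Eps k) : snd (c • x) = c • snd x :=
  TrivSqZeroExt.snd_smul c x
@[simp] theorem fst_mul (x y : Eps k) : fst (x * y) = fst x * fst y := rfl
@[simp] theorem snd_mul (x y : Eps k) : snd (x * y) = fst x * snd y + snd x * fst y := by
  change TrivSqZeroExt.snd _ = _
  exact (TrivSqZeroExt.snd_mul (R := k) (M := k) x y).trans (by simp [fst, snd, mul_comm])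

theorem fst_algebraMap (c : Lam k) :
    fst (algebraMap (Lam k) (Eps k) c) = PowerSeries.constantCoeff c := rfl
theorem snd_algebraMap (c : Lam k) : snd (algebraMap (Lam k) (Eps k) c) = 0 := rfl

@[simp] theorem fst_smul (c : Lam k) (x : Eps k) :
    fst (c • x) = PowerSeries.constantCoeff c * fst x := by
  rw [Algebra.smul_def, fst_mul, fst_algebraMap]
@[simp] theorem snd_smul (c : Lam k) (x : Eps k) :
    snd (c • x) = PowerSeries.constantCoeff c * snd x := by
  rw [Algebra.smul_def, snd_mul, fst_algebraMap, snd_algebraMap]; simp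

variable (k)

/-- The grading of `k[ε]/ε²` with `ε` in degree `e`. -/
def gr (e n : ℤ) : Submodule (Lam k) (Eps k) where
  carrier := {x | (n ≠ 0 → fst x = 0) ∧ (n ≠ e → snd x = 0)}
  add_mem' hx hy := by
    refine ⟨fun h => ?_, fun h => ?_⟩
    · simp [hx.1 h, hy.1 h]
    · simp [hx.2 h, hy.2 h]
  zero_mem' := by simp
  smul_mem' c x hx := by
    refine ⟨fun h => ?_, fun h => ?_⟩
    · simp [hx.1 h]
    · simp [hx.2 h]

theorem gr_internal (e : ℤ) : DirectSum.IsInternal (gr k e) := by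
  refine DirectSum.isInternal_submodule_of_iSupIndep_of_iSup_eq_top ?_ ?_
  · rw [iSupIndep_def]
    intro i
    rw [Submodule.disjoint_def]
    intro x hx hx'
    have h1 : (i = 0 → fst x = 0) ∧ (i = e → snd x = 0) := by
      refine Submodule.iSup_induction _ (motive := fun x : Eps k =>
        (i = 0 → fst x = 0) ∧ (i = e → snd x = 0)) hx' ?_ (by simp) ?_
      · intro j y hy
        by_cases hj : j = i
        · subst hj; simp_all
        · simp only [hj, ne_eq, not_false_eq_true, iSup_pos] at hy
          exact ⟨fun h => hy.1 (by omega), fun h => hy.2 (by omega)⟩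
      · intro y z hy hz
        exact ⟨fun h => by simp [hy.1 h, hz.1 h], fun h => by simp [hy.2 h, hz.2 h]⟩
    ext
    · by_cases h : i = 0
      · exact h1.1 h
      · exact hx.1 h
    · by_cases h : i = e
      · exact h1.2 h
      · exact hx.2 h
  · rw [eq_top_iff]
    rintro x -
    have hx : x = (TrivSqZeroExt.inl (fst x) : DualNumber k) +
        (TrivSqZeroExt.inr (snd x) : DualNumber k) := by
      apply TrivSqZeroExt.ext <;> simp <;> rfl
    rw [hx]
    refine add_mem (S := Submodule (Lam k) (Eps k)) ?_ ?_
    · exact Submodule.mem_iSup_of_mem 0 ⟨fun h => absurd rfl h, fun _ => rfl⟩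
    · exact Submodule.mem_iSup_of_mem e ⟨fun _ => rfl, fun h => absurd rfl h⟩

end Eps

/-- The parameter ring `E_i = k[ε]/ε²` with `ε` of degree `-i`, zero differential, and on which `ħ`
acts as zero. -/
def tangentRing (k : Type u) [Field k] (i : ℤ) : ParamRing k where
  carrier := Eps k
  gr := Eps.gr k (-i)
  gr_internal := Eps.gr_internal k (-i)
  one_mem := ⟨fun h => absurd rfl h, fun _ => rfl⟩
  mul_mem {p q a b} ha hb := by
    refine ⟨fun h => ?_, fun h => ?_⟩
    · by_cases hp : p = 0
      · have hq : q ≠ 0 := by omega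
        simp [hb.1 hq]
      · simp [ha.1 hp]
    · have h1 : Eps.fst a * Eps.snd b = 0 := by
        by_cases hp : p = 0
        · rw [hb.2 (by omega), mul_zero]
        · rw [ha.1 hp, zero_mul]
      have h2 : Eps.snd a * Eps.fst b = 0 := by
        by_cases hq : q = 0
        · rw [ha.2 (by omega), zero_mul]
        · rw [hb.1 hq, mul_zero]
      simp [h1, h2]
  gcomm {p q a b} ha hb := by
    by_cases hp : p = 0
    · subst hp; rw [zero_mul, sgn_zero, one_smul, mul_comm]
    by_cases hq : q = 0
    · subst hq; rw [mul_zero, sgn_zero, one_smul, mul_comm]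
    ext <;> simp [ha.1 hp, hb.1 hq]
  d := 0
  d_mem _ := zero_mem _
  leibniz _ _ := by simp
  d_d _ := rfl
  maxIdeal :=
    { carrier := {x | Eps.fst x = 0}
      add_mem' := fun {x y} hx hy => by
        change _ = _ at hx hy; change _ = _; rw [Eps.fst_add, hx, hy, add_zero]
      zero_mem' := rfl
      smul_mem' := fun c x hx => by
        change _ = _ at hx; change _ = _; rw [Eps.fst_smul, hx, mul_zero] }
  mul_mem_left a x hx := by
    change _ = _ at hx; change _ = _; rw [Eps.fst_mul, hx, mul_zero]
  mul_mem_right a x hx := by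
    change _ = _ at hx; change _ = _; rw [Eps.fst_mul, hx, zero_mul]
  residue a := by
    refine ⟨Eps.fst a, ?_, fun c hc => ?_⟩
    · change Eps.fst _ = 0
      rw [Eps.fst_sub, Eps.fst_algebraMap, PowerSeries.constantCoeff_C, sub_self]
    · change Eps.fst _ = 0 at hc
      rw [Eps.fst_sub, Eps.fst_algebraMap, PowerSeries.constantCoeff_C, sub_eq_zero] at hc
      exact hc.symm
  nilpotent := by
    refine ⟨2, ?_⟩
    rw [pow_two, eq_bot_iff, Submodule.mul_le]
    intro x hx y hy
    change _ = _ at hx hy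
    change _ = _
    ext <;> simp [hx, hy]
  finite := by
    classical
    refine ⟨⟨({1, Eps.eps k} : Finset (Eps k)), ?_⟩⟩
    rw [eq_top_iff]
    rintro x -
    rw [Finset.coe_insert, Finset.coe_singleton, Submodule.mem_span_pair]
    refine ⟨PowerSeries.C (Eps.fst x), PowerSeries.C (Eps.snd x), ?_⟩
    have h1 : Eps.fst (Eps.eps k) = 0 := TrivSqZeroExt.fst_inr k (1 : k)
    have h2 : Eps.snd (Eps.eps k) = 1 := TrivSqZeroExt.snd_inr k (1 : k)
    ext <;> simp [h1, h2]
  one_not_exact x h := by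
    have := congrArg Eps.fst h
    simp at this

namespace Background

variable {k : Type u} [Field k] (B : Background.{u, v, w} k)

section SquareZero

/- Over an ideal of square zero the quantum master equation is linear. -/

variable (A : DGAlg k) (I : Submodule (Lam k) A.carrier)

/-- The image of `P ⊗ I` in `P ⊗ A`. -/
def spanT : Submodule (Lam k) (B.P ⊗[Lam k] A.carrier) :=
  Submodule.span (Lam k) {x | ∃ (p : B.P) (a : A.carrier), a ∈ I ∧ p ⊗ₜ[Lam k] a = x}

theorem degZero_le_spanT : B.degZero A I ≤ B.spanT A I := by
  refine Submodule.span_mono ?_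
  rintro _ ⟨i, p, a, -, -, ha, rfl⟩
  exact ⟨p, a, ha, rfl⟩

theorem bracketT_mem (hr : ∀ a ∈ I, ∀ b, a * b ∈ I) {x : B.P ⊗[Lam k] A.carrier}
    (hx : x ∈ B.degZero A I) (y : B.P ⊗[Lam k] A.carrier) : B.bracketT A x y ∈ B.spanT A I := by
  induction hx using Submodule.span_induction with
  | mem x h =>
    obtain ⟨i, p, a, -, ha, haI, rfl⟩ := h
    induction y with
    | zero => simp
    | add y y' hy hy' => rw [map_add]; exact add_mem hy hy'
    | tmul q b =>
      simp only [bracketT, LinearMap.add_apply, TensorProduct.map₂_apply_tmul,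
        LinearMap.comp_apply]
      refine add_mem (Submodule.subset_span ⟨_, _, hr a haI b, rfl⟩)
        (Submodule.subset_span ⟨_, _, hr _ ?_ b, rfl⟩)
      rw [DGAlg.par, parity_of_mem _ ha]
      exact zsmul_mem haI _
  | zero => simp
  | add x y _ _ hx hy => rw [map_add]; exact add_mem hx hy
  | smul c x _ hx => rw [map_smul]; exact Submodule.smul_mem _ c hx

theorem bracketT_eq_zero (hs : ∀ a ∈ I, ∀ b ∈ I, a * b = 0) {x y : B.P ⊗[Lam k] A.carrier}
    (hx : x ∈ B.degZero A I) (hy : y ∈ B.spanT A I) : B.bracketT A x y = 0 := by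
  induction hx using Submodule.span_induction with
  | mem x h =>
    obtain ⟨i, p, a, -, ha, haI, rfl⟩ := h
    induction hy using Submodule.span_induction with
    | mem y h =>
      obtain ⟨q, b, hb, rfl⟩ := h
      simp only [bracketT, LinearMap.add_apply, TensorProduct.map₂_apply_tmul,
        LinearMap.comp_apply]
      have h : A.par a ∈ I := by
        rw [DGAlg.par, parity_of_mem _ ha]
        exact zsmul_mem haI _
      rw [TensorProduct.map_tmul, TensorProduct.map_tmul, LinearMap.mul_apply',
        LinearMap.mul_apply', hs _ haI _ hb, hs _ h _ hb, TensorProduct.tmul_zero,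
        TensorProduct.tmul_zero, add_zero]
    | zero => simp
    | add y z _ _ hy hz => rw [map_add, hy, hz, add_zero]
    | smul c x _ hx => rw [map_smul, hx, smul_zero]
  | zero => simp
  | add x y _ _ hx hy => rw [map_add, LinearMap.add_apply, hx, hy, add_zero]
  | smul c x _ hx => rw [map_smul, LinearMap.smul_apply, hx, smul_zero]

theorem diffT_mem (hd : ∀ a ∈ I, A.d a ∈ I) {x : B.P ⊗[Lam k] A.carrier}
    (hx : x ∈ B.degZero A I) : B.diffT A x ∈ B.spanT A I := by
  induction hx using Submodule.span_induction with
  | mem x h =>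
    obtain ⟨i, p, a, -, ha, haI, rfl⟩ := h
    exact Submodule.subset_span ⟨_, _, hd a haI, rfl⟩
  | zero => simp
  | add x y _ _ hx hy => rw [map_add]; exact add_mem hx hy
  | smul c x _ hx => rw [map_smul]; exact Submodule.smul_mem _ c hx

/-- The linear part of the master equation. -/
def linearPart : B.P ⊗[Lam k] A.carrier →ₗ[Lam k] B.N ⊗[Lam k] A.carrier :=
  B.actT A ∘ₗ ((B.bracketT A).flip (B.m ⊗ₜ[Lam k] (1 : A.carrier)) + B.diffT A)

theorem mem_solutions_iff (hr : ∀ a ∈ I, ∀ b, a * b ∈ I) (hs : ∀ a ∈ I, ∀ b ∈ I, a * b = 0)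
    (hd : ∀ a ∈ I, A.d a ∈ I) (π : B.P ⊗[Lam k] A.carrier) :
    π ∈ B.solutions A I ↔ π ∈ B.degZero A I ⊓ LinearMap.ker (B.linearPart A) := by
  rw [Submodule.mem_inf, LinearMap.mem_ker]
  refine and_congr_right fun hπ => ?_
  have h1 : ∀ j, ((B.bracketT A π) ^ (j + 2)) (B.m ⊗ₜ[Lam k] (1 : A.carrier)) = 0 := fun j => by
    rw [pow_add, Module.End.mul_apply, pow_two, Module.End.mul_apply,
      B.bracketT_eq_zero A I hs hπ (B.bracketT_mem A I hr hπ _), map_zero]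
  have h2 : ∀ j, ((B.bracketT A π) ^ (j + 1)) (B.diffT A π) = 0 := fun j => by
    rw [pow_add, Module.End.mul_apply, pow_one,
      B.bracketT_eq_zero A I hs hπ (B.diffT_mem A I hd hπ), map_zero]
  have h3 : ∀ n, B.actT A (B.masterSum A (n + 2) π) = B.linearPart A π := fun n => by
    have h4 : B.actT A (B.m ⊗ₜ[Lam k] (1 : A.carrier)) = 0 := by
      simp [actT, B.m_φ]
    rw [masterSum, Finset.sum_range_succ', Finset.sum_range_succ', Finset.sum_eq_zero]
    · rw [h2 0]
      simp [linearPart, h4, add_comm]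
    · intro j _
      rw [h1 j, h2 (j + 1), smul_zero, smul_zero, add_zero]
  constructor
  · intro h
    obtain ⟨n, hn⟩ := Filter.eventually_atTop.1 h
    rw [← h3 n]
    exact hn _ (by omega)
  · intro h
    refine Filter.eventually_atTop.2 ⟨2, fun n hn => ?_⟩
    obtain ⟨n, rfl⟩ := Nat.exists_eq_add_of_le' hn
    rw [h3, h]

end SquareZero

section Tangent

variable (i : ℤ)

theorem tangent_mul {a b : (tangentRing k i).carrier} (ha : a ∈ (tangentRing k i).maxIdeal)
    (hb : b ∈ (tangentRing k i).maxIdeal) : a * b = 0 := by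
  change Eps.fst a = 0 at ha
  change Eps.fst b = 0 at hb
  apply Eps.ext
  · exact (Eps.fst_mul a b).trans (by rw [ha, zero_mul]; rfl)
  · exact (Eps.snd_mul a b).trans (by rw [ha, hb, zero_mul, mul_zero, add_zero]; rfl)

/-- `QM_B (E_i)`, as a submodule of `P ⊗ E_i`. -/
def tangentSolutions : Submodule (Lam k) (B.P ⊗[Lam k] (tangentRing k i).carrier) :=
  B.degZero (tangentRing k i).toDGAlg (tangentRing k i).maxIdeal ⊓
    LinearMap.ker (B.linearPart (tangentRing k i).toDGAlg)

theorem mem_tangentSolutions (x : B.P ⊗[Lam k] (tangentRing k i).carrier) :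
    x ∈ B.solutions (tangentRing k i).toDGAlg (tangentRing k i).maxIdeal ↔
      x ∈ B.tangentSolutions i :=
  B.mem_solutions_iff _ _ (fun _ ha b => (tangentRing k i).mul_mem_right b ha)
    (fun _ ha _ hb => tangent_mul i ha hb) (fun _ _ => zero_mem _) x

/-- The solutions over `E_i ⊗ k[u, v]`, as a submodule of `P ⊗ E_i ⊗ k[u, v]`. -/
def tangentPaths : Submodule (Lam k) (B.P ⊗[Lam k] (tangentRing k i).toDGAlg.forms.carrier) :=
  B.degZero (tangentRing k i).toDGAlg.forms
      ((tangentRing k i).toDGAlg.formsSub (tangentRing k i).maxIdeal) ⊓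
    LinearMap.ker (B.linearPart (tangentRing k i).toDGAlg.forms)

theorem mem_tangentPaths (x : B.P ⊗[Lam k] (tangentRing k i).toDGAlg.forms.carrier) :
    x ∈ B.solutions (tangentRing k i).toDGAlg.forms
      ((tangentRing k i).toDGAlg.formsSub (tangentRing k i).maxIdeal) ↔ x ∈ B.tangentPaths i := by
  have hpar : ∀ a ∈ (tangentRing k i).maxIdeal,
      (tangentRing k i).toDGAlg.par a ∈ (tangentRing k i).maxIdeal := fun a ha => by
    have key : Eps.fst ((tangentRing k i).toDGAlg.par a) = Eps.fst a := by
      refine graded_ind (tangentRing k i).gr_internal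
        (p := fun a => Eps.fst ((tangentRing k i).toDGAlg.par a) = Eps.fst a)
        (by rw [map_zero]) (fun x y hx hy => ?_) (fun n x hx => ?_) a
      · rw [map_add]
        exact (Eps.fst_add _ _).trans (by rw [hx, hy]; rfl)
      · rw [DGAlg.par, parity_of_mem _ hx]
        refine (Eps.fst_zsmul _ _).trans ?_
        by_cases h : n = 0
        · rw [h, sgn_zero, one_smul]
        · rw [hx.1 h, smul_zero]
    change Eps.fst _ = 0
    rw [key]
    exact ha
  refine B.mem_solutions_iff _ _ (fun a ha b => ?_) (fun a ha b hb => ?_) (fun a ha => ?_) x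
  · intro n
    refine ⟨?_, ?_⟩
    · change (a.1 * b.1).coeff n ∈ _
      rw [Polynomial.coeff_mul]
      exact sum_mem fun c _ => (tangentRing k i).mul_mem_right _ (ha _).1
    · change (a.1 * b.2 + a.2 * DGAlg.PolyForm.parPoly _ b.1).coeff n ∈ _
      rw [Polynomial.coeff_add, Polynomial.coeff_mul, Polynomial.coeff_mul]
      exact add_mem (sum_mem fun c _ => (tangentRing k i).mul_mem_right _ (ha _).1)
        (sum_mem fun c _ => (tangentRing k i).mul_mem_right _ (ha _).2)
  · apply DGAlg.PolyForm.ext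
    · change a.1 * b.1 = 0
      ext n
      rw [Polynomial.coeff_mul, Polynomial.coeff_zero]
      exact Finset.sum_eq_zero fun c _ => tangent_mul i (ha _).1 (hb _).1
    · change a.1 * b.2 + a.2 * DGAlg.PolyForm.parPoly _ b.1 = 0
      ext n
      rw [Polynomial.coeff_add, Polynomial.coeff_mul, Polynomial.coeff_mul, Polynomial.coeff_zero,
        Finset.sum_eq_zero fun c _ => tangent_mul i (ha _).1 (hb _).2, zero_add]
      refine Finset.sum_eq_zero fun c _ => tangent_mul i (ha _).2 ?_
      rw [DGAlg.PolyForm.coeff_parPoly]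
      exact hpar _ (hb _).1
  · intro n
    refine ⟨?_, ?_⟩
    · change (DGAlg.PolyForm.dPoly _ a.1).coeff n ∈ _
      rw [DGAlg.PolyForm.coeff_dPoly]
      exact zero_mem _
    · change (DGAlg.PolyForm.dPoly _ a.2 +
        DGAlg.PolyForm.parPoly _ (DGAlg.PolyForm.deriv _ a.1)).coeff n ∈ _
      rw [Polynomial.coeff_add, DGAlg.PolyForm.coeff_dPoly, DGAlg.PolyForm.coeff_parPoly,
        DGAlg.PolyForm.coeff_deriv]
      exact add_mem (zero_mem _) (hpar _ ((tangentRing k i).mul_mem_right _ (ha _).1))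

/-- The elements of `QM_B (E_i)` which are homotopic to zero. -/
def tangentNull : Submodule (Lam k) (B.tangentSolutions i) :=
  ((B.tangentPaths i ⊓ LinearMap.ker (B.push ((tangentRing k i).toDGAlg.ev 1))).map
    (B.push ((tangentRing k i).toDGAlg.ev 0))).comap (B.tangentSolutions i).subtype

theorem homotopic_iff (x y : B.QM (tangentRing k i)) :
    B.Homotopic (tangentRing k i) x y ↔
      (⟨x.1, (B.mem_tangentSolutions i _).1 x.2⟩ - ⟨y.1, (B.mem_tangentSolutions i _).1 y.2⟩ :
        B.tangentSolutions i) ∈ B.tangentNull i := by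
  have hc := (B.mem_tangentPaths i _).1 (B.push_solutions (tangentRing k i).toDGAlg.constHom
    (I' := (tangentRing k i).toDGAlg.formsSub (tangentRing k i).maxIdeal)
    (fun a ha n => by
      change (Polynomial.C a).coeff n ∈ (tangentRing k i).maxIdeal ∧
        (0 : (tangentRing k i).carrier[X]).coeff n ∈ (tangentRing k i).maxIdeal
      rw [Polynomial.coeff_C, Polynomial.coeff_zero]
      refine ⟨?_, zero_mem _⟩
      split
      · exact ha
      · exact zero_mem _) y.2)
  set c := B.push (tangentRing k i).toDGAlg.constHom.toAlgHom.toLinearMap y.1 with hcdef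
  have hs : ∀ s, B.push ((tangentRing k i).toDGAlg.ev s) c = y.1 := fun s => by
    rw [hcdef, push, push, ← LinearMap.comp_apply, ← LinearMap.lTensor_comp,
      show (tangentRing k i).toDGAlg.ev s ∘ₗ
        (tangentRing k i).toDGAlg.constHom.toAlgHom.toLinearMap = LinearMap.id from ?_,
      LinearMap.lTensor_id, LinearMap.id_apply]
    ext a
    exact Polynomial.eval_C
  constructor
  · rintro ⟨ξ, hξ, h0, h1⟩
    refine ⟨ξ - c, ⟨sub_mem ((B.mem_tangentPaths i _).1 hξ) hc, ?_⟩, ?_⟩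
    · change B.push _ _ = 0
      rw [map_sub, h1, hs, sub_self]
    · rw [map_sub, h0, hs]; rfl
  · rintro ⟨ξ, ⟨hξ, h1⟩, h0⟩
    change B.push _ _ = 0 at h1
    change B.push _ _ = x.1 - y.1 at h0
    refine ⟨ξ + c, (B.mem_tangentPaths i _).2 (add_mem hξ hc), ?_, ?_⟩
    · rw [map_add, h0, hs, sub_add_cancel]
    · rw [map_add, h1, hs, zero_add]

/-- The set `QFT_B (E_i)` is a quotient of a module by a submodule. -/
def tangentEquiv : B.QFT (tangentRing k i) ≃ (B.tangentSolutions i ⧸ B.tangentNull i) where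
  toFun := Quot.lift
    (fun x => Submodule.Quotient.mk ⟨x.1, (B.mem_tangentSolutions i _).1 x.2⟩)
    (fun x y h => (Submodule.Quotient.eq _).2 ((B.homotopic_iff i x y).1 h))
  invFun := Quotient.lift (s := Submodule.quotientRel (B.tangentNull i))
    (fun x => Quot.mk _ ⟨x.1, (B.mem_tangentSolutions i _).2 x.2⟩)
    (fun x y h => Quot.sound ((B.homotopic_iff i _ _).2
      ((Submodule.Quotient.eq _).1 (Quotient.sound h))))
  left_inv := by rintro ⟨x⟩; rfl
  right_inv := by rintro ⟨x⟩; rfl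

/-- The degree `i` part `T^i = QFT_B (E_i)` of the tangent space of `QFT_B`. Its linear structure is
the one induced from `P ⊗ E_i`. -/
def TangentSpace : Type (max u v) := B.QFT (tangentRing k i)

instance : AddCommGroup (B.TangentSpace i) := (B.tangentEquiv i).addCommGroup

instance : Module k (B.TangentSpace i) :=
  letI : Module k (B.tangentSolutions i ⧸ B.tangentNull i) :=
    Module.compHom _ (PowerSeries.C : k →+* Lam k)
  (B.tangentEquiv i).module k

/-- The homology `H(B)`: the tangent space `⨁ i, QFT_B (E_i)` of the functor `QFT_B`. -/
abbrev Homology : Type (max u v) := ⨁ i : ℤ, B.TangentSpace i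

end Tangent

/-- The cyclic submodule `P φ` generated by the vacuum is pure in `N`: if `ħ n` lies in `P φ`, then
so does `n`; in other words `N / P φ` has no `ħ`-torsion. -/
def VacuumPure : Prop := ∀ (n : B.N) (p : B.P), hbar k • n = p • B.φ → ∃ q : B.P, n = q • B.φ

end Background

/-- A complete parameter ring, given as the tower of its quotients: `obj n = A / 𝔪^(n+1)`. -/
structure CompleteRing (k : Type u) [Field k] where
  obj : ℕ → ParamRing k
  map : ∀ n, ParamRing.Hom (obj (n + 1)) (obj n)
  surjective : ∀ n, Function.Surjective (map n).toAlgHom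
  maxIdeal_pow : ∀ n, (obj n).maxIdeal ^ (n + 1) = ⊥
  ker_map : ∀ n x, (map n).toAlgHom x = 0 ↔ x ∈ (obj (n + 1)).maxIdeal ^ (n + 1)

namespace CompleteRing

variable {k : Type u} [Field k]

/-- Morphisms of complete parameter rings, as compatible families of morphisms
`R / 𝔪^(n+1) → A / 𝔪^(n+1)`. -/
structure Hom (R A : CompleteRing k) where
  app : ∀ n, ParamRing.Hom (R.obj n) (A.obj n)
  comm : ∀ n x, (A.map n).toAlgHom ((app (n + 1)).toAlgHom x) =
    (app n).toAlgHom ((R.map n).toAlgHom x)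

/-- Two morphisms `f, g : R → A` of complete parameter rings are homotopic if there is a morphism
from `R` to the completion `lim (A / 𝔪^(n+1)) ⊗ k[u, v]` of `A ⊗ k[u, v]`, that is a compatible
family of homotopies, which is `f` at `(0, 0)` and `g` at `(1, 0)`. -/
def Homotopic {R A : CompleteRing k} (f g : Hom R A) : Prop :=
  ∃ H : ∀ n, ParamRing.Homotopy (f.app n) (g.app n),
    ∀ n x, (A.map n).toHom.forms.toAlgHom ((H (n + 1)).toAlgHom x) =
      (H n).toAlgHom ((R.map n).toAlgHom x)

end CompleteRing

namespace Background

variable {k : Type u} [Field k] (B : Background.{u, v, w} k)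

/-- The functor `QM_B` on complete parameter rings: `QM_B (A) = lim QM_B (A / 𝔪^(n+1))`. -/
structure QMhat (A : CompleteRing k) where
  app : ∀ n, B.QM (A.obj n)
  comm : ∀ n, QM.map B (A.map n) (app (n + 1)) = app n

/-- The functor `QFT_B` on complete parameter rings: `QFT_B (A) = lim QFT_B (A / 𝔪^(n+1))`. -/
structure QFThat (A : CompleteRing k) where
  app : ∀ n, B.QFT (A.obj n)
  comm : ∀ n, QFT.map B (A.map n) (app (n + 1)) = app n

/-- The class in `QFT_B (A)` of an element of `QM_B (A)`. -/
def QMhat.toQFT {A : CompleteRing k} (x : B.QMhat A) : B.QFThat A where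
  app n := Quot.mk _ (x.app n)
  comm n := congrArg (Quot.mk _) (x.comm n)

/-- The action of `QFT_B` on morphisms of complete parameter rings. -/
def QFThat.map {R A : CompleteRing k} (f : CompleteRing.Hom R A) (x : B.QFThat R) :
    B.QFThat A where
  app n := QFT.map B (f.app n) (x.app n)
  comm n := by
    rw [← x.comm n]
    exact QFT.map_square B (f.comm n) (x.app (n + 1))

/-- The functor `QFT_B` is homotopy represented by the couple `(R, Ξ)`. -/
structure HomotopyRepresents (R : CompleteRing k) (Ξ : B.QMhat R) : Prop where
  /-- `QFT_B` induces a functor on the homotopy category. -/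
  homotopy_invariant : ∀ (A A' : CompleteRing k) (f g : CompleteRing.Hom A A'),
    CompleteRing.Homotopic f g → ∀ ξ : B.QFThat A, QFThat.map B f ξ = QFThat.map B g ξ
  /-- Every element of `QFT_B (A)` is induced by a morphism from `R`. -/
  exists_hom : ∀ (A : CompleteRing k) (ξ : B.QFThat A),
    ∃ τ : CompleteRing.Hom R A, QFThat.map B τ (QMhat.toQFT B Ξ) = ξ
  /-- The morphism is unique up to homotopy. -/
  hom_unique : ∀ (A : CompleteRing k) (τ τ' : CompleteRing.Hom R A),
    QFThat.map B τ (QMhat.toQFT B Ξ) = QFThat.map B τ' (QMhat.toQFT B Ξ) ↔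
      CompleteRing.Homotopic τ τ'
  /-- The same over an Artin ring `A` with `𝔪^(n+1) = 0`; a morphism `R → A` is the same as a
  morphism `R / 𝔪^(n+1) → A`. -/
  exists_hom_artin : ∀ (A : ParamRing k) (n : ℕ), A.maxIdeal ^ (n + 1) = ⊥ → ∀ ξ : B.QFT A,
    ∃ τ : ParamRing.Hom (R.obj n) A, QFT.map B τ (Quot.mk _ (Ξ.app n)) = ξ
  hom_unique_artin : ∀ (A : ParamRing k) (n : ℕ), A.maxIdeal ^ (n + 1) = ⊥ →
    ∀ τ τ' : ParamRing.Hom (R.obj n) A,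
      QFT.map B τ (Quot.mk _ (Ξ.app n)) = QFT.map B τ' (Quot.mk _ (Ξ.app n)) ↔
        Nonempty (ParamRing.Homotopy τ τ')

end Background

/-! ### Graded commutative power series -/

section PowerSeriesAlgebra

variable (k : Type u) [Field k] {r : ℕ} (deg : Fin r → ℤ)

/-- The exterior algebra over `k[[ħ]]` on the variables `t_j` of odd degree. -/
abbrev OddAlgebra : Type u := ExteriorAlgebra (Lam k) ({j : Fin r // Odd (deg j)} → Lam k)

/-- The graded commutative power series algebra `k[[ħ]][[t_1, …, t_r]]`, where `t_j` has degree
`deg j`: power series in the variables of even degree over the exterior algebra on the variables of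
odd degree. -/
abbrev GradedSeries : Type u := MvPowerSeries {j : Fin r // Even (deg j)} (OddAlgebra k deg)

/-- An odd variable, as an element of the exterior algebra. -/
def oddVar (j : {j : Fin r // Odd (deg j)}) : OddAlgebra k deg :=
  ExteriorAlgebra.ι (Lam k) (Pi.single j 1)

/-- The variable `t_j`. -/
def tvar (j : Fin r) : GradedSeries k deg :=
  if h : Even (deg j) then MvPowerSeries.X ⟨j, h⟩
  else MvPowerSeries.C (oddVar k deg ⟨j, Int.not_even_iff_odd.1 h⟩)

/-- The elements of degree `n` of the exterior algebra: the span of the products of odd variables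
of total degree `n`. -/
def oddGr (n : ℤ) : Submodule (Lam k) (OddAlgebra k deg) :=
  Submodule.span (Lam k) {x | ∃ l : List {j : Fin r // Odd (deg j)},
    (l.map fun j => deg j.1).sum = n ∧ (l.map (oddVar k deg)).prod = x}

/-- The power series which are homogeneous of degree `n`, where `ħ` has degree zero. -/
def seriesGr (n : ℤ) : Submodule (Lam k) (GradedSeries k deg) where
  carrier := {x | ∀ μ, MvPowerSeries.coeff μ x ∈
    oddGr k deg (n - μ.sum fun j e => (e : ℤ) * deg j.1)}
  add_mem' hx hy μ := by rw [map_add]; exact add_mem (hx μ) (hy μ)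
  zero_mem' μ := by rw [map_zero]; exact zero_mem _
  smul_mem' c x hx μ := by
    rw [show MvPowerSeries.coeff μ (c • x) = c • MvPowerSeries.coeff μ x from rfl]
    exact Submodule.smul_mem _ c (hx μ)

/-- The maximal ideal of `k[[ħ]][[t_1, …, t_r]]`, which is generated by `ħ` and the `t_j`. -/
def seriesMax : Submodule (Lam k) (GradedSeries k deg) :=
  (Ideal.span (insert (algebraMap (Lam k) (GradedSeries k deg) (hbar k))
    (Set.range (tvar k deg)))).restrictScalars (Lam k)

variable {k deg}

/-- A differential on `k[[ħ]][[t_1, …, t_r]]`: a `k[[ħ]]`-linear derivation of degree one and square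
zero. -/
structure IsDifferential (δ : GradedSeries k deg →ₗ[Lam k] GradedSeries k deg) : Prop where
  map_gr : ∀ {n : ℤ} {x}, x ∈ seriesGr k deg n → δ x ∈ seriesGr k deg (n + 1)
  leibniz : ∀ {n : ℤ} {x}, x ∈ seriesGr k deg n → ∀ y, δ (x * y) = δ x * y + sgn n • (x * δ y)
  sq_zero : ∀ x, δ (δ x) = 0

/-- The complete parameter ring `R` is `(k[[ħ]][[t_1, …, t_r]], δ)`: there are compatible
isomorphisms of the quotients of `k[[ħ]][[t_1, …, t_r]]` by the powers of the maximal ideal with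
the quotients `R / 𝔪^(n+1)`, which respect the degrees and the differentials. -/
structure Presentation (δ : GradedSeries k deg →ₗ[Lam k] GradedSeries k deg)
    (R : CompleteRing k) where
  proj : ∀ n, GradedSeries k deg →ₐ[Lam k] (R.obj n).carrier
  surjective : ∀ n, Function.Surjective (proj n)
  ker_proj : ∀ n x, proj n x = 0 ↔ x ∈ seriesMax k deg ^ (n + 1)
  comm : ∀ n x, (R.map n).toAlgHom (proj (n + 1) x) = proj n x
  map_gr : ∀ n {i : ℤ} {x}, x ∈ seriesGr k deg i → proj n x ∈ (R.obj n).gr i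
  map_d : ∀ n x, proj n (δ x) = (R.obj n).d (proj n x)

end PowerSeriesAlgebra

end QBackground

end

open QBackground

open scoped TensorProduct DirectSum Polynomial


noncomputable section

namespace QBackground

open Submodule (mul_mem_mul mem_bot subset_span mem_comap mem_sup_right mem_sup_left mem_sup span_le add_mem_sup mkQ_surjective mul_le span_induction)
open LinearMap (comp_apply id_apply lTensor_tmul rTensor_tmul lTensor_id lTensor_comp lTensor_sub lTensor rTensor ker range)
open TensorProduct (tmul_zero tmul_smul add_tmul map_tmul zero_tmul sub_tmul smul_tmul tmul_add)
open Polynomial (monomial coeff_monomial coeff_add coeff_C coeff_smul coeff_sub sum_def eval_monomial)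
open Finset (sum_congr sum_eq_single sum_range_succ' sum_add_distrib sum_sub_distrib)
open Finset.HasAntidiagonal (antidiagonal mem_antidiagonal)
open PowerSeries (C constantCoeff)
open AlgHom (toLinearMap_apply)

instance {k : Type u} [Field k] : CoeSort (DGAlg k) (Type u) := ⟨DGAlg.carrier⟩

instance {k : Type u} [Field k] : CoeSort (ParamRing k) (Type u) := ⟨fun A => A.carrier⟩

instance {k : Type u} [Field k] : Coe (ParamRing k) (DGAlg k) := ⟨ParamRing.toDGAlg⟩

instance {k : Type u} [Field k] {A A' : DGAlg k} : CoeFun (DGAlg.Hom A A') fun _ => A → A' :=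
  ⟨fun f => f.toAlgHom⟩

instance {k : Type u} [Field k] {A A' : ParamRing k} :
    CoeFun (ParamRing.Hom A A') fun _ => A → A' :=
  ⟨fun f => f.toAlgHom⟩

instance {k : Type u} [Field k] {A A' : ParamRing k} {f g : ParamRing.Hom A A'} :
    CoeFun (ParamRing.Homotopy f g) fun _ => A → A'.forms :=
  ⟨fun H => H.toAlgHom⟩

theorem sgn_eq_of_even {a b : ℤ} (h : Even (a - b)) : sgn a = sgn b := by
  have : sgn (a - b) = 1 := by simp [sgn, Int.negOnePow_even _ h]
  calc sgn a = sgn (a - b + b) := by rw [sub_add_cancel]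
    _ = sgn b := by rw [sgn_add, this, one_mul]

theorem sgn_one : sgn 1 = -1 := by simp [sgn]

section Graded

variable {R : Type u} {M : Type v} [CommRing R] [AddCommGroup M] [Module R M]
  {gr : ℤ → Submodule R M} (h : DirectSum.IsInternal gr)

/-- The projection to the part of degree `i`. -/
def pr (i : ℤ) : M →ₗ[R] M := weight h (fun j => if j = i then 1 else 0)

theorem pr_of_mem {i : ℤ} {x : M} (hx : x ∈ gr i) : pr h i x = x := by
  simp [pr, weight_of_mem h _ hx]

theorem pr_of_mem_ne {i j : ℤ} {x : M} (hx : x ∈ gr j) (hij : j ≠ i) : pr h i x = 0 := by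
  simp [pr, weight_of_mem h _ hx, hij]

theorem pr_mem (i : ℤ) (x : M) : pr h i x ∈ gr i := by
  refine graded_ind h (p := fun x => pr h i x ∈ gr i) (by simp)
    (fun x y hx hy => by rw [map_add]; exact add_mem hx hy) (fun j x hx => ?_) x
  by_cases hij : j = i
  · subst hij; rwa [pr_of_mem h hx]
  · rw [pr_of_mem_ne h hx hij]; exact zero_mem _

theorem mem_of_pr_eq {i : ℤ} {x : M} (hx : pr h i x = x) : x ∈ gr i := hx ▸ pr_mem h i x

theorem exists_sum_pr (x : M) : ∃ s : Finset ℤ, ∀ s', s ⊆ s' → ∑ i ∈ s', pr h i x = x := by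
  classical
  refine graded_ind h (p := fun x => ∃ s : Finset ℤ, ∀ s', s ⊆ s' → ∑ i ∈ s', pr h i x = x)
    ⟨∅, by simp⟩ ?_ (fun j x hx => ⟨{j}, fun s' hs => ?_⟩) x
  · rintro x y ⟨s, hs⟩ ⟨t, ht⟩
    refine ⟨s ∪ t, fun s' h' => ?_⟩
    simp only [map_add, sum_add_distrib]
    rw [hs s' (Finset.union_subset_left h'), ht s' (Finset.union_subset_right h')]
  · rw [sum_eq_single j (fun i _ hi => pr_of_mem_ne h hx (Ne.symm hi))
      (fun hj => absurd (hs (Finset.mem_singleton_self j)) hj), pr_of_mem h hx]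

theorem homogeneous_ind {J : Submodule R M} (hJ : ∀ i, ∀ x ∈ J, pr h i x ∈ J) {p : M → Prop}
    (h0 : p 0) (hadd : ∀ x y, p x → p y → p (x + y))
    (hmem : ∀ i, ∀ x ∈ gr i, x ∈ J → p x) {x : M} (hx : x ∈ J) : p x := by
  obtain ⟨s, hs⟩ := exists_sum_pr h x
  rw [← hs s subset_rfl]
  exact Finset.sum_induction _ p hadd h0 fun i _ => hmem i _ (pr_mem h i x) (hJ i x hx)

theorem weight_mem {J : Submodule R M} (hJ : ∀ i, ∀ x ∈ J, pr h i x ∈ J) (c : ℤ → ℤ) {x : M}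
    (hx : x ∈ J) : weight h c x ∈ J := by
  refine homogeneous_ind h hJ (p := fun x => weight h c x ∈ J) (by simp)
    (fun x y hx hy => by rw [map_add]; exact add_mem hx hy) (fun i x hi hx => ?_) hx
  rw [weight_of_mem h c hi]
  exact zsmul_mem hx _

end Graded

namespace DGAlg

variable {k : Type u} [Field k]

/-- A derivation of degree one, which need not have square zero. -/
structure IsDer (A : DGAlg k) (d : A →ₗ[Lam k] A) : Prop where
  map_gr : ∀ {i : ℤ} {a : A}, a ∈ A.gr i → d a ∈ A.gr (i + 1)
  leibniz : ∀ a b, d (a * b) = d a * b + A.par a * d b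

theorem isDer (A : DGAlg k) : A.IsDer A.d := ⟨A.d_mem, A.leibniz'⟩

variable {A : DGAlg k} {d : A →ₗ[Lam k] A}

theorem par_of_mem {i : ℤ} {a : A} (ha : a ∈ A.gr i) : A.par a = sgn i • a :=
  parity_of_mem _ ha

theorem IsDer.map_one (hd : A.IsDer d) : d 1 = 0 := by
  have := hd.leibniz 1 1
  simpa [A.par_one] using this

theorem IsDer.par_map (hd : A.IsDer d) (a : A) : A.par (d a) = -d (A.par a) := by
  refine graded_ind A.gr_internal (p := fun a => A.par (d a) = - d (A.par a))
    (by simp) (fun x y hx hy => by simp [hx, hy]; abel) (fun i a ha => ?_) a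
  rw [par_of_mem ha, par_of_mem (hd.map_gr ha), sgn_succ, map_zsmul, neg_smul]

end DGAlg

namespace Background

variable {k : Type u} [Field k] (B : Background.{u, v, w} k)

/-- The action on the vacuum. -/
def vac : B.P →ₗ[Lam k] B.N := (LinearMap.toSpanSingleton B.P B.N B.φ).restrictScalars (Lam k)

/-- The annihilator of the vacuum. -/
def ann : Submodule (Lam k) B.P := ker B.vac

theorem mem_ann {p : B.P} : p ∈ B.ann ↔ p • B.φ = 0 := Iff.rfl

theorem m_mem_ann : B.m ∈ B.ann := B.m_φ

theorem pr_ann (i : ℤ) (p : B.P) (hp : p ∈ B.ann) : pr B.grP_internal i p ∈ B.ann := by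
  have key : ∀ p : B.P, pr B.grP_internal i p • B.φ = pr B.grN_internal i (p • B.φ) := by
    refine graded_ind B.grP_internal (by simp)
      (fun x y hx hy => by rw [map_add, add_smul, add_smul, map_add, hx, hy]) fun j p hp => ?_
    have h1 : p • B.φ ∈ B.grN j := by simpa using B.smul_mem hp B.φ_mem
    by_cases hij : j = i
    · subst hij; rw [pr_of_mem _ hp, pr_of_mem _ h1]
    · rw [pr_of_mem_ne _ hp hij, pr_of_mem_ne _ h1 hij, zero_smul]
  rw [mem_ann, key, B.mem_ann.1 hp, map_zero]

theorem par_ann {p : B.P} (hp : p ∈ B.ann) : parity B.grP_internal p ∈ B.ann :=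
  weight_mem _ B.pr_ann _ hp

theorem mul_mem_ann (q : B.P) {p : B.P} (hp : p ∈ B.ann) : q * p ∈ B.ann := by
  rw [mem_ann, mul_smul, B.mem_ann.1 hp, smul_zero]

theorem hbar_smul_bracket (p q : B.P) : hbar k • B.bracket p q = B.comm p q :=
  B.hbar_smul_bracketFun p q

theorem bracket_ann {p q : B.P} (hp : p ∈ B.ann) (hq : q ∈ B.ann) : B.bracket p q ∈ B.ann := by
  have h : B.comm p q ∈ B.ann := by
    change p * q - (q * _ + _ * _) ∈ _
    exact sub_mem (B.mul_mem_ann _ hq) (add_mem (B.mul_mem_ann _ (weight_mem _ B.pr_ann _ hp))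
      (B.mul_mem_ann _ (weight_mem _ B.pr_ann _ hp)))
  rw [← hbar_smul_bracket, mem_ann, smul_assoc] at h
  exact B.torsionFreeN _ h

theorem comm_mem {i j : ℤ} {p q : B.P} (hp : p ∈ B.grP i) (hq : q ∈ B.grP j) :
    B.comm p q ∈ B.grP (i + j) := by
  rw [B.comm_apply hp hq]
  exact sub_mem (B.mul_mem hp hq) (zsmul_mem (add_comm i j ▸ B.mul_mem hq hp) _)

theorem bracket_mem {i j : ℤ} {p q : B.P} (hp : p ∈ B.grP i) (hq : q ∈ B.grP j) :
    B.bracket p q ∈ B.grP (i + j) := by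
  apply mem_of_pr_eq B.grP_internal
  apply B.hbar_injective
  rw [← map_smul, hbar_smul_bracket, pr_of_mem _ (B.comm_mem hp hq)]

theorem bracket_symm {i j : ℤ} {p q : B.P} (hp : p ∈ B.grP i) (hq : q ∈ B.grP j) :
    B.bracket p q = -(sgn (i * j) • B.bracket q p) := by
  apply B.hbar_injective
  rw [hbar_smul_bracket, smul_neg, smul_comm, hbar_smul_bracket, B.comm_apply hp hq,
    B.comm_apply hq hp, mul_comm j i, smul_sub, smul_smul, sgn_mul_self, one_smul, neg_sub]

theorem bracket_jacobi {i j l : ℤ} {p q r : B.P} (hp : p ∈ B.grP i) (hq : q ∈ B.grP j)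
    (hr : r ∈ B.grP l) : B.bracket p (B.bracket q r) =
      B.bracket (B.bracket p q) r + sgn (i * j) • B.bracket q (B.bracket p r) := by
  apply B.hbar_injective
  apply B.hbar_injective
  have e : ∀ x y z, hbar k • hbar k • B.bracket x (B.bracket y z) = B.comm x (B.comm y z) :=
    fun x y z => by rw [hbar_smul_bracket, ← map_smul, hbar_smul_bracket]
  have e' : hbar k • hbar k • B.bracket (B.bracket p q) r = B.comm (B.comm p q) r := by
    rw [hbar_smul_bracket, ← LinearMap.smul_apply, ← map_smul, hbar_smul_bracket]
  rw [smul_add, smul_add, e, e', smul_comm (hbar k) (sgn _), smul_comm (hbar k) (sgn _), e,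
    B.comm_apply hp (B.comm_mem hq hr), B.comm_apply (B.comm_mem hp hq) hr,
    B.comm_apply hq (B.comm_mem hp hr), B.comm_apply hq hr, B.comm_apply hp hq,
    B.comm_apply hp hr, mul_add, add_mul, mul_add, sgn_add, sgn_add, sgn_add, mul_comm j i]
  have h1 : sgn (i * j) * sgn (i * j) = 1 := sgn_mul_self _
  simp only [mul_sub, sub_mul, smul_sub, mul_smul_comm, smul_mul_assoc, smul_smul, mul_assoc]
  have h2 : sgn (i * j) * (sgn (i * j) * sgn (j * l)) = sgn (j * l) := by
    rw [← mul_assoc, h1, one_mul]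
  have h3 : sgn (i * j) * (sgn (i * j) * (sgn (j * l) * sgn (i * l))) =
      sgn (i * l) * sgn (j * l) := by
    rw [← mul_assoc, h1, one_mul, mul_comm]
  rw [h2, h3, mul_comm (sgn (j * l)) (sgn (i * j)), mul_comm (sgn (i * j)) (sgn (i * l)),
    mul_left_comm (sgn (i * j)) (sgn (i * l))]
  abel

theorem bracket_m_m : B.bracket B.m B.m = 0 := by
  apply B.hbar_injective
  rw [hbar_smul_bracket, B.comm_apply B.m_mem B.m_mem, B.m_sq, smul_zero, smul_zero, sub_zero]

variable (A : DGAlg k)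

/-- The span of the elements `p ⊗ a` of total degree `n` with `a ∈ J`. -/
def deg (J : Submodule (Lam k) A) (n : ℤ) : Submodule (Lam k) (B.P ⊗[Lam k] A) :=
  Submodule.span (Lam k) {x | ∃ (i : ℤ) (p : B.P) (a : A),
    p ∈ B.grP i ∧ a ∈ A.gr (n - i) ∧ a ∈ J ∧ p ⊗ₜ[Lam k] a = x}

variable {A} {J J' I : Submodule (Lam k) A}

theorem degZero_eq_deg : B.degZero A J = B.deg A J 0 := by
  simp only [degZero, deg, zero_sub]

theorem tmul_mem_deg {n i j : ℤ} {p : B.P} {a : A} (hp : p ∈ B.grP i) (ha : a ∈ A.gr j)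
    (haJ : a ∈ J) (hn : i + j = n) : p ⊗ₜ[Lam k] a ∈ B.deg A J n :=
  subset_span ⟨i, p, a, hp, by rwa [← hn, add_sub_cancel_left], haJ, rfl⟩

theorem tmul_mem_spanT (p : B.P) {a : A} (ha : a ∈ J) : p ⊗ₜ[Lam k] a ∈ B.spanT A J :=
  subset_span ⟨p, a, ha, rfl⟩

variable {B}

theorem deg_le {n : ℤ} {X : Submodule (Lam k) (B.P ⊗[Lam k] A)}
    (h : ∀ i p a, p ∈ B.grP i → a ∈ A.gr (n - i) → a ∈ J → p ⊗ₜ[Lam k] a ∈ X) :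
    B.deg A J n ≤ X := by
  refine span_le.2 ?_
  rintro _ ⟨i, p, a, hp, ha, haJ, rfl⟩
  exact h i p a hp ha haJ

theorem spanT_le {X : Submodule (Lam k) (B.P ⊗[Lam k] A)}
    (h : ∀ p a, a ∈ J → p ⊗ₜ[Lam k] a ∈ X) : B.spanT A J ≤ X := by
  refine span_le.2 ?_
  rintro _ ⟨p, a, haJ, rfl⟩
  exact h p a haJ

theorem deg_mono {n : ℤ} (h : J ≤ J') : B.deg A J n ≤ B.deg A J' n :=
  deg_le fun _ _ _ hp ha haJ => B.tmul_mem_deg hp ha (h haJ) (by ring)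

theorem spanT_mono (h : J ≤ J') : B.spanT A J ≤ B.spanT A J' :=
  spanT_le fun _ _ haJ => B.tmul_mem_spanT _ (h haJ)

theorem deg_le_spanT {n : ℤ} : B.deg A J n ≤ B.spanT A J :=
  deg_le fun _ _ _ _ _ haJ => B.tmul_mem_spanT _ haJ

theorem deg_ext {n : ℤ} {X : Type*} [AddCommGroup X] [Module (Lam k) X]
    {f g : B.P ⊗[Lam k] A →ₗ[Lam k] X}
    (h : ∀ i p a, p ∈ B.grP i → a ∈ A.gr (n - i) → a ∈ J →
      f (p ⊗ₜ[Lam k] a) = g (p ⊗ₜ[Lam k] a)) {x : B.P ⊗[Lam k] A}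
    (hx : x ∈ B.deg A J n) : f x = g x := by
  have : B.deg A J n ≤ LinearMap.eqLocus f g := deg_le h
  exact this hx

variable (B) in
theorem m_mem_deg : B.m ⊗ₜ[Lam k] (1 : A) ∈ B.deg A ⊤ 1 :=
  B.tmul_mem_deg B.m_mem A.one_mem trivial (by ring)

theorem bracketT_tmul {i j : ℤ} (p : B.P) {q : B.P} {a : A} (b : A)
    (hq : q ∈ B.grP j) (ha : a ∈ A.gr i) :
    B.bracketT A (p ⊗ₜ a) (q ⊗ₜ b) = sgn (i * j) • (B.bracket p q ⊗ₜ[Lam k] (a * b)) := by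
  simp only [bracketT, LinearMap.add_apply, TensorProduct.map₂_apply_tmul, comp_apply,
    map_tmul, LinearMap.compl₂_apply, LinearMap.mul_apply', evenPart, oddPart]
  rw [weight_of_mem _ _ hq, weight_of_mem _ _ hq, DGAlg.par_of_mem ha]
  rcases Int.even_or_odd j with hj | hj
  · have : sgn (i * j) = 1 := by simp [sgn, Int.negOnePow_even _ (hj.mul_left i)]
    simp [hj, this]
  · have : sgn (i * j) = sgn i := sgn_eq_of_even (by
      rw [show i * j - i = i * (j - 1) by ring]
      exact (hj.sub_odd odd_one).mul_left _)
    simp only [Int.not_even_iff_odd.2 hj, if_false, zero_smul, map_zero, zero_tmul,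
      zero_add, one_smul, this, smul_mul_assoc, tmul_smul]

theorem bracketT_deg {s t : ℤ} {x y : B.P ⊗[Lam k] A} (hx : x ∈ B.deg A J s)
    (hy : y ∈ B.deg A J' t) : B.bracketT A x y ∈ B.deg A (J * J') (s + t) := by
  have h1 : B.deg A J s ≤ (B.deg A (J * J') (s + t)).comap ((B.bracketT A).flip y) := by
    refine deg_le fun i p a hp ha haJ => ?_
    change B.bracketT A (p ⊗ₜ a) y ∈ B.deg A (J * J') (s + t)
    have h2 : B.deg A J' t ≤
        (B.deg A (J * J') (s + t)).comap (B.bracketT A (p ⊗ₜ[Lam k] a)) := by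
      refine deg_le fun j q b hq hb hbJ => ?_
      rw [mem_comap, bracketT_tmul p b hq ha]
      exact zsmul_mem (B.tmul_mem_deg (B.bracket_mem hp hq) (A.mul_mem ha hb)
        (mul_mem_mul haJ hbJ) (by ring)) _
    exact h2 hy
  exact h1 hx

theorem bracketT_symm {s t : ℤ} {x y : B.P ⊗[Lam k] A} (hx : x ∈ B.deg A ⊤ s)
    (hy : y ∈ B.deg A ⊤ t) : B.bracketT A x y = -(sgn (s * t) • B.bracketT A y x) := by
  refine deg_ext (f := (B.bracketT A).flip y) (g := -(sgn (s * t) • B.bracketT A y))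
    (fun i p a hp ha _ => ?_) hx
  change B.bracketT A (p ⊗ₜ a) y = -(sgn (s * t) • B.bracketT A y (p ⊗ₜ a))
  refine deg_ext (f := B.bracketT A (p ⊗ₜ a))
    (g := -(sgn (s * t) • (B.bracketT A).flip (p ⊗ₜ a))) (fun j q b hq hb _ => ?_) hy
  change B.bracketT A (p ⊗ₜ a) (q ⊗ₜ b) = -(sgn (s * t) • B.bracketT A (q ⊗ₜ b) (p ⊗ₜ a))
  rw [bracketT_tmul p b hq ha, bracketT_tmul q a hp hb, B.bracket_symm hp hq, A.gcomm ha hb,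
    TensorProduct.neg_tmul, tmul_smul, ← TensorProduct.smul_tmul', smul_neg,
    smul_smul, smul_smul, smul_smul, ← sgn_add, ← sgn_add, ← sgn_add]
  congr 2
  refine sgn_eq_of_even ?_
  simp only [Int.even_add, Int.even_sub, Int.even_mul]
  tauto

theorem bracketT_jacobi_tmul {i j m s t l : ℤ} {p q r : B.P} {a b c : A}
    (hp : p ∈ B.grP i) (ha : a ∈ A.gr (s - i)) (hq : q ∈ B.grP j) (hb : b ∈ A.gr (t - j))
    (hr : r ∈ B.grP m) (hc : c ∈ A.gr (l - m)) :
    B.bracketT A (p ⊗ₜ a) (B.bracketT A (q ⊗ₜ b) (r ⊗ₜ c)) =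
      B.bracketT A (B.bracketT A (p ⊗ₜ a) (q ⊗ₜ b)) (r ⊗ₜ c) +
      sgn (s * t) • B.bracketT A (q ⊗ₜ b) (B.bracketT A (p ⊗ₜ a) (r ⊗ₜ c)) := by
  have e1 : b * (a * c) = sgn ((t - j) * (s - i)) • (a * (b * c)) := by
    rw [← mul_assoc, A.gcomm hb ha, smul_mul_assoc, mul_assoc]
  rw [bracketT_tmul q c hr hb, bracketT_tmul p b hq ha, bracketT_tmul p c hr ha, map_zsmul,
    map_zsmul, map_zsmul, LinearMap.smul_apply, bracketT_tmul p _ (B.bracket_mem hq hr) ha,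
    bracketT_tmul _ c hr (A.mul_mem ha hb), bracketT_tmul q _ (B.bracket_mem hp hr) hb,
    B.bracket_jacobi hp hq hr, e1, mul_assoc]
  generalize B.bracket (B.bracket p q) r = X
  generalize B.bracket q (B.bracket p r) = Y
  generalize a * (b * c) = Z
  rw [add_tmul, tmul_smul, ← TensorProduct.smul_tmul']
  generalize X ⊗ₜ[Lam k] Z = X'
  generalize Y ⊗ₜ[Lam k] Z = Y'
  have s1 : sgn ((s - i) * (j + m)) * sgn ((t - j) * m) =
      sgn ((s - i) * j) * sgn ((s - i + (t - j)) * m) := by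
    rw [← sgn_add, ← sgn_add]
    congr 1
    ring
  have s2 : sgn ((s - i) * (j + m)) * sgn ((t - j) * m) * sgn (i * j) =
      sgn (s * t) * sgn ((s - i) * m) * sgn ((t - j) * (i + m)) * sgn ((t - j) * (s - i)) := by
    simp only [← sgn_add]
    exact sgn_eq_of_even ⟨s * j - s * t, by ring⟩
  have e2 := congrArg (· • X') s1
  have e3 := congrArg (· • Y') s2
  simp only [smul_add, smul_smul] at e2 e3 ⊢
  simp only [mul_assoc, mul_comm, mul_left_comm] at e2 e3 ⊢
  rw [e2, e3]

theorem bracketT_jacobi {s t l : ℤ} {x y z : B.P ⊗[Lam k] A} (hx : x ∈ B.deg A ⊤ s)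
    (hy : y ∈ B.deg A ⊤ t) (hz : z ∈ B.deg A ⊤ l) : B.bracketT A x (B.bracketT A y z) =
      B.bracketT A (B.bracketT A x y) z + sgn (s * t) • B.bracketT A y (B.bracketT A x z) := by
  have h1 : ∀ i p a j q b, p ∈ B.grP i → a ∈ A.gr (s - i) → q ∈ B.grP j → b ∈ A.gr (t - j) →
      B.bracketT A (p ⊗ₜ a) (B.bracketT A (q ⊗ₜ b) z) =
        B.bracketT A (B.bracketT A (p ⊗ₜ a) (q ⊗ₜ b)) z +
        sgn (s * t) • B.bracketT A (q ⊗ₜ b) (B.bracketT A (p ⊗ₜ a) z) := by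
    intro i p a j q b hp ha hq hb
    exact deg_ext (f := B.bracketT A (p ⊗ₜ a) ∘ₗ B.bracketT A (q ⊗ₜ b))
      (g := B.bracketT A (B.bracketT A (p ⊗ₜ a) (q ⊗ₜ b)) +
        sgn (s * t) • (B.bracketT A (q ⊗ₜ b) ∘ₗ B.bracketT A (p ⊗ₜ a)))
      (fun m r c hr hc _ => bracketT_jacobi_tmul hp ha hq hb hr hc) hz
  have h2 : ∀ i p a, p ∈ B.grP i → a ∈ A.gr (s - i) →
      B.bracketT A (p ⊗ₜ a) (B.bracketT A y z) = B.bracketT A (B.bracketT A (p ⊗ₜ a) y) z +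
        sgn (s * t) • B.bracketT A y (B.bracketT A (p ⊗ₜ a) z) := by
    intro i p a hp ha
    exact deg_ext (f := B.bracketT A (p ⊗ₜ a) ∘ₗ (B.bracketT A).flip z)
      (g := (B.bracketT A).flip z ∘ₗ B.bracketT A (p ⊗ₜ a) +
        sgn (s * t) • (B.bracketT A).flip (B.bracketT A (p ⊗ₜ a) z))
      (fun j q b hq hb _ => h1 i p a j q b hp ha hq hb) hy
  exact deg_ext (f := (B.bracketT A).flip (B.bracketT A y z))
    (g := (B.bracketT A).flip z ∘ₗ (B.bracketT A).flip y +
      sgn (s * t) • (B.bracketT A y ∘ₗ (B.bracketT A).flip z))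
    (fun i p a hp ha _ => h2 i p a hp ha) hx

variable (B) in
/-- The map `p ⊗ a ↦ (-1)^|p| p ⊗ d a`, for a linear map `d` of odd degree. -/
def diffP {X Y : Type u} [AddCommGroup X] [Module (Lam k) X] [AddCommGroup Y] [Module (Lam k) Y]
    (d : X →ₗ[Lam k] Y) : B.P ⊗[Lam k] X →ₗ[Lam k] B.P ⊗[Lam k] Y :=
  TensorProduct.map (parity B.grP_internal) d

theorem diffP_tmul {X Y : Type u} [AddCommGroup X] [Module (Lam k) X] [AddCommGroup Y]
    [Module (Lam k) Y] (d : X →ₗ[Lam k] Y) {i : ℤ} {p : B.P} (hp : p ∈ B.grP i) (a : X) :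
    B.diffP d (p ⊗ₜ a) = sgn i • (p ⊗ₜ[Lam k] d a) := by
  rw [diffP, map_tmul, parity_of_mem _ hp, TensorProduct.smul_tmul']

theorem diffP_deg {A' : DGAlg k} {d : A →ₗ[Lam k] A'} {e : ℤ}
    {J' : Submodule (Lam k) A'} (hd : ∀ i, ∀ a ∈ A.gr i, a ∈ J → d a ∈ A'.gr (i + e))
    (hJ : ∀ a ∈ J, d a ∈ J') {n : ℤ}
    {x : B.P ⊗[Lam k] A} (hx : x ∈ B.deg A J n) : B.diffP d x ∈ B.deg A' J' (n + e) := by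
  have : B.deg A J n ≤ (B.deg A' J' (n + e)).comap (B.diffP d) := by
    refine deg_le fun i p a hp ha haJ => ?_
    rw [mem_comap, diffP_tmul d hp]
    exact zsmul_mem (B.tmul_mem_deg hp (hd _ _ ha haJ) (hJ a haJ) (by ring)) _
  exact this hx

theorem push_deg {A' : DGAlg k} {f : A →ₗ[Lam k] A'} {e : ℤ}
    {J' : Submodule (Lam k) A'} (hf : ∀ i, ∀ a ∈ A.gr i, a ∈ J → f a ∈ A'.gr (i + e))
    (hJ : ∀ a ∈ J, f a ∈ J') {n : ℤ}
    {x : B.P ⊗[Lam k] A} (hx : x ∈ B.deg A J n) : B.push f x ∈ B.deg A' J' (n + e) := by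
  have : B.deg A J n ≤ (B.deg A' J' (n + e)).comap (B.push f) := by
    refine deg_le fun i p a hp ha haJ => ?_
    rw [mem_comap, lTensor_tmul]
    exact B.tmul_mem_deg hp (hf _ _ ha haJ) (hJ a haJ) (by ring)
  exact this hx

theorem push_deg_zero {A' : DGAlg k} {f : A →ₗ[Lam k] A'} {J' : Submodule (Lam k) A'}
    (hf : ∀ {i a}, a ∈ A.gr i → f a ∈ A'.gr i) (hJ : ∀ a ∈ J, f a ∈ J') {i : ℤ}
    {x : B.P ⊗[Lam k] A} (hx : x ∈ B.deg A J i) : B.push f x ∈ B.deg A' J' i := by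
  simpa using push_deg (A' := A') (e := 0) (f := f)
    (fun i a ha _ => by rw [add_zero]; exact hf ha) hJ hx

theorem push_spanT {A' : DGAlg k} {f : A →ₗ[Lam k] A'}
    {J' : Submodule (Lam k) A'} (hJ : ∀ a ∈ J, f a ∈ J')
    {x : B.P ⊗[Lam k] A} (hx : x ∈ B.spanT A J) : B.push f x ∈ B.spanT A' J' := by
  have : B.spanT A J ≤ (B.spanT A' J').comap (B.push f) := by
    refine spanT_le fun p a haJ => ?_
    rw [mem_comap, lTensor_tmul]
    exact B.tmul_mem_spanT p (hJ a haJ)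
  exact this hx

theorem diffP_spanT {A' : DGAlg k} {f : A →ₗ[Lam k] A'}
    {J' : Submodule (Lam k) A'} (hJ : ∀ a ∈ J, f a ∈ J')
    {x : B.P ⊗[Lam k] A} (hx : x ∈ B.spanT A J) : B.diffP f x ∈ B.spanT A' J' := by
  have : B.spanT A J ≤ (B.spanT A' J').comap (B.diffP f) := by
    refine spanT_le fun p a haJ => ?_
    rw [mem_comap, diffP, map_tmul]
    exact B.tmul_mem_spanT _ (hJ a haJ)
  exact this hx

theorem diffP_bracketT {d : A →ₗ[Lam k] A} (hd : A.IsDer d) {s t : ℤ}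
    {x y : B.P ⊗[Lam k] A} (hx : x ∈ B.deg A ⊤ s) (hy : y ∈ B.deg A ⊤ t) :
    B.diffP d (B.bracketT A x y) =
      B.bracketT A (B.diffP d x) y + sgn s • B.bracketT A x (B.diffP d y) := by
  refine deg_ext (f := B.diffP d ∘ₗ (B.bracketT A).flip y)
    (g := (B.bracketT A).flip y ∘ₗ B.diffP d + sgn s • (B.bracketT A).flip (B.diffP d y))
    (fun i p a hp ha _ => ?_) hx
  change B.diffP d (B.bracketT A (p ⊗ₜ a) y) = B.bracketT A (B.diffP d (p ⊗ₜ a)) y +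
    sgn s • B.bracketT A (p ⊗ₜ a) (B.diffP d y)
  refine deg_ext (f := B.diffP d ∘ₗ B.bracketT A (p ⊗ₜ a))
    (g := B.bracketT A (B.diffP d (p ⊗ₜ a)) + sgn s • (B.bracketT A (p ⊗ₜ a) ∘ₗ B.diffP d))
    (fun j q b hq hb _ => ?_) hy
  change B.diffP d (B.bracketT A (p ⊗ₜ a) (q ⊗ₜ b)) = B.bracketT A (B.diffP d (p ⊗ₜ a)) (q ⊗ₜ b) +
    sgn s • B.bracketT A (p ⊗ₜ a) (B.diffP d (q ⊗ₜ b))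
  rw [bracketT_tmul p b hq ha, diffP_tmul d hp, diffP_tmul d hq, map_zsmul, map_zsmul, map_zsmul,
    LinearMap.smul_apply, diffP_tmul d (B.bracket_mem hp hq), bracketT_tmul p b hq (hd.map_gr ha),
    bracketT_tmul p _ hq ha, hd.leibniz, DGAlg.par_of_mem ha, tmul_add, smul_mul_assoc, tmul_smul]
  simp only [smul_add, smul_smul, ← sgn_add]
  congr 1
  · congr 1
    refine sgn_eq_of_even ?_
    simp only [Int.even_add, Int.even_sub, Int.even_mul]
    tauto
  · congr 1
    refine sgn_eq_of_even ?_
    simp only [Int.even_add, Int.even_sub, Int.even_mul]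
    tauto

end Background


namespace Background

variable {k : Type u} [Field k]

variable (k) in
/-- The scalar `1 / j!`. -/
def invFact (j : ℕ) : Lam k := C ((j.factorial : k)⁻¹)

variable (k) in
theorem invFact_zero : invFact k 0 = 1 := by simp [invFact]

variable (k) in
theorem invFact_one : invFact k 1 = 1 := by simp [invFact]

theorem invFact_succ [CharZero k] (j : ℕ) : ((j + 1 : ℕ) : Lam k) * invFact k (j + 1) = invFact k j := by
  rw [invFact, invFact, ← map_natCast (C (R := k)), ← map_mul, Nat.factorial_succ]
  congr 1
  have h1 : ((j + 1 : ℕ) : k) ≠ 0 := by exact_mod_cast Nat.succ_ne_zero j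
  have h2 : (j.factorial : k) ≠ 0 := by exact_mod_cast Nat.factorial_ne_zero j
  push_cast at *
  field_simp

theorem natCast_smul_cancel [CharZero k] {M : Type*} [AddCommGroup M] [Module (Lam k) M] (j : ℕ)
    {x y : M} (h : ((j + 1 : ℕ) : Lam k) • x = ((j + 1 : ℕ) : Lam k) • y) : x = y := by
  have h1 : ((j + 1 : ℕ) : k) ≠ 0 := by exact_mod_cast Nat.succ_ne_zero j
  have h2 : (C (((j + 1 : ℕ) : k)⁻¹) : Lam k) * ((j + 1 : ℕ) : Lam k) = 1 := by
    rw [← map_natCast (C (R := k)), ← map_mul, inv_mul_cancel₀ h1, map_one]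
  have := congrArg ((C (((j + 1 : ℕ) : k)⁻¹) : Lam k) • ·) h
  simpa only [smul_smul, h2, one_smul] using this

theorem add_apply_sub_apply {R L : Type*} [CommRing R] [AddCommGroup L] [Module R L]
    (f : L →ₗ[R] L →ₗ[R] L) (π q x y : L) :
    f (π + q) x - f π y = f π (x - y) + f q x := by
  rw [map_add, LinearMap.add_apply, map_sub]; abel

theorem sub_apply_sub {R L : Type*} [CommRing R] [AddCommGroup L] [Module R L]
    (f : L →ₗ[R] L →ₗ[R] L) {x y : L} (h : f y x = f x y) :
    f (x - y) (x - y) = f x x - (2 : R) • f x y + f y y := by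
  simp only [map_sub, LinearMap.sub_apply, h, two_smul]
  abel

theorem end_pow_succ_apply {R L : Type*} [CommRing R] [AddCommGroup L] [Module R L]
    (f : L →ₗ[R] L) (j : ℕ) (x : L) : (f ^ (j + 1)) x = f ((f ^ j) x) := by
  rw [pow_succ']; rfl

variable {B : Background.{u, v, w} k} {A A' : DGAlg k}

variable (B A) in
/-- The expansion of the master equation for a derivation `d` whose square need not be zero. -/
def master (d : A →ₗ[Lam k] A) (n : ℕ) (π : B.P ⊗[Lam k] A) :
    B.P ⊗[Lam k] A :=
  ∑ j ∈ Finset.range n, (invFact k j • ((B.bracketT A π) ^ j) (B.m ⊗ₜ[Lam k] (1 : A)) +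
      invFact k (j + 1) • ((B.bracketT A π) ^ j) (B.diffP d π))

theorem masterSum_eq (n : ℕ) (π : B.P ⊗[Lam k] A) : B.masterSum A n π = B.master A A.d n π := rfl

variable (B A) in
/-- The span of the `p ⊗ a` where `p` annihilates the vacuum. -/
def annT : Submodule (Lam k) (B.P ⊗[Lam k] A) :=
  Submodule.span (Lam k) {x | ∃ (p : B.P) (a : A), p ∈ B.ann ∧ p ⊗ₜ[Lam k] a = x}

theorem tmul_mem_annT {p : B.P} (hp : p ∈ B.ann) (a : A) : p ⊗ₜ[Lam k] a ∈ B.annT A :=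
  subset_span ⟨p, a, hp, rfl⟩

theorem annT_le {X : Submodule (Lam k) (B.P ⊗[Lam k] A)}
    (h : ∀ p a, p ∈ B.ann → p ⊗ₜ[Lam k] a ∈ X) : B.annT A ≤ X := by
  refine span_le.2 ?_
  rintro _ ⟨p, a, hp, rfl⟩
  exact h p a hp

theorem bracketT_annT {x y : B.P ⊗[Lam k] A} (hx : x ∈ B.annT A) (hy : y ∈ B.annT A) :
    B.bracketT A x y ∈ B.annT A := by
  have h1 : B.annT A ≤ (B.annT A).comap ((B.bracketT A).flip y) := by
    refine annT_le fun p a hp => ?_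
    change B.bracketT A (p ⊗ₜ a) y ∈ B.annT A
    have h2 : B.annT A ≤ (B.annT A).comap (B.bracketT A (p ⊗ₜ[Lam k] a)) := by
      refine annT_le fun q b hq => ?_
      rw [mem_comap]
      simp only [bracketT, LinearMap.add_apply, TensorProduct.map₂_apply_tmul,
        comp_apply, map_tmul, LinearMap.compl₂_apply]
      exact add_mem (tmul_mem_annT (B.bracket_ann hp (weight_mem _ B.pr_ann _ hq)) _)
        (tmul_mem_annT (B.bracket_ann hp (weight_mem _ B.pr_ann _ hq)) _)
    exact h2 hy
  exact h1 hx

theorem diffP_annT {d : A →ₗ[Lam k] A'} {x : B.P ⊗[Lam k] A}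
    (hx : x ∈ B.annT A) : B.diffP d x ∈ B.annT A' := by
  have h1 : B.annT A ≤ (B.annT A').comap (B.diffP d) := by
    refine annT_le fun p a hp => ?_
    rw [mem_comap, diffP, map_tmul]
    exact tmul_mem_annT (B.par_ann hp) _
  exact h1 hx

theorem push_annT {d : A →ₗ[Lam k] A'} {x : B.P ⊗[Lam k] A}
    (hx : x ∈ B.annT A) : B.push d x ∈ B.annT A' := by
  have h1 : B.annT A ≤ (B.annT A').comap (B.push d) := by
    refine annT_le fun p a hp => ?_
    rw [mem_comap, lTensor_tmul]
    exact tmul_mem_annT hp _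
  exact h1 hx

theorem m_mem_annT : B.m ⊗ₜ[Lam k] (1 : A) ∈ B.annT A := tmul_mem_annT B.m_mem_ann _

variable (B A) in
/-- The elements which annihilate the vacuum modulo `J`. -/
def annMod (J : Submodule (Lam k) A) : Submodule (Lam k) (B.P ⊗[Lam k] A) :=
  B.annT A ⊔ B.spanT A J

theorem push_annMod {J : Submodule (Lam k) A} {J' : Submodule (Lam k) A'}
    {f : A →ₗ[Lam k] A'} (hJ : ∀ a ∈ J, f a ∈ J')
    {x : B.P ⊗[Lam k] A} (hx : x ∈ B.annMod A J) : B.push f x ∈ B.annMod A' J' := by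
  obtain ⟨y, hy, z, hz, rfl⟩ := mem_sup.1 hx
  rw [map_add]
  exact add_mem_sup (push_annT hy) (push_spanT hJ hz)

theorem diffP_annMod {J : Submodule (Lam k) A} {J' : Submodule (Lam k) A'}
    {f : A →ₗ[Lam k] A'} (hJ : ∀ a ∈ J, f a ∈ J')
    {x : B.P ⊗[Lam k] A} (hx : x ∈ B.annMod A J) : B.diffP f x ∈ B.annMod A' J' := by
  obtain ⟨y, hy, z, hz, rfl⟩ := mem_sup.1 hx
  rw [map_add]
  exact add_mem_sup (diffP_annT hy) (diffP_spanT hJ hz)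

variable (B A) in
/-- The differential `{m, -} - d` of `P ⊗ A`. -/
def totalD (d : A →ₗ[Lam k] A) : B.P ⊗[Lam k] A →ₗ[Lam k]
    B.P ⊗[Lam k] A := rTensor A (B.bracket B.m) - B.diffP d

theorem bracketT_m (x : B.P ⊗[Lam k] A) :
    B.bracketT A (B.m ⊗ₜ 1) x = rTensor A (B.bracket B.m) x := by
  induction x with
  | zero => simp
  | add x y hx hy => rw [map_add, map_add, hx, hy]
  | tmul p a =>
    refine graded_ind B.grP_internal (p := fun p => B.bracketT A (B.m ⊗ₜ 1) (p ⊗ₜ a) =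
      rTensor A (B.bracket B.m) (p ⊗ₜ a)) (by simp)
      (fun x y hx hy => by rw [add_tmul, map_add, map_add, hx, hy])
      (fun i p hp => ?_) p
    rw [bracketT_tmul _ _ hp A.one_mem, zero_mul, sgn_zero, one_smul, one_mul, rTensor_tmul]

theorem totalD_apply (d : A →ₗ[Lam k] A) (x : B.P ⊗[Lam k] A) :
    B.totalD A d x = B.bracketT A (B.m ⊗ₜ 1) x - B.diffP d x := by
  rw [bracketT_m]; rfl

theorem totalD_tmul (d : A →ₗ[Lam k] A) {i : ℤ} {p : B.P} (hp : p ∈ B.grP i)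
    (a : A) : B.totalD A d (p ⊗ₜ a) =
      B.bracket B.m p ⊗ₜ a - sgn i • (p ⊗ₜ[Lam k] d a) := by
  rw [← diffP_tmul d hp]; rfl

section Ad

variable {I J J' : Submodule (Lam k) A} {d : A →ₗ[Lam k] A}

theorem deg_eq_bot {n : ℤ} (h : J = ⊥) : B.deg A J n = ⊥ := by
  rw [eq_bot_iff]
  refine deg_le fun i p a _ _ ha => ?_
  rw [h, mem_bot] at ha
  rw [ha, tmul_zero]
  exact zero_mem _

theorem ad_deg {n : ℤ} {π x : B.P ⊗[Lam k] A} (hπ : π ∈ B.deg A I 0)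
    (hx : x ∈ B.deg A J n) (h : I * J ≤ J') : B.bracketT A π x ∈ B.deg A J' n := by
  have := bracketT_deg hπ hx
  rw [zero_add] at this
  exact deg_mono h this

theorem ad_pow_deg {n : ℤ} {π x : B.P ⊗[Lam k] A} (hπ : π ∈ B.deg A I 0)
    (hx : x ∈ B.deg A J n) (h : I * J ≤ J) (j : ℕ) : (B.bracketT A π ^ j) x ∈ B.deg A J n := by
  induction j with
  | zero => exact hx
  | succ j ih => rw [end_pow_succ_apply]; exact ad_deg hπ ih h

theorem ad_pow_eq_zero {n : ℤ} {π x : B.P ⊗[Lam k] A} (hπ : π ∈ B.deg A I 0)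
    (hx : x ∈ B.deg A ⊤ n) {N j : ℕ} (hN : I ^ N = ⊥) (hj : N ≤ j) :
    (B.bracketT A π ^ j) x = 0 := by
  have key : ∀ j, (B.bracketT A π ^ j) x ∈ B.deg A (I ^ j * ⊤) n := by
    intro j
    induction j with
    | zero =>
      refine deg_mono ?_ hx
      rw [pow_zero, one_mul]
    | succ j ih =>
      rw [end_pow_succ_apply]
      exact ad_deg hπ ih (by rw [pow_succ', mul_assoc])
  have h0 : I ^ j * ⊤ = ⊥ := by
    rw [← Nat.sub_add_cancel hj, pow_add, hN, Submodule.mul_bot, Submodule.bot_mul]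
  have := key j
  rwa [deg_eq_bot h0, mem_bot] at this

theorem diffP_mem (hd : A.IsDer d) (hJ : ∀ a ∈ J, d a ∈ J) {n : ℤ} {x : B.P ⊗[Lam k] A}
    (hx : x ∈ B.deg A J n) : B.diffP d x ∈ B.deg A J (n + 1) :=
  diffP_deg (fun _ _ ha _ => hd.map_gr ha) hJ hx

variable {π q : B.P ⊗[Lam k] A}

theorem master_succ (n : ℕ) : B.master A d (n + 1) π = B.m ⊗ₜ 1 + (∑ j ∈ Finset.range n,
      invFact k (j + 1) • ((B.bracketT A π) ^ j) (B.bracketT A π (B.m ⊗ₜ[Lam k] (1 : A))) +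
    ∑ j ∈ Finset.range (n + 1), invFact k (j + 1) • ((B.bracketT A π) ^ j) (B.diffP d π)) := by
  rw [master, sum_add_distrib, sum_range_succ', ← add_assoc]
  congr 1
  rw [add_comm]
  congr 1
  simp [invFact_zero]

theorem master_mem (hd : A.IsDer d) (hI : I * ⊤ ≤ I) (hdI : ∀ a ∈ I, d a ∈ I)
    (hπ : π ∈ B.deg A I 0) {n : ℕ} (hn : 1 ≤ n) :
    B.master A d n π - B.m ⊗ₜ 1 ∈ B.deg A I 1 := by
  obtain ⟨n, rfl⟩ := Nat.exists_eq_add_of_le' hn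
  rw [master_succ, add_sub_cancel_left]
  have hII : I * I ≤ I := (mul_le_mul' le_rfl le_top).trans hI
  refine add_mem (sum_mem fun j _ => Submodule.smul_mem _ _ ?_)
    (sum_mem fun j _ => Submodule.smul_mem _ _ ?_)
  · exact ad_pow_deg hπ (ad_deg hπ B.m_mem_deg hI) hII j
  · have := diffP_mem hd hdI hπ
    rw [zero_add] at this
    exact ad_pow_deg hπ this hII j

theorem master_mem_top (hd : A.IsDer d) (hI : I * ⊤ ≤ I) (hdI : ∀ a ∈ I, d a ∈ I)
    (hπ : π ∈ B.deg A I 0) {n : ℕ} (hn : 1 ≤ n) : B.master A d n π ∈ B.deg A ⊤ 1 := by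
  rw [← sub_add_cancel (B.master A d n π) (B.m ⊗ₜ 1)]
  exact add_mem (deg_mono le_top (master_mem hd hI hdI hπ hn)) B.m_mem_deg

theorem master_stable (hd : A.IsDer d) (hπ : π ∈ B.deg A I 0) {N n : ℕ}
    (hN : I ^ N = ⊥) (hn : N ≤ n) : B.master A d n π = B.master A d N π := by
  rw [master, master, eq_comm]
  refine Finset.sum_subset (Finset.range_mono hn) fun j _ hj => ?_
  rw [Finset.mem_range, not_lt] at hj
  rw [ad_pow_eq_zero hπ B.m_mem_deg hN hj, ad_pow_eq_zero hπ
    (diffP_mem (J := ⊤) hd (fun _ _ => trivial) (deg_mono le_top hπ)) hN hj, smul_zero, smul_zero, add_zero]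

/-- The master equation under a small change of `π`. -/
theorem master_add (hd : A.IsDer d) (hI : I * ⊤ ≤ I) (hdI : ∀ a ∈ I, d a ∈ I) (hJ : J ≤ I)
    (hJt : J * ⊤ ≤ J) (hdJ : ∀ a ∈ J, d a ∈ J) (hIJ : I * J ≤ J') (hJI : J * I ≤ J')
    (hJ' : J' ≤ J) (hπ : π ∈ B.deg A I 0) (hq : q ∈ B.deg A J 0) {n : ℕ} (hn : 2 ≤ n) :
    B.master A d n (π + q) - B.master A d n π + B.totalD A d q ∈ B.spanT A J' := by
  obtain ⟨n, rfl⟩ := Nat.exists_eq_add_of_le' hn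
  have hII : I * I ≤ I := (mul_le_mul' le_rfl le_top).trans hI
  have hπq : π + q ∈ B.deg A I 0 := add_mem hπ (deg_mono hJ hq)
  have key : ∀ x y : B.P ⊗[Lam k] A, x ∈ B.deg A I 1 → x - y ∈ B.deg A J 1 → ∀ j,
      ((B.bracketT A (π + q)) ^ (j + 1)) x - ((B.bracketT A π) ^ (j + 1)) y ∈ B.deg A J' 1 := by
    intro x y hx hxy j
    have h1 : ∀ x y : B.P ⊗[Lam k] A, x ∈ B.deg A I 1 → x - y ∈ B.deg A J 1 →
        B.bracketT A (π + q) x - B.bracketT A π y ∈ B.deg A J' 1 := by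
      intro x y hx hxy
      rw [add_apply_sub_apply]
      exact add_mem (ad_deg hπ hxy hIJ) (ad_deg hq hx hJI)
    induction j with
    | zero => simpa using h1 x y hx hxy
    | succ j ih =>
      rw [end_pow_succ_apply, end_pow_succ_apply _ (j + 1)]
      exact h1 _ _ (ad_pow_deg hπq hx hII _) (deg_mono hJ' ih)
  have hqm : B.bracketT A q (B.m ⊗ₜ 1) ∈ B.deg A J 1 := ad_deg hq B.m_mem_deg hJt
  have hdq : B.diffP d q ∈ B.deg A J 1 := by simpa using diffP_mem hd hdJ hq
  have k1 := key (B.bracketT A (π + q) (B.m ⊗ₜ 1)) (B.bracketT A π (B.m ⊗ₜ 1))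
    (ad_deg hπq B.m_mem_deg hI) (by rw [map_add, LinearMap.add_apply, add_sub_cancel_left]; exact hqm)
  have k2 := key (B.diffP d (π + q)) (B.diffP d π)
    (by simpa using diffP_mem hd hdI hπq) (by rw [map_add, add_sub_cancel_left]; exact hdq)
  have hD : B.totalD A d q = - B.bracketT A q (B.m ⊗ₜ 1) - B.diffP d q := by
    rw [totalD_apply, bracketT_symm B.m_mem_deg (deg_mono le_top hq), mul_zero, sgn_zero, one_smul]
  rw [show n + 2 = n + 1 + 1 from rfl, master_succ, master_succ, hD]
  rw [sum_range_succ', sum_range_succ', sum_range_succ' _ (n + 1),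
    sum_range_succ' (fun j => invFact k (j + 1) •
      ((B.bracketT A π) ^ j) (B.bracketT A π (B.m ⊗ₜ[Lam k] (1 : A)))) n]
  have e : ∀ a b b' c c' e e' f f' g h : B.P ⊗[Lam k] A,
      a + (b + c + (e + f)) - (a + (b' + c' + (e' + f'))) + (- g - h) =
        (b - b') + (e - e') + ((c - c') - g) + ((f - f') - h) := by intros; abel
  rw [e, ← sum_sub_distrib, ← sum_sub_distrib]
  refine add_mem (add_mem (add_mem (sum_mem fun j _ => ?_) (sum_mem fun j _ => ?_)) ?_) ?_
  · rw [← smul_sub]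
    exact Submodule.smul_mem _ _ (deg_le_spanT (k1 j))
  · rw [← smul_sub]
    exact Submodule.smul_mem _ _ (deg_le_spanT (k2 j))
  · simp [invFact_one]
  · simp [invFact_one]

theorem push_bracketT_of_par (T : A →ₐ[Lam k] A')
    (hT : ∀ {i a}, a ∈ A.gr i → T a ∈ A'.gr i) (x y : B.P ⊗[Lam k] A) :
    B.push T.toLinearMap (B.bracketT A x y) =
      B.bracketT A' (B.push T.toLinearMap x) (B.push T.toLinearMap y) := by
  have h : ∀ a, T (A.par a) = A'.par (T a) := graded_ind A.gr_internal (by simp)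
    (fun x y hx hy => by simp [hx, hy]) fun i a ha => by
      rw [DGAlg.par_of_mem ha, DGAlg.par_of_mem (hT ha), map_zsmul]
  induction x with
  | zero => simp
  | add x x' hx hx' => simp only [map_add, LinearMap.add_apply, hx, hx']
  | tmul p a =>
    induction y with
    | zero => simp
    | add y y' hy hy' => simp only [map_add, hy, hy']
    | tmul q b => simp [bracketT, h]

/-- The master equation and algebra maps which need not respect the differential. -/
theorem master_push (T : A →ₐ[Lam k] A')
    (hT : ∀ {i a}, a ∈ A.gr i → T a ∈ A'.gr i) {d' : A' →ₗ[Lam k] A'}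
    {I' K K' : Submodule (Lam k) A'} (hTI : ∀ a ∈ I, T a ∈ I') (hd : A.IsDer d)
    (hd' : A'.IsDer d') (hK : ∀ a ∈ I, d' (T a) - T (d a) ∈ K) (hIK : I' * K ≤ K') (hK' : K' ≤ K)
    (hπ : π ∈ B.deg A I 0) {n : ℕ} (hn : 1 ≤ n) :
    B.master A' d' n (B.push T.toLinearMap π) - B.push T.toLinearMap (B.master A d n π) -
      B.diffP (d' ∘ₗ T.toLinearMap - T.toLinearMap ∘ₗ d) π ∈ B.spanT A' K' := by
  obtain ⟨n, rfl⟩ := Nat.exists_eq_add_of_le' hn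
  have hpow : ∀ j x, B.push T.toLinearMap ((B.bracketT A π ^ j) x) =
      (B.bracketT A' (B.push T.toLinearMap π) ^ j) (B.push T.toLinearMap x) := by
    intro j x
    induction j with
    | zero => simp
    | succ j ih =>
      rw [end_pow_succ_apply, end_pow_succ_apply, push_bracketT_of_par T hT, ih]
  have hΔ : B.diffP d' (B.push T.toLinearMap π) - B.push T.toLinearMap (B.diffP d π) =
      B.diffP (d' ∘ₗ T.toLinearMap - T.toLinearMap ∘ₗ d) π := by
    have : B.diffP d' ∘ₗ B.push T.toLinearMap - B.push T.toLinearMap ∘ₗ B.diffP d =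
      B.diffP (d' ∘ₗ T.toLinearMap - T.toLinearMap ∘ₗ d) := by
      ext p a
      simp [diffP, TensorProduct.tmul_sub]
    rw [← this]; rfl
  have hΔm : B.diffP (d' ∘ₗ T.toLinearMap - T.toLinearMap ∘ₗ d) π ∈ B.deg A' K 1 := by
    have := diffP_deg (B := B) (A := A) (A' := A') (e := 1) (d := d' ∘ₗ T.toLinearMap - T.toLinearMap ∘ₗ d)
      (J := I) (J' := K) (fun i a ha _ => sub_mem (hd'.map_gr (hT ha)) (hT (hd.map_gr ha))) hK hπ
    simpa using this
  have hpm : B.push T.toLinearMap π ∈ B.deg A' I' 0 := by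
    have := push_deg (B := B) (A := A) (A' := A') (e := 0) (f := T.toLinearMap)
      (J := I) (J' := I') (fun i a ha _ => by rw [add_zero]; exact hT ha) hTI hπ
    simpa using this
  have key : ∀ j, (B.bracketT A' (B.push T.toLinearMap π) ^ (j + 1))
      (B.diffP (d' ∘ₗ T.toLinearMap - T.toLinearMap ∘ₗ d) π) ∈ B.deg A' K' 1 := by
    intro j
    rw [pow_succ, Module.End.mul_apply]
    exact ad_pow_deg hpm (ad_deg hpm hΔm hIK) ((mul_le_mul' le_rfl hK').trans hIK) j
  rw [master, master, map_sum, ← sum_sub_distrib]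
  have hterm : ∀ j, (invFact k j • ((B.bracketT A' (B.push T.toLinearMap π)) ^ j)
        (B.m ⊗ₜ[Lam k] (1 : A')) + invFact k (j + 1) •
        ((B.bracketT A' (B.push T.toLinearMap π)) ^ j) (B.diffP d' (B.push T.toLinearMap π))) -
      B.push T.toLinearMap (invFact k j • ((B.bracketT A π) ^ j) (B.m ⊗ₜ[Lam k] (1 : A)) +
        invFact k (j + 1) • ((B.bracketT A π) ^ j) (B.diffP d π)) =
      invFact k (j + 1) • (B.bracketT A' (B.push T.toLinearMap π) ^ j)
        (B.diffP (d' ∘ₗ T.toLinearMap - T.toLinearMap ∘ₗ d) π) := by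
    intro j
    rw [map_add, map_smul, map_smul, hpow, hpow, ← hΔ, map_sub, smul_sub,
      lTensor_tmul, toLinearMap_apply, map_one]
    abel
  rw [sum_congr rfl fun j _ => hterm j, sum_range_succ']
  simp only [zero_add, invFact_one, one_smul, pow_zero, Module.End.one_apply, add_sub_cancel_right]
  exact sum_mem fun j _ => Submodule.smul_mem _ _ (deg_le_spanT (key j))

section Curvature

/-- The terms of order `j` of the expansion of the master equation. -/
def coeffM (d : A →ₗ[Lam k] A) (π : B.P ⊗[Lam k] A) : ℕ → B.P ⊗[Lam k] A
  | 0 => B.m ⊗ₜ 1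
  | j + 1 => invFact k (j + 1) • ((B.bracketT A π ^ (j + 1)) (B.m ⊗ₜ[Lam k] (1 : A)) +
      (B.bracketT A π ^ j) (B.diffP d π))

theorem coeffM_rec [CharZero k] (j : ℕ) : ((j + 1 : ℕ) : Lam k) • coeffM d π (j + 1) =
    B.bracketT A π (coeffM d π j) + if j = 0 then B.diffP d π else 0 := by
  rw [coeffM, smul_smul, invFact_succ]
  cases j with
  | zero => simp [coeffM, invFact_zero]
  | succ j =>
    rw [coeffM, map_smul, map_add, ← end_pow_succ_apply, ← end_pow_succ_apply,
      if_neg (Nat.succ_ne_zero j), add_zero]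

theorem coeffM_mem (hd : A.IsDer d) (hπ : π ∈ B.deg A ⊤ 0) (j : ℕ) :
    coeffM d π j ∈ B.deg A ⊤ 1 := by
  cases j with
  | zero => exact B.m_mem_deg
  | succ j =>
    refine Submodule.smul_mem _ _ (add_mem (ad_pow_deg hπ B.m_mem_deg le_top _)
      (ad_pow_deg hπ ?_ le_top _))
    simpa using diffP_mem (J := ⊤) hd (fun _ _ => trivial) hπ

theorem coeffM_eq_zero (hd : A.IsDer d) (hπ : π ∈ B.deg A I 0) {N : ℕ}
    (hN : I ^ N = ⊥) {j : ℕ} (hj : N + 1 ≤ j) : coeffM d π j = 0 := by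
  obtain ⟨j, rfl⟩ := Nat.exists_eq_add_of_le' (Nat.le_of_add_left_le hj : 1 ≤ j)
  rw [coeffM, ad_pow_eq_zero hπ B.m_mem_deg hN (by omega), ad_pow_eq_zero hπ
    (diffP_mem (J := ⊤) hd (fun _ _ => trivial) (deg_mono le_top hπ)) hN (by omega), add_zero,
    smul_zero]

theorem master_eq_sum_coeffM (hπ : π ∈ B.deg A I 0) {N n : ℕ} (hN : I ^ N = ⊥) (hn : N ≤ n) :
    B.master A d n π = ∑ j ∈ Finset.range (n + 1), coeffM d π j := by
  have h : ∀ n, B.master A d n π + invFact k n • (B.bracketT A π ^ n)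
      (B.m ⊗ₜ[Lam k] (1 : A)) = ∑ j ∈ Finset.range (n + 1), coeffM d π j := by
    intro n
    induction n with
    | zero => simp [master, coeffM, invFact_zero]
    | succ n ih =>
      rw [Finset.sum_range_succ, ← ih, master, Finset.sum_range_succ, ← master, coeffM, smul_add]
      abel
  rw [← h, ad_pow_eq_zero hπ B.m_mem_deg hN hn, smul_zero, add_zero]

theorem curvature_coeff [CharZero k] (hd : A.IsDer d) (hπ : π ∈ B.deg A ⊤ 0) (l : ℕ) :
    (∑ x ∈ antidiagonal (l + 1), B.bracketT A (coeffM d π x.1) (coeffM d π x.2)) -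
      (2 : Lam k) • B.diffP d (coeffM d π (l + 1)) =
    -((2 : Lam k) • invFact k (l + 1) • (B.bracketT A π ^ l) (B.diffP d (B.diffP d π))) := by
  set f := coeffM d π with hf
  have hfm : ∀ j, f j ∈ B.deg A ⊤ 1 := coeffM_mem hd hπ
  have hsymm : ∀ i j, B.bracketT A (f i) (f j) = B.bracketT A (f j) (f i) := fun i j => by
    rw [bracketT_symm (hfm i) (hfm j), mul_one, sgn_one, neg_one_smul, neg_neg]
  have hdπ : B.diffP d π ∈ B.deg A ⊤ 1 := by
    simpa using diffP_mem (J := ⊤) hd (fun _ _ => trivial) hπ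
  have hder : ∀ i j, B.bracketT A π (B.bracketT A (f i) (f j)) =
      B.bracketT A (B.bracketT A π (f i)) (f j) + B.bracketT A (f i) (B.bracketT A π (f j)) := by
    intro i j
    rw [bracketT_jacobi hπ (hfm i) (hfm j), zero_mul, sgn_zero, one_smul]
  have had : ∀ j, B.bracketT A π (f j) ∈ B.deg A ⊤ 1 := fun j => ad_deg hπ (hfm j) le_top
  have hsymm' : ∀ i j, B.bracketT A (f i) (B.bracketT A π (f j)) =
      B.bracketT A (B.bracketT A π (f j)) (f i) := fun i j => by
    rw [bracketT_symm (hfm i) (had j), mul_one, sgn_one, neg_one_smul, neg_neg]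
  have hquad : ∀ l, ((l + 1 : ℕ) : Lam k) •
      (∑ x ∈ antidiagonal (l + 1), B.bracketT A (f x.1) (f x.2)) =
      B.bracketT A π (∑ x ∈ antidiagonal l, B.bracketT A (f x.1) (f x.2)) +
        (2 : Lam k) • B.bracketT A (B.diffP d π) (f l) := by
    intro l
    have e1 : ((l + 1 : ℕ) : Lam k) • (∑ x ∈ antidiagonal (l + 1), B.bracketT A (f x.1) (f x.2)) =
        (2 : Lam k) • ∑ x ∈ antidiagonal (l + 1),
          ((x.1 : ℕ) : Lam k) • B.bracketT A (f x.1) (f x.2) := by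
      have e2 : (∑ x ∈ antidiagonal (l + 1), ((x.1 : ℕ) : Lam k) •
          B.bracketT A (f x.1) (f x.2)) = ∑ x ∈ antidiagonal (l + 1),
          ((x.2 : ℕ) : Lam k) • B.bracketT A (f x.1) (f x.2) := by
        rw [← Finset.Nat.sum_antidiagonal_swap]
        exact sum_congr rfl fun x _ => by rw [Prod.fst_swap, Prod.snd_swap, hsymm]
      rw [two_smul]
      nth_rewrite 2 [e2]
      rw [← sum_add_distrib, Finset.smul_sum]
      refine sum_congr rfl fun x hx => ?_
      rw [← add_smul, ← Nat.cast_add, mem_antidiagonal.1 hx]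
    have e3 : ∑ x ∈ antidiagonal (l + 1), ((x.1 : ℕ) : Lam k) • B.bracketT A (f x.1) (f x.2) =
        (∑ x ∈ antidiagonal l, B.bracketT A (B.bracketT A π (f x.1)) (f x.2)) +
          B.bracketT A (B.diffP d π) (f l) := by
      rw [Finset.Nat.antidiagonal_succ, Finset.sum_cons, Finset.sum_map]
      simp only [Nat.cast_zero, zero_smul, zero_add, Function.Embedding.coe_prodMap,
        Function.Embedding.coeFn_mk, Prod.map_fst, Prod.map_snd, Function.Embedding.refl_apply]
      have e4 : ∀ x : ℕ × ℕ, ((x.1.succ : ℕ) : Lam k) • B.bracketT A (f x.1.succ) (f x.2) =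
          B.bracketT A (B.bracketT A π (f x.1)) (f x.2) +
            if x.1 = 0 then B.bracketT A (B.diffP d π) (f x.2) else 0 := by
        intro x
        rw [← LinearMap.smul_apply, ← map_smul, hf, Nat.succ_eq_add_one, coeffM_rec, map_add,
          LinearMap.add_apply]
        split <;> simp
      rw [sum_congr rfl fun x _ => e4 x, sum_add_distrib]
      congr 1
      rw [sum_eq_single (0, l)]
      · simp
      · rintro ⟨i, j⟩ hx hne
        rw [mem_antidiagonal] at hx
        refine if_neg fun h => hne ?_
        simp only at h hx
        rw [h, zero_add] at hx
        rw [h, hx]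
      · intro h
        exact absurd (mem_antidiagonal.2 (zero_add l)) h
    have e5 : B.bracketT A π (∑ x ∈ antidiagonal l, B.bracketT A (f x.1) (f x.2)) =
        (2 : Lam k) • ∑ x ∈ antidiagonal l,
          B.bracketT A (B.bracketT A π (f x.1)) (f x.2) := by
      rw [map_sum, sum_congr rfl fun x _ => hder x.1 x.2, sum_add_distrib, two_smul]
      congr 1
      rw [← Finset.Nat.sum_antidiagonal_swap]
      exact sum_congr rfl fun x _ => by rw [Prod.fst_swap, Prod.snd_swap, hsymm']
    rw [e1, e3, e5, smul_add]
  have hlin : ∀ l, ((l + 1 : ℕ) : Lam k) • B.diffP d (f (l + 1)) =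
      B.bracketT A (B.diffP d π) (f l) + B.bracketT A π (B.diffP d (f l)) +
        if l = 0 then B.diffP d (B.diffP d π) else 0 := by
    intro l
    rw [← map_smul, hf, coeffM_rec, map_add, diffP_bracketT hd hπ (hfm l), sgn_zero, one_smul]
    split <;> simp <;> rfl
  induction l with
  | zero =>
    apply natCast_smul_cancel (k := k) 0
    rw [smul_sub, smul_comm ((0 + 1 : ℕ) : Lam k) (2 : Lam k), hquad 0, hlin 0, if_pos rfl]
    have h0 : B.bracketT A (f 0) (f 0) = 0 := by
      rw [hf, coeffM, bracketT_m, rTensor_tmul, bracket_m_m, zero_tmul]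
    have h0' : B.diffP d (f 0) = 0 := by
      rw [hf, coeffM, diffP_tmul _ B.m_mem, hd.map_one, tmul_zero, smul_zero]
    simp [h0, h0', invFact_one]
  | succ l ih =>
    apply natCast_smul_cancel (k := k) (l + 1)
    rw [smul_sub, smul_comm ((l + 1 + 1 : ℕ) : Lam k) (2 : Lam k), hquad (l + 1), hlin (l + 1),
      if_neg (Nat.succ_ne_zero l), add_zero, smul_add, add_comm, add_sub_add_left_eq_sub,
      ← map_smul (B.bracketT A π), ← map_sub, ih, map_neg, map_smul, map_smul,
      ← end_pow_succ_apply, smul_neg, smul_comm ((l + 1 + 1 : ℕ) : Lam k) (2 : Lam k),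
      smul_smul ((l + 1 + 1 : ℕ) : Lam k), invFact_succ]

theorem sum_antidiagonal_range {M : Type*} [AddCommGroup M] (n : ℕ) (g : ℕ → ℕ → M)
    (hg : ∀ i j, n < i ∨ n < j → g i j = 0) :
    ∑ l ∈ Finset.range (2 * n + 1), ∑ x ∈ antidiagonal l, g x.1 x.2 =
      ∑ i ∈ Finset.range (n + 1), ∑ j ∈ Finset.range (n + 1), g i j := by
  rw [← Finset.sum_product', ← Finset.sum_fiberwise_of_maps_to (t := Finset.range (2 * n + 1))
    (g := fun x : ℕ × ℕ => x.1 + x.2)]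
  · refine sum_congr rfl fun l _ => ?_
    symm
    refine Finset.sum_subset (fun x hx => ?_) fun x hx hx' => hg _ _ ?_
    · exact mem_antidiagonal.2 (Finset.mem_filter.1 hx).2
    · rw [mem_antidiagonal] at hx
      simp only [Finset.mem_filter, Finset.mem_product, Finset.mem_range, hx, and_true] at hx'
      omega
  · intro x hx
    simp only [Finset.mem_product, Finset.mem_range] at hx ⊢
    omega

/-- The Maurer–Cartan equation satisfied by the expansion of the master equation, up to the
curvature `d (d π)`. -/
theorem curvature [CharZero k] (hd : A.IsDer d) (hπ : π ∈ B.deg A I 0) {N n : ℕ}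
    (hN : I ^ N = ⊥) (hn : N ≤ n) (hn1 : 1 ≤ n) (hJ : B.diffP d (B.diffP d π) ∈ B.deg A J 2)
    (hIJ : I * J ≤ J') (hJ' : J' ≤ J) :
    B.bracketT A (B.master A d n π) (B.master A d n π) - (2 : Lam k) • B.diffP d (B.master A d n π) +
      (2 : Lam k) • B.diffP d (B.diffP d π) ∈ B.spanT A J' := by
  have hsum : B.bracketT A (B.master A d n π) (B.master A d n π) -
      (2 : Lam k) • B.diffP d (B.master A d n π) = ∑ l ∈ Finset.range (2 * n + 1),
      ((∑ x ∈ antidiagonal l, B.bracketT A (coeffM d π x.1) (coeffM d π x.2)) -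
      (2 : Lam k) • B.diffP d (coeffM d π l)) := by
    rw [sum_sub_distrib, sum_antidiagonal_range n
      (fun i j => B.bracketT A (coeffM d π i) (coeffM d π j)), master_eq_sum_coeffM hπ hN hn]
    · congr 1
      · simp only [map_sum, LinearMap.sum_apply]
        exact Finset.sum_comm
      · rw [← Finset.smul_sum, map_sum]
        congr 1
        refine Finset.sum_subset (Finset.range_mono (by omega)) fun j _ hj => ?_
        rw [Finset.mem_range, not_lt] at hj
        rw [coeffM_eq_zero hd hπ hN (by omega), map_zero]
    · rintro i j (h | h)
      · simp only [coeffM_eq_zero hd hπ hN (show N + 1 ≤ i by omega), map_zero,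
          LinearMap.zero_apply]
      · simp only [coeffM_eq_zero hd hπ hN (show N + 1 ≤ j by omega), map_zero]
  have h0 : (∑ x ∈ antidiagonal 0, B.bracketT A (coeffM d π x.1) (coeffM d π x.2)) -
      (2 : Lam k) • B.diffP d (coeffM d π 0) = 0 := by
    simp only [Finset.Nat.antidiagonal_zero, Finset.sum_singleton, coeffM]
    rw [bracketT_m, rTensor_tmul, bracket_m_m, zero_tmul,
      diffP_tmul _ B.m_mem, hd.map_one, tmul_zero, smul_zero, smul_zero, sub_zero]
  rw [hsum, sum_range_succ', h0, add_zero, sum_congr rfl fun l _ =>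
    curvature_coeff hd (deg_mono le_top hπ) l]
  obtain ⟨n, rfl⟩ := Nat.exists_eq_add_of_le' hn1
  rw [show 2 * (n + 1) = 2 * n + 1 + 1 by ring, sum_range_succ', zero_add, invFact_one,
    pow_zero, Module.End.one_apply, one_smul, add_assoc, neg_add_cancel, add_zero]
  refine sum_mem fun l _ => neg_mem (Submodule.smul_mem _ _ (Submodule.smul_mem _ _ ?_))
  rw [pow_succ, Module.End.mul_apply]
  exact deg_le_spanT (ad_pow_deg hπ (ad_deg hπ hJ hIJ) ((mul_le_mul' le_rfl hJ').trans hIJ) l)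

/-- The obstruction to solving the master equation modulo `J'` is closed up to curvature. -/
theorem obstruction_closed [CharZero k] (hd : A.IsDer d) (hI : I * ⊤ ≤ I) (hdI : ∀ a ∈ I, d a ∈ I) (hJ : J ≤ I)
    (hIJ : I * J ≤ J') (hJ' : J' ≤ J) (hπ : π ∈ B.deg A I 0) {N n : ℕ}
    (hN : I ^ N = ⊥) (hn : N ≤ n) (hn1 : 1 ≤ n) (hJc : B.diffP d (B.diffP d π) ∈ B.deg A J 2)
    {o : B.P ⊗[Lam k] A} (ho : o ∈ B.deg A J 1)
    (hη : B.master A d n π - o ∈ B.annT A) :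
    B.totalD A d o + B.diffP d (B.diffP d π) ∈ B.annMod A J' := by
  set M := B.master A d n π with hM
  have hMd : M ∈ B.deg A ⊤ 1 := master_mem_top hd hI hdI hπ hn1
  have h1 := curvature hd hπ hN hn hn1 hJc hIJ hJ'
  rw [← hM] at h1
  have ho' : o ∈ B.deg A ⊤ 1 := deg_mono le_top ho
  have hsymm : B.bracketT A o M = B.bracketT A M o := by
    rw [bracketT_symm ho' hMd, mul_one, sgn_one, neg_one_smul, neg_neg]
  have h2 : B.bracketT A M o - B.bracketT A (B.m ⊗ₜ 1) o ∈ B.spanT A J' := by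
    rw [← LinearMap.sub_apply, ← map_sub]
    exact deg_le_spanT (deg_mono hIJ (bracketT_deg (master_mem hd hI hdI hπ hn1) ho))
  have h3 : B.bracketT A o o ∈ B.spanT A J' :=
    deg_le_spanT (deg_mono ((mul_le_mul' hJ le_rfl).trans hIJ) (bracketT_deg ho ho))
  have h4 : B.bracketT A (M - o) (M - o) - (2 : Lam k) • B.diffP d (M - o) ∈ B.annT A :=
    sub_mem (bracketT_annT hη hη) (Submodule.smul_mem _ _ (diffP_annT hη))
  have h5 : (2 : Lam k) • (B.totalD A d o + B.diffP d (B.diffP d π)) ∈ B.annMod A J' := by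
    have : (2 : Lam k) • (B.totalD A d o + B.diffP d (B.diffP d π)) =
        -(B.bracketT A (M - o) (M - o) - (2 : Lam k) • B.diffP d (M - o)) +
        ((B.bracketT A M M - (2 : Lam k) • B.diffP d M + (2 : Lam k) • B.diffP d (B.diffP d π)) -
          (2 : Lam k) • (B.bracketT A M o - B.bracketT A (B.m ⊗ₜ 1) o) + B.bracketT A o o) := by
      have e : B.bracketT A (M - o) (M - o) = B.bracketT A M M - (2 : Lam k) • B.bracketT A M o +
          B.bracketT A o o := by
        exact sub_apply_sub _ hsymm
      rw [e, totalD_apply, map_sub]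
      generalize B.bracketT A M M = x1
      generalize B.bracketT A M o = x2
      generalize B.bracketT A o o = x3
      simp only [two_smul]
      abel
    rw [this]
    exact add_mem_sup (neg_mem h4) (add_mem (sub_mem h1 (Submodule.smul_mem _ _ h2)) h3)
  have h6 : (C ((2 : k)⁻¹) : Lam k) * 2 = 1 := by
    rw [← map_ofNat (C (R := k)) 2, ← map_mul, inv_mul_cancel₀ two_ne_zero, map_one]
  have := Submodule.smul_mem _ (C ((2 : k)⁻¹) : Lam k) h5
  rwa [smul_smul, h6, one_smul] at this

end Curvature

end Ad

end Background


section Torsion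

variable {k : Type u} [Field k]

theorem flat_of_hbar_torsionFree {M : Type*} [AddCommGroup M] [Module (Lam k) M]
    (h : ∀ x : M, hbar k • x = 0 → x = 0) : Module.Flat (Lam k) M := by
  rw [Module.Flat.flat_iff_torsion_eq_bot_of_isBezout,
    ← Submodule.isTorsionFree_iff_torsion_eq_bot, Module.isTorsionFree_iff_smul_eq_zero]
  intro c x hcx
  by_cases hc : c = 0
  · exact Or.inl hc
  right
  have hpow : ∀ n : ℕ, ∀ x : M, hbar k ^ n • x = 0 → x = 0 := by
    intro n
    induction n with
    | zero => intro x hx; simpa using hx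
    | succ n ih =>
      intro x hx
      rw [pow_succ, mul_smul] at hx
      exact h x (ih _ hx)
  obtain ⟨n, u, hu⟩ := IsDiscreteValuationRing.eq_unit_mul_pow_irreducible hc
    (PowerSeries.X_irreducible (R := k))
  rw [hu, mul_smul] at hcx
  exact hpow n x (u.isUnit.smul_eq_zero.1 hcx)

theorem smul_eq_C_smul {M : Type*} [AddCommGroup M] [Module (Lam k) M] {x : M}
    (hx : hbar k • x = 0) (c : Lam k) :
    c • x = (C (constantCoeff c) : Lam k) • x := by
  obtain ⟨b, hb⟩ := PowerSeries.X_dvd_iff.2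
    (show constantCoeff (c - C (constantCoeff c)) = 0 by simp)
  rw [← sub_eq_zero, ← sub_smul, hb, mul_comm, mul_smul, hx, smul_zero]

end Torsion

section Contraction

/-- A complex over a field with a finite basis of its homology contracts onto it. -/
theorem exists_contraction {k V : Type*} [Field k] [AddCommGroup V] [Module k V] {r : ℕ}
    (D : V →ₗ[k] V) (v : Fin r → V) (hDD : ∀ x, D (D x) = 0) (hv : ∀ j, D (v j) = 0)
    (hspan : ∀ x, D x = 0 → ∃ (c : Fin r → k) (y : V), x = ∑ j, c j • v j + D y)
    (hind : ∀ (c : Fin r → k) (y : V), ∑ j, c j • v j = D y → c = 0) :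
    ∃ (e : Fin r → V →ₗ[k] k) (s : V →ₗ[k] V), (∀ j x, e j (D x) = 0) ∧
      (∀ x, x = ∑ j, e j x • v j + D (s x) + s (D x)) ∧ (∀ j, s (v j) = 0) ∧
      ∀ i j, e i (v j) = if i = j then 1 else 0 := by
  let f : (Fin r → k) →ₗ[k] V ⧸ range D :=
    (range D).mkQ ∘ₗ Fintype.linearCombination k v
  have hf : ker f = ⊥ := by
    rw [LinearMap.ker_eq_bot']
    intro c hc
    obtain ⟨y, hy⟩ := (Submodule.Quotient.mk_eq_zero _).1 hc
    exact hind c y (by rw [hy, Fintype.linearCombination_apply])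
  obtain ⟨g, hg⟩ := f.exists_leftInverse_of_injective hf
  let e : Fin r → V →ₗ[k] k := fun j => LinearMap.proj j ∘ₗ g ∘ₗ (range D).mkQ
  have he : ∀ j x, e j (D x) = 0 := fun j x => by
    have : (range D).mkQ (D x) = 0 :=
      (Submodule.Quotient.mk_eq_zero _).2 (LinearMap.mem_range_self D x)
    simp [e, this]
  have hec : ∀ (c : Fin r → k) j, e j (∑ i, c i • v i) = c j := fun c j => by
    have := congrFun (LinearMap.congr_fun hg c) j
    simpa [f, e, Fintype.linearCombination_apply] using this
  have hev : ∀ i j, e i (v j) = if i = j then 1 else 0 := fun i j => by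
    have h := hec (Pi.single j 1) i
    simp only [Pi.single_apply, ite_smul, one_smul, zero_smul, Finset.sum_ite_eq',
      Finset.mem_univ, if_true] at h
    exact h
  have hD : ∀ c : Fin r → k, D (∑ i, c i • v i) = 0 := fun c => by simp [hv]
  obtain ⟨q, hq⟩ := (ker D).exists_isCompl
  let π : V →ₗ[k] V := (ker D).subtype ∘ₗ (ker D).projectionOnto q hq
  have hπ1 : ∀ x, D x = 0 → π x = x := fun x hx => by
    simp only [π, comp_apply, Submodule.subtype_apply]
    exact congrArg Subtype.val (Submodule.projectionOnto_apply_left hq ⟨x, hx⟩)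
  have hπ2 : ∀ x, D (π x) = 0 := fun x => ((ker D).projectionOnto q hq x).2
  obtain ⟨t, ht⟩ : ∃ t : V →ₗ[k] V, ∀ x, t (D x) = x - π x := by
    have hle : ker D ≤ ker (LinearMap.id - π) := fun x hx => by
      simp [hπ1 x hx]
    let t0 : range D →ₗ[k] V := (ker D).liftQ (LinearMap.id - π) hle ∘ₗ
      D.quotKerEquivRange.symm.toLinearMap
    obtain ⟨t, ht⟩ := t0.exists_extend
    refine ⟨t, fun x => ?_⟩
    have h1 := LinearMap.congr_fun ht ⟨D x, LinearMap.mem_range_self D x⟩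
    have h2 : D.quotKerEquivRange.symm ⟨D x, LinearMap.mem_range_self D x⟩ =
        (ker D).mkQ x := by
      rw [LinearEquiv.symm_apply_eq]; rfl
    simp only [t0, comp_apply, LinearEquiv.coe_coe, h2] at h1
    simpa using h1
  let E : V →ₗ[k] V := ∑ j, (e j).smulRight (v j)
  have hE : ∀ x, E x = ∑ j, e j x • v j := fun x => by simp [E]
  refine ⟨fun j => e j ∘ₗ π, t ∘ₗ (π - E ∘ₗ π), fun j x => ?_, fun x => ?_, fun j => ?_,
    fun i j => ?_⟩
  · rw [comp_apply, hπ1 _ (hDD x), he]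
  · have hcyc : D (π x - E (π x)) = 0 := by
      rw [map_sub, hπ2, hE, hD, sub_zero]
    have hex : ∀ x, D x = 0 → D (t (x - E x)) = x - E x := by
      intro x hx
      obtain ⟨c, y, hcy⟩ := hspan x hx
      have : x - E x = D y := by
        rw [hE]
        have : ∀ j, e j x = c j := fun j => by rw [hcy, map_add, he, add_zero, hec]
        simp only [this]
        rw [hcy]; abel
      rw [this, ht, map_sub, hπ2, sub_zero]
    have h1 : (t ∘ₗ (π - E ∘ₗ π)) (D x) = x - π x := by
      have : E (D x) = 0 := by rw [hE]; simp [he]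
      simp [hπ1 _ (hDD x), this, ht]
    have h2 : D ((t ∘ₗ (π - E ∘ₗ π)) x) = π x - E (π x) := by
      simpa using hex (π x) (hπ2 x)
    rw [h1, h2, hE]
    simp only [comp_apply]
    abel
  · have : E (v j) = v j := by
      rw [hE]
      simp [hev]
    simp [hπ1 _ (hv j), this]
  · rw [comp_apply, hπ1 _ (hv j), hev]

end Contraction

namespace Background

variable {k : Type u} [Field k] {B : Background.{u, v, w} k} {A : DGAlg k}

variable (B) in
/-- The elements of `P` that annihilate the vacuum modulo `ħ`. -/
def annBar : Submodule (Lam k) B.P := B.ann ⊔ range (LinearMap.lsmul (Lam k) B.P (hbar k))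

theorem ann_le_annBar : B.ann ≤ B.annBar := le_sup_left

theorem hbar_smul_mem_annBar (p : B.P) : hbar k • p ∈ B.annBar :=
  mem_sup_right ⟨p, rfl⟩

theorem mem_annBar_iff {p : B.P} : p ∈ B.annBar ↔ ∃ q, p - hbar k • q ∈ B.ann := by
  constructor
  · intro h
    obtain ⟨y, hy, _, ⟨q, rfl⟩, rfl⟩ := mem_sup.1 h
    exact ⟨q, by simpa using hy⟩
  · rintro ⟨q, hq⟩
    rw [← sub_add_cancel p (hbar k • q)]
    exact add_mem_sup hq ⟨q, rfl⟩

theorem bracket_m_annBar {p : B.P} (hp : p ∈ B.annBar) : B.bracket B.m p ∈ B.annBar := by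
  obtain ⟨q, hq⟩ := mem_annBar_iff.1 hp
  refine mem_annBar_iff.2 ⟨B.bracket B.m q, ?_⟩
  rw [← map_smul, ← map_sub]
  exact B.bracket_ann B.m_mem_ann hq

theorem bracket_m_bracket_m [CharZero k] (p : B.P) : B.bracket B.m (B.bracket B.m p) = 0 := by
  refine graded_ind B.grP_internal (p := fun p => B.bracket B.m (B.bracket B.m p) = 0) (by simp)
    (fun x y hx hy => by simp [hx, hy]) (fun i p hp => ?_) p
  have h := B.bracket_jacobi B.m_mem B.m_mem hp
  rw [bracket_m_m, map_zero, LinearMap.zero_apply, zero_add, mul_one, sgn_one, neg_one_smul,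
    eq_neg_iff_add_eq_zero, ← two_nsmul, ← Nat.cast_smul_eq_nsmul (Lam k)] at h
  exact natCast_smul_cancel (k := k) 1 (by simpa using h)

section Flat

variable {J J' : Submodule (Lam k) A}

theorem quotient_ann_torsionFree (x : B.P ⧸ B.ann) (h : hbar k • x = 0) : x = 0 := by
  induction x using Submodule.Quotient.induction_on with
  | H p =>
    rw [← Submodule.Quotient.mk_smul, Submodule.Quotient.mk_eq_zero, mem_ann, smul_assoc] at h
    rw [Submodule.Quotient.mk_eq_zero, mem_ann]
    exact B.torsionFreeN _ h

theorem rTensor_mkQ_ann_eq_zero_iff (x : B.P ⊗[Lam k] A) :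
    B.ann.mkQ.rTensor A x = 0 ↔ x ∈ B.annT A := by
  have hex : Function.Exact B.ann.subtype B.ann.mkQ :=
    LinearMap.exact_subtype_mkQ B.ann
  rw [← LinearMap.mem_ker, (rTensor_exact A hex B.ann.mkQ_surjective).linearMap_ker_eq]
  constructor
  · rintro ⟨y, rfl⟩
    induction y with
    | zero => simp
    | add y z hy hz => rw [map_add]; exact add_mem hy hz
    | tmul p a => exact tmul_mem_annT p.2 a
  · exact fun h => annT_le (X := range _) (fun p a hp => ⟨⟨p, hp⟩ ⊗ₜ a, rfl⟩) h

theorem actT_eq_zero_iff (hB : B.VacuumPure) (x : B.P ⊗[Lam k] A) :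
    B.actT A x = 0 ↔ x ∈ B.annT A := by
  rw [← rTensor_mkQ_ann_eq_zero_iff]
  let g : B.P ⧸ B.ann →ₗ[Lam k] B.N := B.ann.liftQ B.vac le_rfl
  have hg : Function.Injective g := LinearMap.ker_eq_bot.1 (Submodule.ker_liftQ_eq_bot _ _ _ le_rfl)
  have hfac : B.actT A x = g.rTensor A (B.ann.mkQ.rTensor A x) := by
    rw [← comp_apply, ← LinearMap.rTensor_comp]; rfl
  have hflat : Module.Flat (Lam k) (B.N ⧸ range g) := by
    refine flat_of_hbar_torsionFree fun x hx => ?_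
    induction x using Submodule.Quotient.induction_on with
    | H n =>
      rw [← Submodule.Quotient.mk_smul, Submodule.Quotient.mk_eq_zero] at hx
      rw [Submodule.Quotient.mk_eq_zero]
      obtain ⟨p, hp⟩ := hx
      obtain ⟨p, rfl⟩ := B.ann.mkQ_surjective p
      obtain ⟨q, hq⟩ := hB n p hp.symm
      exact ⟨B.ann.mkQ q, hq.symm⟩
  have hinj : Function.Injective (g.rTensor A) := by
    have := LinearMap.lTensor_injective_of_exact_of_flat (range g).mkQ
      (mkQ_surjective _) g hg (LinearMap.exact_map_mkQ_range g) A
    rw [← LinearMap.lTensor_inj_iff_rTensor_inj]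
    exact this
  rw [hfac]
  exact ⟨fun h => hinj (by rw [h, map_zero]), fun h => by rw [h, map_zero]⟩

variable (B J J') in
/-- Reduction of `P ⊗ J` modulo the annihilator of the vacuum, `ħ` and `J'`. -/
def red : B.P ⊗[Lam k] J →ₗ[Lam k] (B.P ⧸ B.annBar) ⊗[Lam k] (J ⧸ J'.comap J.subtype) :=
  TensorProduct.map B.annBar.mkQ (J'.comap J.subtype).mkQ

theorem red_surjective : Function.Surjective (B.red J J') :=
  TensorProduct.map_surjective (mkQ_surjective _) (mkQ_surjective _)

theorem exists_of_mem_spanT {x : B.P ⊗[Lam k] A} (hx : x ∈ B.spanT A J) :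
    ∃ y : B.P ⊗[Lam k] J, J.subtype.lTensor B.P y = x :=
  spanT_le (X := range (J.subtype.lTensor B.P)) (fun p a ha => ⟨p ⊗ₜ ⟨a, ha⟩, rfl⟩) hx

theorem lTensor_subtype_mem (y : B.P ⊗[Lam k] J) : J.subtype.lTensor B.P y ∈ B.spanT A J := by
  induction y with
  | zero => simp
  | add y z hy hz => rw [map_add]; exact add_mem hy hz
  | tmul p a => exact B.tmul_mem_spanT p a.2

theorem red_eq_zero_iff (hJ' : J' ≤ J) (hħ : ∀ a ∈ J, hbar k • a ∈ J') (y : B.P ⊗[Lam k] J) :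
    B.red J J' y = 0 ↔ J.subtype.lTensor B.P y ∈ B.annMod A J' := by
  constructor
  · intro h
    rw [red, ← LinearMap.mem_ker, TensorProduct.map_ker (LinearMap.exact_subtype_mkQ B.annBar)
      (mkQ_surjective _) (LinearMap.exact_subtype_mkQ _)
      (mkQ_surjective _)] at h
    obtain ⟨_, ⟨y1, rfl⟩, _, ⟨y2, rfl⟩, rfl⟩ := mem_sup.1 h
    rw [map_add]
    clear h
    refine add_mem ?_ ?_
    · induction y1 with
      | zero => simp
      | add y z hy hz => rw [map_add, map_add]; exact add_mem hy hz
      | tmul p a => exact mem_sup_right (B.tmul_mem_spanT p a.2)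
    · induction y2 with
      | zero => simp
      | add y z hy hz => rw [map_add, map_add]; exact add_mem hy hz
      | tmul p a =>
        obtain ⟨⟨p, hp⟩, rfl⟩ : ∃ p', p' = p := ⟨p, rfl⟩
        obtain ⟨q, hq⟩ := mem_annBar_iff.1 hp
        have : p ⊗ₜ[Lam k] (a : A) =
            (p - hbar k • q) ⊗ₜ (a : A) + q ⊗ₜ (hbar k • (a : A)) := by
          rw [sub_tmul, smul_tmul, sub_add_cancel]
        change p ⊗ₜ[Lam k] (a : A) ∈ _
        rw [this]
        exact add_mem_sup (tmul_mem_annT hq _) (B.tmul_mem_spanT q (hħ _ a.2))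
  · intro h
    obtain ⟨y1, hy1, y2, hy2, h12⟩ := mem_sup.1 h
    obtain ⟨z, hz, hz0⟩ : ∃ z : B.P ⊗[Lam k] J, J.subtype.lTensor B.P z = y2 ∧
        B.red J J' z = 0 := by
      refine spanT_le (X := (ker (B.red J J')).map (J.subtype.lTensor B.P)) ?_ hy2 |>.imp
        fun z hz => ⟨hz.2, hz.1⟩
      intro p a ha
      refine ⟨p ⊗ₜ ⟨a, hJ' ha⟩, ?_, rfl⟩
      have : (J'.comap J.subtype).mkQ ⟨a, hJ' ha⟩ = 0 := (Submodule.Quotient.mk_eq_zero _).2 ha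
      simp only [SetLike.mem_coe, LinearMap.mem_ker, red, map_tmul]
      rw [this, tmul_zero]
    have h3 : J.subtype.lTensor B.P (y - z) ∈ B.annT A := by
      rw [map_sub, hz, ← h12, add_sub_cancel_right]; exact hy1
    rw [← rTensor_mkQ_ann_eq_zero_iff, ← comp_apply, LinearMap.rTensor_comp_lTensor,
      ← LinearMap.lTensor_comp_rTensor, comp_apply] at h3
    have hflat : Module.Flat (Lam k) (B.P ⧸ B.ann) :=
      flat_of_hbar_torsionFree quotient_ann_torsionFree
    have h4 := Module.Flat.lTensor_preserves_injective_linearMap (M := B.P ⧸ B.ann) J.subtype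
      J.injective_subtype
    have h5 : B.ann.mkQ.rTensor J (y - z) = 0 := h4 (by rw [h3, map_zero])
    have h6 : B.red J J' (y - z) = TensorProduct.map (Submodule.factor ann_le_annBar)
        (J'.comap J.subtype).mkQ (B.ann.mkQ.rTensor J (y - z)) := by
      rw [← comp_apply, rTensor, ← TensorProduct.map_comp]
      rfl
    rw [h5, map_zero, map_sub, hz0, sub_zero] at h6
    exact h6

end Flat


section Proj

variable {J J' : Submodule (Lam k) A}

variable (B A) in
/-- The projection of `P ⊗ A` to the part of total degree `n`. -/
def prT (n : ℤ) : B.P ⊗[Lam k] A →ₗ[Lam k] B.P ⊗[Lam k] A :=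
  TensorProduct.lift (DirectSum.toModule (Lam k) ℤ _ (fun i =>
      (TensorProduct.mk (Lam k) B.P A).compl₂ (pr A.gr_internal (n - i)) ∘ₗ (B.grP i).subtype) ∘ₗ
    (LinearEquiv.ofBijective (DirectSum.coeLinearMap B.grP) B.grP_internal).symm.toLinearMap)

theorem prT_tmul (n : ℤ) {i : ℤ} {p : B.P} (hp : p ∈ B.grP i) (a : A) :
    B.prT A n (p ⊗ₜ a) = p ⊗ₜ pr A.gr_internal (n - i) a := by
  have h1 : (LinearEquiv.ofBijective (DirectSum.coeLinearMap B.grP) B.grP_internal).symm p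
      = DirectSum.lof (Lam k) ℤ (fun i => B.grP i) i ⟨p, hp⟩ := by
    rw [LinearEquiv.symm_apply_eq]
    exact (DirectSum.coeLinearMap_lof B.grP i ⟨p, hp⟩).symm
  simp only [prT, TensorProduct.lift.tmul, comp_apply, LinearEquiv.coe_coe, h1,
    DirectSum.toModule_lof]
  rfl

theorem prT_of_mem {n : ℤ} {x : B.P ⊗[Lam k] A} (hx : x ∈ B.deg A J n) :
    B.prT A n x = x := by
  refine deg_ext (g := LinearMap.id) (fun i p a hp ha _ => ?_) hx
  rw [prT_tmul n hp, pr_of_mem _ ha, id_apply]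

theorem spanT_le_of_homogeneous {X : Submodule (Lam k) (B.P ⊗[Lam k] A)}
    (h : ∀ i p a, p ∈ B.grP i → a ∈ J → p ⊗ₜ[Lam k] a ∈ X) : B.spanT A J ≤ X := by
  refine spanT_le fun p a ha => ?_
  refine graded_ind B.grP_internal (p := fun p => p ⊗ₜ[Lam k] a ∈ X) (by simp)
    (fun x y hx hy => by rw [add_tmul]; exact add_mem hx hy)
    (fun i p hp => h i p a hp ha) p

theorem annT_le_of_homogeneous {X : Submodule (Lam k) (B.P ⊗[Lam k] A)}
    (h : ∀ i p a, p ∈ B.grP i → p ∈ B.ann → p ⊗ₜ[Lam k] a ∈ X) : B.annT A ≤ X := by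
  refine annT_le fun p a hp => ?_
  refine homogeneous_ind B.grP_internal B.pr_ann (p := fun p => p ⊗ₜ[Lam k] a ∈ X) (by simp)
    (fun x y hx hy => by rw [add_tmul]; exact add_mem hx hy)
    (fun i p hp hpa => h i p a hp hpa) hp

theorem prT_spanT (hJ : ∀ i, ∀ a ∈ J, pr A.gr_internal i a ∈ J) (n : ℤ)
    {x : B.P ⊗[Lam k] A} (hx : x ∈ B.spanT A J) : B.prT A n x ∈ B.deg A J n :=
  spanT_le_of_homogeneous (X := (B.deg A J n).comap (B.prT A n)) (fun i p a hp ha => by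
    rw [mem_comap, prT_tmul n hp]
    exact B.tmul_mem_deg hp (pr_mem _ _ _) (hJ _ a ha) (by ring)) hx

theorem prT_annT (n : ℤ) {x : B.P ⊗[Lam k] A} (hx : x ∈ B.annT A) :
    B.prT A n x ∈ B.annT A :=
  annT_le_of_homogeneous (X := (B.annT A).comap (B.prT A n)) (fun i p a hp hpa => by
    rw [mem_comap, prT_tmul n hp]
    exact tmul_mem_annT hpa _) hx

theorem prT_annMod (hJ : ∀ i, ∀ a ∈ J, pr A.gr_internal i a ∈ J) (n : ℤ)
    {x : B.P ⊗[Lam k] A} (hx : x ∈ B.annMod A J) : B.prT A n x ∈ B.annMod A J := by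
  obtain ⟨y, hy, z, hz, rfl⟩ := mem_sup.1 hx
  rw [map_add]
  exact add_mem_sup (prT_annT n hy) (deg_le_spanT (prT_spanT hJ n hz))

/-- An element of degree `n` that annihilates the vacuum modulo `J` does so after subtraction of
an element of `P ⊗ J` of degree `n`. -/
theorem exists_sub_mem_annT (hJ : ∀ i, ∀ a ∈ J, pr A.gr_internal i a ∈ J) {n : ℤ}
    {x : B.P ⊗[Lam k] A} (hx : x ∈ B.annMod A J) (hxn : x ∈ B.deg A ⊤ n) :
    ∃ o ∈ B.deg A J n, x - o ∈ B.annT A := by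
  obtain ⟨y, hy, z, hz, hyz⟩ := mem_sup.1 hx
  refine ⟨B.prT A n z, prT_spanT hJ n hz, ?_⟩
  have : x - B.prT A n z = B.prT A n y := by
    rw [sub_eq_iff_eq_add, ← map_add, hyz, prT_of_mem hxn]
  rw [this]
  exact prT_annT n hy

theorem prT_bracket_m (n : ℤ) (x : B.P ⊗[Lam k] A) : B.prT A n (rTensor A (B.bracket B.m) x) =
      rTensor A (B.bracket B.m) (B.prT A (n - 1) x) := by
  have hx : x ∈ B.spanT A ⊤ := by
    induction x with
    | zero => exact zero_mem _
    | add x y hx hy => exact add_mem hx hy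
    | tmul p a => exact B.tmul_mem_spanT p trivial
  refine spanT_le_of_homogeneous (X := LinearMap.eqLocus
    (B.prT A n ∘ₗ rTensor A (B.bracket B.m))
    (rTensor A (B.bracket B.m) ∘ₗ B.prT A (n - 1))) (fun i p a hp _ => ?_) hx
  rw [LinearMap.mem_eqLocus, comp_apply, comp_apply, rTensor_tmul,
    prT_tmul _ hp, prT_tmul _ (B.bracket_mem B.m_mem hp), rTensor_tmul]
  congr 3
  ring

theorem prT_push {A' : DGAlg k} {f : A →ₗ[Lam k] A'} {e : ℤ}
    (hf : ∀ i, ∀ a ∈ A.gr i, f a ∈ A'.gr (i + e)) (n : ℤ) (x : B.P ⊗[Lam k] A) :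
    B.prT A' n (B.push f x) = B.push f (B.prT A (n - e) x) := by
  have hx : x ∈ B.spanT A ⊤ := by
    induction x with
    | zero => exact zero_mem _
    | add x y hx hy => exact add_mem hx hy
    | tmul p a => exact B.tmul_mem_spanT p trivial
  refine spanT_le_of_homogeneous (X := LinearMap.eqLocus
    (B.prT A' n ∘ₗ B.push f) (B.push f ∘ₗ B.prT A (n - e))) (fun i p a hp _ => ?_) hx
  rw [LinearMap.mem_eqLocus, comp_apply, comp_apply, lTensor_tmul,
    prT_tmul _ hp, prT_tmul _ hp, lTensor_tmul]
  congr 1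
  refine graded_ind A.gr_internal (p := fun a => pr A'.gr_internal (n - i) (f a) =
    f (pr A.gr_internal (n - e - i) a)) (by simp) (fun x y hx hy => by simp [hx, hy])
    (fun j a ha => ?_) a
  by_cases hj : j = n - e - i
  · have h1 := hf _ _ ha
    rw [show j + e = n - i by omega] at h1
    rw [pr_of_mem _ h1, pr_of_mem _ (by rwa [← hj])]
  · rw [pr_of_mem_ne _ ha hj, map_zero, pr_of_mem_ne _ (hf _ _ ha) (by omega)]

end Proj


/-- Representatives `p j` of degree `deg j` of a basis of the homology of the background: the
homology of `P` modulo `ħ` and the annihilator of the vacuum, for the differential `[m, -] / ħ`. -/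
structure IsHomologyBasis (B : Background.{u, v, w} k) {r : ℕ} (deg : Fin r → ℤ) (p : Fin r → B.P) :
    Prop where
  mem : ∀ j, p j ∈ B.grP (deg j)
  cycle : ∀ j, B.bracket B.m (p j) ∈ B.annBar
  span : ∀ x, B.bracket B.m x ∈ B.annBar → ∃ (c : Fin r → k) (y : B.P),
    x - ∑ j, (C (c j) : Lam k) • p j - B.bracket B.m y ∈ B.annBar
  indep : ∀ (c : Fin r → k) (y : B.P),
    ∑ j, (C (c j) : Lam k) • p j - B.bracket B.m y ∈ B.annBar → c = 0

section ContractionLemma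

variable {r : ℕ} {deg : Fin r → ℤ} {p : Fin r → B.P} {J J' : Submodule (Lam k) A}
  {d : A →ₗ[Lam k] A}

variable (B) in
/-- The differential `[m, -] / ħ` modulo `ħ` and the annihilator of the vacuum. -/
def barD : B.P ⧸ B.annBar →ₗ[Lam k] B.P ⧸ B.annBar :=
  B.annBar.mapQ B.annBar (B.bracket B.m) fun _ hp => bracket_m_annBar hp

theorem hbar_smul_quotient_annBar (x : B.P ⧸ B.annBar) : hbar k • x = 0 := by
  obtain ⟨p, rfl⟩ := B.annBar.mkQ_surjective x
  rw [← map_smul]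
  exact (Submodule.Quotient.mk_eq_zero _).2 (hbar_smul_mem_annBar p)

theorem IsHomologyBasis.exists_contraction [CharZero k] (hp : B.IsHomologyBasis deg p) :
    ∃ (e : Fin r → (B.P ⧸ B.annBar) → k) (s : B.P ⧸ B.annBar →ₗ[Lam k] B.P ⧸ B.annBar),
      (∀ j x y, e j (x + y) = e j x + e j y) ∧
      (∀ j (c : Lam k) x, e j (c • x) = constantCoeff c * e j x) ∧ (∀ j x, e j (B.barD x) = 0) ∧
      (∀ x, x = ∑ j, (C (e j x) : Lam k) • B.annBar.mkQ (p j) + B.barD (s x) +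
        s (B.barD x)) ∧ (∀ j, s (B.annBar.mkQ (p j)) = 0) ∧
      ∀ i j, e i (B.annBar.mkQ (p j)) = if i = j then 1 else 0 := by
  let i1 : Module k (B.P ⧸ B.annBar) := Module.compHom _ (C : k →+* Lam k)
  have hsm : ∀ (c : k) (x : B.P ⧸ B.annBar), c • x = (C c : Lam k) • x :=
    fun _ _ => rfl
  have hC : ∀ (c : Lam k) (x : B.P ⧸ B.annBar), c • x = constantCoeff c • x :=
    fun c x => by rw [hsm, smul_eq_C_smul (hbar_smul_quotient_annBar x)]
  let D : B.P ⧸ B.annBar →ₗ[k] B.P ⧸ B.annBar :=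
    { toFun := B.barD
      map_add' := map_add _
      map_smul' := fun c x => by rw [hsm, map_smul, hsm, RingHom.id_apply] }
  obtain ⟨e, s, h1, h2, h3, h4⟩ := QBackground.exists_contraction D (fun j => B.annBar.mkQ (p j))
    (fun x => by
      obtain ⟨x, rfl⟩ := B.annBar.mkQ_surjective x
      change B.annBar.mkQ (B.bracket B.m (B.bracket B.m x)) = 0
      rw [bracket_m_bracket_m, map_zero])
    (fun j => (Submodule.Quotient.mk_eq_zero _).2 (hp.cycle j))
    (fun x hx => by
      obtain ⟨x, rfl⟩ := B.annBar.mkQ_surjective x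
      obtain ⟨c, y, hcy⟩ := hp.span x ((Submodule.Quotient.mk_eq_zero _).1 hx)
      refine ⟨c, B.annBar.mkQ y, ?_⟩
      rw [← sub_eq_zero, ← sub_sub]
      have := (Submodule.Quotient.mk_eq_zero _).2 hcy
      rw [← Submodule.mkQ_apply, map_sub, map_sub, map_sum] at this
      simp only [map_smul] at this
      exact this)
    (fun c y hcy => by
      obtain ⟨y, rfl⟩ := B.annBar.mkQ_surjective y
      refine hp.indep c y ((Submodule.Quotient.mk_eq_zero _).1 ?_)
      rw [← Submodule.mkQ_apply, map_sub, map_sum, sub_eq_zero]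
      simp only [map_smul]
      exact hcy)
  refine ⟨fun j => e j, { toFun := s, map_add' := map_add _, map_smul' := fun c x => ?_ },
    fun j => map_add _, fun j c x => ?_, h1, h2, h3, h4⟩
  · rw [hC, map_smul, RingHom.id_apply, hC]
  · change e j (c • x) = _ * e j x
    rw [hC, map_smul, smul_eq_mul]

theorem totalD_of_mem {n : ℤ} {x : B.P ⊗[Lam k] A} (hx : x ∈ B.deg A J n) : B.totalD A d x =
      rTensor A (B.bracket B.m) x - sgn n • B.push (d ∘ₗ A.par) x := by
  refine deg_ext (g := rTensor A (B.bracket B.m) - sgn n • B.push (d ∘ₗ A.par))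
    (fun i p a hp ha _ => ?_) hx
  rw [totalD_tmul _ hp, LinearMap.sub_apply, rTensor_tmul, LinearMap.smul_apply,
    lTensor_tmul, comp_apply, DGAlg.par_of_mem ha, map_zsmul, tmul_smul, smul_smul, ← sgn_add]
  congr 2
  exact sgn_eq_of_even ⟨i - n, by ring⟩

set_option maxHeartbeats 1000000 in
/-- The fundamental lemma of obstruction theory: cycles with coefficients in `J / J'` are, up to
boundaries, linear combinations of the representatives of the basis of the homology. -/
theorem IsHomologyBasis.contract [CharZero k] (hp : B.IsHomologyBasis deg p) (hd : A.IsDer d)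
    (hJ' : J' ≤ J) (hħ : ∀ a ∈ J, hbar k • a ∈ J')
    (hJ : ∀ i, ∀ a ∈ J, pr A.gr_internal i a ∈ J) (hJh : ∀ i, ∀ a ∈ J', pr A.gr_internal i a ∈ J')
    (hdJ : ∀ a ∈ J, d a ∈ J) (hdJ' : ∀ a ∈ J', d a ∈ J')
    {n : ℤ} {z : B.P ⊗[Lam k] A} (hz : z ∈ B.deg A J n) {o : Fin r → A}
    (hoJ : ∀ j, o j ∈ J) (ho : ∀ j, o j ∈ A.gr (n + 1 - deg j))
    (hzo : B.totalD A d z - ∑ j, p j ⊗ₜ o j ∈ B.annMod A J') :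
    ∃ (x : Fin r → A) (w : B.P ⊗[Lam k] A), (∀ j, x j ∈ J) ∧
      (∀ j, x j ∈ A.gr (n - deg j)) ∧ w ∈ B.deg A J (n - 1) ∧
      z - ∑ j, p j ⊗ₜ x j - B.totalD A d w ∈ B.annMod A J' ∧
      ∀ j, -(sgn (deg j) • d (x j)) - o j ∈ J' := by
  obtain ⟨e, s, eadd, esmul, eD, es, sp, ep⟩ := hp.exists_contraction
  set K := J'.comap J.subtype with hK
  have hpar : ∀ a ∈ J, A.par a ∈ J := fun a ha => weight_mem _ hJ _ ha
  have hpar' : ∀ a ∈ J', A.par a ∈ J' := fun a ha => weight_mem _ hJh _ ha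
  let T : A →ₗ[Lam k] A := d ∘ₗ A.par
  have hT : ∀ a ∈ J, T a ∈ J := fun a ha => hdJ _ (hpar a ha)
  let TJ : J →ₗ[Lam k] J := T.restrict hT
  have hTK : K ≤ K.comap TJ := fun a ha => hdJ' _ (hpar' _ ha)
  let TV : (J ⧸ K) →ₗ[Lam k] (J ⧸ K) := K.mapQ K TJ hTK
  have hħV : ∀ x : J ⧸ K, hbar k • x = 0 := fun x => by
    obtain ⟨x, rfl⟩ := K.mkQ_surjective x
    rw [← map_smul]
    exact (Submodule.Quotient.mk_eq_zero _).2 (hħ _ x.2)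
  let E : Fin r → (B.P ⧸ B.annBar) ⊗[Lam k] (J ⧸ K) →ₗ[Lam k] (J ⧸ K) := fun j =>
    TensorProduct.lift (LinearMap.mk₂ (Lam k) (fun x y => (C (e j x) : Lam k) • y)
      (fun x x' y => by rw [eadd, map_add, add_smul])
      (fun c x y => by
        rw [esmul, map_mul, mul_smul, ← smul_eq_C_smul]
        rw [smul_comm, hħV, smul_zero])
      (fun x y y' => smul_add _ _ _) (fun c x y => smul_comm _ _ _))
  have hE : ∀ j x y, E j (x ⊗ₜ y) = (C (e j x) : Lam k) • y := fun _ _ _ => rfl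
  have hdecomp : ∀ y : (B.P ⧸ B.annBar) ⊗[Lam k] (J ⧸ K),
      y = ∑ j, B.annBar.mkQ (p j) ⊗ₜ E j y + B.barD.rTensor _ (s.rTensor _ y) +
        s.rTensor _ (B.barD.rTensor _ y) := by
    intro y
    induction y with
    | zero => simp
    | add x y hx hy =>
      conv_lhs => rw [hx, hy]
      simp only [map_add, tmul_add, sum_add_distrib]
      abel
    | tmul x y =>
      conv_lhs => rw [es x]
      simp only [rTensor_tmul, add_tmul, TensorProduct.sum_tmul, hE,
        tmul_smul, TensorProduct.smul_tmul']
  have hED : ∀ j y, E j (B.barD.rTensor _ y) = 0 := by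
    intro j y
    induction y with
    | zero => simp
    | add x y hx hy => rw [map_add, map_add, hx, hy, add_zero]
    | tmul x y => rw [rTensor_tmul, hE, eD, map_zero, zero_smul]
  have hET : ∀ j y, E j (TV.lTensor _ y) = TV (E j y) := by
    intro j y
    induction y with
    | zero => simp
    | add x y hx hy => simp only [map_add, hx, hy]
    | tmul x y => rw [lTensor_tmul, hE, hE, map_smul]
  obtain ⟨y, rfl⟩ := exists_of_mem_spanT (deg_le_spanT hz)
  have push1 : ∀ y : B.P ⊗[Lam k] J, J.subtype.lTensor B.P ((B.bracket B.m).rTensor J y) =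
      (B.bracket B.m).rTensor A (J.subtype.lTensor B.P y) := fun y => by
    rw [← comp_apply, ← comp_apply, LinearMap.lTensor_comp_rTensor, LinearMap.rTensor_comp_lTensor]
  have push2 : ∀ y : B.P ⊗[Lam k] J, J.subtype.lTensor B.P (TJ.lTensor B.P y) =
      T.lTensor B.P (J.subtype.lTensor B.P y) := fun y => by
    rw [← comp_apply, ← comp_apply, ← lTensor_comp, ← lTensor_comp]
    rfl
  have red1 : ∀ y, B.red J J' ((B.bracket B.m).rTensor J y) = B.barD.rTensor _ (B.red J J' y) := by
    intro y
    rw [red, ← comp_apply, ← comp_apply, rTensor, rTensor,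
      ← TensorProduct.map_comp, ← TensorProduct.map_comp]
    rfl
  have red2 : ∀ y, B.red J J' (TJ.lTensor _ y) = TV.lTensor _ (B.red J J' y) := by
    intro y
    rw [red, ← comp_apply, ← comp_apply, lTensor, lTensor,
      ← TensorProduct.map_comp, ← TensorProduct.map_comp]
    rfl
  have hcyc : B.barD.rTensor _ (B.red J J' y) - sgn n • TV.lTensor _ (B.red J J' y) -
      ∑ j, B.annBar.mkQ (p j) ⊗ₜ[Lam k] K.mkQ ⟨o j, hoJ j⟩ = 0 := by
    have h := (red_eq_zero_iff hJ' hħ ((B.bracket B.m).rTensor J y - sgn n • TJ.lTensor B.P y -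
      ∑ j, p j ⊗ₜ ⟨o j, hoJ j⟩)).2 (by
        rw [totalD_of_mem hz] at hzo
        rw [map_sub, map_sub, push1, map_zsmul, push2, map_sum]
        exact hzo)
    rw [map_sub, map_sub, red1, map_zsmul, red2, map_sum] at h
    exact h
  obtain ⟨w, hw⟩ := red_surjective (J := J) (J' := J') (s.rTensor _ (B.red J J' y))
  choose x hx using fun j => K.mkQ_surjective (E j (B.red J J' y))
  have hcomm : ∀ y : (B.P ⧸ B.annBar) ⊗[Lam k] (J ⧸ K),
      s.rTensor _ (TV.lTensor _ y) = TV.lTensor _ (s.rTensor _ y) := fun y => by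
    rw [← comp_apply, ← comp_apply, LinearMap.lTensor_comp_rTensor, LinearMap.rTensor_comp_lTensor]
  have hsD : s.rTensor _ (B.barD.rTensor _ (B.red J J' y)) = sgn n • TV.lTensor _ (B.red J J' w) := by
    rw [sub_sub, sub_eq_zero] at hcyc
    rw [hcyc, map_add, map_zsmul, hw, map_sum, Finset.sum_eq_zero, add_zero, hcomm]
    intro j _
    rw [rTensor_tmul, sp, zero_tmul]
  have hz1 : J.subtype.lTensor B.P y - ∑ j, p j ⊗ₜ (x j : A) -
      ((B.bracket B.m).rTensor A (J.subtype.lTensor B.P w) +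
        sgn n • T.lTensor B.P (J.subtype.lTensor B.P w)) ∈ B.annMod A J' := by
    have h := (red_eq_zero_iff hJ' hħ (y - ∑ j, p j ⊗ₜ x j - ((B.bracket B.m).rTensor J w +
      sgn n • TJ.lTensor B.P w))).1 (by
        rw [map_sub, map_sub, map_add, red1, map_zsmul, red2, map_sum, hw]
        conv_lhs => enter [1, 1]; rw [hdecomp (B.red J J' y), hsD, hw]
        have : ∀ j, B.red J J' (p j ⊗ₜ x j) = B.annBar.mkQ (p j) ⊗ₜ[Lam k] E j (B.red J J' y) :=
          fun j => by rw [← hx]; rfl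
        simp only [this]
        abel)
    rw [map_sub, map_sub, map_add, push1, map_zsmul, push2, map_sum] at h
    exact h
  have hTdeg : ∀ i, ∀ a ∈ A.gr i, T a ∈ A.gr (i + 1) := fun i a ha => by
    change d (A.par a) ∈ _
    rw [DGAlg.par_of_mem ha, map_zsmul]
    exact zsmul_mem (hd.map_gr ha) _
  refine ⟨fun j => pr A.gr_internal (n - deg j) (x j), B.prT A (n - 1) (J.subtype.lTensor B.P w),
    fun j => hJ _ _ (x j).2, fun j => pr_mem _ _ _, prT_spanT hJ _ (lTensor_subtype_mem w), ?_, ?_⟩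
  · have h := prT_annMod hJh n hz1
    rw [map_sub, map_sub, map_add, map_sum, prT_of_mem hz, prT_bracket_m, map_zsmul,
      prT_push hTdeg] at h
    rw [totalD_of_mem (prT_spanT hJ (n - 1) (lTensor_subtype_mem w)), sgn_pred, neg_smul,
      sub_neg_eq_add]
    simp only [prT_tmul n (hp.mem _)] at h
    exact h
  · intro j
    have h1 := congrArg (E j) hcyc
    rw [map_sub, map_sub, hED, map_zsmul, hET, map_zero, zero_sub, map_sum] at h1
    simp only [hE, ep] at h1
    rw [sum_eq_single j (fun i _ hi => by simp [Ne.symm hi]) (by simp), if_pos rfl, map_one,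
      one_smul, ← hx] at h1
    have h2 : -(sgn n • T (x j)) - o j ∈ J' := by
      have := (Submodule.Quotient.mk_eq_zero K (x := -(sgn n • TJ (x j)) - ⟨o j, hoJ j⟩)).1 (by
        rw [← Submodule.mkQ_apply, map_sub, map_neg, map_zsmul]
        exact h1)
      exact this
    have h3 := hJh (n + 1 - deg j) _ h2
    have h4 : pr A.gr_internal (n + 1 - deg j) (T (x j)) = T (pr A.gr_internal (n - deg j) (x j)) := by
      refine graded_ind A.gr_internal (p := fun a => pr A.gr_internal (n + 1 - deg j) (T a) =
        T (pr A.gr_internal (n - deg j) a)) (by simp) (fun x y hx hy => by simp [hx, hy])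
        (fun i a ha => ?_) (x j)
      by_cases hi : i = n - deg j
      · have h5 := hTdeg _ _ ha
        rw [show i + 1 = n + 1 - deg j by omega] at h5
        rw [pr_of_mem _ h5, pr_of_mem _ (by rwa [← hi])]
      · rw [pr_of_mem_ne _ ha hi, map_zero, pr_of_mem_ne _ (hTdeg _ _ ha) (by omega)]
    rw [map_sub, map_neg, map_zsmul, h4, pr_of_mem _ (ho j)] at h3
    change -(sgn n • d (A.par (pr A.gr_internal (n - deg j) (x j)))) - o j ∈ J' at h3
    rw [DGAlg.par_of_mem (pr_mem _ _ _), map_zsmul, smul_smul, ← sgn_add,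
      show sgn (n + (n - deg j)) = sgn (deg j) from sgn_eq_of_even ⟨n - deg j, by ring⟩] at h3
    exact h3

end ContractionLemma

end Background

namespace DGAlg

variable {k : Type u} [Field k] {A A' : DGAlg k}

theorem Hom.map_pr (f : Hom A A') (i : ℤ) (a : A) :
    f (pr A.gr_internal i a) = pr A'.gr_internal i (f a) := by
  refine graded_ind A.gr_internal (p := fun a => f (pr A.gr_internal i a) =
    pr A'.gr_internal i (f a)) (by simp) (fun x y hx hy => by simp [hx, hy])
    (fun j a ha => ?_) a
  by_cases hj : j = i
  · subst hj; rw [pr_of_mem _ ha, pr_of_mem _ (f.map_gr ha)]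
  · rw [pr_of_mem_ne _ ha hj, map_zero, pr_of_mem_ne _ (f.map_gr ha) hj]

theorem forms_ext {x y : A.forms} (h1 : ∀ n, x.1.coeff n = y.1.coeff n)
    (h2 : ∀ n, x.2.coeff n = y.2.coeff n) : x = y :=
  PolyForm.ext (Polynomial.ext h1) (Polynomial.ext h2)

namespace PolyForm

/-- Apply a linear map to the coefficients of a form. -/
def mapPoly (f : A →ₗ[Lam k] A') : A[X] →ₗ[Lam k] A'[X] :=
  have h : ∀ (p : A[X]) (n : ℕ),
      (p.sum fun n a => monomial n (f a)).coeff n = f (p.coeff n) := fun p n => by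
    simp +contextual [sum_def, coeff_monomial]
  { toFun := fun p => p.sum fun n a => monomial n (f a)
    map_add' := fun p q => by ext n; simp only [coeff_add, h, map_add]
    map_smul' := fun c p => by
      ext n; simp only [coeff_smul, h, map_smul, RingHom.id_apply] }

@[simp] theorem coeff_mapPoly (f : A →ₗ[Lam k] A') (p : A[X]) (n : ℕ) :
    (mapPoly f p).coeff n = f (p.coeff n) := by
  simp +contextual [mapPoly, sum_def, coeff_monomial]

/-- Apply a linear map to the coefficients of a form. -/
def mapL (f : A →ₗ[Lam k] A') : A.forms →ₗ[Lam k] A'.forms :=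
  LinearMap.prodMap (mapPoly f) (mapPoly f)

@[simp] theorem fst_mapL (f : A →ₗ[Lam k] A') (x : A.forms) : (mapL f x).1 = mapPoly f x.1 := rfl
@[simp] theorem snd_mapL (f : A →ₗ[Lam k] A') (x : A.forms) : (mapL f x).2 = mapPoly f x.2 := rfl

theorem mapL_hom (f : Hom A A') : mapL f.toAlgHom.toLinearMap = f.forms.toAlgHom.toLinearMap := by
  refine LinearMap.ext fun x => forms_ext (fun n => ?_) fun n => ?_
  · change _ = (Polynomial.mapAlgHom f.toAlgHom x.1).coeff n
    simp
  · change _ = (Polynomial.mapAlgHom f.toAlgHom x.2).coeff n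
    simp

variable (A) in
/-- The antiderivative of a polynomial that vanishes at `0`. -/
def integ : A[X] →ₗ[Lam k] A[X] :=
  have h : ∀ (p : A[X]) (n : ℕ),
      (p.sum fun n a => monomial (n + 1) ((C ((n + 1 : k)⁻¹) : Lam k) • a)).coeff n
        = if n = 0 then 0 else (C ((n : k)⁻¹) : Lam k) • p.coeff (n - 1) := fun p n => by
    rcases n with _ | n
    · simp [sum_def, coeff_monomial]
    · simp +contextual [sum_def, coeff_monomial]
  { toFun := fun p => p.sum fun n a =>
      monomial (n + 1) ((C ((n + 1 : k)⁻¹) : Lam k) • a)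
    map_add' := fun p q => by
      ext n
      simp only [coeff_add, h]
      split <;> simp
    map_smul' := fun c p => by
      ext n
      simp only [coeff_smul, h, RingHom.id_apply]
      split
      · simp
      · rw [smul_comm] }

@[simp] theorem coeff_integ_zero (p : A[X]) : (integ A p).coeff 0 = 0 := by
  simp [integ, sum_def, coeff_monomial]

@[simp] theorem coeff_integ_succ (p : A[X]) (n : ℕ) :
    (integ A p).coeff (n + 1) = (C ((n + 1 : k)⁻¹) : Lam k) • p.coeff n := by
  simp +contextual [integ, sum_def, coeff_monomial]

theorem deriv_integ [CharZero k] (p : A[X]) : deriv A (integ A p) = p := by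
  ext n
  rw [coeff_deriv, coeff_integ_succ, ← Nat.cast_succ (R := A), ← nsmul_eq_mul',
    ← Nat.cast_smul_eq_nsmul (Lam k), smul_smul, ← map_natCast (C (R := k)), ← map_mul,
    Nat.cast_succ, mul_inv_cancel₀ (Nat.cast_add_one_ne_zero n), map_one, one_smul]

theorem integ_deriv [CharZero k] (p : A[X]) :
    integ A (deriv A p) = p - Polynomial.C (p.coeff 0) := by
  ext n
  rcases n with _ | n
  · simp
  · rw [coeff_integ_succ, coeff_deriv, ← Nat.cast_succ (R := A), ← nsmul_eq_mul',
      ← Nat.cast_smul_eq_nsmul (Lam k), smul_smul, ← map_natCast (C (R := k)), ← map_mul,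
      Nat.cast_succ, inv_mul_cancel₀ (Nat.cast_add_one_ne_zero n), map_one, one_smul]
    simp

theorem mapPoly_integ (f : A →ₗ[Lam k] A') (p : A[X]) :
    mapPoly f (integ A p) = integ A' (mapPoly f p) := by
  ext n
  rcases n with _ | n <;> simp

end PolyForm

open PolyForm

theorem eval_mapPoly (f : A →ₗ[Lam k] A') (p : A[X]) (s : ℤ) :
    (mapPoly f p).eval (s : A') = f (p.eval (s : A)) := by
  induction p using Polynomial.induction_on' with
  | add p q hp hq => simp [hp, hq]
  | monomial n a =>
    have : mapPoly f (monomial n a) = monomial n (f a) := by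
      ext i
      simp only [coeff_mapPoly, coeff_monomial]
      split <;> simp
    rw [this, eval_monomial, eval_monomial, ← Int.cast_pow, ← Int.cast_pow,
      ← zsmul_eq_mul', ← zsmul_eq_mul', map_zsmul]

theorem mapL_mapL {A'' : DGAlg k} (f : A →ₗ[Lam k] A') (g : A' →ₗ[Lam k] A'')
    (x : A.forms) : mapL g (mapL f x) = mapL (g ∘ₗ f) x :=
  forms_ext (fun n => by simp) (fun n => by simp)

theorem ev_mapL (f : A →ₗ[Lam k] A') (x : A.forms) (s : ℤ) :
    A'.ev s (mapL f x) = f (A.ev s x) := eval_mapPoly f x.1 s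

theorem eval_mul_intCast (p q : A[X]) (s : ℤ) :
    (p * q).eval (s : A) = p.eval (s : A) * q.eval (s : A) :=
  Polynomial.eval₂_mul_noncomm _ _ fun n => (Int.cast_commute s (q.coeff n)).symm

variable (A) in
/-- Evaluation of forms at an integral point. -/
def evHom (s : ℤ) : Hom A.forms A where
  toAlgHom := AlgHom.ofLinearMap (A.ev s) (by
    change (1 : A[X]).eval _ = 1
    simp) (fun x y => eval_mul_intCast x.1 y.1 s)
  map_gr {i x} hx := by
    change (x.1 : A[X]).eval (s : A) ∈ _
    rw [Polynomial.eval_eq_sum, sum_def]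
    refine sum_mem fun n _ => ?_
    rw [← Int.cast_pow, ← zsmul_eq_mul']
    exact zsmul_mem (hx n).1 _
  map_d x := by
    have : dPoly A x.1 = mapPoly A.d x.1 := by ext n; simp
    change (dPoly A x.1).eval (s : A) = A.d ((x.1 : A[X]).eval (s : A))
    rw [this, eval_mapPoly]

theorem evHom_toLinearMap (s : ℤ) : (A.evHom s).toAlgHom.toLinearMap = A.ev s := rfl

theorem evHom_apply (s : ℤ) (x : A.forms) : A.evHom s x = A.ev s x := rfl

variable (A) in
/-- Integration of forms from the point `s`, an operator of degree `-1` on forms. -/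
def sigma (s : ℤ) : A.forms →ₗ[Lam k] A.forms :=
  inl A ∘ₗ (parPoly A).toLinearMap ∘ₗ (LinearMap.id - Polynomial.CAlgHom.toLinearMap ∘ₗ
    (Polynomial.leval (s : A)).restrictScalars (Lam k)) ∘ₗ integ A ∘ₗ
    LinearMap.snd (Lam k) A[X] A[X]

theorem fst_sigma (s : ℤ) (x : A.forms) : (A.sigma s x).1 =
    parPoly A (integ A x.2 - Polynomial.C ((integ A x.2).eval (s : A))) := rfl

theorem snd_sigma (s : ℤ) (x : A.forms) : (A.sigma s x).2 = 0 := rfl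

theorem const_apply (a : A) : A.constHom a = inl A (Polynomial.C a) := rfl

theorem ev_const (s : ℤ) (a : A) : A.ev s (A.constHom a) = a :=
  Polynomial.eval_C

theorem d_sigma [CharZero k] (s : ℤ) (x : A.forms) :
    A.forms.d (A.sigma s x) + A.sigma s (A.forms.d x) = x - A.constHom (A.ev s x) := by
  have hd : ∀ p, dPoly A p = mapPoly A.d p := fun p => by ext n; simp
  have hp : ∀ p, parPoly A p = mapPoly A.par p := fun p => by ext n; simp
  let τ : A[X] → A[X] := fun p =>
    integ A p - Polynomial.C ((integ A p).eval (s : A))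
  have hC : ∀ (f : A →ₗ[Lam k] A) a,
      mapPoly f (Polynomial.C a) = Polynomial.C (f a) := fun f a => by
    ext n; simp only [coeff_mapPoly, coeff_C]; split <;> simp
  have hτ : ∀ (f : A →ₗ[Lam k] A) p, τ (mapPoly f p) = mapPoly f (τ p) :=
    fun f p => by simp only [τ, map_sub, hC, mapPoly_integ, ← eval_mapPoly]
  have hadd : ∀ p q, τ (p + q) = τ p + τ q := fun p q => by
    simp only [τ, map_add, Polynomial.eval_add]; abel
  have hder : ∀ p, τ (PolyForm.deriv A p) = p - Polynomial.C (p.eval (s : A)) := fun p => by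
    simp only [τ, integ_deriv, Polynomial.eval_sub, Polynomial.eval_C, Polynomial.C_sub]; abel
  apply PolyForm.ext
  · change dPoly A (parPoly A (τ x.2)) + parPoly A (τ (dPoly A x.2 +
      parPoly A (PolyForm.deriv A x.1))) = x.1 - Polynomial.C (x.1.eval (s : A))
    have h1 : ∀ p, τ (dPoly A p) = dPoly A (τ p) := fun p => by rw [hd, hd, hτ]
    have h2 : ∀ p, τ (parPoly A p) = parPoly A (τ p) := fun p => by rw [hp, hp, hτ]
    rw [hadd, map_add, h1, h2, parPoly_parPoly, dPoly_parPoly, hder]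
    abel
  · change dPoly A 0 + parPoly A (PolyForm.deriv A (parPoly A (τ x.2))) + 0 = x.2 - 0
    rw [map_zero, zero_add, add_zero, sub_zero, deriv_parPoly, parPoly_parPoly, map_sub,
      deriv_integ]
    simp [PolyForm.deriv]

theorem sigma_gr (s : ℤ) {i : ℤ} {x : A.forms} (hx : x ∈ A.forms.gr i) :
    A.sigma s x ∈ A.forms.gr (i - 1) := by
  intro n
  refine ⟨?_, by rw [snd_sigma, Polynomial.coeff_zero]; exact zero_mem _⟩
  have h : ∀ m, (integ A x.2).coeff m ∈ A.gr (i - 1) := fun m => by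
    rcases m with _ | m
    · rw [coeff_integ_zero]; exact zero_mem _
    · rw [coeff_integ_succ]; exact Submodule.smul_mem _ _ (hx m).2
  have h' : (integ A x.2).eval (s : A) ∈ A.gr (i - 1) := by
    rw [Polynomial.eval_eq_sum, sum_def]
    refine sum_mem fun n _ => ?_
    rw [← Int.cast_pow, ← zsmul_eq_mul']
    exact zsmul_mem (h n) _
  have h'' : (integ A x.2 - Polynomial.C ((integ A x.2).eval (s : A))).coeff n ∈
      A.gr (i - 1) := by
    rw [coeff_sub, coeff_C]
    refine sub_mem (h n) ?_
    split
    · exact h'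
    · exact zero_mem _
  rw [fst_sigma, coeff_parPoly, par_of_mem h'']
  exact zsmul_mem h'' _

theorem ev_sigma (s : ℤ) (x : A.forms) : A.ev s (A.sigma s x) = 0 := by
  change (parPoly A (integ A x.2 - Polynomial.C ((integ A x.2).eval (s : A)))).eval
    (s : A) = 0
  have hp : ∀ p, parPoly A p = mapPoly A.par p := fun p => by ext n; simp
  rw [hp, eval_mapPoly, Polynomial.eval_sub, Polynomial.eval_C, sub_self, map_zero]

theorem mapL_sigma (f : A →ₗ[Lam k] A') (hf : ∀ a, f (A.par a) = A'.par (f a))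
    (s : ℤ) (x : A.forms) : mapL f (A.sigma s x) = A'.sigma s (mapL f x) := by
  have hp : ∀ p, mapPoly f (parPoly A p) = parPoly A' (mapPoly f p) := fun p => by
    ext n; simp [hf]
  apply PolyForm.ext
  · rw [fst_mapL, fst_sigma, fst_sigma, hp, map_sub, mapPoly_integ, snd_mapL,
      ← mapPoly_integ, eval_mapPoly]
    congr 2
    ext n
    simp only [coeff_mapPoly, coeff_C]
    split <;> simp
  · rw [snd_mapL, snd_sigma, snd_sigma, map_zero]

section FormsSub

variable {I J K : Submodule (Lam k) A}

theorem formsSub_mono (h : I ≤ J) : A.formsSub I ≤ A.formsSub J :=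
  fun _ hx n => ⟨h (hx n).1, h (hx n).2⟩

theorem formsSub_bot : A.formsSub ⊥ = ⊥ := by
  exact eq_bot_iff.2 fun x hx => forms_ext (fun n => (hx n).1) fun n => (hx n).2

theorem formsSub_top : A.formsSub ⊤ = ⊤ := eq_top_iff.2 fun _ _ _ => ⟨trivial, trivial⟩

theorem formsSub_mul (hJ : ∀ i, ∀ a ∈ J, pr A.gr_internal i a ∈ J) (h : I * J ≤ K) :
    A.formsSub I * A.formsSub J ≤ A.formsSub K := by
  rw [mul_le]
  intro x hx y hy n
  constructor
  · change (x.1 * y.1).coeff n ∈ K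
    rw [Polynomial.coeff_mul]
    exact sum_mem fun c _ => h (mul_mem_mul (hx _).1 (hy _).1)
  · change (x.1 * y.2 + x.2 * parPoly A y.1).coeff n ∈ K
    rw [coeff_add, Polynomial.coeff_mul, Polynomial.coeff_mul]
    refine add_mem (sum_mem fun c _ => h (mul_mem_mul (hx _).1 (hy _).2))
      (sum_mem fun c _ => h (mul_mem_mul (hx _).2 ?_))
    rw [coeff_parPoly]
    exact weight_mem _ hJ _ (hy _).1

theorem mapL_formsSub {f : A →ₗ[Lam k] A'} {J : Submodule (Lam k) A'}
    (hf : ∀ a ∈ I, f a ∈ J) {x : A.forms} (hx : x ∈ A.formsSub I) :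
    mapL f x ∈ A'.formsSub J := fun n => by
  rw [fst_mapL, snd_mapL, coeff_mapPoly, coeff_mapPoly]
  exact ⟨hf _ (hx n).1, hf _ (hx n).2⟩

theorem formsSub_d (hI : ∀ i, ∀ a ∈ I, pr A.gr_internal i a ∈ I) (hd : ∀ a ∈ I, A.d a ∈ I)
    {x : A.forms} (hx : x ∈ A.formsSub I) : A.forms.d x ∈ A.formsSub I := by
  intro n
  constructor
  · change (dPoly A x.1).coeff n ∈ I
    rw [coeff_dPoly]
    exact hd _ (hx n).1
  · change (dPoly A x.2 + parPoly A (PolyForm.deriv A x.1)).coeff n ∈ I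
    rw [coeff_add, coeff_dPoly, coeff_parPoly, coeff_deriv, ← Nat.cast_succ, ← nsmul_eq_mul']
    exact add_mem (hd _ (hx n).2) (weight_mem _ hI _ (nsmul_mem (hx _).1 _))

theorem forms_pr (i : ℤ) (x : A.forms) : pr A.forms.gr_internal i x =
    (mapPoly (pr A.gr_internal i) x.1, mapPoly (pr A.gr_internal (i - 1)) x.2) := by
  refine graded_ind A.forms.gr_internal (p := fun x => pr A.forms.gr_internal i x =
    ((mapPoly (pr A.gr_internal i) x.1, mapPoly (pr A.gr_internal (i - 1)) x.2) : PolyForm A))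
    ?_ ?_ (fun j x hx => ?_) x
  · rw [map_zero]
    exact PolyForm.ext (map_zero (mapPoly _)).symm (map_zero (mapPoly _)).symm
  · intro x y hx hy
    rw [map_add, hx, hy]
    exact PolyForm.ext (map_add (mapPoly _) _ _).symm (map_add (mapPoly _) _ _).symm
  · by_cases hj : j = i
    · subst hj
      rw [pr_of_mem _ hx]
      exact forms_ext (fun n => by rw [coeff_mapPoly, pr_of_mem _ (hx n).1])
        fun n => by rw [coeff_mapPoly, pr_of_mem _ (hx n).2]
    · rw [pr_of_mem_ne _ hx hj]
      exact forms_ext (fun n => by rw [coeff_mapPoly, pr_of_mem_ne _ (hx n).1 hj]; rfl)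
        fun n => by rw [coeff_mapPoly, pr_of_mem_ne _ (hx n).2 (by omega)]; rfl

theorem formsSub_pr (hI : ∀ i, ∀ a ∈ I, pr A.gr_internal i a ∈ I) (i : ℤ) (x : A.forms)
    (hx : x ∈ A.formsSub I) : pr A.forms.gr_internal i x ∈ A.formsSub I := by
  intro n
  rw [forms_pr]
  change (mapPoly _ _).coeff n ∈ I ∧ (mapPoly _ _).coeff n ∈ I
  rw [coeff_mapPoly, coeff_mapPoly]
  exact ⟨hI _ _ (hx n).1, hI _ _ (hx n).2⟩

theorem ev_formsSub (s : ℤ) {x : A.forms} (hx : x ∈ A.formsSub I) : A.ev s x ∈ I := by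
  change (x.1 : A[X]).eval (s : A) ∈ _
  rw [Polynomial.eval_eq_sum, sum_def]
  refine sum_mem fun n _ => ?_
  rw [← Int.cast_pow, ← zsmul_eq_mul']
  exact zsmul_mem (hx n).1 _

theorem const_formsSub {a : A} (ha : a ∈ I) :
    A.constHom a ∈ A.formsSub I := fun n => by
  change (Polynomial.C a).coeff n ∈ I ∧ (0 : A[X]).coeff n ∈ I
  rw [coeff_C, Polynomial.coeff_zero]
  refine ⟨?_, zero_mem _⟩
  split
  · exact ha
  · exact zero_mem _

theorem sigma_formsSub (hI : ∀ i, ∀ a ∈ I, pr A.gr_internal i a ∈ I) (s : ℤ)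
    {x : A.forms} (hx : x ∈ A.formsSub I) : A.sigma s x ∈ A.formsSub I := by
  intro n
  refine ⟨?_, by rw [snd_sigma, Polynomial.coeff_zero]; exact zero_mem _⟩
  have h : ∀ m, (integ A x.2).coeff m ∈ I := fun m => by
    rcases m with _ | m
    · rw [coeff_integ_zero]; exact zero_mem _
    · rw [coeff_integ_succ]; exact Submodule.smul_mem _ _ (hx m).2
  rw [fst_sigma, coeff_parPoly, coeff_sub, coeff_C]
  refine weight_mem _ hI _ (sub_mem (h n) ?_)
  split
  · rw [Polynomial.eval_eq_sum, sum_def]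
    refine sum_mem fun n _ => ?_
    rw [← Int.cast_pow, ← zsmul_eq_mul']
    exact zsmul_mem (h n) _
  · exact zero_mem _

end FormsSub

variable (A) in
/-- The linear map `a ↦ a + (b - a) u` for a pair of scalars. -/
def affine (a b : ℤ) : A →ₗ[Lam k] A.forms :=
  inl A ∘ₗ (a • (monomial 0).restrictScalars (Lam k) +
    (b - a) • (monomial 1).restrictScalars (Lam k))

theorem affine_fst (a b : ℤ) (x : A) : (A.affine a b x).1 =
    a • monomial 0 x + (b - a) • monomial 1 x := rfl

theorem affine_snd (a b : ℤ) (x : A) : (A.affine a b x).2 = 0 := rfl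

theorem ev_affine (a b : ℤ) (s : ℤ) (x : A) :
    A.ev s (A.affine a b x) = (a + s * (b - a)) • x := by
  change (a • monomial 0 x + (b - a) • monomial 1 x : A[X]).eval
    (s : A) = _
  rw [Polynomial.eval_add, Polynomial.eval_smul, Polynomial.eval_smul, eval_monomial,
    eval_monomial, pow_zero, mul_one, pow_one, ← zsmul_eq_mul', smul_smul, ← add_smul, mul_comm]

theorem affine_gr (a b : ℤ) {i : ℤ} {x : A} (hx : x ∈ A.gr i) :
    A.affine a b x ∈ A.forms.gr i := by
  intro n
  refine ⟨?_, by rw [affine_snd, Polynomial.coeff_zero]; exact zero_mem _⟩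
  rw [affine_fst, coeff_add, coeff_smul, coeff_smul, coeff_monomial, coeff_monomial]
  refine add_mem (zsmul_mem ?_ _) (zsmul_mem ?_ _) <;> split <;> simp [hx]

theorem affine_formsSub (a b : ℤ) {I : Submodule (Lam k) A} {x : A} (hx : x ∈ I) :
    A.affine a b x ∈ A.formsSub I := by
  intro n
  refine ⟨?_, by rw [affine_snd, Polynomial.coeff_zero]; exact zero_mem _⟩
  rw [affine_fst, coeff_add, coeff_smul, coeff_smul, coeff_monomial, coeff_monomial]
  refine add_mem (zsmul_mem ?_ _) (zsmul_mem ?_ _) <;> split <;> simp [hx]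

theorem affine_one_one (x : A) : A.affine 1 1 x = A.constHom x := by
  apply PolyForm.ext
  · rw [affine_fst]; simp [const_apply]
  · rfl

end DGAlg

namespace Background

variable {k : Type u} [Field k] {B : Background.{u, v, w} k} {A A' : DGAlg k}

theorem diffP_diffP (f g : A →ₗ[Lam k] A) (x : B.P ⊗[Lam k] A) :
    B.diffP f (B.diffP g x) = B.push (f ∘ₗ g) x := by
  induction x with
  | zero => simp
  | add x y hx hy => simp only [map_add, hx, hy]
  | tmul p a =>
    refine graded_ind B.grP_internal (p := fun p => B.diffP f (B.diffP g (p ⊗ₜ a)) =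
      B.push (f ∘ₗ g) (p ⊗ₜ a)) (by simp)
      (fun x y hx hy => by rw [add_tmul]; simp only [map_add, hx, hy])
      (fun i p hp => ?_) p
    rw [diffP_tmul _ hp, map_zsmul, diffP_tmul _ hp, smul_smul, sgn_mul_self, one_smul]
    rfl

theorem bracket_m_diffP (f : A →ₗ[Lam k] A') (x : B.P ⊗[Lam k] A) :
    (B.bracket B.m).rTensor A' (B.diffP f x) =
      -B.diffP f ((B.bracket B.m).rTensor A x) := by
  induction x with
  | zero => simp
  | add x y hx hy => simp only [map_add, hx, hy, neg_add]
  | tmul p a =>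
    refine graded_ind B.grP_internal (p := fun p =>
      (B.bracket B.m).rTensor A' (B.diffP f (p ⊗ₜ a)) =
      -B.diffP f ((B.bracket B.m).rTensor A (p ⊗ₜ a))) (by simp)
      (fun x y hx hy => by rw [add_tmul]; simp only [map_add, hx, hy, neg_add])
      (fun i p hp => ?_) p
    rw [diffP_tmul _ hp, rTensor_tmul, diffP_tmul _ (B.bracket_mem B.m_mem hp),
      map_zsmul, rTensor_tmul, add_comm, sgn_succ, neg_smul, neg_neg]

theorem bracket_m_push (f : A →ₗ[Lam k] A') (x : B.P ⊗[Lam k] A) :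
    (B.bracket B.m).rTensor A' (B.push f x) =
      B.push f ((B.bracket B.m).rTensor A x) := by
  rw [← comp_apply, ← comp_apply, LinearMap.lTensor_comp_rTensor, LinearMap.rTensor_comp_lTensor]

theorem push_push {A'' : DGAlg k} (f : A →ₗ[Lam k] A') (g : A' →ₗ[Lam k] A'') (x : B.P ⊗[Lam k] A) :
    B.push g (B.push f x) = B.push (g ∘ₗ f) x := by
  rw [push, push, push, ← comp_apply, ← lTensor_comp]

theorem diffP_push {A'' : DGAlg k} (f : A →ₗ[Lam k] A')
    (g : A' →ₗ[Lam k] A'') (x : B.P ⊗[Lam k] A) :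
    B.diffP g (B.push f x) = B.diffP (g ∘ₗ f) x := by
  induction x with
  | zero => simp
  | add x y hx hy => simp only [map_add, hx, hy]
  | tmul p a => rfl

theorem push_diffP {A'' : DGAlg k} (f : A →ₗ[Lam k] A')
    (g : A' →ₗ[Lam k] A'') (x : B.P ⊗[Lam k] A) :
    B.push g (B.diffP f x) = B.diffP (g ∘ₗ f) x := by
  induction x with
  | zero => simp
  | add x y hx hy => simp only [map_add, hx, hy]
  | tmul p a => rfl

theorem totalD_push {f : A →ₗ[Lam k] A'} {d : A →ₗ[Lam k] A}
    {d' : A' →ₗ[Lam k] A'} (hf : ∀ a, f (d a) = d' (f a))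
    (x : B.P ⊗[Lam k] A) : B.totalD A' d' (B.push f x) = B.push f (B.totalD A d x) := by
  simp only [totalD, LinearMap.sub_apply, map_sub, bracket_m_push, diffP_push, push_diffP]
  congr 3
  ext a
  exact (hf a).symm

theorem totalD_diffP (d σ : A →ₗ[Lam k] A) (x : B.P ⊗[Lam k] A) :
    B.totalD A d (B.diffP σ x) = -B.diffP σ (B.totalD A d x) - B.push (d ∘ₗ σ + σ ∘ₗ d) x := by
  simp only [totalD, LinearMap.sub_apply, map_sub, bracket_m_diffP, diffP_diffP]
  simp only [push, LinearMap.lTensor_add, LinearMap.add_apply]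
  abel

theorem totalD_totalD [CharZero k] {d : A →ₗ[Lam k] A} (hd : ∀ a, d (d a) = 0)
    (x : B.P ⊗[Lam k] A) : B.totalD A d (B.totalD A d x) = 0 := by
  have h1 : (B.bracket B.m).rTensor A ((B.bracket B.m).rTensor A x) = 0 := by
    rw [← comp_apply, ← LinearMap.rTensor_comp, show B.bracket B.m ∘ₗ B.bracket B.m = 0
      from LinearMap.ext bracket_m_bracket_m, LinearMap.rTensor_zero, LinearMap.zero_apply]
  have h2 : d ∘ₗ d = 0 := LinearMap.ext hd
  simp only [totalD, LinearMap.sub_apply, map_sub, bracket_m_diffP, diffP_diffP, h1, h2]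
  simp [push]

theorem totalD_deg {J : Submodule (Lam k) A} {d : A →ₗ[Lam k] A}
    (hd : A.IsDer d) (hJ : ∀ a ∈ J, d a ∈ J) {n : ℤ} {x : B.P ⊗[Lam k] A}
    (hx : x ∈ B.deg A J n) : B.totalD A d x ∈ B.deg A J (n + 1) := by
  refine sub_mem ?_ (diffP_mem hd hJ hx)
  have h1 : B.deg A J n ≤ (B.deg A J (n + 1)).comap ((B.bracket B.m).rTensor A) :=
    deg_le fun i p a hp ha haJ => B.tmul_mem_deg (B.bracket_mem B.m_mem hp) ha haJ (by ring)
  exact h1 hx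

theorem push_ev_deg (s : ℤ) {K : Submodule (Lam k) A} {i : ℤ} {x : B.P ⊗[Lam k] A.forms}
    (hx : x ∈ B.deg A.forms (A.formsSub K) i) : B.push (A.ev (s : A)) x ∈ B.deg A K i :=
  push_deg_zero (A.evHom s).map_gr (fun _ ha => DGAlg.ev_formsSub s ha) hx

theorem push_affine_deg (a b : ℤ) {K : Submodule (Lam k) A} {i : ℤ} {x : B.P ⊗[Lam k] A}
    (hx : x ∈ B.deg A K i) : B.push (A.affine a b) x ∈ B.deg A.forms (A.formsSub K) i :=
  push_deg_zero (DGAlg.affine_gr a b) (fun _ hc => DGAlg.affine_formsSub a b hc) hx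

theorem ev_comp_affine (s a b : ℤ) : A.ev (s : A) ∘ₗ A.affine a b =
    ((a + s * (b - a) : ℤ) : Lam k) • LinearMap.id :=
  LinearMap.ext fun c => (DGAlg.ev_affine a b s c).trans (Int.cast_smul_eq_zsmul _ _ _).symm

theorem push_smul_id (z : ℤ) (x : B.P ⊗[Lam k] A) :
    B.push ((z : Lam k) • (LinearMap.id : A →ₗ[Lam k] A)) x = z • x := by
  rw [push, LinearMap.lTensor_smul, lTensor_id, LinearMap.smul_apply, id_apply,
    Int.cast_smul_eq_zsmul]

theorem push_ev_affine (s a b : ℤ) (x : B.P ⊗[Lam k] A) :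
    B.push (A.ev (s : A)) (B.push (A.affine a b) x) = (a + s * (b - a)) • x := by
  rw [push_push, ev_comp_affine, push_smul_id]

theorem push_ev_totalD (s : ℤ) (x : B.P ⊗[Lam k] A.forms) :
    B.push (A.ev (s : A)) (B.totalD A.forms A.forms.d x) =
      B.totalD A A.d (B.push (A.ev (s : A)) x) :=
  (totalD_push (fun a => (A.evHom s).map_d a) x).symm

theorem totalD_sigma [CharZero k] (s : ℤ) (x : B.P ⊗[Lam k] A.forms) :
    B.totalD A.forms A.forms.d (B.diffP (A.sigma s) x) =
      -B.diffP (A.sigma s) (B.totalD A.forms A.forms.d x) -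
        (x - B.push A.constHom.toAlgHom.toLinearMap (B.push (A.ev (s : A)) x)) := by
  have h : A.forms.d ∘ₗ A.sigma s + A.sigma s ∘ₗ A.forms.d =
      LinearMap.id - A.constHom.toAlgHom.toLinearMap ∘ₗ A.ev (s : A) :=
    LinearMap.ext fun a => DGAlg.d_sigma s a
  rw [totalD_diffP, h, push_push, push, push, lTensor_sub, lTensor_id]
  rfl

theorem sigma_deg {K : Submodule (Lam k) A} (hK : ∀ i, ∀ a ∈ K, pr A.gr_internal i a ∈ K) (s : ℤ)
    {i : ℤ} {x : B.P ⊗[Lam k] A.forms} (hx : x ∈ B.deg A.forms (A.formsSub K) i) :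
    B.diffP (A.sigma s) x ∈ B.deg A.forms (A.formsSub K) (i - 1) := by
  rw [sub_eq_add_neg]
  exact diffP_deg (fun _ _ ha _ => A.sigma_gr s ha) (fun _ ha => DGAlg.sigma_formsSub hK s ha) hx

end Background

open QBackground.DGAlg (evHom_apply par_of_mem formsSub_mul ev_formsSub affine_formsSub ev_affine formsSub_bot affine_gr const_formsSub formsSub_top formsSub_d formsSub_mono evHom_toLinearMap sigma_formsSub formsSub_pr mapL_formsSub forms_ext mapL_mapL)
open QBackground.DGAlg.PolyForm (mapL coeff_mapPoly mapPoly fst_mapL snd_mapL mapL_hom parPoly)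

section FreeModel

variable {k : Type u} [Field k] {r : ℕ}

variable (k) in
/-- The ideal generated by `ħ` and the elements `t j`. -/
def genIdeal {F : Type u} [Ring F] [Algebra (Lam k) F] {ι : Type*} (t : ι → F) :
    Submodule (Lam k) F :=
  ⊤ * Submodule.span (Lam k) (insert (algebraMap (Lam k) F (hbar k)) (Set.range t))

section Gen

variable {F : Type u} [Ring F] [Algebra (Lam k) F] {ι : Type*} {t : ι → F}

theorem hbar_mem_genIdeal : algebraMap (Lam k) F (hbar k) ∈ genIdeal k t := by
  rw [← one_mul (algebraMap _ _ _)]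
  exact mul_mem_mul trivial (subset_span (Set.mem_insert _ _))

theorem gen_mem_genIdeal (j : ι) : t j ∈ genIdeal k t := by
  rw [← one_mul (t j)]
  exact mul_mem_mul trivial
    (subset_span (Set.mem_insert_of_mem _ (Set.mem_range_self j)))

theorem top_mul_genIdeal : ⊤ * genIdeal k t ≤ genIdeal k t := by
  rw [genIdeal, ← mul_assoc]
  exact mul_le_mul' le_top le_rfl

theorem mul_mem_genIdeal (a : F) {x : F} (hx : x ∈ genIdeal k t) : a * x ∈ genIdeal k t :=
  top_mul_genIdeal (mul_mem_mul trivial hx)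

theorem genIdeal_le {X : Submodule (Lam k) F} (hX : ∀ a, ∀ x ∈ X, a * x ∈ X)
    (h1 : algebraMap (Lam k) F (hbar k) ∈ X) (h2 : ∀ j, t j ∈ X) : genIdeal k t ≤ X := by
  rw [genIdeal, mul_le]
  intro a _ x hx
  refine hX a x (span_le.2 ?_ hx)
  rintro _ (rfl | ⟨j, rfl⟩)
  · exact h1
  · exact h2 j

theorem monomial_ind (hadj : Algebra.adjoin (Lam k) (Set.range t) = ⊤) {p : F → Prop}
    (h0 : p 0) (hadd : ∀ x y, p x → p y → p (x + y)) (hsmul : ∀ (c : Lam k) x, p x → p (c • x))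
    (hmon : ∀ x ∈ Submonoid.closure (Set.range t), p x) (x : F) : p x := by
  have hx : x ∈ Submodule.span (Lam k) (Submonoid.closure (Set.range t) : Set F) := by
    rw [← Algebra.adjoin_eq_span, hadj]; trivial
  induction hx using span_induction with
  | mem x h => exact hmon x h
  | zero => exact h0
  | add x y _ _ hx hy => exact hadd x y hx hy
  | smul c x _ hx => exact hsmul c x hx

theorem genIdeal_mul_top (hadj : Algebra.adjoin (Lam k) (Set.range t) = ⊤)
    (hs : ∀ i j, ∃ c : ℤ, t i * t j = c • (t j * t i)) : genIdeal k t * ⊤ ≤ genIdeal k t := by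
  have key : ∀ j, ∀ x ∈ Submonoid.closure (Set.range t), ∃ c : ℤ, t j * x = c • (x * t j) := by
    intro j x hx
    induction hx using Submonoid.closure_induction with
    | mem x h => obtain ⟨i, rfl⟩ := h; exact hs j i
    | one => exact ⟨1, by simp⟩
    | mul x y _ _ hx hy =>
      obtain ⟨c, hc⟩ := hx
      obtain ⟨c', hc'⟩ := hy
      refine ⟨c * c', ?_⟩
      rw [← mul_assoc, hc, smul_mul_assoc, mul_assoc, hc', mul_smul_comm, smul_smul, mul_assoc]
  have h1 : ∀ g ∈ Submodule.span (Lam k) (insert (algebraMap (Lam k) F (hbar k)) (Set.range t)),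
      ∀ x, g * x ∈ genIdeal k t := by
    intro g hg x
    refine (span_le (p := (genIdeal k t).comap (LinearMap.mulRight (Lam k) x))).2 ?_ hg
    rintro _ (rfl | ⟨j, rfl⟩)
    · change algebraMap (Lam k) F (hbar k) * x ∈ genIdeal k t
      rw [Algebra.commutes]
      exact mul_mem_genIdeal x hbar_mem_genIdeal
    · change t j * x ∈ genIdeal k t
      refine monomial_ind hadj (p := fun x => t j * x ∈ genIdeal k t) (by simp)
        (fun x y hx hy => by rw [mul_add]; exact add_mem hx hy)
        (fun c x hx => by rw [mul_smul_comm]; exact Submodule.smul_mem _ c hx)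
        (fun x hx => ?_) x
      obtain ⟨c, hc⟩ := key j x hx
      rw [hc]
      exact zsmul_mem (mul_mem_genIdeal x (gen_mem_genIdeal j)) c
  rw [mul_le]
  intro y hy x _
  rw [genIdeal] at hy
  refine Submodule.mul_induction_on hy (fun a _ g hg => ?_) (fun a b ha hb => ?_)
  · rw [mul_assoc]
    exact mul_mem_genIdeal a (h1 g hg x)
  · rw [add_mul]; exact add_mem ha hb

end Gen

/-- The universal property of the quotient of the free graded commutative algebra on generators
`t j` of degree `deg j` by the power `n + 1` of the ideal generated by `ħ` and the `t j`. -/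
structure IsFreeModel (deg : Fin r → ℤ) (n : ℕ) {F : Type u} [Ring F] [Algebra (Lam k) F]
    (t : Fin r → F) : Prop where
  adjoin_eq_top : Algebra.adjoin (Lam k) (Set.range t) = ⊤
  sign : ∀ i j, t i * t j = sgn (deg i * deg j) • (t j * t i)
  pow_eq_bot : genIdeal k t ^ (n + 1) = ⊥
  exists_hom : ∀ (D : Type u) [Ring D] [Algebra (Lam k) D] (I : Submodule (Lam k) D) (a : Fin r → D),
    I * I ≤ I → algebraMap (Lam k) D (hbar k) ∈ I → I ^ (n + 1) = ⊥ → (∀ j, a j ∈ I) →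
    (∀ i j, a i * a j = sgn (deg i * deg j) • (a j * a i)) → ∃ T : F →ₐ[Lam k] D, ∀ j, T (t j) = a j

section CoefSub

variable {F : Type u} [Ring F] [Algebra (Lam k) F]

/-- The elements of the group algebra with coefficients in a submodule. -/
def coefSub (J : Submodule (Lam k) F) : Submodule (Lam k) (AddMonoidAlgebra F ℤ) where
  carrier := {f | ∀ i, f.coeff i ∈ J}
  add_mem' hf hg i := by rw [AddMonoidAlgebra.coeff_add]; exact add_mem (hf i) (hg i)
  zero_mem' i := by rw [AddMonoidAlgebra.coeff_zero]; exact zero_mem _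
  smul_mem' c f hf i := by
    rw [AddMonoidAlgebra.coeff_smul_apply]; exact Submodule.smul_mem _ c (hf i)

theorem coefSub_mul {I J K : Submodule (Lam k) F} (h : I * J ≤ K) :
    coefSub I * coefSub J ≤ coefSub K := by
  rw [mul_le]
  intro f hf g hg i
  rw [AddMonoidAlgebra.coeff_mul]
  refine sum_mem fun a _ => sum_mem fun b _ => ?_
  dsimp only
  split
  · exact h (mul_mem_mul (hf a) (hg b))
  · exact zero_mem _

theorem coefSub_bot : coefSub (⊥ : Submodule (Lam k) F) = ⊥ := by
  rw [eq_bot_iff]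
  intro f hf
  rw [mem_bot]
  ext i
  exact hf i

theorem coefSub_pow (I : Submodule (Lam k) F) (n : ℕ) : coefSub I ^ (n + 1) ≤ coefSub (I ^ (n + 1)) := by
  induction n with
  | zero => simp
  | succ n ih =>
    rw [pow_succ]
    exact (mul_le_mul' ih le_rfl).trans (coefSub_mul (pow_succ I (n + 1)).ge)

theorem single_mem_coefSub {J : Submodule (Lam k) F} {a : F} (ha : a ∈ J) (i : ℤ) :
    AddMonoidAlgebra.single i a ∈ coefSub J := by
  intro j
  rw [AddMonoidAlgebra.coeff_single, Finsupp.single_apply]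
  split
  · exact ha
  · exact zero_mem _

end CoefSub


section Grading

variable {F : Type u} [Ring F] [Algebra (Lam k) F] {deg : Fin r → ℤ} {n : ℕ} {t : Fin r → F}

theorem IsFreeModel.two_sided (h : IsFreeModel (k := k) deg n t) :
    genIdeal k t * ⊤ ≤ genIdeal k t :=
  genIdeal_mul_top h.adjoin_eq_top fun i j => ⟨_, h.sign i j⟩

theorem IsFreeModel.genIdeal_mul_self (h : IsFreeModel (k := k) deg n t) :
    genIdeal k t * genIdeal k t ≤ genIdeal k t :=
  (mul_le_mul' le_rfl le_top).trans h.two_sided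

theorem IsFreeModel.exists_coaction (h : IsFreeModel (k := k) deg n t) :
    ∃ ρ : F →ₐ[Lam k] AddMonoidAlgebra F ℤ, ∀ j, ρ (t j) = AddMonoidAlgebra.single (deg j) (t j) := by
  refine h.exists_hom _ (coefSub (genIdeal k t)) _ (coefSub_mul h.genIdeal_mul_self)
    (single_mem_coefSub hbar_mem_genIdeal 0) ?_ (fun j => single_mem_coefSub (gen_mem_genIdeal j) _)
    (fun i j => ?_)
  · rw [eq_bot_iff, ← coefSub_bot, ← h.pow_eq_bot]
    exact coefSub_pow _ n
  · rw [AddMonoidAlgebra.single_mul_single, AddMonoidAlgebra.single_mul_single, h.sign i j,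
      add_comm (deg i)]
    ext l
    simp only [AddMonoidAlgebra.coeff_single, AddMonoidAlgebra.coeff_smul_apply,
      Finsupp.single_apply]
    split <;> simp

/-- The grading of a free model. -/
def IsFreeModel.coaction (h : IsFreeModel (k := k) deg n t) : F →ₐ[Lam k] AddMonoidAlgebra F ℤ :=
  h.exists_coaction.choose

theorem IsFreeModel.coaction_gen (h : IsFreeModel (k := k) deg n t) (j : Fin r) :
    h.coaction (t j) = AddMonoidAlgebra.single (deg j) (t j) := h.exists_coaction.choose_spec j

/-- The elements of degree `i` of a free model. -/
def IsFreeModel.gr (h : IsFreeModel (k := k) deg n t) (i : ℤ) : Submodule (Lam k) F where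
  carrier := {x | h.coaction x = AddMonoidAlgebra.single i x}
  add_mem' hx hy := by
    change _ = _ at hx hy
    change _ = _
    rw [map_add, hx, hy, AddMonoidAlgebra.single_add]
  zero_mem' := by change _ = _; rw [map_zero, AddMonoidAlgebra.single_zero]
  smul_mem' c x hx := by
    change _ = _ at hx
    change _ = _
    rw [map_smul, hx, AddMonoidAlgebra.smul_single]

theorem IsFreeModel.mem_gr (h : IsFreeModel (k := k) deg n t) {i : ℤ} {x : F} :
    x ∈ h.gr i ↔ h.coaction x = AddMonoidAlgebra.single i x := Iff.rfl

theorem IsFreeModel.one_mem (h : IsFreeModel (k := k) deg n t) : (1 : F) ∈ h.gr 0 := by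
  rw [h.mem_gr, map_one]; rfl

theorem IsFreeModel.mul_mem (h : IsFreeModel (k := k) deg n t) {i j : ℤ} {x y : F}
    (hx : x ∈ h.gr i) (hy : y ∈ h.gr j) : x * y ∈ h.gr (i + j) := by
  rw [h.mem_gr] at *
  rw [map_mul, hx, hy, AddMonoidAlgebra.single_mul_single]

theorem IsFreeModel.gen_mem (h : IsFreeModel (k := k) deg n t) (j : Fin r) : t j ∈ h.gr (deg j) :=
  h.coaction_gen j

theorem IsFreeModel.exists_mem_gr (h : IsFreeModel (k := k) deg n t) {x : F}
    (hx : x ∈ Submonoid.closure (Set.range t)) : ∃ i, x ∈ h.gr i := by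
  induction hx using Submonoid.closure_induction with
  | mem x hx => obtain ⟨j, rfl⟩ := hx; exact ⟨_, h.gen_mem j⟩
  | one => exact ⟨0, h.one_mem⟩
  | mul x y _ _ hx hy =>
    obtain ⟨i, hi⟩ := hx
    obtain ⟨j, hj⟩ := hy
    exact ⟨_, h.mul_mem hi hj⟩

theorem IsFreeModel.gr_internal (h : IsFreeModel (k := k) deg n t) : DirectSum.IsInternal h.gr := by
  refine DirectSum.isInternal_submodule_of_iSupIndep_of_iSup_eq_top ?_ ?_
  · rw [iSupIndep_def]
    intro i
    rw [Submodule.disjoint_def]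
    intro x hx hx'
    have h1 : (h.coaction x).coeff i = 0 := by
      refine Submodule.iSup_induction _ (motive := fun x => (h.coaction x).coeff i = 0) hx' ?_
        (by simp) ?_
      · intro j y hy
        by_cases hj : j = i
        · subst hj; simp_all
        · simp only [hj, ne_eq, not_false_eq_true, iSup_pos] at hy
          rw [h.mem_gr.1 hy, AddMonoidAlgebra.coeff_single, Finsupp.single_apply, if_neg hj]
      · intro y z hy hz
        rw [map_add, AddMonoidAlgebra.coeff_add]
        simp [hy, hz]
    rwa [h.mem_gr.1 hx, AddMonoidAlgebra.coeff_single, Finsupp.single_eq_same] at h1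
  · rw [eq_top_iff]
    rintro x -
    refine monomial_ind h.adjoin_eq_top (p := fun x => x ∈ iSup h.gr) (zero_mem _)
      (fun x y hx hy => add_mem hx hy) (fun c x hx => Submodule.smul_mem _ c hx)
      (fun x hx => ?_) x
    obtain ⟨i, hi⟩ := h.exists_mem_gr hx
    exact Submodule.mem_iSup_of_mem i hi

theorem IsFreeModel.gcomm (h : IsFreeModel (k := k) deg n t) {i j : ℤ} {x y : F}
    (hx : x ∈ h.gr i) (hy : y ∈ h.gr j) : x * y = sgn (i * j) • (y * x) := by
  have hmon : ∀ x ∈ Submonoid.closure (Set.range t), ∃ e, x ∈ h.gr e ∧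
      ∀ l, x * t l = sgn (e * deg l) • (t l * x) := by
    intro x hx
    induction hx using Submonoid.closure_induction with
    | mem x hx => obtain ⟨j, rfl⟩ := hx; exact ⟨_, h.gen_mem j, fun l => h.sign j l⟩
    | one => exact ⟨0, h.one_mem, fun l => by simp [sgn_zero]⟩
    | mul x y _ _ hx hy =>
      obtain ⟨e, he, h1⟩ := hx
      obtain ⟨e', he', h2⟩ := hy
      refine ⟨_, h.mul_mem he he', fun l => ?_⟩
      rw [mul_assoc, h2, mul_smul_comm, ← mul_assoc, h1, smul_mul_assoc, smul_smul, mul_assoc,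
        add_mul, sgn_add, mul_comm]
  have hmon2 : ∀ x ∈ Submonoid.closure (Set.range t), ∃ e, x ∈ h.gr e ∧
      ∀ y ∈ Submonoid.closure (Set.range t), ∃ e', y ∈ h.gr e' ∧
        x * y = sgn (e * e') • (y * x) := by
    intro x hx
    obtain ⟨e, he, h1⟩ := hmon x hx
    refine ⟨e, he, fun y hy => ?_⟩
    induction hy using Submonoid.closure_induction with
    | mem y hy => obtain ⟨j, rfl⟩ := hy; exact ⟨_, h.gen_mem j, h1 j⟩
    | one => exact ⟨0, h.one_mem, by simp [sgn_zero]⟩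
    | mul y z _ _ hy hz =>
      obtain ⟨a, ha, h2⟩ := hy
      obtain ⟨b, hb, h3⟩ := hz
      refine ⟨_, h.mul_mem ha hb, ?_⟩
      rw [← mul_assoc, h2, smul_mul_assoc, mul_assoc, h3, mul_smul_comm, smul_smul, mul_assoc,
        mul_add, sgn_add]
  have key : ∀ x y, pr h.gr_internal i x * pr h.gr_internal j y =
      sgn (i * j) • (pr h.gr_internal j y * pr h.gr_internal i x) := by
    intro x y
    refine monomial_ind h.adjoin_eq_top (p := fun x => pr h.gr_internal i x * pr h.gr_internal j y =
      sgn (i * j) • (pr h.gr_internal j y * pr h.gr_internal i x)) (by simp)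
      (fun x x' hx hx' => by simp only [map_add, add_mul, mul_add, hx, hx', smul_add])
      (fun c x hx => by
        simp only [map_smul, smul_mul_assoc, mul_smul_comm, hx]
        rw [smul_comm]) (fun x hx => ?_) x
    refine monomial_ind h.adjoin_eq_top (p := fun y => pr h.gr_internal i x * pr h.gr_internal j y =
      sgn (i * j) • (pr h.gr_internal j y * pr h.gr_internal i x)) (by simp)
      (fun x x' hx hx' => by simp only [map_add, add_mul, mul_add, hx, hx', smul_add])
      (fun c x hx => by
        simp only [map_smul, smul_mul_assoc, mul_smul_comm, hx]
        rw [smul_comm]) (fun y hy => ?_) y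
    obtain ⟨e, he, h1⟩ := hmon2 x hx
    obtain ⟨e', he', h2⟩ := h1 y hy
    by_cases hi : e = i
    · by_cases hj : e' = j
      · subst hi hj
        rw [pr_of_mem _ he, pr_of_mem _ he', h2]
      · rw [pr_of_mem_ne _ he' hj]; simp
    · rw [pr_of_mem_ne _ he hi]; simp
  have := key x y
  rwa [pr_of_mem _ hx, pr_of_mem _ hy] at this

/-- A free model as a differential graded algebra with a given differential. -/
def IsFreeModel.toDGAlg (h : IsFreeModel (k := k) deg n t) (d : F →ₗ[Lam k] F)
    (d_mem : ∀ {i : ℤ} {a : F}, a ∈ h.gr i → d a ∈ h.gr (i + 1))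
    (leibniz : ∀ {i : ℤ} {a : F}, a ∈ h.gr i → ∀ b, d (a * b) = d a * b + sgn i • (a * d b))
    (d_d : ∀ a, d (d a) = 0) : DGAlg k where
  carrier := F
  gr := h.gr
  gr_internal := h.gr_internal
  one_mem := h.one_mem
  mul_mem := h.mul_mem
  gcomm := h.gcomm
  d := d
  d_mem := d_mem
  leibniz := leibniz
  d_d := d_d

end Grading

end FreeModel

section Homogeneous

variable {k : Type u} [Field k] {A : DGAlg k}

theorem mul_pr_mem {I J : Submodule (Lam k) A}
    (hI : ∀ i, ∀ a ∈ I, pr A.gr_internal i a ∈ I) (hJ : ∀ i, ∀ a ∈ J, pr A.gr_internal i a ∈ J)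
    (i : ℤ) (a : A) (ha : a ∈ I * J) : pr A.gr_internal i a ∈ I * J := by
  refine Submodule.mul_induction_on ha (fun x hx y hy => ?_)
    (fun x y hx hy => by rw [map_add]; exact add_mem hx hy)
  refine homogeneous_ind A.gr_internal hI (p := fun x => pr A.gr_internal i (x * y) ∈ I * J)
    (by simp) (fun x x' hx hx' => by rw [add_mul, map_add]; exact add_mem hx hx')
    (fun p x hp hx => ?_) hx
  refine homogeneous_ind A.gr_internal hJ (p := fun y => pr A.gr_internal i (x * y) ∈ I * J)
    (by simp) (fun x x' hx hx' => by rw [mul_add, map_add]; exact add_mem hx hx')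
    (fun q y hq hy => ?_) hy
  by_cases hpq : p + q = i
  · rw [pr_of_mem _ (hpq ▸ A.mul_mem hp hq)]
    exact mul_mem_mul hx hy
  · rw [pr_of_mem_ne _ (A.mul_mem hp hq) hpq]
    exact zero_mem _

theorem pow_pr_mem {I : Submodule (Lam k) A} (hI : ∀ i, ∀ a ∈ I, pr A.gr_internal i a ∈ I) (n : ℕ) :
    ∀ i, ∀ a ∈ I ^ (n + 1), pr A.gr_internal i a ∈ I ^ (n + 1) := by
  induction n with
  | zero => simpa using hI
  | succ n ih =>
    rw [pow_succ]
    exact mul_pr_mem ih hI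

theorem span_pr_mem {s : Set A} (hs : ∀ a ∈ s, ∃ i, a ∈ A.gr i) (i : ℤ) (a : A)
    (ha : a ∈ Submodule.span (Lam k) s) : pr A.gr_internal i a ∈ Submodule.span (Lam k) s := by
  refine span_le (p := (Submodule.span (Lam k) s).comap (pr A.gr_internal i)) |>.2 ?_ ha
  intro b hb
  obtain ⟨j, hj⟩ := hs b hb
  change pr A.gr_internal i b ∈ Submodule.span (Lam k) s
  by_cases h : j = i
  · rw [pr_of_mem _ (h ▸ hj)]; exact subset_span hb
  · rw [pr_of_mem_ne _ hj h]; exact zero_mem _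

theorem algebraMap_mem (c : Lam k) : algebraMap (Lam k) A c ∈ A.gr 0 := by
  rw [Algebra.algebraMap_eq_smul_one]; exact Submodule.smul_mem _ c A.one_mem

theorem mul_d_mem {I J K : Submodule (Lam k) A} {d : A →ₗ[Lam k] A}
    (hd : A.IsDer d) (hI : ∀ i, ∀ a ∈ I, pr A.gr_internal i a ∈ I)
    (hdI : ∀ a ∈ I, ∀ b ∈ J, d a * b ∈ K) (hdJ : ∀ a ∈ I, ∀ b ∈ J, a * d b ∈ K)
    (a : A) (ha : a ∈ I * J) : d a ∈ K := by
  refine Submodule.mul_induction_on ha (fun x hx y hy => ?_)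
    (fun x y hx hy => by rw [map_add]; exact add_mem hx hy)
  rw [hd.leibniz]
  exact add_mem (hdI x hx y hy) (hdJ _ (weight_mem _ hI _ hx) y hy)

end Homogeneous

section Free

variable {k : Type u} [Field k] {r : ℕ}

/-- A differential graded algebra which is a free model as a graded algebra. -/
structure IsFree (deg : Fin r → ℤ) (n : ℕ) (F : DGAlg k) (t : Fin r → F) : Prop where
  model : IsFreeModel (k := k) deg n t
  mem : ∀ j, t j ∈ F.gr (deg j)

namespace IsFree

variable {deg : Fin r → ℤ} {n : ℕ} {F D : DGAlg k} {t : Fin r → F}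

theorem hom_pr (hF : IsFree deg n F t) (T : F →ₐ[Lam k] D)
    (hT : ∀ j, T (t j) ∈ D.gr (deg j)) (i : ℤ) (x : F) :
    T (pr F.gr_internal i x) = pr D.gr_internal i (T x) := by
  refine monomial_ind hF.model.adjoin_eq_top (p := fun x => T (pr F.gr_internal i x) =
    pr D.gr_internal i (T x)) (by simp) (fun x y hx hy => by simp [hx, hy])
    (fun c x hx => by simp [hx]) (fun x hx => ?_) x
  obtain ⟨e, h1, h2⟩ : ∃ e, x ∈ F.gr e ∧ T x ∈ D.gr e := by
    induction hx using Submonoid.closure_induction with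
    | mem x hx => obtain ⟨j, rfl⟩ := hx; exact ⟨_, hF.mem j, hT j⟩
    | one => exact ⟨0, F.one_mem, by rw [map_one]; exact D.one_mem⟩
    | mul x y _ _ hx hy =>
      obtain ⟨i, hi, hi'⟩ := hx
      obtain ⟨j, hj, hj'⟩ := hy
      exact ⟨_, F.mul_mem hi hj, by rw [map_mul]; exact D.mul_mem hi' hj'⟩
  by_cases he : e = i
  · subst he; rw [pr_of_mem _ h1, pr_of_mem _ h2]
  · rw [pr_of_mem_ne _ h1 he, pr_of_mem_ne _ h2 he, map_zero]

theorem hom_gr (hF : IsFree deg n F t) (T : F →ₐ[Lam k] D)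
    (hT : ∀ j, T (t j) ∈ D.gr (deg j)) {i : ℤ} {x : F} (hx : x ∈ F.gr i) :
    T x ∈ D.gr i := by
  rw [← pr_of_mem F.gr_internal hx, hF.hom_pr T hT]
  exact pr_mem _ _ _

theorem hom_par (hF : IsFree deg n F t) (T : F →ₐ[Lam k] D)
    (hT : ∀ j, T (t j) ∈ D.gr (deg j)) (x : F) : T (F.par x) = D.par (T x) := by
  refine graded_ind F.gr_internal (p := fun x => T (F.par x) = D.par (T x)) (by simp)
    (fun x y hx hy => by simp [hx, hy]) (fun i x hx => ?_) x
  rw [par_of_mem hx, par_of_mem (hF.hom_gr T hT hx), map_zsmul]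

theorem genIdeal_pr (hF : IsFree deg n F t) (i : ℤ) (x : F) (hx : x ∈ genIdeal k t) :
    pr F.gr_internal i x ∈ genIdeal k t := by
  refine mul_pr_mem (I := ⊤) (fun _ _ _ => Submodule.mem_top) (fun i x hx => span_pr_mem (fun a ha => ?_) i x hx) i x hx
  obtain rfl | ⟨j, rfl⟩ := ha
  · exact ⟨0, algebraMap_mem _⟩
  · exact ⟨_, hF.mem j⟩

theorem hom_mem_add (hF : IsFree deg n F t) {T : F →ₐ[Lam k] D}
    {I : Submodule (Lam k) D} (hI : I * I ≤ I) (hT : ∀ j, T (t j) ∈ I) (x : F) :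
    ∃ c : Lam k, T x - algebraMap (Lam k) D c ∈ I := by
  refine monomial_ind hF.model.adjoin_eq_top
    (p := fun x => ∃ c : Lam k, T x - algebraMap (Lam k) D c ∈ I) ⟨0, by simp⟩
    ?_ ?_ (fun x hx => ?_) x
  · rintro x y ⟨c, hc⟩ ⟨c', hc'⟩
    refine ⟨c + c', ?_⟩
    rw [map_add, map_add, add_sub_add_comm]
    exact add_mem hc hc'
  · rintro c x ⟨c', hc'⟩
    refine ⟨c * c', ?_⟩
    rw [map_smul, map_mul, ← Algebra.smul_def, ← smul_sub]
    exact Submodule.smul_mem _ c hc'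
  · have key : x = 1 ∨ T x ∈ I := by
      induction hx using Submonoid.closure_induction with
      | mem x hx => obtain ⟨j, rfl⟩ := hx; exact Or.inr (hT j)
      | one => exact Or.inl rfl
      | mul x y _ _ hx hy =>
        obtain rfl | hx := hx
        · rwa [one_mul]
        · obtain rfl | hy := hy
          · rw [mul_one]; exact Or.inr hx
          · rw [map_mul]; exact Or.inr (hI (mul_mem_mul hx hy))
    obtain rfl | hx := key
    · exact ⟨1, by simp⟩
    · exact ⟨0, by simpa using hx⟩

theorem mul_hom_mem (hF : IsFree deg n F t) {T : F →ₐ[Lam k] D}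
    {I J : Submodule (Lam k) D} (hI : I * I ≤ I) (hT : ∀ j, T (t j) ∈ I) (hJ : J * I ≤ J)
    {b : D} (hb : b ∈ J) (x : F) : b * T x ∈ J := by
  obtain ⟨c, hc⟩ := hF.hom_mem_add hI hT x
  rw [← sub_add_cancel (T x) (algebraMap _ _ c), mul_add, ← Algebra.commutes, ← Algebra.smul_def]
  exact add_mem (hJ (mul_mem_mul hb hc)) (Submodule.smul_mem _ c hb)

theorem hom_mul_mem (hF : IsFree deg n F t) {T : F →ₐ[Lam k] D}
    {I J : Submodule (Lam k) D} (hI : I * I ≤ I) (hT : ∀ j, T (t j) ∈ I) (hJ : I * J ≤ J)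
    {b : D} (hb : b ∈ J) (x : F) : T x * b ∈ J := by
  obtain ⟨c, hc⟩ := hF.hom_mem_add hI hT x
  rw [← sub_add_cancel (T x) (algebraMap _ _ c), add_mul, ← Algebra.smul_def]
  exact add_mem (hJ (mul_mem_mul hc hb)) (Submodule.smul_mem _ c hb)

theorem hom_mem (hF : IsFree deg n F t) {T : F →ₐ[Lam k] D}
    {I : Submodule (Lam k) D} (hI : I * I ≤ I)
    (hħ : algebraMap (Lam k) D (hbar k) ∈ I) (hT : ∀ j, T (t j) ∈ I) :
    genIdeal k t ≤ I.comap T.toLinearMap := by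
  refine genIdeal_le (fun a x hx => ?_) ?_ hT
  · change T (a * x) ∈ I
    rw [map_mul]
    exact hF.hom_mul_mem hI hT hI hx a
  · change T (algebraMap _ _ _) ∈ I
    rwa [T.commutes]

theorem hom_sub_mem (hF : IsFree deg n F t) {T T' : F →ₐ[Lam k] D}
    {I J : Submodule (Lam k) D} (hI : I * I ≤ I) (hT : ∀ j, T (t j) ∈ I)
    (hT' : ∀ j, T' (t j) ∈ I) (hIJ : I * J ≤ J) (hJI : J * I ≤ J)
    (h : ∀ j, T' (t j) - T (t j) ∈ J) (x : F) : T' x - T x ∈ J := by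
  refine monomial_ind hF.model.adjoin_eq_top (p := fun x => T' x - T x ∈ J) (by simp)
    (fun x y hx hy => by rw [map_add, map_add, add_sub_add_comm]; exact add_mem hx hy)
    (fun c x hx => by rw [map_smul, map_smul, ← smul_sub]; exact Submodule.smul_mem _ c hx)
    (fun x hx => ?_) x
  induction hx using Submonoid.closure_induction with
  | mem x hx => obtain ⟨j, rfl⟩ := hx; exact h j
  | one => simp
  | mul x y _ _ hx hy =>
    have : T' (x * y) - T (x * y) = (T' x - T x) * T' y + T x * (T' y - T y) := by
      rw [map_mul, map_mul]; noncomm_ring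
    rw [this]
    exact add_mem (hF.mul_hom_mem hI hT' hJI hx y) (hF.hom_mul_mem hI hT hIJ hy x)

theorem hom_sub_mem_sq (hF : IsFree deg n F t) {T T' : F →ₐ[Lam k] D}
    {I J J' : Submodule (Lam k) D} (hI : I * I ≤ I)
    (hħ : algebraMap (Lam k) D (hbar k) ∈ I) (hT : ∀ j, T (t j) ∈ I)
    (hT' : ∀ j, T' (t j) ∈ I) (hIJ : I * J ≤ J') (hJI : J * I ≤ J') (hJ' : J' ≤ J)
    (h : ∀ j, T' (t j) - T (t j) ∈ J) {x : F} (hx : x ∈ genIdeal k t ^ 2) :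
    T' x - T x ∈ J' := by
  rw [pow_two] at hx
  have h1 := hF.hom_sub_mem hI hT hT' (hIJ.trans hJ') (hJI.trans hJ') h
  refine Submodule.mul_induction_on hx (fun x hx y hy => ?_) (fun x y hx hy => by
    rw [map_add, map_add, add_sub_add_comm]; exact add_mem hx hy)
  have : T' (x * y) - T (x * y) = (T' x - T x) * T' y + T x * (T' y - T y) := by
    rw [map_mul, map_mul]; noncomm_ring
  rw [this]
  exact add_mem (hJI (mul_mem_mul (h1 x) (hF.hom_mem hI hħ hT' hy)))
    (hIJ (mul_mem_mul (hF.hom_mem hI hħ hT hx) (h1 y)))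

section Defect

variable {d : F →ₗ[Lam k] F} {d' : D →ₗ[Lam k] D}

theorem defect_mul (hF : IsFree deg n F t) (hd : F.IsDer d) (hd' : D.IsDer d')
    {T : F →ₐ[Lam k] D} (hT : ∀ j, T (t j) ∈ D.gr (deg j)) (x y : F) :
    d' (T (x * y)) - T (d (x * y)) = (d' (T x) - T (d x)) * T y +
      T (F.par x) * (d' (T y) - T (d y)) := by
  rw [map_mul, hd'.leibniz, hd.leibniz, map_add, map_mul, map_mul, hF.hom_par T hT]
  noncomm_ring

theorem defect_mem (hF : IsFree deg n F t) (hd : F.IsDer d) (hd' : D.IsDer d')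
    {T : F →ₐ[Lam k] D} (hT : ∀ j, T (t j) ∈ D.gr (deg j))
    {I J : Submodule (Lam k) D} (hI : I * I ≤ I) (hTI : ∀ j, T (t j) ∈ I)
    (hIJ : I * J ≤ J) (hJI : J * I ≤ J) (h : ∀ j, d' (T (t j)) - T (d (t j)) ∈ J)
    (x : F) : d' (T x) - T (d x) ∈ J := by
  refine monomial_ind hF.model.adjoin_eq_top (p := fun x => d' (T x) - T (d x) ∈ J) (by simp)
    (fun x y hx hy => by
      simp only [map_add, add_sub_add_comm]; exact add_mem hx hy)
    (fun c x hx => by simp only [map_smul, ← smul_sub]; exact Submodule.smul_mem _ c hx)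
    (fun x hx => ?_) x
  induction hx using Submonoid.closure_induction with
  | mem x hx => obtain ⟨j, rfl⟩ := hx; exact h j
  | one => simp [hd.map_one, hd'.map_one]
  | mul x y _ _ hx hy =>
    rw [hF.defect_mul hd hd' hT]
    exact add_mem (hF.mul_hom_mem hI hTI hJI hx y) (hF.hom_mul_mem hI hTI hIJ hy _)

theorem defect_mem_sq (hF : IsFree deg n F t) (hd : F.IsDer d) (hd' : D.IsDer d')
    {T : F →ₐ[Lam k] D} (hT : ∀ j, T (t j) ∈ D.gr (deg j))
    {I J J' : Submodule (Lam k) D} (hI : I * I ≤ I)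
    (hħ : algebraMap (Lam k) D (hbar k) ∈ I) (hTI : ∀ j, T (t j) ∈ I)
    (hIJ : I * J ≤ J') (hJI : J * I ≤ J') (hJ' : J' ≤ J)
    (h : ∀ j, d' (T (t j)) - T (d (t j)) ∈ J) {x : F} (hx : x ∈ genIdeal k t ^ 2) :
    d' (T x) - T (d x) ∈ J' := by
  rw [pow_two] at hx
  have h1 := hF.defect_mem hd hd' hT hI hTI (hIJ.trans hJ') (hJI.trans hJ') h
  refine Submodule.mul_induction_on hx (fun x hx y hy => ?_) (fun x y hx hy => by
    simp only [map_add, add_sub_add_comm]; exact add_mem hx hy)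
  rw [hF.defect_mul hd hd' hT]
  exact add_mem (hJI (mul_mem_mul (h1 x) (hF.hom_mem hI hħ hTI hy)))
    (hIJ (mul_mem_mul (hF.hom_mem hI hħ hTI
      (weight_mem _ hF.genIdeal_pr _ hx)) (h1 y)))

end Defect

theorem exists_algHom (hF : IsFree deg n F t) {I : Submodule (Lam k) D} (hI : I * I ≤ I)
    (hħ : algebraMap (Lam k) D (hbar k) ∈ I) (hn : I ^ (n + 1) = ⊥) (a : Fin r → D)
    (ha : ∀ j, a j ∈ I) (hadeg : ∀ j, a j ∈ D.gr (deg j)) :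
    ∃ T : F →ₐ[Lam k] D, ∀ j, T (t j) = a j :=
  hF.model.exists_hom _ I a hI hħ hn ha fun i j => D.gcomm (hadeg i) (hadeg j)

theorem algHom_ext (hF : IsFree deg n F t) {X : Type*} [Ring X] [Algebra (Lam k) X]
    {T T' : F →ₐ[Lam k] X} (h : ∀ j, T (t j) = T' (t j)) : T = T' :=
  AlgHom.ext_of_adjoin_eq_top hF.model.adjoin_eq_top (by rintro _ ⟨j, rfl⟩; exact h j)

theorem formsSub_pow {A : DGAlg k} {I : Submodule (Lam k) A}
    (hI : ∀ i, ∀ a ∈ I, pr A.gr_internal i a ∈ I) (n : ℕ) :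
    A.formsSub I ^ (n + 1) ≤ A.formsSub (I ^ (n + 1)) := by
  induction n with
  | zero => simp
  | succ n ih =>
    rw [pow_succ]
    exact (mul_le_mul' ih le_rfl).trans (formsSub_mul hI (pow_succ I (n + 1)).ge)

theorem forms_algebraMap {A : DGAlg k} (c : Lam k) :
    algebraMap (Lam k) A.forms c = A.constHom (algebraMap (Lam k) A c) :=
  (A.constHom.toAlgHom.commutes c).symm

theorem exists_der (hF : IsFree deg n F t) (w : Fin r → F)
    (hw : ∀ j, w j ∈ F.gr (deg j + 1)) (hwI : ∀ j, w j ∈ genIdeal k t) :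
    ∃ d : F →ₗ[Lam k] F, F.IsDer d ∧ ∀ j, d (t j) = w j := by
  have hmul := formsSub_mul hF.genIdeal_pr hF.model.genIdeal_mul_self
  let a : Fin r → F.forms := fun j =>
    DGAlg.PolyForm.mono 0 (t j) (sgn (deg j + 1) • w j)
  obtain ⟨T, hT⟩ := hF.model.exists_hom F.forms (F.formsSub (genIdeal k t)) a hmul
    (by
      rw [forms_algebraMap]
      exact const_formsSub hbar_mem_genIdeal)
    (by
      rw [eq_bot_iff, ← formsSub_bot, ← hF.model.pow_eq_bot]
      exact formsSub_pow hF.genIdeal_pr n)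
    (fun j m => by
      change (monomial 0 _).coeff m ∈ _ ∧ (monomial 0 _).coeff m ∈ _
      rw [coeff_monomial, coeff_monomial]
      split
      · exact ⟨gen_mem_genIdeal j, zsmul_mem (hwI j) _⟩
      · exact ⟨zero_mem _, zero_mem _⟩)
    (fun i j => by
      have hpar : ∀ j, parPoly F (monomial 0 (t j)) =
          monomial 0 (sgn (deg j) • t j) := fun j => by
        ext m
        rw [DGAlg.PolyForm.coeff_parPoly, coeff_monomial, coeff_monomial]
        split
        · exact par_of_mem (hF.mem j)
        · simp
      have h1 := F.gcomm (hF.mem i) (hw j)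
      have h2 := F.gcomm (hw i) (hF.mem j)
      apply DGAlg.PolyForm.ext
      · change monomial 0 (t i) * monomial 0 (t j) =
          sgn (deg i * deg j) • (monomial 0 (t j) * monomial 0 (t i))
        rw [Polynomial.monomial_mul_monomial, Polynomial.monomial_mul_monomial, hF.model.sign i j,
          map_zsmul]
      · change monomial 0 (t i) * monomial 0 (sgn (deg j + 1) • w j) +
          monomial 0 (sgn (deg i + 1) • w i) *
            parPoly F (monomial 0 (t j)) =
          sgn (deg i * deg j) • (monomial 0 (t j) *
            monomial 0 (sgn (deg i + 1) • w i) +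
          monomial 0 (sgn (deg j + 1) • w j) *
            parPoly F (monomial 0 (t i)))
        rw [hpar, hpar]
        simp only [Polynomial.monomial_mul_monomial, mul_smul_comm, smul_mul_assoc, h1, h2,
          ← map_add, ← map_zsmul, smul_add, smul_smul, ← sgn_add]
        congr 1
        rw [add_comm]
        congr 2
        · exact sgn_eq_of_even ⟨deg j, by ring⟩
        · congr 1
          ring)
  let T1 : F →ₐ[Lam k] F := (F.evHom 0).toAlgHom.comp T
  have hT1 : T1 = AlgHom.id _ _ := hF.algHom_ext fun j => by
    change F.ev _ (T (t j)) = t j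
    rw [hT]
    change (monomial 0 (t j)).eval _ = t j
    simp
  have hfst : ∀ x, (T x).1.coeff 0 = x := fun x => by
    have h : F.ev ((0 : ℤ) : F) (T x) = x := DFunLike.congr_fun hT1 x
    rw [Int.cast_zero] at h
    rwa [Polynomial.coeff_zero_eq_eval_zero]
  let β : F →ₗ[Lam k] F := (Polynomial.lcoeff F 0).restrictScalars (Lam k) ∘ₗ
    LinearMap.snd (Lam k) F[X] F[X] ∘ₗ T.toLinearMap
  have hβ : ∀ x, β x = (T x).2.coeff 0 := fun x => rfl
  have hβmul : ∀ x y, β (x * y) = x * β y + β x * F.par y := fun x y => by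
    rw [hβ, map_mul]
    change ((T x).1 * (T y).2 + (T x).2 * parPoly F (T y).1).coeff 0 = _
    rw [coeff_add, Polynomial.mul_coeff_zero, Polynomial.mul_coeff_zero,
      DGAlg.PolyForm.coeff_parPoly, hfst, hfst]
    rfl
  have hβt : ∀ j, F.par (β (t j)) = w j := fun j => by
    rw [hβ, hT]
    change F.par ((monomial 0 _).coeff 0) = _
    rw [Polynomial.coeff_monomial_same, map_zsmul, par_of_mem (hw j), smul_smul,
      sgn_mul_self, one_smul]
  have hleib : ∀ x y, F.par (β (x * y)) = F.par (β x) * y + F.par x * F.par (β y) := fun x y => by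
    rw [hβmul, map_add, DGAlg.par_mul, DGAlg.par_mul, DGAlg.par_par, add_comm]
  refine ⟨F.par ∘ₗ β, ⟨fun {i x} hx => ?_, hleib⟩, hβt⟩
  have hone : F.par (β 1) = 0 := by
    have := hleib 1 1
    simpa [DGAlg.par_one] using this
  have key : ∀ x, F.par (β (pr F.gr_internal i x)) = pr F.gr_internal (i + 1) (F.par (β x)) := by
    intro x
    refine monomial_ind hF.model.adjoin_eq_top (p := fun x => F.par (β (pr F.gr_internal i x)) =
      pr F.gr_internal (i + 1) (F.par (β x))) (by simp) (fun x y hx hy => by simp [hx, hy])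
      (fun c x hx => by simp [hx]) (fun x hx => ?_) x
    obtain ⟨e, h1, h2⟩ : ∃ e, x ∈ F.gr e ∧ F.par (β x) ∈ F.gr (e + 1) := by
      induction hx using Submonoid.closure_induction with
      | mem x hx => obtain ⟨j, rfl⟩ := hx; exact ⟨_, hF.mem j, by rw [hβt]; exact hw j⟩
      | one => exact ⟨0, F.one_mem, by rw [hone]; exact zero_mem _⟩
      | mul x y _ _ hx hy =>
        obtain ⟨i, hi, hi'⟩ := hx
        obtain ⟨j, hj, hj'⟩ := hy
        refine ⟨_, F.mul_mem hi hj, ?_⟩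
        rw [hleib, par_of_mem hi, smul_mul_assoc]
        refine add_mem ?_ (zsmul_mem ?_ _)
        · have := F.mul_mem hi' hj
          rwa [show i + 1 + j = i + j + 1 by ring] at this
        · have := F.mul_mem hi hj'
          rwa [show i + (j + 1) = i + j + 1 by ring] at this
    by_cases he : e = i
    · subst he; rw [pr_of_mem _ h1, pr_of_mem _ h2]
    · rw [pr_of_mem_ne _ h1 he, pr_of_mem_ne _ h2 (by omega), map_zero, map_zero]
  have := key x
  rw [pr_of_mem _ hx] at this
  change F.par (β x) ∈ _
  rw [this]
  exact pr_mem _ _ _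

end IsFree

end Free

section Lifting

variable {k : Type u} [Field k] {r : ℕ}

/-- A finite filtration of a multiplicatively closed `I` by submodules `J m` such that
multiplication by `I` raises the filtration degree. -/
structure Filt (D : DGAlg k) (I : Submodule (Lam k) D) (n : ℕ)
    (J : ℕ → Submodule (Lam k) D) (N : ℕ) : Prop where
  mul_self : I * I ≤ I
  hbar_mem : algebraMap (Lam k) D (hbar k) ∈ I
  pow_eq_bot : I ^ (n + 1) = ⊥
  le : ∀ m, J m ≤ I
  anti : ∀ m, J (m + 1) ≤ J m
  mul_left : ∀ m, I * J m ≤ J (m + 1)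
  mul_right : ∀ m, J m * I ≤ J (m + 1)
  pr_mem : ∀ m i, ∀ a ∈ J m, pr D.gr_internal i a ∈ J m
  d_mem : ∀ m, ∀ a ∈ J m, D.d a ∈ J m
  eq_bot : J N = ⊥

/-- A nilpotent differential graded ideal which contains `ħ`. -/
structure NilIdeal (D : DGAlg k) (I : Submodule (Lam k) D) (n : ℕ) : Prop where
  mul_top : I * ⊤ ≤ I
  top_mul : ⊤ * I ≤ I
  hbar_mem : algebraMap (Lam k) D (hbar k) ∈ I
  pow_eq_bot : I ^ (n + 1) = ⊥
  pr_mem : ∀ i, ∀ a ∈ I, pr D.gr_internal i a ∈ I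
  d_mem : ∀ a ∈ I, D.d a ∈ I

theorem hbar_smul_mem {D : DGAlg k} {I J J' : Submodule (Lam k) D}
    (hħ : algebraMap (Lam k) D (hbar k) ∈ I) (h : I * J ≤ J') {a : D}
    (ha : a ∈ J) : hbar k • a ∈ J' := by
  rw [Algebra.smul_def]
  exact h (mul_mem_mul hħ ha)

theorem NilIdeal.mul_self {D : DGAlg k} {I : Submodule (Lam k) D} {n : ℕ}
    (h : NilIdeal D I n) : I * I ≤ I := (mul_le_mul' le_rfl le_top).trans h.mul_top

theorem NilIdeal.forms {D : DGAlg k} {I : Submodule (Lam k) D} {n : ℕ}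
    (h : NilIdeal D I n) : NilIdeal D.forms (D.formsSub I) n where
  mul_top := by
    rw [← formsSub_top]
    exact formsSub_mul (fun _ _ _ => trivial) h.mul_top
  top_mul := by
    rw [← formsSub_top]
    exact formsSub_mul h.pr_mem h.top_mul
  hbar_mem := by
    rw [IsFree.forms_algebraMap]
    exact const_formsSub h.hbar_mem
  pow_eq_bot := by
    rw [eq_bot_iff, ← formsSub_bot, ← h.pow_eq_bot]
    exact IsFree.formsSub_pow h.pr_mem n
  pr_mem := formsSub_pr h.pr_mem
  d_mem _ ha := formsSub_d h.pr_mem h.d_mem ha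

theorem Filt.forms {D : DGAlg k} {I : Submodule (Lam k) D} {n N : ℕ}
    {J : ℕ → Submodule (Lam k) D} (hI : NilIdeal D I n) (h : Filt D I n J N) :
    Filt D.forms (D.formsSub I) n (fun m => D.formsSub (J m)) N where
  mul_self := hI.forms.mul_self
  hbar_mem := hI.forms.hbar_mem
  pow_eq_bot := hI.forms.pow_eq_bot
  le m := formsSub_mono (h.le m)
  anti m := formsSub_mono (h.anti m)
  mul_left m := formsSub_mul (h.pr_mem m) (h.mul_left m)
  mul_right m := formsSub_mul hI.pr_mem (h.mul_right m)
  pr_mem m := formsSub_pr (h.pr_mem m)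
  d_mem m _ ha := formsSub_d (h.pr_mem m) (h.d_mem m) ha
  eq_bot := by rw [h.eq_bot, formsSub_bot]

variable {deg : Fin r → ℤ} {n N : ℕ} {F D : DGAlg k} {t : Fin r → F}
  {I : Submodule (Lam k) D} {J : ℕ → Submodule (Lam k) D}

/-- A graded algebra map out of a free model which commutes with the differentials on the
generators is a morphism. -/
def IsFree.toHom (hF : IsFree deg n F t) (T : F →ₐ[Lam k] D)
    (hT : ∀ j, T (t j) ∈ D.gr (deg j)) (hd : ∀ j, D.d (T (t j)) = T (F.d (t j))) :
    DGAlg.Hom F D where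
  toAlgHom := T
  map_gr := hF.hom_gr T hT
  map_d x := by
    have := hF.defect_mem F.isDer D.isDer hT (I := ⊤) (J := ⊥) le_top
      (fun _ => trivial) (by simp) (by simp) (fun j => by rw [hd, sub_self]; exact zero_mem _) x
    exact (sub_eq_zero.1 ((mem_bot _).1 this)).symm

theorem IsFree.exists_lift (hF : IsFree deg n F t) (hmin : ∀ j, F.d (t j) ∈ genIdeal k t ^ 2)
    (hJ : Filt D I n J N)
    (hac : ∀ m i, ∀ x ∈ J m, x ∈ D.gr i → D.d x ∈ J (m + 1) →
      ∃ y ∈ J m, y ∈ D.gr (i - 1) ∧ x - D.d y ∈ J (m + 1))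
    (T : F →ₐ[Lam k] D) (hTI : ∀ j, T (t j) ∈ I)
    (hT : ∀ j, T (t j) ∈ D.gr (deg j)) (hdef : ∀ j, D.d (T (t j)) - T (F.d (t j)) ∈ J 0) :
    ∃ T' : DGAlg.Hom F D, (∀ j, T' (t j) ∈ I) ∧
      ∀ j, T' (t j) - T (t j) ∈ J 0 := by
  have key : ∀ m, ∃ T' : F →ₐ[Lam k] D, (∀ j, T' (t j) ∈ I) ∧
      (∀ j, T' (t j) ∈ D.gr (deg j)) ∧ (∀ j, D.d (T' (t j)) - T' (F.d (t j)) ∈ J m) ∧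
      ∀ j, T' (t j) - T (t j) ∈ J 0 := by
    intro m
    induction m with
    | zero => exact ⟨T, hTI, hT, hdef, fun j => by rw [sub_self]; exact zero_mem _⟩
    | succ m ih =>
      obtain ⟨S, hSI, hS, hSd, hST⟩ := ih
      have hJ0 : J m ≤ J 0 := by
        clear hSd hac
        induction m with
        | zero => exact le_rfl
        | succ m ih => exact (hJ.anti m).trans ih
      have h1 : ∀ j, ∃ y ∈ J m, y ∈ D.gr (deg j) ∧
          (D.d (S (t j)) - S (F.d (t j))) - D.d y ∈ J (m + 1) := fun j => by
        have hg : D.d (S (t j)) - S (F.d (t j)) ∈ D.gr (deg j + 1) :=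
          sub_mem (D.d_mem (hS j)) (hF.hom_gr S hS (F.d_mem (hF.mem j)))
        obtain ⟨y, hy, hy', h⟩ := hac m _ _ (hSd j) hg (by
          have := hF.defect_mem_sq F.isDer D.isDer hS hJ.mul_self hJ.hbar_mem hSI
            (hJ.mul_left m) (hJ.mul_right m) (hJ.anti m) hSd (hmin j)
          rw [F.d_d, map_zero, sub_zero] at this
          rw [map_sub, D.d_d, zero_sub]
          exact neg_mem this)
        rw [add_sub_cancel_right] at hy'
        exact ⟨y, hy, hy', h⟩
      choose y hy hyg hyd using h1
      have hyI : ∀ j, S (t j) - y j ∈ I := fun j => sub_mem (hSI j) (hJ.le m (hy j))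
      have hyg' : ∀ j, S (t j) - y j ∈ D.gr (deg j) := fun j => sub_mem (hS j) (hyg j)
      obtain ⟨S', hS'⟩ := hF.exists_algHom hJ.mul_self hJ.hbar_mem hJ.pow_eq_bot _ hyI hyg'
      refine ⟨S', fun j => hS' j ▸ hyI j, fun j => hS' j ▸ hyg' j, fun j => ?_, fun j => ?_⟩
      · have h2 := hF.hom_sub_mem_sq hJ.mul_self hJ.hbar_mem hSI (fun j => hS' j ▸ hyI j)
          (hJ.mul_left m) (hJ.mul_right m) (hJ.anti m)
          (fun j => by rw [hS', sub_sub_cancel_left]; exact neg_mem (hy j)) (hmin j)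
        rw [hS', map_sub]
        have := sub_mem (hyd j) h2
        convert this using 1
        abel
      · rw [hS', sub_right_comm]
        exact sub_mem (hST j) (hJ0 (hy j))
  obtain ⟨T', hTI', hT', hd, h0⟩ := key N
  refine ⟨hF.toHom T' hT' fun j => ?_, hTI', h0⟩
  have := hd j
  rw [hJ.eq_bot, mem_bot, sub_eq_zero] at this
  exact this

end Lifting

namespace Background

section PathLifting

variable {k : Type u} [Field k] {r : ℕ} {B : Background.{u, v, w} k}

theorem mem_deg_of_mem_spanT {A : DGAlg k} {J : Submodule (Lam k) A}
    (hJ : ∀ i, ∀ a ∈ J, pr A.gr_internal i a ∈ J) {i : ℤ} {x : B.P ⊗[Lam k] A}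
    (hx : x ∈ B.spanT A J) (hxi : x ∈ B.deg A ⊤ i) : x ∈ B.deg A J i := by
  rw [← prT_of_mem hxi]
  exact prT_spanT hJ i hx

theorem totalD_annT {A : DGAlg k} {d : A →ₗ[Lam k] A}
    {x : B.P ⊗[Lam k] A} (hx : x ∈ B.annT A) : B.totalD A d x ∈ B.annT A := by
  rw [totalD_apply]
  exact sub_mem (bracketT_annT m_mem_annT hx) (diffP_annT hx)

theorem sgn_smul_sgn_smul {M : Type*} [AddCommGroup M] (i : ℤ) (x : M) :
    sgn i • sgn i • x = x := by rw [smul_smul, sgn_mul_self, one_smul]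

/-- The data of a free model with a solution of the master equation that is a versal first order
deformation. -/
structure IsVersal (B : Background.{u, v, w} k) (degP : Fin r → ℤ) (p : Fin r → B.P) (n : ℕ)
    (F : DGAlg k) (t : Fin r → F) (Ξ : B.P ⊗[Lam k] F) : Prop where
  free : IsFree (fun j => -degP j) n F t
  basis : B.IsHomologyBasis degP p
  d_mem : ∀ j, F.d (t j) ∈ genIdeal k t ^ 2
  mem : Ξ ∈ B.deg F (genIdeal k t) 0
  master : B.master F F.d (n + 2) Ξ ∈ B.annT F
  linear : Ξ - ∑ j, p j ⊗ₜ t j ∈ B.spanT F (genIdeal k t ^ 2)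

variable {degP : Fin r → ℤ} {p : Fin r → B.P} {n N : ℕ} {F A : DGAlg k} {t : Fin r → F}
  {Ξ : B.P ⊗[Lam k] F} {I : Submodule (Lam k) A}
  {J : ℕ → Submodule (Lam k) A}

theorem IsVersal.push_sub_mem (hV : IsVersal B degP p n F t Ξ) {f : F →ₗ[Lam k] A}
    {J' : Submodule (Lam k) A} (hf : ∀ x ∈ genIdeal k t ^ 2, f x ∈ J') :
    B.push f Ξ - ∑ j, p j ⊗ₜ f (t j) ∈ B.spanT A J' := by
  have := push_spanT hf hV.linear
  rwa [map_sub, map_sum] at this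

theorem IsVersal.diffP_sub_mem (hV : IsVersal B degP p n F t Ξ) {f : F →ₗ[Lam k] A}
    {J' : Submodule (Lam k) A} (hf : ∀ x ∈ genIdeal k t ^ 2, f x ∈ J') :
    B.diffP f Ξ - ∑ j, p j ⊗ₜ (sgn (degP j) • f (t j)) ∈ B.spanT A J' := by
  have := diffP_spanT hf hV.linear
  rw [map_sub, map_sum] at this
  convert this using 3 with j
  rw [diffP_tmul f (hV.basis.mem j), tmul_smul]

theorem IsVersal.path_step [CharZero k] (hV : IsVersal B degP p n F t Ξ) (hI : NilIdeal A I n)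
    (hJ : Filt A I n J N) (hJt : ∀ m, J m * ⊤ ≤ J m) (m : ℕ)
    {τ : F →ₐ[Lam k] A} (hτI : ∀ j, τ (t j) ∈ I)
    (hτ : ∀ j, τ (t j) ∈ A.gr (-degP j)) (hdef : ∀ j, A.d (τ (t j)) - τ (F.d (t j)) ∈ J m)
    {ξ : B.P ⊗[Lam k] A.forms} (hξ : ξ ∈ B.deg A.forms (A.formsSub I) 0)
    (hξM : B.master A.forms A.forms.d (n + 2) ξ ∈ B.annMod A.forms (A.formsSub (J m)))
    {π : B.P ⊗[Lam k] A} (hπ : π ∈ B.deg A I 0)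
    (hπM : B.master A A.d (n + 2) π ∈ B.annT A)
    (h0 : B.push (A.ev 0) ξ - B.push τ.toLinearMap Ξ ∈ B.spanT A (J m))
    (h1 : B.push (A.ev 1) ξ - π ∈ B.spanT A (J m)) :
    ∃ (τ' : F →ₐ[Lam k] A) (ξ' : B.P ⊗[Lam k] A.forms),
      (∀ j, τ' (t j) ∈ I) ∧ (∀ j, τ' (t j) ∈ A.gr (-degP j)) ∧
      (∀ j, A.d (τ' (t j)) - τ' (F.d (t j)) ∈ J (m + 1)) ∧ ξ' ∈ B.deg A.forms (A.formsSub I) 0 ∧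
      B.master A.forms A.forms.d (n + 2) ξ' ∈ B.annMod A.forms (A.formsSub (J (m + 1))) ∧
      B.push (A.ev 0) ξ' - B.push τ'.toLinearMap Ξ ∈ B.spanT A (J (m + 1)) ∧
      B.push (A.ev 1) ξ' - π ∈ B.spanT A (J (m + 1)) ∧
      (∀ j, τ' (t j) - τ (t j) ∈ J m) ∧ ξ' - ξ ∈ B.spanT A.forms (A.formsSub (J m)) := by
  have hF := hV.free
  have hIΩ := hI.forms
  have hJΩ := hJ.forms hI
  have hJtΩ : A.formsSub (J m) * ⊤ ≤ A.formsSub (J m) := by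
    rw [← formsSub_top]
    exact formsSub_mul (fun _ _ _ => trivial) (hJt m)
  have masterev : ∀ (s : ℤ) (x : B.P ⊗[Lam k] A.forms),
      B.push (A.ev (s : A)) (B.master A.forms A.forms.d (n + 2) x) =
        B.master A A.d (n + 2) (B.push (A.ev (s : A)) x) := fun s x =>
    B.push_masterSum (A.evHom s) (n + 2) x
  have hτΞ : B.push τ.toLinearMap Ξ ∈ B.deg A I 0 :=
    push_deg_zero (f := τ.toLinearMap) (hF.hom_gr τ hτ) (fun a ha => hF.hom_mem hI.mul_self hI.hbar_mem hτI ha) hV.mem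
  rw [← Int.cast_zero (R := A)] at h0
  rw [← Int.cast_one (R := A)] at h1
  have he0 := mem_deg_of_mem_spanT (hJ.pr_mem m) h0
    (sub_mem (deg_mono le_top (push_ev_deg 0 hξ)) (deg_mono le_top hτΞ))
  have he1 := mem_deg_of_mem_spanT (hJ.pr_mem m) h1
    (sub_mem (deg_mono le_top (push_ev_deg 1 hξ)) (deg_mono le_top hπ))
  set e0 := B.push (A.ev (0 : ℤ)) ξ - B.push τ.toLinearMap Ξ with he0def
  set e1 := B.push (A.ev (1 : ℤ)) ξ - π with he1def
  set c := -B.push (A.affine 1 0) e0 - B.push (A.affine 0 1) e1 with hcdef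
  have hc : c ∈ B.deg A.forms (A.formsSub (J m)) 0 :=
    sub_mem (neg_mem (push_affine_deg 1 0 he0)) (push_affine_deg 0 1 he1)
  have hJIΩ := hJΩ.le m
  set ξ1 := ξ + c with hξ1def
  have hξ1 : ξ1 ∈ B.deg A.forms (A.formsSub I) 0 := add_mem hξ (deg_mono hJIΩ hc)
  have h10 : B.push (A.ev (0 : ℤ)) ξ1 = B.push τ.toLinearMap Ξ := by
    rw [hξ1def, hcdef, map_add, map_sub, map_neg, push_ev_affine, push_ev_affine, he0def]
    simp
  have h11 : B.push (A.ev (1 : ℤ)) ξ1 = π := by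
    rw [hξ1def, hcdef, map_add, map_sub, map_neg, push_ev_affine, push_ev_affine, he1def]
    simp
  have hmadd : ∀ {π q : B.P ⊗[Lam k] A.forms}, π ∈ B.deg A.forms (A.formsSub I) 0 →
      q ∈ B.deg A.forms (A.formsSub (J m)) 0 →
      B.master A.forms A.forms.d (n + 2) (π + q) - B.master A.forms A.forms.d (n + 2) π +
        B.totalD A.forms A.forms.d q ∈ B.spanT A.forms (A.formsSub (J (m + 1))) :=
    fun hπ hq => master_add A.forms.isDer hIΩ.mul_top hIΩ.d_mem hJIΩ hJtΩ (hJΩ.d_mem m)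
      (hJΩ.mul_left m) (hJΩ.mul_right m) (hJΩ.anti m) hπ hq (by omega)
  have hM1 : B.master A.forms A.forms.d (n + 2) ξ1 ∈ B.annMod A.forms (A.formsSub (J m)) := by
    have h2 := hmadd hξ hc
    have h3 := deg_le_spanT (totalD_deg A.forms.isDer (hJΩ.d_mem m) hc)
    have h4 : B.master A.forms A.forms.d (n + 2) ξ1 =
      (B.master A.forms A.forms.d (n + 2) ξ1 - B.master A.forms A.forms.d (n + 2) ξ +
        B.totalD A.forms A.forms.d c) - B.totalD A.forms A.forms.d c +
        B.master A.forms A.forms.d (n + 2) ξ := by abel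
    rw [h4]
    exact add_mem (mem_sup_right (sub_mem (spanT_mono (hJΩ.anti m) h2) h3)) hξM
  obtain ⟨o, ho, hoann⟩ := exists_sub_mem_annT (hJΩ.pr_mem m) hM1
    (master_mem_top A.forms.isDer hIΩ.mul_top hIΩ.d_mem hξ1 (by omega))
  have hdd : B.diffP A.forms.d (B.diffP A.forms.d ξ1) = 0 := by
    rw [diffP_diffP, show A.forms.d ∘ₗ A.forms.d = 0 from LinearMap.ext A.forms.d_d, push,
      LinearMap.lTensor_zero, LinearMap.zero_apply]
  have hDo : B.totalD A.forms A.forms.d o ∈ B.annMod A.forms (A.formsSub (J (m + 1))) := by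
    have := obstruction_closed A.forms.isDer hIΩ.mul_top hIΩ.d_mem hJIΩ (hJΩ.mul_left m)
      (hJΩ.anti m) hξ1 hIΩ.pow_eq_bot (by omega : n + 1 ≤ n + 2) (by omega)
      (by rw [hdd]; exact zero_mem _) ho hoann
    rwa [hdd, add_zero] at this
  have ho1 : B.push (A.ev (1 : ℤ)) o ∈ B.annT A := by
    have h2 := push_annT (d := A.ev (1 : ℤ)) hoann
    rw [map_sub, masterev, h11] at h2
    have := sub_mem hπM h2
    rwa [sub_sub_cancel] at this
  set q := -B.diffP (A.sigma 1) o with hqdef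
  have hq : q ∈ B.deg A.forms (A.formsSub (J m)) 0 := by
    have := sigma_deg (hJ.pr_mem m) 1 ho
    rw [sub_self] at this
    exact neg_mem this
  have hDq : B.totalD A.forms A.forms.d q - o ∈ B.annMod A.forms (A.formsSub (J (m + 1))) := by
    have h3 := push_annT (d := A.constHom.toAlgHom.toLinearMap) ho1
    have h4 := diffP_annMod (f := A.sigma 1)
      (fun a ha => sigma_formsSub (hJ.pr_mem (m + 1)) 1 ha) hDo
    rw [hqdef, map_neg, totalD_sigma]
    convert sub_mem h4 (mem_sup_left h3) using 1
    abel
  have hq1 : B.push (A.ev (1 : ℤ)) q = 0 := by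
    rw [hqdef, map_neg, push_diffP, show A.ev (1 : ℤ) ∘ₗ A.sigma 1 = 0 from
      LinearMap.ext fun x => DGAlg.ev_sigma 1 x]
    simp [diffP]
  set z := B.push (A.ev (0 : ℤ)) q with hzdef
  have hz : z ∈ B.deg A (J m) 0 := push_ev_deg 0 hq
  have hdefm : ∀ x ∈ genIdeal k t, A.d (τ x) - τ (F.d x) ∈ J m := fun x _ =>
    hF.defect_mem F.isDer A.isDer hτ hI.mul_self hτI ((hJ.mul_left m).trans (hJ.anti m))
      ((hJ.mul_right m).trans (hJ.anti m)) hdef x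
  set O : Fin r → A := fun j => sgn (degP j) • (A.d (τ (t j)) - τ (F.d (t j))) with hOdef
  have hmastτ : B.master A A.d (n + 2) (B.push τ.toLinearMap Ξ) - ∑ j, p j ⊗ₜ O j ∈
      B.annMod A (J (m + 1)) := by
    have h2 := master_push τ (hF.hom_gr τ hτ)
      (fun a ha => hF.hom_mem hI.mul_self hI.hbar_mem hτI ha) F.isDer A.isDer hdefm
      (hJ.mul_left m) (hJ.anti m) hV.mem (show 1 ≤ n + 2 by omega)
    have h3 := push_annT (d := τ.toLinearMap) hV.master
    have h4 := hV.diffP_sub_mem (f := A.d ∘ₗ τ.toLinearMap - τ.toLinearMap ∘ₗ F.d)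
      (J' := J (m + 1)) (fun x hx => hF.defect_mem_sq F.isDer A.isDer hτ hI.mul_self hI.hbar_mem
        hτI (hJ.mul_left m) (hJ.mul_right m) (hJ.anti m) hdef hx)
    have h5 := add_mem (mem_sup_right (add_mem h2 h4)) (mem_sup_left h3)
    change _ ∈ B.annMod A (J (m + 1)) at h5
    convert h5 using 1
    rw [show ∑ j, p j ⊗ₜ[Lam k] O j = ∑ j, p j ⊗ₜ[Lam k] (sgn (degP j) •
      (A.d ∘ₗ τ.toLinearMap - τ.toLinearMap ∘ₗ F.d) (t j)) from rfl]
    abel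
  have hDz : B.totalD A A.d z - ∑ j, p j ⊗ₜ O j ∈ B.annMod A (J (m + 1)) := by
    have h2 := push_annMod (f := A.ev (0 : ℤ)) (J' := J (m + 1)) (fun a ha => ev_formsSub 0 ha) hDq
    have h3 := push_annT (d := A.ev (0 : ℤ)) hoann
    rw [map_sub, masterev, h10] at h3
    rw [map_sub, push_ev_totalD] at h2
    have h5 := add_mem (sub_mem h2 (mem_sup_left h3)) hmastτ
    convert h5 using 1
    abel
  have hOg : ∀ j, O j ∈ A.gr (0 + 1 - degP j) := fun j => by
    refine zsmul_mem (sub_mem ?_ ?_) _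
    · have := A.d_mem (hτ j)
      rwa [neg_add_eq_sub, ← zero_add (1 : ℤ)] at this
    · have := hF.hom_gr τ hτ (F.d_mem (hF.mem j))
      rwa [neg_add_eq_sub, ← zero_add (1 : ℤ)] at this
  obtain ⟨x, w, hxJ, hxg, hw, hzx, hdx⟩ := hV.basis.contract A.isDer (hJ.anti m)
    (fun a ha => hbar_smul_mem hI.hbar_mem (hJ.mul_left m) ha) (hJ.pr_mem m) (hJ.pr_mem (m + 1))
    (hJ.d_mem m) (hJ.d_mem (m + 1)) hz (fun j => zsmul_mem (hdef j) _) hOg hDz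
  have hτ'I : ∀ j, τ (t j) + x j ∈ I := fun j => add_mem (hτI j) (hJ.le m (hxJ j))
  have hτ'g : ∀ j, τ (t j) + x j ∈ A.gr (-degP j) := fun j => by
    refine add_mem (hτ j) ?_
    have := hxg j
    rwa [zero_sub] at this
  obtain ⟨τ', hτ'⟩ := hF.exists_algHom hI.mul_self hI.hbar_mem hI.pow_eq_bot _ hτ'I hτ'g
  have hτ'J : ∀ j, τ' (t j) - τ (t j) ∈ J m := fun j => by
    rw [hτ', add_sub_cancel_left]; exact hxJ j
  have hsq : ∀ y ∈ genIdeal k t ^ 2, τ' y - τ y ∈ J (m + 1) := fun y hy =>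
    hF.hom_sub_mem_sq hI.mul_self hI.hbar_mem hτI (fun j => hτ' j ▸ hτ'I j)
      (hJ.mul_left m) (hJ.mul_right m) (hJ.anti m) hτ'J hy
  have hτ'Ξ : B.push τ'.toLinearMap Ξ - B.push τ.toLinearMap Ξ - ∑ j, p j ⊗ₜ x j ∈
      B.spanT A (J (m + 1)) := by
    have := hV.push_sub_mem (f := τ'.toLinearMap - τ.toLinearMap) hsq
    simp only [LinearMap.sub_apply, toLinearMap_apply, hτ', add_sub_cancel_left] at this
    rwa [push, lTensor_sub, LinearMap.sub_apply] at this
  have hDw := totalD_deg A.isDer (hJ.d_mem m) hw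
  rw [zero_sub, neg_add_cancel] at hDw
  have hsum : ∑ j, p j ⊗ₜ x j ∈ B.deg A (J m) 0 := sum_mem fun j _ =>
    B.tmul_mem_deg (hV.basis.mem j) (hxg j) (hxJ j) (by ring)
  obtain ⟨β, hβ, hα⟩ := exists_sub_mem_annT (hJ.pr_mem (m + 1)) hzx
    (deg_mono le_top (sub_mem (sub_mem hz hsum) hDw))
  set α := z - ∑ j, p j ⊗ₜ x j - B.totalD A A.d w - β with hαdef
  have hαJ : α ∈ B.deg A (J m) 0 :=
    sub_mem (sub_mem (sub_mem hz hsum) hDw) (deg_mono (hJ.anti m) hβ)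
  set q' := q - B.totalD A.forms A.forms.d (B.push (A.affine 1 0) w) - B.push (A.affine 1 0) α
    with hq'def
  have hwΩ := totalD_deg A.forms.isDer (hJΩ.d_mem m) (push_affine_deg 1 0 hw)
  rw [zero_sub, neg_add_cancel] at hwΩ
  have hq' : q' ∈ B.deg A.forms (A.formsSub (J m)) 0 :=
    sub_mem (sub_mem hq hwΩ) (push_affine_deg 1 0 hαJ)
  have hDq' : B.totalD A.forms A.forms.d q' - o ∈
      B.annMod A.forms (A.formsSub (J (m + 1))) := by
    rw [hq'def, map_sub, map_sub, totalD_totalD A.forms.d_d, sub_zero, sub_right_comm]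
    exact sub_mem hDq (mem_sup_left (totalD_annT (push_annT hα)))
  refine ⟨τ', ξ1 + q', fun j => hτ' j ▸ hτ'I j, fun j => hτ' j ▸ hτ'g j, fun j => ?_,
    add_mem hξ1 (deg_mono hJIΩ hq'), ?_, ?_, ?_, hτ'J, ?_⟩
  · have h2 := hdx j
    have h3 := hsq _ (hV.d_mem j)
    have h4 := sub_mem (neg_mem (zsmul_mem h2 (sgn (degP j)))) h3
    simp only [smul_sub, smul_neg, sgn_smul_sgn_smul] at h4
    rw [hτ', map_add]
    convert h4 using 1
    abel
  · have h2 := hmadd hξ1 hq'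
    have h3 := add_mem (sub_mem (mem_sup_right h2) hDq') (mem_sup_left hoann)
    change _ ∈ B.annMod A.forms (A.formsSub (J (m + 1))) at h3
    convert h3 using 1
    abel
  · rw [← Int.cast_zero (R := A), map_add, h10, hq'def, map_sub, map_sub,
      push_ev_totalD, push_ev_affine, push_ev_affine, ← hzdef]
    have h2 := sub_mem (deg_le_spanT hβ) hτ'Ξ
    convert h2 using 1
    rw [hαdef]
    simp only [zero_sub, zero_mul, add_zero, one_smul]
    abel
  · rw [← Int.cast_one (R := A), map_add, h11, hq'def, map_sub, map_sub,
      push_ev_totalD, push_ev_affine, push_ev_affine, hq1]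
    simp
  · rw [hξ1def, add_assoc, add_sub_cancel_left]
    exact add_mem (deg_le_spanT hc) (deg_le_spanT hq')

/-- Lifting of a morphism together with a path of solutions along a filtration. -/
theorem IsVersal.exists_path [CharZero k] (hV : IsVersal B degP p n F t Ξ) (hI : NilIdeal A I n)
    (hJ : Filt A I n J N) (hJt : ∀ m, J m * ⊤ ≤ J m)
    {τ : F →ₐ[Lam k] A} (hτI : ∀ j, τ (t j) ∈ I)
    (hτ : ∀ j, τ (t j) ∈ A.gr (-degP j)) (hdef : ∀ j, A.d (τ (t j)) - τ (F.d (t j)) ∈ J 0)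
    {ξ : B.P ⊗[Lam k] A.forms} (hξ : ξ ∈ B.deg A.forms (A.formsSub I) 0)
    (hξM : B.master A.forms A.forms.d (n + 2) ξ ∈ B.annMod A.forms (A.formsSub (J 0)))
    {π : B.P ⊗[Lam k] A} (hπ : π ∈ B.deg A I 0)
    (hπM : B.master A A.d (n + 2) π ∈ B.annT A)
    (h0 : B.push (A.ev 0) ξ - B.push τ.toLinearMap Ξ ∈ B.spanT A (J 0))
    (h1 : B.push (A.ev 1) ξ - π ∈ B.spanT A (J 0)) :
    ∃ (τ' : DGAlg.Hom F A) (ξ' : B.P ⊗[Lam k] A.forms),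
      (∀ j, τ' (t j) ∈ I) ∧ ξ' ∈ B.deg A.forms (A.formsSub I) 0 ∧
      B.master A.forms A.forms.d (n + 2) ξ' ∈ B.annT A.forms ∧
      B.push (A.ev 0) ξ' = B.push τ'.toAlgHom.toLinearMap Ξ ∧ B.push (A.ev 1) ξ' = π ∧
      (∀ j, τ' (t j) - τ (t j) ∈ J 0) ∧
      ξ' - ξ ∈ B.spanT A.forms (A.formsSub (J 0)) := by
  have key : ∀ m, ∃ (τ' : F →ₐ[Lam k] A) (ξ' : B.P ⊗[Lam k] A.forms),
      (∀ j, τ' (t j) ∈ I) ∧ (∀ j, τ' (t j) ∈ A.gr (-degP j)) ∧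
      (∀ j, A.d (τ' (t j)) - τ' (F.d (t j)) ∈ J m) ∧ ξ' ∈ B.deg A.forms (A.formsSub I) 0 ∧
      B.master A.forms A.forms.d (n + 2) ξ' ∈ B.annMod A.forms (A.formsSub (J m)) ∧
      B.push (A.ev 0) ξ' - B.push τ'.toLinearMap Ξ ∈ B.spanT A (J m) ∧
      B.push (A.ev 1) ξ' - π ∈ B.spanT A (J m) ∧
      (∀ j, τ' (t j) - τ (t j) ∈ J 0) ∧ ξ' - ξ ∈ B.spanT A.forms (A.formsSub (J 0)) := by
    intro m
    induction m with
    | zero =>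
      exact ⟨τ, ξ, hτI, hτ, hdef, hξ, hξM, h0, h1,
        fun j => by rw [sub_self]; exact zero_mem _, by rw [sub_self]; exact zero_mem _⟩
    | succ m ih =>
      obtain ⟨τ1, ξ1, a1, a2, a3, a4, a5, a6, a7, a8, a9⟩ := ih
      obtain ⟨τ2, ξ2, b1, b2, b3, b4, b5, b6, b7, b8, b9⟩ :=
        hV.path_step hI hJ hJt m a1 a2 a3 a4 a5 hπ hπM a6 a7
      have hJ0 : J m ≤ J 0 := antitone_nat_of_succ_le hJ.anti (Nat.zero_le m)
      refine ⟨τ2, ξ2, b1, b2, b3, b4, b5, b6, b7, fun j => ?_, ?_⟩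
      · have := add_mem (hJ0 (b8 j)) (a8 j)
        rwa [sub_add_sub_cancel] at this
      · have := add_mem (spanT_mono (formsSub_mono hJ0) b9) a9
        rwa [sub_add_sub_cancel] at this
  obtain ⟨τ', ξ', a1, a2, a3, a4, a5, a6, a7, a8, a9⟩ := key N
  have hsb : ∀ {D : DGAlg k} {x : B.P ⊗[Lam k] D}, x ∈ B.spanT D ⊥ → x = 0 :=
    fun {D x} hx => by
      have : B.spanT D ⊥ ≤ ⊥ := spanT_le fun p a ha => by
        rw [(mem_bot _).1 ha, tmul_zero]; exact zero_mem _
      exact (mem_bot _).1 (this hx)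
  rw [hJ.eq_bot] at a6 a7
  rw [hJ.eq_bot, formsSub_bot] at a5
  refine ⟨hV.free.toHom τ' a2 fun j => ?_, ξ', a1, a4, ?_, sub_eq_zero.1 (hsb a6),
    sub_eq_zero.1 (hsb a7), a8, a9⟩
  · have := a3 j
    rw [hJ.eq_bot, mem_bot, sub_eq_zero] at this
    exact this
  · obtain ⟨y, hy, z, hz, h⟩ := mem_sup.1 a5
    rw [← h]
    rw [hsb hz, add_zero]
    exact hy

end PathLifting

end Background

section Stable

variable {k : Type u} [Field k] {D D' : DGAlg k}

/-- Submodules which are stable under the structure of a differential graded algebra and under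
multiplication by `I`. -/
structure Stable (D : DGAlg k) (I K : Submodule (Lam k) D) : Prop where
  mul_left : ∀ a ∈ I, ∀ x ∈ K, a * x ∈ K
  mul_right : ∀ a ∈ I, ∀ x ∈ K, x * a ∈ K
  pr_mem : ∀ i, ∀ x ∈ K, pr D.gr_internal i x ∈ K
  d_mem : ∀ x ∈ K, D.d x ∈ K

theorem Stable.inf {I K K' : Submodule (Lam k) D} (h : Stable D I K)
    (h' : Stable D I K') : Stable D I (K ⊓ K') where
  mul_left a ha x hx := ⟨h.mul_left a ha x hx.1, h'.mul_left a ha x hx.2⟩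
  mul_right a ha x hx := ⟨h.mul_right a ha x hx.1, h'.mul_right a ha x hx.2⟩
  pr_mem i x hx := ⟨h.pr_mem i x hx.1, h'.pr_mem i x hx.2⟩
  d_mem x hx := ⟨h.d_mem x hx.1, h'.d_mem x hx.2⟩

theorem Stable.comap (f : DGAlg.Hom D D') {I : Submodule (Lam k) D}
    {I' K : Submodule (Lam k) D'} (hf : ∀ a ∈ I, f a ∈ I')
    (h : Stable D' I' K) : Stable D I (K.comap f.toAlgHom.toLinearMap) where
  mul_left a ha x hx := by
    change f (a * x) ∈ K
    rw [map_mul]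
    exact h.mul_left _ (hf a ha) _ hx
  mul_right a ha x hx := by
    change f (x * a) ∈ K
    rw [map_mul]
    exact h.mul_right _ (hf a ha) _ hx
  pr_mem i x hx := by
    change f _ ∈ K
    rw [f.map_pr]
    exact h.pr_mem i _ hx
  d_mem x hx := by
    change f _ ∈ K
    rw [f.map_d]
    exact h.d_mem _ hx

theorem Stable.bot (I : Submodule (Lam k) D) : Stable D I ⊥ where
  mul_left a _ x hx := by rw [(mem_bot _).1 hx, mul_zero]; exact zero_mem _
  mul_right a _ x hx := by rw [(mem_bot _).1 hx, zero_mul]; exact zero_mem _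
  pr_mem i x hx := by rw [(mem_bot _).1 hx, map_zero]; exact zero_mem _
  d_mem x hx := by rw [(mem_bot _).1 hx, map_zero]; exact zero_mem _

theorem Stable.ker (f : DGAlg.Hom D D') (I : Submodule (Lam k) D) :
    Stable D I (ker f.toAlgHom.toLinearMap) :=
  Stable.comap f (I' := ⊤) (fun _ _ => trivial) (Stable.bot _)

theorem Filt.inf {I I' K : Submodule (Lam k) D} {n N : ℕ}
    {J : ℕ → Submodule (Lam k) D} (h : Filt D I n J N) (hle : I' ≤ I)
    (hmul : I' * I' ≤ I') (hħ : algebraMap (Lam k) D (hbar k) ∈ I')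
    (hK : Stable D I' K) (hJ : J 0 ⊓ K ≤ I') : Filt D I' n (fun m => J m ⊓ K) N := by
  have hJ0 : ∀ m, J m ≤ J 0 := fun m => by
    induction m with
    | zero => exact le_rfl
    | succ m ih => exact (h.anti m).trans ih
  refine ⟨hmul, hħ, ?_, fun m => (inf_le_inf_right K (hJ0 m)).trans hJ,
    fun m => inf_le_inf_right K (h.anti m), fun m => mul_le.2 fun a ha x hx => ?_,
    fun m => mul_le.2 fun x hx a ha => ?_, fun m i x hx => ?_, fun m x hx => ?_, ?_⟩
  · exact eq_bot_iff.2 ((pow_le_pow_left' hle (n + 1)).trans_eq h.pow_eq_bot)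
  · exact ⟨h.mul_left m (mul_mem_mul (hle ha) hx.1), hK.mul_left a ha x hx.2⟩
  · exact ⟨h.mul_right m (mul_mem_mul hx.1 (hle ha)), hK.mul_right a ha x hx.2⟩
  · exact ⟨h.pr_mem m i x hx.1, hK.pr_mem i x hx.2⟩
  · exact ⟨h.d_mem m x hx.1, hK.d_mem x hx.2⟩
  · simp [h.eq_bot]

end Stable

namespace ParamRing

variable {k : Type u} [Field k] (A : ParamRing k)

theorem one_notMem : (1 : A) ∉ A.maxIdeal := fun h => by
  obtain ⟨c, -, hc⟩ := A.residue 0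
  have h0 := hc 0 (by simp)
  have h1 := hc 1 (by simpa using h)
  exact one_ne_zero (h1.trans h0.symm)

theorem notMem_of_isUnit {a : A} (ha : IsUnit a) : a ∉ A.maxIdeal := fun h => by
  obtain ⟨b, hb⟩ := ha.exists_right_inv
  exact A.one_notMem (hb ▸ A.mul_mem_right b h)

theorem algebraMap_C_notMem {c : k} (hc : c ≠ 0) :
    algebraMap (Lam k) A (C c) ∉ A.maxIdeal :=
  A.notMem_of_isUnit (((isUnit_iff_ne_zero.2 hc).map (C (R := k))).map _)

theorem hbar_mem : algebraMap (Lam k) A (hbar k) ∈ A.maxIdeal := by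
  obtain ⟨c, hc, -⟩ := A.residue (algebraMap (Lam k) A (hbar k))
  by_cases h : c = 0
  · simpa [h] using hc
  · exfalso
    refine A.notMem_of_isUnit ?_ hc
    rw [← map_sub]
    refine IsUnit.map _ (PowerSeries.isUnit_iff_constantCoeff.2 ?_)
    simpa using h

theorem mem_of_mul_self_eq_zero {a : A} (n : ℕ) (ha : a ^ n = 0) : a ∈ A.maxIdeal := by
  obtain ⟨c, hc, -⟩ := A.residue a
  by_cases h : c = 0
  · simpa [h] using hc
  · exfalso
    have key : ∀ m : ℕ, a ^ m - algebraMap (Lam k) A (C (c ^ m)) ∈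
        A.maxIdeal := by
      intro m
      induction m with
      | zero => simp
      | succ m ih =>
        have h1 : a ^ (m + 1) - algebraMap (Lam k) A (C (c ^ (m + 1))) =
            (a ^ m - algebraMap (Lam k) A (C (c ^ m))) * a + algebraMap (Lam k) A (C (c ^ m)) *
              (a - algebraMap (Lam k) A (C c)) := by
          rw [pow_succ, pow_succ, map_mul, map_mul]; noncomm_ring
        rw [h1]
        exact add_mem (A.mul_mem_right _ ih) (A.mul_mem_left _ hc)
    have := key n
    rw [ha, zero_sub, neg_mem_iff] at this
    exact A.algebraMap_C_notMem (pow_ne_zero n h) this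

theorem gr_le {i : ℤ} (hi : i ≠ 0) : A.gr i ≤ A.maxIdeal := by
  intro a ha
  have := A.finite
  have hfin : {i | A.gr i ≠ ⊥}.Finite :=
    WellFoundedGT.finite_ne_bot_of_iSupIndep A.gr_internal.submodule_iSupIndep
  have hpow : ∀ m : ℕ, a ^ m ∈ A.gr (m * i) := fun m => by
    induction m with
    | zero => simpa using A.one_mem
    | succ m ih =>
      have := A.mul_mem ih ha
      rw [pow_succ]
      convert this using 2
      push_cast; ring
  obtain ⟨m, hm⟩ : ∃ m : ℕ, A.gr (m * i) = ⊥ := by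
    by_contra! h
    refine Set.infinite_of_injective_forall_mem (f := fun m : ℕ => (m : ℤ) * i) ?_ h hfin
    intro x y hxy
    exact_mod_cast mul_right_cancel₀ hi hxy
  refine A.mem_of_mul_self_eq_zero m ?_
  have := hpow m
  rwa [hm, mem_bot] at this

theorem pr_mem_max (i : ℤ) (a : A) (ha : a ∈ A.maxIdeal) :
    pr A.gr_internal i a ∈ A.maxIdeal := by
  by_cases hi : i = 0
  · subst hi
    obtain ⟨s, hs⟩ := exists_sum_pr A.gr_internal a
    have h := hs (insert 0 s) (Finset.subset_insert _ _)
    rw [← Finset.add_sum_erase _ _ (Finset.mem_insert_self 0 s)] at h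
    rw [eq_sub_of_add_eq h]
    exact sub_mem ha (sum_mem fun j hj => A.gr_le (Finset.ne_of_mem_erase hj) (pr_mem _ _ _))
  · exact A.gr_le hi (pr_mem _ _ _)

theorem d_mem_max (a : A) (ha : a ∈ A.maxIdeal) : A.d a ∈ A.maxIdeal := by
  refine homogeneous_ind A.gr_internal A.pr_mem_max (p := fun a => A.d a ∈ A.maxIdeal)
    (by simp) (fun x y hx hy => by rw [map_add]; exact add_mem hx hy) (fun i a ha ham => ?_) ha
  by_cases hi : i + 1 = 0
  · obtain ⟨c, hc, -⟩ := A.residue (A.d a)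
    by_cases h : c = 0
    · simpa [h] using hc
    · exfalso
      set μ := 1 - (C c⁻¹ : Lam k) • A.d a with hμ
      have hμm : μ ∈ A.maxIdeal := by
        have h1 := Submodule.smul_mem A.maxIdeal (C c⁻¹ : Lam k) hc
        rw [smul_sub] at h1
        have h2 : (C c⁻¹ : Lam k) • algebraMap (Lam k) A (C c) = 1 := by
          rw [Algebra.smul_def, ← map_mul, ← map_mul, inv_mul_cancel₀ h, map_one, map_one]
        rw [h2] at h1
        have := neg_mem h1
        rwa [neg_sub] at this
      obtain ⟨N, hN⟩ := A.nilpotent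
      have hμN : μ ^ N = 0 := by
        have := Submodule.pow_mem_pow A.maxIdeal hμm N
        rwa [hN, mem_bot] at this
      have hone : A.d 1 = 0 := A.isDer.map_one
      have hdμ : A.d μ = 0 := by rw [hμ, map_sub, map_smul, A.d_d, hone, smul_zero, sub_zero]
      have hpow : ∀ m, A.d (μ ^ m) = 0 := fun m => by
        induction m with
        | zero => rw [pow_zero, hone]
        | succ m ih => rw [pow_succ, A.leibniz', ih, hdμ, zero_mul, mul_zero, add_zero]
      refine A.one_not_exact ((C c⁻¹ : Lam k) • a * ∑ m ∈ Finset.range N, μ ^ m) ?_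
      rw [A.leibniz', map_sum, Finset.sum_eq_zero (fun m _ => hpow m), mul_zero, add_zero, map_smul]
      rw [show (C c⁻¹ : Lam k) • A.d a = 1 - μ by rw [hμ, sub_sub_cancel],
        mul_neg_geom_sum, hμN, sub_zero]
  · exact A.gr_le hi (A.d_mem ha)

theorem nilIdeal {n : ℕ} (hn : A.maxIdeal ^ (n + 1) = ⊥) : NilIdeal A.toDGAlg A.maxIdeal n where
  mul_top := mul_le.2 fun _ ha b _ => A.mul_mem_right b ha
  top_mul := mul_le.2 fun b _ _ ha => A.mul_mem_left b ha
  hbar_mem := A.hbar_mem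
  pow_eq_bot := hn
  pr_mem := A.pr_mem_max
  d_mem := A.d_mem_max

end ParamRing

namespace Background

section Paths

variable {k : Type u} [Field k] {r : ℕ} {B : Background.{u, v, w} k}

/-- Solutions of the master equation over a nilpotent ideal. -/
structure IsSol (B : Background.{u, v, w} k) (A : DGAlg k) (I : Submodule (Lam k) A) (n : ℕ)
    (π : B.P ⊗[Lam k] A) : Prop where
  mem : π ∈ B.deg A I 0
  master : B.master A A.d (n + 2) π ∈ B.annT A

theorem mem_solutions_iff_isSol (hB : B.VacuumPure) {A : DGAlg k}
    {I : Submodule (Lam k) A} {n : ℕ} (hn : I ^ (n + 1) = ⊥)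
    {π : B.P ⊗[Lam k] A} : π ∈ B.solutions A I ↔ B.IsSol A I n π := by
  have h1 : π ∈ B.deg A I 0 → ∀ N, n + 1 ≤ N →
      B.masterSum A N π = B.master A A.d (n + 2) π := fun hπ N hN => by
    rw [masterSum_eq, master_stable A.isDer hπ hn hN,
      master_stable A.isDer hπ hn (by omega : n + 1 ≤ n + 2)]
  constructor
  · rintro ⟨hπ, h⟩
    rw [degZero_eq_deg] at hπ
    obtain ⟨N, hN⟩ := Filter.eventually_atTop.1 h
    refine ⟨hπ, (actT_eq_zero_iff hB _).1 ?_⟩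
    rw [← h1 hπ (max N (n + 1)) (le_max_right _ _)]
    exact hN _ (le_max_left _ _)
  · rintro ⟨hπ, h⟩
    refine ⟨by rwa [degZero_eq_deg], Filter.eventually_atTop.2 ⟨n + 1, fun N hN => ?_⟩⟩
    rw [h1 hπ N hN]
    exact (actT_eq_zero_iff hB _).2 h

theorem IsSol.push {A A' : DGAlg k} (f : DGAlg.Hom A A') {I : Submodule (Lam k) A}
    {I' : Submodule (Lam k) A'} (hI : ∀ a ∈ I, f a ∈ I') {n : ℕ}
    {π : B.P ⊗[Lam k] A} (h : B.IsSol A I n π) :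
    B.IsSol A' I' n (B.push f.toAlgHom.toLinearMap π) :=
  ⟨push_deg_zero f.map_gr hI h.mem, by
    rw [← masterSum_eq, ← B.push_masterSum]; exact push_annT h.master⟩

/-- There is a path of solutions from `x` to `y`. -/
def Joined (B : Background.{u, v, w} k) (A : DGAlg k) (I : Submodule (Lam k) A) (n : ℕ)
    (x y : B.P ⊗[Lam k] A) : Prop :=
  ∃ ξ, B.IsSol A.forms (A.formsSub I) n ξ ∧ B.push (A.ev 0) ξ = x ∧ B.push (A.ev 1) ξ = y

variable {A : DGAlg k} {I : Submodule (Lam k) A} {n : ℕ}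

theorem push_ev_const (s : ℤ) (x : B.P ⊗[Lam k] A) :
    B.push (A.ev (s : A)) (B.push A.constHom.toAlgHom.toLinearMap x) = x := by
  rw [push_push, show A.ev (s : A) ∘ₗ A.constHom.toAlgHom.toLinearMap = LinearMap.id from
    LinearMap.ext fun a => DGAlg.ev_const s a, push, lTensor_id, id_apply]

theorem push_ev_zero_const (x : B.P ⊗[Lam k] A) :
    B.push (A.ev 0) (B.push A.constHom.toAlgHom.toLinearMap x) = x := by
  have := push_ev_const 0 x
  rwa [Int.cast_zero] at this

theorem push_ev_one_const (x : B.P ⊗[Lam k] A) :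
    B.push (A.ev 1) (B.push A.constHom.toAlgHom.toLinearMap x) = x := by
  have := push_ev_const 1 x
  rwa [Int.cast_one] at this

theorem Joined.refl {x : B.P ⊗[Lam k] A} (hx : B.IsSol A I n x) : B.Joined A I n x x :=
  ⟨_, hx.push A.constHom (fun _ ha => const_formsSub ha), push_ev_zero_const x, push_ev_one_const x⟩

variable {degP : Fin r → ℤ} {p : Fin r → B.P} {F : DGAlg k} {t : Fin r → F} {Ξ : B.P ⊗[Lam k] F}

theorem IsVersal.isSol (hV : IsVersal B degP p n F t Ξ) : B.IsSol F (genIdeal k t) n Ξ :=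
  ⟨hV.mem, hV.master⟩

theorem NilIdeal.pow_filt (hI : NilIdeal A I n) : Filt A I n (fun m => I ^ (m + 1)) n where
  mul_self := hI.mul_self
  hbar_mem := hI.hbar_mem
  pow_eq_bot := hI.pow_eq_bot
  le m := by
    induction m with
    | zero => simp
    | succ m ih =>
      rw [pow_succ]
      exact (mul_le_mul' ih le_rfl).trans hI.mul_self
  anti m := by
    rw [pow_succ, pow_succ, mul_assoc]
    exact mul_le_mul' le_rfl hI.mul_self
  mul_left m := by rw [← pow_succ']
  mul_right m := by rw [← pow_succ]
  pr_mem m := pow_pr_mem hI.pr_mem m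
  d_mem m := by
    induction m with
    | zero => simpa using hI.d_mem
    | succ m ih =>
      intro a ha
      rw [pow_succ] at ha ⊢
      exact mul_d_mem A.isDer (pow_pr_mem hI.pr_mem m) (fun a ha b hb => mul_mem_mul (ih a ha) hb)
        (fun a ha b hb => mul_mem_mul ha (hI.d_mem b hb)) a ha
  eq_bot := hI.pow_eq_bot

theorem NilIdeal.pow_mul_top (hI : NilIdeal A I n) (m : ℕ) : I ^ (m + 1) * ⊤ ≤ I ^ (m + 1) := by
  rw [pow_succ, mul_assoc]
  exact mul_le_mul' le_rfl hI.mul_top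

/-- Every solution is joined to one that is induced from the versal solution. -/
theorem IsVersal.exists_joined [CharZero k] (hV : IsVersal B degP p n F t Ξ) (hI : NilIdeal A I n)
    {π : B.P ⊗[Lam k] A} (hπ : B.IsSol A I n π) : ∃ τ : DGAlg.Hom F A, (∀ j, τ (t j) ∈ I) ∧
      B.Joined A I n (B.push τ.toAlgHom.toLinearMap Ξ) π := by
  have hF := hV.free
  obtain ⟨τ, hτ⟩ := hF.exists_algHom hI.mul_self hI.hbar_mem hI.pow_eq_bot (fun _ => 0)
    (fun _ => zero_mem _) (fun _ => zero_mem _)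
  have hτI : ∀ j, τ (t j) ∈ I := fun j => hτ j ▸ zero_mem _
  have hτm := hF.hom_mem hI.mul_self hI.hbar_mem hτI
  have hsq : genIdeal k t ^ 2 ≤ genIdeal k t := by
    rw [pow_two]; exact hF.model.genIdeal_mul_self
  obtain ⟨τ', ξ, h1, h2, h3, h4, h5, -, -⟩ := hV.exists_path hI (NilIdeal.pow_filt hI)
    (NilIdeal.pow_mul_top hI) (τ := τ) hτI (fun j => hτ j ▸ zero_mem _)
    (fun j => by
      rw [hτ, map_zero, zero_sub, zero_add, pow_one]
      exact neg_mem (hτm (hsq (hV.d_mem j))))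
    (ξ := 0) (zero_mem _)
    (by
      have := master_mem A.forms.isDer hI.forms.mul_top hI.forms.d_mem
        (zero_mem (B.deg A.forms (A.formsSub I) 0)) (show 1 ≤ n + 2 by omega)
      rw [zero_add, pow_one, ← sub_add_cancel (B.master _ _ _ _) (B.m ⊗ₜ 1)]
      exact add_mem (mem_sup_right (deg_le_spanT this)) (mem_sup_left m_mem_annT))
    hπ.mem hπ.master
    (by
      rw [map_zero, zero_sub, zero_add, pow_one]
      exact neg_mem (push_spanT hτm (deg_le_spanT hV.mem)))
    (by
      rw [map_zero, zero_sub, zero_add, pow_one]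
      exact neg_mem (deg_le_spanT hπ.mem))
  exact ⟨τ', h1, ξ, ⟨h2, h3⟩, h4, h5⟩

/-- Interpolation between the restrictions to the ends. -/
def ends (A : DGAlg k) : A.forms →ₗ[Lam k] A.forms :=
  A.affine 1 0 ∘ₗ A.ev ((0 : ℤ) : A) + A.affine 0 1 ∘ₗ A.ev ((1 : ℤ) : A)

/-- The forms that vanish at both ends of the interval. -/
def vanishing (A : DGAlg k) (J : Submodule (Lam k) A) :
    Submodule (Lam k) A.forms :=
  A.formsSub J ⊓ (ker (A.ev ((0 : ℤ) : A)) ⊓ ker (A.ev ((1 : ℤ) : A)))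

theorem mem_vanishing {J : Submodule (Lam k) A} {x : A.forms} :
    x ∈ vanishing A J ↔ x ∈ A.formsSub J ∧ A.ev ((0 : ℤ) : A) x = 0 ∧
      A.ev ((1 : ℤ) : A) x = 0 := Iff.rfl

theorem sub_ends_mem {J : Submodule (Lam k) A} {a : A.forms}
    (ha : a ∈ A.formsSub J) : (LinearMap.id - ends A : A.forms →ₗ[Lam k] A.forms) a ∈ vanishing A J := by
  refine ⟨sub_mem ha (add_mem (affine_formsSub 1 0 (ev_formsSub 0 ha))
    (affine_formsSub 0 1 (ev_formsSub 1 ha))), ?_, ?_⟩ <;>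
  · change A.ev _ (a - (A.affine 1 0 _ + A.affine 0 1 _)) = 0
    rw [map_sub, map_add, ev_affine, ev_affine]
    simp

theorem vanishing_filt {N : ℕ} {J : ℕ → Submodule (Lam k) A} (hI : NilIdeal A I n)
    (hJ : Filt A I n J N) :
    Filt A.forms (A.formsSub I) n (fun m => vanishing A (J m)) N := by
  have h := hJ.forms hI
  exact h.inf le_rfl h.mul_self h.hbar_mem ((Stable.ker (A.evHom 0) _).inf
    (Stable.ker (A.evHom 1) _)) (inf_le_left.trans (h.le 0))

theorem vanishing_mul_top {J : Submodule (Lam k) A} (hJ : J * ⊤ ≤ J) :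
    vanishing A J * ⊤ ≤ vanishing A J := by
  refine mul_le.2 fun b hb a _ => ⟨?_, ((Stable.ker (A.evHom 0) ⊤).inf
    (Stable.ker (A.evHom 1) ⊤)).mul_right a trivial b hb.2⟩
  have : A.formsSub J * ⊤ ≤ A.formsSub J := by
    rw [← formsSub_top]
    exact formsSub_mul (fun _ _ _ => trivial) hJ
  exact this (mul_mem_mul hb.1 trivial)

theorem mem_spanT_vanishing {J : Submodule (Lam k) A} {x : B.P ⊗[Lam k] A.forms}
    (hx : x ∈ B.spanT A.forms (A.formsSub J)) (h0 : B.push (A.ev 0) x = 0)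
    (h1 : B.push (A.ev 1) x = 0) : x ∈ B.spanT A.forms (vanishing A J) := by
  have h2 := push_spanT (f := LinearMap.id - ends A) (fun a ha => sub_ends_mem ha) hx
  have h3 : B.push (LinearMap.id - ends A) x = x := by
    rw [ends, push, lTensor_sub, lTensor_id, LinearMap.sub_apply,
      LinearMap.lTensor_add, lTensor_comp, lTensor_comp, LinearMap.add_apply,
      comp_apply, comp_apply, Int.cast_zero, Int.cast_one]
    change x - (_ + _) = x
    rw [show lTensor B.P (A.ev 0) x = 0 from h0, show lTensor B.P (A.ev 1) x = 0 from h1]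
    simp
  rwa [h3] at h2

variable [CharZero k]

/-- Morphisms whose versal solutions are joined to the ends of a path are homotopic. -/
theorem IsVersal.exists_homotopy (hV : IsVersal B degP p n F t Ξ) (hI : NilIdeal A I n)
    {τ τ' : DGAlg.Hom F A} (hτ : ∀ j, τ (t j) ∈ I) (hτ' : ∀ j, τ' (t j) ∈ I)
    {x y : B.P ⊗[Lam k] A} (hx : B.Joined A I n (B.push τ.toAlgHom.toLinearMap Ξ) x)
    (hxy : B.Joined A I n x y) (hy : B.Joined A I n (B.push τ'.toAlgHom.toLinearMap Ξ) y) :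
    ∃ H : DGAlg.Hom F A.forms, (∀ j, H (t j) ∈ A.formsSub I) ∧ (∀ a, A.ev 0 (H a) = τ a) ∧
      ∀ a, A.ev 1 (H a) = τ' a := by
  obtain ⟨ξ, hξ, hξ0, hξ1⟩ := hx
  obtain ⟨ξ', hξ', hξ'0, hξ'1⟩ := hy
  obtain ⟨η, hη, hη0, hη1⟩ := hxy
  rw [← Int.cast_zero] at hξ0 hξ'0 hη0
  rw [← Int.cast_one] at hξ1 hξ'1 hη1
  have hF := hV.free
  have hIΩ := hI.forms
  have hJ := vanishing_filt hI (NilIdeal.pow_filt hI)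
  have hJt : ∀ m, vanishing A (I ^ (m + 1)) * ⊤ ≤ vanishing A (I ^ (m + 1)) := fun m =>
    vanishing_mul_top (NilIdeal.pow_mul_top hI m)
  have hev : ∀ (s a b : ℤ) (c : A), A.evHom s (A.affine a b c) =
      (a + s * (b - a)) • c := fun s a b c => ev_affine a b s c
  have haI : ∀ j, A.affine 1 0 (τ (t j)) + A.affine 0 1 (τ' (t j)) ∈
      A.formsSub I := fun j => add_mem (affine_formsSub 1 0 (hτ j))
    (affine_formsSub 0 1 (hτ' j))
  have hag : ∀ j, A.affine 1 0 (τ (t j)) + A.affine 0 1 (τ' (t j)) ∈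
      A.forms.gr (-degP j) := fun j => add_mem (affine_gr 1 0 (τ.map_gr (hF.mem j)))
    (affine_gr 0 1 (τ'.map_gr (hF.mem j)))
  obtain ⟨T, hT⟩ := hF.exists_algHom hIΩ.mul_self hIΩ.hbar_mem hIΩ.pow_eq_bot _ haI hag
  have hT0 : (A.evHom 0).toAlgHom.comp T = τ.toAlgHom := hF.algHom_ext fun j => by
    rw [AlgHom.comp_apply, hT, map_add, hev, hev]; simp
  have hT1 : (A.evHom 1).toAlgHom.comp T = τ'.toAlgHom := hF.algHom_ext fun j => by
    rw [AlgHom.comp_apply, hT, map_add, hev, hev]; simp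
  have hTI : ∀ j, T (t j) ∈ A.formsSub I := fun j => hT j ▸ haI j
  have hTm := hF.hom_mem hIΩ.mul_self hIΩ.hbar_mem hTI
  have hsq : genIdeal k t ^ 2 ≤ genIdeal k t := by
    rw [pow_two]; exact hF.model.genIdeal_mul_self
  have hdef : ∀ j, A.forms.d (T (t j)) - T (F.d (t j)) ∈ vanishing A (I ^ (0 + 1)) := fun j => by
    refine mem_vanishing.2 ⟨?_, ?_, ?_⟩
    · rw [zero_add, pow_one]
      exact sub_mem (hIΩ.d_mem _ (hTI j)) (hTm (hsq (hV.d_mem j)))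
    · rw [map_sub, ← evHom_apply, ← evHom_apply, DGAlg.Hom.map_d,
        ← AlgHom.comp_apply, ← AlgHom.comp_apply, hT0, τ.map_d, sub_self]
    · rw [map_sub, ← evHom_apply, ← evHom_apply, DGAlg.Hom.map_d,
        ← AlgHom.comp_apply, ← AlgHom.comp_apply, hT1, τ'.map_d, sub_self]
  set Z := B.push (mapL (A.affine 1 0)) ξ + B.push (mapL (A.affine 0 1)) ξ' with hZ
  have hmapg : ∀ (a b : ℤ) {i : ℤ} {c : A.forms}, c ∈ A.forms.gr i →
      mapL (A.affine a b) c ∈ A.forms.forms.gr i := fun a b i c hc m => by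
    rw [fst_mapL, snd_mapL, coeff_mapPoly, coeff_mapPoly]
    exact ⟨affine_gr a b (hc m).1, affine_gr a b (hc m).2⟩
  have hZm : Z ∈ B.deg A.forms.forms (A.forms.formsSub (A.formsSub I)) 0 :=
    add_mem (push_deg_zero (hmapg 1 0) (fun c hc => mapL_formsSub
        (fun c hc => affine_formsSub 1 0 hc) hc) hξ.mem)
      (push_deg_zero (hmapg 0 1) (fun c hc => mapL_formsSub
        (fun c hc => affine_formsSub 0 1 hc) hc) hξ'.mem)
  have hcompL : ∀ (s a b : ℤ), mapL (A.ev (s : A)) ∘ₗ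
      mapL (A.affine a b) = ((a + s * (b - a) : ℤ) : Lam k) • LinearMap.id :=
    fun s a b => by
      apply LinearMap.ext
      intro c
      rw [comp_apply, mapL_mapL, ev_comp_affine]
      exact forms_ext (fun n => coeff_mapPoly _ _ n) (fun n => coeff_mapPoly _ _ n)
  have hpe : ∀ (s a b : ℤ) (c : B.P ⊗[Lam k] A.forms), B.push (mapL (A.ev (s : A)))
        (B.push (mapL (A.affine a b)) c) = (a + s * (b - a)) • c :=
    fun s a b c => by
      rw [push_push, hcompL, push_smul_id]
  have hZ0 : B.push (mapL (A.ev ((0 : ℤ) : A))) Z = ξ := by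
    rw [hZ, map_add, hpe, hpe]; simp
  have hZ1 : B.push (mapL (A.ev ((1 : ℤ) : A))) Z = ξ' := by
    rw [hZ, map_add, hpe, hpe]; simp
  have hmev : ∀ s : ℤ, B.push (mapL (A.ev (s : A)))
      (B.master A.forms.forms A.forms.forms.d (n + 2) Z) = B.master A.forms A.forms.d (n + 2)
        (B.push (mapL (A.ev (s : A))) Z) := fun s => by
    have := B.push_masterSum (A.evHom s).forms (n + 2) Z
    rwa [← mapL_hom, evHom_toLinearMap] at this
  have hZM : B.master A.forms.forms A.forms.forms.d (n + 2) Z ∈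
      B.annMod A.forms.forms (A.forms.formsSub (vanishing A (I ^ (0 + 1)))) := by
    set M := B.master A.forms.forms A.forms.forms.d (n + 2) Z with hM
    have hM1 : M - B.m ⊗ₜ 1 ∈ B.deg A.forms.forms (A.forms.formsSub (A.formsSub I)) 1 :=
      master_mem A.forms.forms.isDer hIΩ.forms.mul_top hIΩ.forms.d_mem hZm (by omega)
    set Q : A.forms →ₗ[Lam k] A.forms := LinearMap.id - ends A with hQ
    have h1 : B.push (mapL Q) (M - B.m ⊗ₜ 1) ∈
        B.spanT A.forms.forms (A.forms.formsSub (vanishing A (I ^ (0 + 1)))) := by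
      refine push_spanT (fun c hc => mapL_formsSub (fun c hc => ?_) hc) (deg_le_spanT hM1)
      rw [zero_add, pow_one]
      exact sub_ends_mem hc
    have h2 : mapL Q = LinearMap.id - (mapL (A.affine 1 0) ∘ₗ mapL (A.ev ((0 : ℤ) : A)) +
        mapL (A.affine 0 1) ∘ₗ mapL (A.ev ((1 : ℤ) : A))) := by
      apply LinearMap.ext
      intro c
      rw [LinearMap.sub_apply, LinearMap.add_apply, comp_apply, comp_apply, mapL_mapL, mapL_mapL]
      refine forms_ext (fun m => ?_) fun m => ?_
      · change ((mapPoly Q) c.1).coeff m = (c.1 - (mapPoly _ c.1 + mapPoly _ c.1)).coeff m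
        simp only [coeff_sub, coeff_add, coeff_mapPoly]
        rfl
      · change ((mapPoly Q) c.2).coeff m = (c.2 - (mapPoly _ c.2 + mapPoly _ c.2)).coeff m
        simp only [coeff_sub, coeff_add, coeff_mapPoly]
        rfl
    have h3 : ∀ s : ℤ, B.push (mapL (A.ev (s : A))) M ∈ B.annT A.forms →
        B.push (mapL (A.ev (s : A))) (M - B.m ⊗ₜ 1) ∈ B.annT A.forms :=
      fun s hs => by
        rw [map_sub]
        exact sub_mem hs (push_annT m_mem_annT)
    have h4 := h3 0 (by rw [hM, hmev, hZ0]; exact hξ.master)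
    have h5 := h3 1 (by rw [hM, hmev, hZ1]; exact hξ'.master)
    have h6 : M = B.push (mapL Q) (M - B.m ⊗ₜ 1) + (B.push (mapL (A.affine 1 0))
          (B.push (mapL (A.ev ((0 : ℤ) : A))) (M - B.m ⊗ₜ 1)) +
        B.push (mapL (A.affine 0 1)) (B.push (mapL (A.ev ((1 : ℤ) : A))) (M - B.m ⊗ₜ 1)) +
        B.m ⊗ₜ 1) := by
      rw [h2, push_push, push_push]
      rw [push, lTensor_sub, lTensor_id, LinearMap.sub_apply,
        LinearMap.lTensor_add, LinearMap.add_apply, id_apply]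
      abel
    rw [h6]
    exact add_mem (mem_sup_right h1) (mem_sup_left
      (add_mem (add_mem (push_annT h4) (push_annT h5)) m_mem_annT))
  have hends : ∀ {x : B.P ⊗[Lam k] A.forms}, x ∈ B.spanT A.forms (A.formsSub I) →
      B.push (A.ev ((0 : ℤ) : A)) x = 0 → B.push (A.ev ((1 : ℤ) : A)) x = 0 →
      x ∈ B.spanT A.forms (vanishing A (I ^ (0 + 1))) := fun hx h0 h1 => by
    rw [zero_add, pow_one]
    exact mem_spanT_vanishing hx (by rwa [Int.cast_zero] at h0) (by rwa [Int.cast_one] at h1)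
  have hevZ : ∀ s : ℤ, B.push (A.forms.ev (s : A.forms)) Z =
      B.push (A.affine 1 0) (B.push (A.ev (s : A)) ξ) +
      B.push (A.affine 0 1) (B.push (A.ev (s : A)) ξ') := fun s => by
    have h : ∀ a b : ℤ, A.forms.ev (s : A.forms) ∘ₗ mapL (A.affine a b) =
        A.affine a b ∘ₗ A.ev (s : A) := fun a b =>
      LinearMap.ext fun c => DGAlg.ev_mapL (A.affine a b) c s
    rw [hZ, map_add, push_push, push_push, push_push, push_push, h, h]
  have hZI : ∀ s : ℤ, B.push (A.forms.ev (s : A.forms)) Z ∈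
      B.spanT A.forms (A.formsSub I) := fun s =>
    push_spanT (fun c hc => ev_formsSub s hc) (deg_le_spanT hZm)
  have hTΞ : ∀ (s : ℤ), B.push (A.ev (s : A)) (B.push T.toLinearMap Ξ) =
      B.push ((A.evHom s).toAlgHom.comp T).toLinearMap Ξ := fun s => by
    rw [push_push]; rfl
  obtain ⟨H, -, hH, -, -, -, -, hH', -⟩ := hV.exists_path hIΩ hJ hJt hTI
    (hF.hom_gr T (fun j => hT j ▸ hag j) <| hF.mem ·) hdef hZm hZM hη.mem hη.master
    (by
      have h : B.push (A.forms.ev ((0 : ℤ) : A.forms)) Z - B.push T.toLinearMap Ξ ∈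
          B.spanT A.forms (vanishing A (I ^ (0 + 1))) := by
        refine hends (sub_mem (hZI 0) (push_spanT hTm (deg_le_spanT hV.mem))) ?_ ?_
        · rw [map_sub, hevZ, map_add, push_ev_affine, push_ev_affine, hTΞ, hT0, hξ0]; simp
        · rw [map_sub, hevZ, map_add, push_ev_affine, push_ev_affine, hTΞ, hT1, hξ'0]; simp
      rwa [Int.cast_zero] at h)
    (by
      have h : B.push (A.forms.ev ((1 : ℤ) : A.forms)) Z - η ∈
          B.spanT A.forms (vanishing A (I ^ (0 + 1))) := by
        refine hends (sub_mem (hZI 1) (deg_le_spanT hη.mem)) ?_ ?_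
        · rw [map_sub, hevZ, map_add, push_ev_affine, push_ev_affine, hξ1, hη0]; simp
        · rw [map_sub, hevZ, map_add, push_ev_affine, push_ev_affine, hξ'1, hη1]; simp
      rwa [Int.cast_one] at h)
  have hend : ∀ s : ℤ, (∀ j, A.ev (s : A) (H (t j) - T (t j)) = 0) →
      (A.evHom s).toAlgHom.comp H.toAlgHom = (A.evHom s).toAlgHom.comp T := fun s hs =>
    hF.algHom_ext fun j => sub_eq_zero.1 (by
      rw [AlgHom.comp_apply, AlgHom.comp_apply, ← map_sub]; exact hs j)
  refine ⟨H, hH, fun a => ?_, fun a => ?_⟩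
  · have := DFunLike.congr_fun ((hend 0 fun j => (mem_vanishing.1 (hH' j)).2.1).trans hT0) a
    rwa [AlgHom.comp_apply, evHom_apply, Int.cast_zero] at this
  · have := DFunLike.congr_fun ((hend 1 fun j => (mem_vanishing.1 (hH' j)).2.2).trans hT1) a
    rwa [AlgHom.comp_apply, evHom_apply, Int.cast_one] at this

end Paths

end Background

namespace Background

variable {k : Type u} [Field k] {r : ℕ} {B : Background.{u, v, w} k}

theorem QFT.map_eq_of_homotopy {A A' : ParamRing k} {f g : ParamRing.Hom A A'}
    (H : ParamRing.Homotopy f g) (ξ : B.QFT A) : QFT.map B f ξ = QFT.map B g ξ := by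
  induction ξ using Quot.ind with
  | mk x =>
    refine Quot.sound ⟨_, B.push_solutions H.toHom (fun _ h => H.map_max h) x.2, ?_, ?_⟩
    · rw [push_push]
      exact congrFun (congrArg _ (congrArg _ (LinearMap.ext H.ev_zero))) x.1
    · rw [push_push]
      exact congrFun (congrArg _ (congrArg _ (LinearMap.ext H.ev_one))) x.1

theorem homotopic_iff_joined (hB : B.VacuumPure) {A : ParamRing k} {n : ℕ}
    (hA : A.maxIdeal ^ (n + 1) = ⊥) (x y : B.QM A) :
    B.Homotopic A x y ↔ B.Joined A A.maxIdeal n x.1 y.1 :=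
  exists_congr fun _ => and_congr_left fun _ =>
    mem_solutions_iff_isSol hB (A.nilIdeal hA).forms.pow_eq_bot

theorem QM.isSol (hB : B.VacuumPure) {A : ParamRing k} {n : ℕ}
    (hA : A.maxIdeal ^ (n + 1) = ⊥) (x : B.QM A) : B.IsSol A A.maxIdeal n x.1 :=
  (mem_solutions_iff_isSol hB hA).1 x.2

section Artin

variable [CharZero k] {degP : Fin r → ℤ} {p : Fin r → B.P} {n : ℕ} {R A : ParamRing k}
  {t : Fin r → R} {Ξ : B.QM R}

theorem IsVersal.exists_hom_artin (hB : B.VacuumPure)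
    (hV : IsVersal B degP p n R t Ξ.1) (hR : R.maxIdeal = genIdeal k t)
    (hA : A.maxIdeal ^ (n + 1) = ⊥) (ξ : B.QFT A) :
    ∃ τ : ParamRing.Hom R A, QFT.map B τ (Quot.mk _ Ξ) = ξ := by
  induction ξ using Quot.ind with
  | mk x =>
    have hI := A.nilIdeal hA
    obtain ⟨τ, hτ, hj⟩ := hV.exists_joined hI (x.isSol hB hA)
    exact ⟨⟨τ, fun ha => hV.free.hom_mem hI.mul_self hI.hbar_mem hτ (hR ▸ ha)⟩,
      Quot.sound ((homotopic_iff_joined hB hA _ _).2 hj)⟩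

theorem IsVersal.exists_paramHomotopy (hV : IsVersal B degP p n R t Ξ.1)
    (hR : R.maxIdeal = genIdeal k t) (hA : A.maxIdeal ^ (n + 1) = ⊥) {τ τ' : ParamRing.Hom R A}
    {x y : B.P ⊗[Lam k] A}
    (hx : B.Joined A A.maxIdeal n (B.push τ.toAlgHom.toLinearMap Ξ.1) x)
    (hxy : B.Joined A A.maxIdeal n x y)
    (hy : B.Joined A A.maxIdeal n (B.push τ'.toAlgHom.toLinearMap Ξ.1) y) :
    Nonempty (ParamRing.Homotopy τ τ') := by
  have hI := A.nilIdeal hA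
  have hm : ∀ (σ : ParamRing.Hom R A) j, σ (t j) ∈ A.maxIdeal := fun σ j =>
    σ.map_max (hR ▸ gen_mem_genIdeal j)
  obtain ⟨H, h, h0, h1⟩ := hV.exists_homotopy hI (τ := τ.toHom) (τ' := τ'.toHom) (hm τ) (hm τ')
    hx hxy hy
  exact ⟨⟨H, fun ha => hV.free.hom_mem hI.forms.mul_self hI.forms.hbar_mem h (hR ▸ ha), h0, h1⟩⟩

theorem IsVersal.hom_unique_artin (hB : B.VacuumPure)
    (hV : IsVersal B degP p n R t Ξ.1) (hR : R.maxIdeal = genIdeal k t)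
    (hA : A.maxIdeal ^ (n + 1) = ⊥) (τ τ' : ParamRing.Hom R A) :
    QFT.map B τ (Quot.mk _ Ξ) = QFT.map B τ' (Quot.mk _ Ξ) ↔
      Nonempty (ParamRing.Homotopy τ τ') := by
  have hI := A.nilIdeal hA
  have hsol : ∀ σ : ParamRing.Hom R A,
      B.IsSol A A.maxIdeal n (B.push σ.toAlgHom.toLinearMap Ξ.1) := fun σ =>
    (QM.map B σ Ξ).isSol hB hA
  have hrefl : ∀ σ : ParamRing.Hom R A, B.Joined A A.maxIdeal n
      (B.push σ.toAlgHom.toLinearMap Ξ.1) (B.push σ.toAlgHom.toLinearMap Ξ.1) := fun σ =>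
    Joined.refl (hsol σ)
  have hjoin : ∀ {σ σ' : ParamRing.Hom R A}, Nonempty (ParamRing.Homotopy σ σ') →
      B.Joined A A.maxIdeal n
      (B.push σ.toAlgHom.toLinearMap Ξ.1) (B.push σ'.toAlgHom.toLinearMap Ξ.1) := by
    rintro σ σ' ⟨H⟩
    refine ⟨_, IsSol.push H.toHom (I' := A.formsSub A.maxIdeal) (fun _ h => H.map_max h)
      (by rw [hR]; exact hV.isSol), ?_, ?_⟩
    · rw [push_push]
      exact congrFun (congrArg _ (congrArg _ (LinearMap.ext H.ev_zero))) Ξ.1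
    · rw [push_push]
      exact congrFun (congrArg _ (congrArg _ (LinearMap.ext H.ev_one))) Ξ.1
  refine ⟨fun h => ?_, fun ⟨H⟩ => QFT.map_eq_of_homotopy H _⟩
  have key : ∀ x y : B.QM A, Relation.EqvGen (B.Homotopic A) x y → ∀ σ σ' : ParamRing.Hom R A,
      B.Joined A A.maxIdeal n (B.push σ.toAlgHom.toLinearMap Ξ.1) x.1 →
      B.Joined A A.maxIdeal n (B.push σ'.toAlgHom.toLinearMap Ξ.1) y.1 →
      Nonempty (ParamRing.Homotopy σ σ') := by
    intro x y hxy
    induction hxy with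
    | rel x y h =>
      intro σ σ' hx hy
      exact hV.exists_paramHomotopy hR hA hx ((homotopic_iff_joined hB hA _ _).1 h) hy
    | refl x =>
      intro σ σ' hx hy
      exact hV.exists_paramHomotopy hR hA hx (Joined.refl (x.isSol hB hA)) hy
    | symm x y _ ih =>
      intro σ σ' hx hy
      exact hV.exists_paramHomotopy hR hA (hrefl σ) (hrefl σ) (hjoin (ih σ' σ hy hx))
    | trans x y z _ _ ih1 ih2 =>
      intro σ σ'' hx hz
      obtain ⟨σ', hσ', hy⟩ := hV.exists_joined hI (y.isSol hB hA)
      let s : ParamRing.Hom R A :=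
        ⟨σ', fun ha => hV.free.hom_mem hI.mul_self hI.hbar_mem hσ' (hR ▸ ha)⟩
      exact hV.exists_paramHomotopy hR hA (hjoin (ih1 σ s hx hy)) (hjoin (ih2 s σ'' hy hz))
        (hrefl σ'')
  exact key _ _ (Quot.eqvGen_exact h) τ τ' (hrefl τ) (hrefl τ')

end Artin

end Background

namespace ParamRing

variable {k : Type u} [Field k]

/-- Composition of morphisms of parameter rings. -/
def Hom.comp {A B C : ParamRing k} (g : Hom B C) (f : Hom A B) : Hom A C where
  toAlgHom := g.toAlgHom.comp f.toAlgHom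
  map_gr h := g.map_gr (f.map_gr h)
  map_d a := by simp [f.map_d, g.map_d]
  map_max h := g.map_max (f.map_max h)

theorem Hom.exists_lift {A C : ParamRing k} {f : Hom A C} (hf : Function.Surjective f.toAlgHom)
    {i : ℤ} {c : C} (hc : c ∈ C.maxIdeal) (hci : c ∈ C.gr i) :
    ∃ a ∈ A.maxIdeal, a ∈ A.gr i ∧ f a = c := by
  obtain ⟨a, ha⟩ := hf c
  have ham : a ∈ A.maxIdeal := by
    obtain ⟨s, hs, -⟩ := A.residue a
    have h1 := f.map_max hs
    rw [map_sub, ha, f.toAlgHom.commutes] at h1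
    have h2 := sub_mem hc h1
    rw [sub_sub_cancel] at h2
    by_cases h : s = 0
    · simpa [h] using hs
    · exact absurd h2 (C.algebraMap_C_notMem h)
  refine ⟨pr A.gr_internal i a, A.pr_mem_max i a ham, pr_mem _ _ _, ?_⟩
  rw [f.map_pr, ha, pr_of_mem _ hci]

theorem forms_exists_lift {D E : DGAlg k} (f : DGAlg.Hom D E) {i : ℤ}
    {J : Submodule (Lam k) D} {K : Submodule (Lam k) E}
    (h : ∀ i, ∀ c ∈ K, c ∈ E.gr i → ∃ a ∈ J, a ∈ D.gr i ∧ f a = c)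
    {c : E.forms} (hc : c ∈ E.formsSub K) (hci : c ∈ E.forms.gr i) :
    ∃ a ∈ D.formsSub J, a ∈ D.forms.gr i ∧ f.forms a = c := by
  have key : ∀ (i : ℤ) (q : E[X]), (∀ n, q.coeff n ∈ K ∧ q.coeff n ∈ E.gr i) →
      ∃ q' : D[X], (∀ n, q'.coeff n ∈ J ∧ q'.coeff n ∈ D.gr i) ∧
        ∀ n, f (q'.coeff n) = q.coeff n := by
    intro i q hq
    choose a ha ha' hfa using fun n => h i (q.coeff n) (hq n).1 (hq n).2
    have hcoef : ∀ n, (∑ m ∈ q.support, monomial m (a m)).coeff n =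
        if n ∈ q.support then a n else 0 := fun n => by
      simp [coeff_monomial]
    refine ⟨∑ m ∈ q.support, monomial m (a m), fun n => ?_, fun n => ?_⟩
    · rw [hcoef]
      split
      · exact ⟨ha n, ha' n⟩
      · exact ⟨zero_mem _, zero_mem _⟩
    · rw [hcoef]
      split_ifs with hn
      · exact hfa n
      · rw [map_zero, Polynomial.notMem_support_iff.1 hn]
  obtain ⟨q1, h1, h1'⟩ := key i c.1 fun n => ⟨(hc n).1, (hci n).1⟩
  obtain ⟨q2, h2, h2'⟩ := key (i - 1) c.2 fun n => ⟨(hc n).2, (hci n).2⟩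
  refine ⟨(q1, q2), fun n => ⟨(h1 n).1, (h2 n).1⟩, fun n => ⟨(h1 n).2, (h2 n).2⟩, ?_⟩
  refine (LinearMap.congr_fun (mapL_hom f) (q1, q2)).symm.trans ?_
  exact forms_ext (fun n => (coeff_mapPoly _ _ n).trans (h1' n))
    fun n => (coeff_mapPoly _ _ n).trans (h2' n)

end ParamRing

namespace DGAlg

variable {k : Type u} [Field k] {A A' A'' : DGAlg k}

open PolyForm

theorem mapL_gr {f : A →ₗ[Lam k] A'} {c : ℤ}
    (hf : ∀ i, ∀ a ∈ A.gr i, f a ∈ A'.gr (i + c)) {i : ℤ} {x : A.forms}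
    (hx : x ∈ A.forms.gr i) : mapL f x ∈ A'.forms.gr (i + c) := fun n => by
  rw [fst_mapL, snd_mapL, coeff_mapPoly, coeff_mapPoly]
  refine ⟨hf _ _ (hx n).1, ?_⟩
  rw [add_sub_right_comm]
  exact hf _ _ (hx n).2

theorem fst_forms_d (x : A.forms) (n : ℕ) :
    (A.forms.d x).1.coeff n = A.d (x.1.coeff n) := coeff_dPoly x.1 n

theorem snd_forms_d (x : A.forms) (n : ℕ) : (A.forms.d x).2.coeff n =
    A.d (x.2.coeff n) + (n + 1) • A.par (x.1.coeff (n + 1)) := by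
  change (dPoly A x.2 + parPoly A (deriv A x.1)).coeff n = _
  rw [coeff_add, coeff_dPoly, coeff_parPoly, coeff_deriv, ← Nat.cast_succ,
    ← nsmul_eq_mul', map_nsmul]

theorem d_mapL {g : A →ₗ[Lam k] A'} (hg : ∀ a, g (A.par a) = -A'.par (g a))
    (x : A.forms) : A'.forms.d (mapL g x) + mapL g (A.forms.d x) =
      mapL (A'.d ∘ₗ g + g ∘ₗ A.d) x := by
  have h1 : ∀ (p q : A'.forms) n, (p + q).1.coeff n = p.1.coeff n + q.1.coeff n :=
    fun p q n => coeff_add _ _ _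
  have h2 : ∀ (p q : A'.forms) n, (p + q).2.coeff n = p.2.coeff n + q.2.coeff n :=
    fun p q n => coeff_add _ _ _
  refine forms_ext (fun n => ?_) (fun n => ?_)
  · rw [h1, fst_forms_d, fst_mapL, fst_mapL, coeff_mapPoly, coeff_mapPoly, fst_forms_d, fst_mapL,
      coeff_mapPoly]
    rfl
  · rw [h2, snd_forms_d, snd_mapL, snd_mapL, fst_mapL, coeff_mapPoly, coeff_mapPoly, coeff_mapPoly,
      snd_forms_d, snd_mapL, coeff_mapPoly, map_add, map_nsmul, hg, LinearMap.add_apply,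
      comp_apply, comp_apply, smul_neg]
    abel

theorem forms_const (f : Hom A A') (a : A) :
    f.forms (A.constHom a) = A'.constHom (f a) :=
  PolyForm.ext (Polynomial.map_C _) (Polynomial.map_zero _)

theorem forms_affine (f : Hom A A') (a b : ℤ) (x : A) :
    f.forms (A.affine a b x) = A'.affine a b (f x) := by
  rw [← toLinearMap_apply, ← mapL_hom]
  refine forms_ext (fun n => ?_) (fun n => ?_)
  · rw [fst_mapL, coeff_mapPoly, affine_fst, affine_fst]
    simp only [coeff_add, coeff_smul, coeff_monomial, map_add, map_zsmul, toLinearMap_apply]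
    split_ifs <;> simp
  · rw [snd_mapL, affine_snd, affine_snd, map_zero]

theorem forms_mapL (f : Hom A A') {g : A →ₗ[Lam k] A}
    {g' : A' →ₗ[Lam k] A'} (h : ∀ a, f (g a) = g' (f a))
    (x : A.forms) :
    f.forms (mapL g x) = mapL g' (f.forms x) := by
  rw [← toLinearMap_apply, ← toLinearMap_apply, ← mapL_hom, mapL_mapL, mapL_mapL]
  exact congrFun (congrArg _ (congrArg _ (LinearMap.ext h))) x

theorem forms_sigma (f : Hom A A') (s : ℤ) (x : A.forms) :
    f.forms (A.sigma s x) = A'.sigma s (f.forms x) := by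
  rw [← toLinearMap_apply, ← toLinearMap_apply, ← mapL_hom]
  exact mapL_sigma _ f.map_par s x

theorem evHom_mapL (f : A →ₗ[Lam k] A') (s : ℤ) (x : A.forms) :
    (A'.evHom s) (mapL f x) = f (A.evHom s x) := ev_mapL f x s

theorem evHom_forms (f : Hom A A') (s : ℤ) (x : A.forms) :
    (A'.evHom s) (f.forms x) = f (A.evHom s x) :=
  f.ev_forms s x

theorem evHom_const (s : ℤ) (a : A) : A.evHom s (A.constHom a) = a := ev_const s a

theorem evHom_sigma (s : ℤ) (x : A.forms) : A.evHom s (A.sigma s x) = 0 := ev_sigma s x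

theorem evHom_affine (a b s : ℤ) (x : A) :
    A.evHom s (A.affine a b x) = (a + s * (b - a)) • x := ev_affine a b s x

theorem sigma_par (s : ℤ) (x : A.forms) :
    A.sigma s (A.forms.par x) = -A.forms.par (A.sigma s x) := by
  refine graded_ind A.forms.gr_internal
    (p := fun x => A.sigma s (A.forms.par x) = -A.forms.par (A.sigma s x)) (by simp)
    (fun x y hx hy => by rw [map_add, map_add, map_add, map_add, hx, hy, neg_add])
    (fun i x hx => ?_) x
  rw [par, parity_of_mem _ hx, parity_of_mem _ (sigma_gr s hx), sgn_pred, map_zsmul, neg_smul,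
    neg_neg]

variable (A) in
/-- The form `a v` on the interval. -/
def vform : A →ₗ[Lam k] A.forms :=
  PolyForm.inr A ∘ₗ (Polynomial.CAlgHom (R := Lam k) (A := A)).toLinearMap

theorem vform_fst (a : A) : (A.vform a).1 = 0 := rfl

theorem vform_snd (a : A) : (A.vform a).2 = Polynomial.C a := rfl

theorem parPoly_C (a : A) : parPoly A (Polynomial.C a) = Polynomial.C (A.par a) := by
  ext n
  rw [coeff_parPoly, coeff_C, coeff_C]
  split <;> simp

theorem const_mul_vform (a b : A) :
    A.constHom a * A.vform b = A.vform (a * b) := by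
  apply PolyForm.ext
  · exact mul_zero _
  · change Polynomial.C a * Polynomial.C b + 0 * parPoly A 0 = Polynomial.C (a * b)
    rw [zero_mul, add_zero, Polynomial.C_mul]

theorem vform_mul_const (a b : A) :
    A.vform a * A.constHom b = A.vform (a * A.par b) := by
  apply PolyForm.ext
  · exact zero_mul _
  · change 0 * 0 + Polynomial.C a * parPoly A (Polynomial.C b) = Polynomial.C (a * A.par b)
    rw [zero_mul, zero_add, parPoly_C, Polynomial.C_mul]

theorem vform_mul_vform (a b : A) : A.vform a * A.vform b = 0 := by
  apply PolyForm.ext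
  · exact zero_mul _
  · change 0 * Polynomial.C b + Polynomial.C a * parPoly A 0 = 0
    rw [zero_mul, zero_add, map_zero, mul_zero]

theorem d_vform (a : A) : A.forms.d (A.vform a) = A.vform (A.d a) := by
  refine forms_ext (fun n => ?_) (fun n => ?_)
  · rw [fst_forms_d, vform_fst, vform_fst, Polynomial.coeff_zero, map_zero]
  · rw [snd_forms_d, vform_snd, vform_snd, vform_fst, coeff_C, coeff_C,
      Polynomial.coeff_zero, map_zero, smul_zero, add_zero]
    split <;> simp

theorem pr_vform (i : ℤ) (a : A) :
    pr A.forms.gr_internal i (A.vform a) = A.vform (pr A.gr_internal (i - 1) a) := by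
  rw [forms_pr]
  refine forms_ext (fun n => ?_) (fun n => ?_)
  · change (mapPoly _ (A.vform a).1).coeff n = _
    rw [coeff_mapPoly, vform_fst, vform_fst, Polynomial.coeff_zero, map_zero]
  · change (mapPoly _ (A.vform a).2).coeff n = _
    rw [coeff_mapPoly, vform_snd, vform_snd, coeff_C, coeff_C]
    split <;> simp

theorem evHom_vform (s : ℤ) (a : A) : A.evHom s (A.vform a) = 0 :=
  Polynomial.eval_zero

theorem vform_mem_formsSub {I : Submodule (Lam k) A} {a : A} :
    A.vform a ∈ A.formsSub I ↔ a ∈ I := by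
  constructor
  · intro h
    simpa [vform_snd] using (h 0).2
  · intro h n
    rw [vform_fst, vform_snd, coeff_C, Polynomial.coeff_zero]
    refine ⟨zero_mem _, ?_⟩
    split
    · exact h
    · exact zero_mem _

theorem forms_vform (f : Hom A A') (a : A) :
    f.forms (A.vform a) = A'.vform (f a) :=
  PolyForm.ext (Polynomial.map_zero _) (Polynomial.map_C _)

theorem sigma_vform (a : A) : A.sigma 0 (A.vform a) = A.affine 0 1 (A.par a) := by
  refine forms_ext (fun n => ?_) (fun n => ?_)
  · rw [fst_sigma, affine_fst, vform_snd, coeff_parPoly, Int.cast_zero,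
      ← Polynomial.coeff_zero_eq_eval_zero, coeff_integ_zero, map_zero, sub_zero, zero_smul,
      zero_add, sub_zero, one_smul, coeff_monomial]
    rcases n with _ | n
    · simp
    · rw [coeff_integ_succ, coeff_C]
      rcases n with _ | n <;> simp
  · rw [snd_sigma, affine_snd]

theorem d_affine (a b : ℤ) (x : A) :
    A.forms.d (A.affine a b x) = A.affine a b (A.d x) + (b - a) • A.vform (A.par x) := by
  refine forms_ext (fun n => ?_) (fun n => ?_)
  · change _ = ((A.affine a b (A.d x)).1 + (b - a) • (0 : A[X])).coeff n
    rw [fst_forms_d, smul_zero, add_zero, affine_fst, affine_fst]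
    simp only [coeff_add, coeff_smul, coeff_monomial, map_add, map_zsmul]
    split_ifs <;> simp
  · change _ = ((A.affine a b (A.d x)).2 + (b - a) • (Polynomial.C (A.par x))).coeff n
    rw [snd_forms_d, affine_snd, affine_snd, affine_fst]
    simp only [coeff_add, coeff_smul, coeff_monomial, map_add,
      map_zsmul, coeff_C, Polynomial.coeff_zero, map_zero, zero_add]
    rcases n with _ | n <;> simp

variable (A) in
/-- Integration of forms that vanish at both ends of the interval, corrected by a linear function
so that the result vanishes at both ends. -/
def relSigma : A.forms →ₗ[Lam k] A.forms :=
  A.sigma 0 - A.affine 0 1 ∘ₗ (A.evHom 1).toAlgHom.toLinearMap ∘ₗ A.sigma 0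

theorem relSigma_apply (x : A.forms) : A.relSigma x =
    A.sigma 0 x - A.affine 0 1 (A.evHom 1 (A.sigma 0 x)) := rfl

theorem evHom_zero_relSigma (x : A.forms) :
    A.evHom 0 (A.relSigma x) = 0 := by
  rw [relSigma_apply, map_sub, evHom_sigma, evHom_affine]
  simp

theorem evHom_one_relSigma (x : A.forms) :
    A.evHom 1 (A.relSigma x) = 0 := by
  rw [relSigma_apply, map_sub, evHom_affine]
  simp

theorem relSigma_vform (a : A) : A.relSigma (A.vform a) = 0 := by
  rw [relSigma_apply, sigma_vform, evHom_affine]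
  simp

theorem relSigma_gr {i : ℤ} {x : A.forms} (hx : x ∈ A.forms.gr i) :
    A.relSigma x ∈ A.forms.gr (i - 1) :=
  sub_mem (sigma_gr 0 hx) (affine_gr 0 1 ((A.evHom 1).map_gr (sigma_gr 0 hx)))

theorem relSigma_formsSub {I : Submodule (Lam k) A}
    (hI : ∀ i, ∀ a ∈ I, pr A.gr_internal i a ∈ I) {x : A.forms}
    (hx : x ∈ A.formsSub I) : A.relSigma x ∈ A.formsSub I :=
  sub_mem (sigma_formsSub hI 0 hx) (affine_formsSub 0 1 (ev_formsSub 1 (sigma_formsSub hI 0 hx)))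

theorem d_relSigma [CharZero k] {x : A.forms} (h0 : A.evHom 0 x = 0)
    (h1 : A.evHom 1 x = 0) : A.forms.d (A.relSigma x) + A.relSigma (A.forms.d x) =
      x - A.vform (A.par (A.evHom 1 (A.sigma 0 x))) := by
  have h := d_sigma (A := A) 0 x
  rw [← evHom_apply, h0, map_zero, sub_zero] at h
  have h2 := congrArg (A.evHom 1).toAlgHom h
  rw [map_add, h1, (A.evHom 1).map_d] at h2
  rw [relSigma_apply, relSigma_apply, map_sub, d_affine, eq_neg_of_add_eq_zero_left h2, map_neg,
    sub_zero, one_smul]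
  refine Eq.trans ?_ (congrArg (· - A.vform (A.par (A.evHom 1 (A.sigma 0 x)))) h)
  abel

end DGAlg

namespace DGAlg

variable {k : Type u} [Field k] {A A' A'' C : DGAlg k}

open PolyForm

/-- Composition of morphisms. -/
def Hom.comp (g : Hom A' A'') (f : Hom A A') : Hom A A'' where
  toAlgHom := g.toAlgHom.comp f.toAlgHom
  map_gr h := g.map_gr (f.map_gr h)
  map_d a := by simp [f.map_d, g.map_d]

theorem forms_congr {f : Hom A A'} {g : Hom A' C} {f' : Hom A A''} {g' : Hom A'' C}
    (h : ∀ a, g (f a) = g' (f' a)) (x : A.forms) :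
    g.forms (f.forms x) = g'.forms (f'.forms x) := by
  simp only [← toLinearMap_apply, ← mapL_hom, mapL_mapL]
  exact congrFun (congrArg _ (congrArg _ (LinearMap.ext h))) x

theorem mem_formsSub_ker {f : Hom A A'} {x : A.forms} :
    x ∈ A.formsSub (ker f.toAlgHom.toLinearMap) ↔ f.forms x = 0 := by
  rw [← toLinearMap_apply, ← mapL_hom]
  constructor
  · intro hx
    refine forms_ext (fun n => ?_) (fun n => ?_)
    · rw [fst_mapL, coeff_mapPoly]; exact (hx n).1
    · rw [snd_mapL, coeff_mapPoly]; exact (hx n).2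
  · intro hx n
    have h1 := congrArg (fun y : A'.forms => y.1.coeff n) hx
    have h2 := congrArg (fun y : A'.forms => y.2.coeff n) hx
    simp only [fst_mapL, snd_mapL, coeff_mapPoly] at h1 h2
    exact ⟨h1, h2⟩

theorem mapL_eq_self {f : A →ₗ[Lam k] A} {x : A.forms}
    {J : Submodule (Lam k) A} (hx : x ∈ A.formsSub J) (h : ∀ a ∈ J, f a = a) :
    mapL f x = x :=
  forms_ext (fun n => by rw [fst_mapL, coeff_mapPoly, h _ (hx n).1])
    (fun n => by rw [snd_mapL, coeff_mapPoly, h _ (hx n).2])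

theorem d_mapL_sigma [CharZero k] (s : ℤ) {x : A.forms.forms}
    (h : (A.evHom s).forms x = 0) : A.forms.forms.d (mapL (A.sigma s) x) +
      mapL (A.sigma s) (A.forms.forms.d x) = x := by
  rw [d_mapL (sigma_par s)]
  refine mapL_eq_self (mem_formsSub_ker.2 h) fun a ha => ?_
  rw [LinearMap.add_apply, comp_apply, comp_apply, d_sigma, ← evHom_apply,
    show (A.evHom s) a = 0 from ha, map_zero, sub_zero]

theorem mapL_sigma_gr (s : ℤ) {i : ℤ} {x : A.forms.forms} (hx : x ∈ A.forms.forms.gr i) :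
    mapL (A.sigma s) x ∈ A.forms.forms.gr (i - 1) :=
  mapL_gr (c := -1) (fun _ _ ha => sigma_gr s ha) hx

theorem evHom_forms_mapL_sigma (s : ℤ) (x : A.forms.forms) :
    (A.evHom s).forms (mapL (A.sigma s) x) = 0 := by
  refine mem_formsSub_ker.1 fun n => ?_
  rw [fst_mapL, snd_mapL, coeff_mapPoly, coeff_mapPoly]
  exact ⟨evHom_sigma s _, evHom_sigma s _⟩

theorem evHom_forms_mapL_affine (a b s : ℤ) (x : A.forms) :
    (A.evHom s).forms (mapL (A.affine a b) x) = (a + s * (b - a)) • x := by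
  rw [← toLinearMap_apply, ← mapL_hom, mapL_mapL]
  refine forms_ext (fun n => ?_) (fun n => ?_)
  · rw [fst_mapL, coeff_mapPoly]
    refine (evHom_affine a b s _).trans ?_
    exact (coeff_smul _ _ _).symm
  · rw [snd_mapL, coeff_mapPoly]
    refine (evHom_affine a b s _).trans ?_
    exact (coeff_smul _ _ _).symm

theorem affine_add (a b c d : ℤ) (x : A) :
    A.affine a b x + A.affine c d x = A.affine (a + c) (b + d) x := by
  apply PolyForm.ext
  · change (A.affine a b x).1 + (A.affine c d x).1 = (A.affine (a + c) (b + d) x).1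
    rw [affine_fst, affine_fst, affine_fst]
    module
  · change (A.affine a b x).2 + (A.affine c d x).2 = (A.affine (a + c) (b + d) x).2
    rw [affine_snd, affine_snd, affine_snd, add_zero]

theorem stable_range_vform : Stable A.forms (range (A.constHom.toAlgHom.toLinearMap.coprod A.vform))
      (range A.vform) where
  mul_left := by
    rintro _ ⟨⟨a, b⟩, rfl⟩ _ ⟨c, rfl⟩
    refine ⟨a * c, ?_⟩
    rw [LinearMap.coprod_apply, add_mul, vform_mul_vform, add_zero, toLinearMap_apply,
      const_mul_vform]
  mul_right := by
    rintro _ ⟨⟨a, b⟩, rfl⟩ _ ⟨c, rfl⟩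
    refine ⟨c * A.par a, ?_⟩
    rw [LinearMap.coprod_apply, mul_add, vform_mul_vform, add_zero, toLinearMap_apply,
      vform_mul_const]
  pr_mem := by
    rintro i _ ⟨c, rfl⟩
    exact ⟨_, (pr_vform i c).symm⟩
  d_mem := by
    rintro _ ⟨c, rfl⟩
    exact ⟨_, (d_vform c).symm⟩

theorem range_const_vform_mul_self : range (A.constHom.toAlgHom.toLinearMap.coprod A.vform) *
      range (A.constHom.toAlgHom.toLinearMap.coprod A.vform) ≤
      range (A.constHom.toAlgHom.toLinearMap.coprod A.vform) := by
  rw [mul_le]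
  rintro _ ⟨⟨a, b⟩, rfl⟩ _ ⟨⟨a', b'⟩, rfl⟩
  refine ⟨(a * a', a * b' + b * A.par a'), ?_⟩
  simp only [LinearMap.coprod_apply, toLinearMap_apply]
  rw [add_mul, mul_add, mul_add, vform_mul_vform, const_mul_vform, vform_mul_const, map_mul,
    map_add, add_zero, add_assoc]

end DGAlg

section Box

variable {k : Type u} [Field k] {r : ℕ} {deg : Fin r → ℤ} {n : ℕ}
  {S A C D E : DGAlg k} {t : Fin r → S} {I : Submodule (Lam k) A}

theorem IsFree.defect_mem_ker (hF : IsFree deg n S t) {T : S →ₐ[Lam k] D}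
    {g : DGAlg.Hom D E} {y : DGAlg.Hom S E} (h : ∀ j, g (T (t j)) = y (t j))
    (x : S) : D.d (T x) - T (S.d x) ∈ ker g.toAlgHom.toLinearMap := by
  change g _ = 0
  have h' : g.toAlgHom.comp T = y.toAlgHom := hF.algHom_ext h
  rw [map_sub, g.map_d, ← AlgHom.comp_apply, ← AlgHom.comp_apply, h', y.map_d, sub_self]

theorem IsFree.defect_mem_of_mem (hF : IsFree deg n S t) {I : Submodule (Lam k) D} (hI : I * I ≤ I)
    (hħ : algebraMap (Lam k) D (hbar k) ∈ I) (hdI : ∀ a ∈ I, D.d a ∈ I)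
    (hmin : ∀ j, S.d (t j) ∈ genIdeal k t ^ 2)
    {T : S →ₐ[Lam k] D} (hT : ∀ j, T (t j) ∈ I) (j : Fin r) :
    D.d (T (t j)) - T (S.d (t j)) ∈ I := by
  refine sub_mem (hdI _ (hT j)) (hF.hom_mem hI hħ hT ?_)
  have h := hmin j
  rw [sq] at h
  exact (mul_le_mul' le_top le_rfl).trans top_mul_genIdeal h

open DGAlg DGAlg.PolyForm

variable [CharZero k]

/-- Two homotopies between the same morphisms are the opposite sides of a square, the remaining
sides of which are a constant homotopy and a homotopy of the form `τ + θ v`. -/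
theorem IsFree.exists_box (hF : IsFree deg n S t) (hmin : ∀ j, S.d (t j) ∈ genIdeal k t ^ 2)
    (hI : NilIdeal A I n) {τ τ' : DGAlg.Hom S A} {x y : DGAlg.Hom S A.forms}
    (hx : ∀ j, x (t j) ∈ A.formsSub I) (hy : ∀ j, y (t j) ∈ A.formsSub I)
    (hx0 : ∀ j, A.evHom 0 (x (t j)) = τ (t j))
    (hx1 : ∀ j, A.evHom 1 (x (t j)) = τ' (t j))
    (hy0 : ∀ j, A.evHom 0 (y (t j)) = τ (t j))
    (hy1 : ∀ j, A.evHom 1 (y (t j)) = τ' (t j)) :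
    ∃ (W : DGAlg.Hom S A.forms.forms) (θ : Fin r → A), (∀ j, θ j ∈ I) ∧
      (∀ j, W (t j) ∈ A.forms.formsSub (A.formsSub I)) ∧
      (∀ j, (A.evHom 0).forms (W (t j)) = x (t j)) ∧ (∀ j, (A.evHom 1).forms (W (t j)) = y (t j)) ∧
      (∀ j, A.forms.evHom 1 (W (t j)) = A.constHom (τ' (t j))) ∧ ∀ j, A.forms.evHom 0 (W (t j)) =
        A.constHom (τ (t j)) + A.vform (θ j) := by
  have hP := Background.NilIdeal.pow_filt hI
  have hPΩ : Filt A.forms.forms (A.forms.formsSub (A.formsSub I)) n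
    (fun m => A.forms.formsSub (A.formsSub (I ^ (m + 1)))) n := (hP.forms hI).forms hI.forms
  have hIpr : ∀ m i, ∀ a ∈ A.formsSub (I ^ (m + 1)), pr A.forms.gr_internal i a ∈
      A.formsSub (I ^ (m + 1)) := fun m => (hP.forms hI).pr_mem m
  set Q := range (A.constHom.toAlgHom.toLinearMap.coprod A.vform) with hQ
  set I' := A.forms.formsSub (A.formsSub I) ⊓ Q.comap (A.forms.evHom 0).toAlgHom.toLinearMap
    with hI'
  have hI'mem : ∀ z, z ∈ I' ↔ z ∈ A.forms.formsSub (A.formsSub I) ∧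
    A.forms.evHom 0 z ∈ Q := fun _ => Iff.rfl
  set K := ker (A.evHom 0).forms.toAlgHom.toLinearMap ⊓
    (ker (A.evHom 1).forms.toAlgHom.toLinearMap ⊓ (ker (A.forms.evHom 1).toAlgHom.toLinearMap ⊓
    (range A.vform).comap (A.forms.evHom 0).toAlgHom.toLinearMap)) with hK
  have hKmem : ∀ z, z ∈ K ↔ (A.evHom 0).forms z = 0 ∧
    (A.evHom 1).forms z = 0 ∧ A.forms.evHom 1 z = 0 ∧
    ∃ a, A.vform a = A.forms.evHom 0 z := fun _ => Iff.rfl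
  have hVQ : ∀ a, A.vform a ∈ Q := fun a => ⟨(0, a), by simp⟩
  have hcQ : ∀ a, A.constHom a ∈ Q := fun a => ⟨(a, 0), by simp⟩
  have hħ : algebraMap (Lam k) A.forms.forms (hbar k) ∈ I' := by
    refine (hI'mem _).2 ⟨hI.forms.forms.hbar_mem, ?_⟩
    rw [(A.forms.evHom 0).toAlgHom.commutes, ← A.constHom.toAlgHom.commutes]
    exact hcQ _
  have hmul : I' * I' ≤ I' := by
    rw [mul_le]
    intro a ha b hb
    rw [hI'mem] at ha hb ⊢
    refine ⟨hI.forms.forms.mul_self (mul_mem_mul ha.1 hb.1), ?_⟩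
    rw [map_mul]
    exact range_const_vform_mul_self (mul_mem_mul ha.2 hb.2)
  have hFilt := hPΩ.inf (I' := I') (K := K) inf_le_left hmul hħ
    ((Stable.ker _ _).inf ((Stable.ker _ _).inf ((Stable.ker _ _).inf
      (Stable.comap _ (fun a ha => ha.2) stable_range_vform))))
    (fun z hz => by
      rw [zero_add, pow_one] at hz
      obtain ⟨h1, -, -, -, a, ha⟩ := hz
      exact (hI'mem _).2 ⟨h1, ha ▸ hVQ a⟩)
  have hω : ∀ j, mapL (A.affine 1 0) (x (t j)) + mapL (A.affine 0 1) (y (t j)) ∈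
      A.forms.formsSub (A.formsSub I) := fun j =>
    add_mem (mapL_formsSub (fun a ha => affine_formsSub 1 0 ha) (hx j))
      (mapL_formsSub (fun a ha => affine_formsSub 0 1 ha) (hy j))
  have hω0 : ∀ j, A.forms.evHom 0 (mapL (A.affine 1 0) (x (t j)) +
      mapL (A.affine 0 1) (y (t j))) = A.constHom (τ (t j)) := fun j => by
    rw [map_add, evHom_mapL, evHom_mapL, hx0, hy0, affine_add, ← affine_one_one]
    rfl
  have hω1 : ∀ j, A.forms.evHom 1 (mapL (A.affine 1 0) (x (t j)) +
      mapL (A.affine 0 1) (y (t j))) = A.constHom (τ' (t j)) := fun j => by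
    rw [map_add, evHom_mapL, evHom_mapL, hx1, hy1, affine_add, ← affine_one_one]
    rfl
  have hωx : ∀ j, (A.evHom 0).forms (mapL (A.affine 1 0) (x (t j)) +
      mapL (A.affine 0 1) (y (t j))) = x (t j) := fun j => by
    rw [map_add, evHom_forms_mapL_affine, evHom_forms_mapL_affine]
    simp
  have hωy : ∀ j, (A.evHom 1).forms (mapL (A.affine 1 0) (x (t j)) +
      mapL (A.affine 0 1) (y (t j))) = y (t j) := fun j => by
    rw [map_add, evHom_forms_mapL_affine, evHom_forms_mapL_affine]
    simp
  have hωI : ∀ j, mapL (A.affine 1 0) (x (t j)) + mapL (A.affine 0 1) (y (t j)) ∈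
      I' := fun j => (hI'mem _).2 ⟨hω j, by rw [hω0]; exact hcQ _⟩
  have hωg : ∀ j, mapL (A.affine 1 0) (x (t j)) + mapL (A.affine 0 1) (y (t j)) ∈
      A.forms.forms.gr (deg j) := fun j => by
    have h := add_mem (mapL_gr (c := 0) (fun i a ha => by
      rw [add_zero]; exact A.affine_gr 1 0 ha) (x.map_gr (hF.mem j)))
      (mapL_gr (c := 0) (fun i a ha => by
      rw [add_zero]; exact A.affine_gr 0 1 ha) (y.map_gr (hF.mem j)))
    rwa [add_zero] at h
  obtain ⟨T, hT⟩ := hF.exists_algHom hmul hħ hFilt.pow_eq_bot _ hωI hωg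
  obtain ⟨W, hWI, hW⟩ := hF.exists_lift hmin hFilt (fun m i z hz hzi hdz => by
      obtain ⟨hz1, hz2, hz3, hz4, a, ha⟩ := hz
      obtain ⟨hz1', -, -, -, -⟩ := hdz
      change A.vform a = A.forms.evHom 0 z at ha
      have hs := d_sigma (A := A.forms) 1 z
      rw [← evHom_apply, show (A.forms.evHom 1) z = 0 from hz4, map_zero, sub_zero] at hs
      set y0 := A.forms.sigma 1 z with hy0
      set c := A.forms.evHom 0 y0 with hc
      have hy0s : ∀ s, (A.evHom s).forms z = 0 → (A.evHom s).forms y0 = 0 :=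
        fun s h => by rw [hy0, forms_sigma, h, map_zero]
      have hc0 : ∀ s, (A.evHom s).forms z = 0 → A.evHom s c = 0 :=
        fun s h => by
          rw [hc, ← evHom_forms, hy0s s h, map_zero]
      have hy0I : y0 ∈ A.forms.formsSub (A.formsSub (I ^ (m + 1))) := sigma_formsSub (hIpr m) 1 hz1
      have hcI : c ∈ A.formsSub (I ^ (m + 1)) := ev_formsSub 0 hy0I
      have hKc := d_relSigma (hc0 0 hz2) (hc0 1 hz3)
      have hy0g : y0 ∈ A.forms.forms.gr (i - 1) := sigma_gr 1 hzi
      have hcg : c ∈ A.forms.gr (i - 1) := (A.forms.evHom 0).map_gr hy0g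
      have hpow : ∀ i, ∀ a ∈ I ^ (m + 1), pr A.gr_internal i a ∈ I ^ (m + 1) := hP.pr_mem m
      set e := A.forms.evHom 0 (A.forms.sigma 1 (A.forms.forms.d z)) with he
      have hdc : A.forms.d c = A.vform a - e := by
        have h := congrArg (A.forms.evHom 0).toAlgHom hs
        rw [map_add, (A.forms.evHom 0).map_d, ← ha] at h
        exact eq_sub_of_add_eq h
      have hKdc : A.relSigma (A.forms.d c) = -A.relSigma e := by
        rw [hdc, map_sub, relSigma_vform, zero_sub]
      have heI : e ∈ A.formsSub (I ^ (m + 1 + 1)) :=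
        ev_formsSub 0 (sigma_formsSub (hIpr (m + 1)) 1 hz1')
      have hKdcI : A.relSigma (A.forms.d c) ∈ A.formsSub (I ^ (m + 1 + 1)) := by
        rw [hKdc]
        exact neg_mem (relSigma_formsSub (hP.pr_mem (m + 1)) heI)
      have hdif : z - A.forms.forms.d (y0 - A.forms.forms.d (A.forms.affine 1 0 (A.relSigma c)) -
          A.forms.affine 1 0 (A.relSigma (A.forms.d c))) = A.forms.sigma 1 (A.forms.forms.d z) +
          A.forms.forms.d (A.forms.affine 1 0 (A.relSigma (A.forms.d c))) := by
        rw [map_sub, map_sub, A.forms.forms.d_d, sub_zero]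
        nth_rewrite 1 [← hs]
        abel
      have hev : ∀ s : ℤ, ∀ b : A.forms, A.forms.evHom s (A.forms.affine 1 0 b) =
          (1 - s) • b := fun s b => by
        rw [evHom_affine]
        congr 1
        ring
      have hzero : ∀ s, (A.evHom s).forms z = 0 →
          (∀ b, A.evHom s (A.relSigma b) = 0) → (A.evHom s).forms.toAlgHom
          (y0 - A.forms.forms.d (A.forms.affine 1 0 (A.relSigma c)) -
          A.forms.affine 1 0 (A.relSigma (A.forms.d c))) = 0 := fun s h hb => by
        rw [map_sub, map_sub, hy0s s h, (A.evHom s).forms.map_d, forms_affine, forms_affine, hb, hb]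
        simp
      refine ⟨y0 - A.forms.forms.d (A.forms.affine 1 0 (A.relSigma c)) -
        A.forms.affine 1 0 (A.relSigma (A.forms.d c)), ⟨?_, ?_, ?_, ?_, ?_⟩, ?_, ?_, ?_⟩
      · refine sub_mem (sub_mem hy0I (hPΩ.d_mem m _ (affine_formsSub 1 0
          (relSigma_formsSub hpow hcI)))) (affine_formsSub 1 0 ((formsSub_mono (hP.anti m)) hKdcI))
      · exact hzero 0 hz2 evHom_zero_relSigma
      · exact hzero 1 hz3 evHom_one_relSigma
      · change (A.forms.evHom 1) _ = 0
        rw [map_sub, map_sub, (A.forms.evHom 1).map_d, hev, hev, hy0, evHom_sigma]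
        simp
      · refine ⟨A.par (A.evHom 1 (A.sigma 0 c)), ?_⟩
        change _ = A.forms.evHom 0 _
        rw [map_sub, map_sub, (A.forms.evHom 0).map_d, hev, hev, sub_zero, one_smul, one_smul,
          sub_sub, hKc, ← hc, sub_sub_cancel]
      · refine sub_mem (sub_mem hy0g ?_) (affine_gr 1 0 ?_)
        · have := A.forms.forms.d_mem (affine_gr 1 0 (relSigma_gr hcg))
          rwa [sub_add_cancel] at this
        · have := relSigma_gr (A.forms.d_mem hcg)
          rwa [add_sub_cancel_right] at this
      · rw [hdif]
        exact add_mem (sigma_formsSub (hIpr (m + 1)) 1 hz1')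
          (hPΩ.d_mem (m + 1) _ (affine_formsSub 1 0 hKdcI))
      · have hyK : ∀ s, (A.evHom s).forms z = 0 →
            (∀ b, A.evHom s (A.relSigma b) = 0) → (A.evHom s).forms.toAlgHom
            (z - A.forms.forms.d (y0 - A.forms.forms.d (A.forms.affine 1 0 (A.relSigma c)) -
            A.forms.affine 1 0 (A.relSigma (A.forms.d c)))) = 0 := fun s h hb => by
          rw [map_sub, h, (A.evHom s).forms.map_d, hzero s h hb, map_zero, sub_zero]
        refine ⟨hyK 0 hz2 evHom_zero_relSigma, hyK 1 hz3 evHom_one_relSigma, ?_, ?_⟩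
        · change (A.forms.evHom 1) _ = 0
          rw [hdif, map_add, evHom_sigma, (A.forms.evHom 1).map_d, hev]
          simp
        · have h2 := d_relSigma (x := A.forms.d c) (by
            rw [(A.evHom 0).map_d, hc0 0 hz2, map_zero]) (by
            rw [(A.evHom 1).map_d, hc0 1 hz3, map_zero])
          rw [A.forms.d_d, map_zero, add_zero] at h2
          refine ⟨a - A.par (A.evHom 1 (A.sigma 0 (A.forms.d c))), ?_⟩
          change _ = A.forms.evHom 0 _
          rw [hdif, map_add, (A.forms.evHom 0).map_d, hev, sub_zero, one_smul, h2, ← he, hdc,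
            map_sub]
          abel) T
    (fun j => by rw [hT]; exact hωI j) (fun j => by rw [hT]; exact hωg j) (fun j => by
      have hTI : ∀ j, T (t j) ∈ A.forms.formsSub (A.formsSub I) := fun j => by
        rw [hT]; exact hω j
      refine ⟨?_, ?_, ?_, ?_, ?_⟩
      · rw [zero_add, pow_one]
        exact hF.defect_mem_of_mem hI.forms.forms.mul_self hI.forms.forms.hbar_mem
          hI.forms.forms.d_mem hmin hTI j
      · exact hF.defect_mem_ker (y := x) (fun j => by rw [hT, hωx]) _
      · exact hF.defect_mem_ker (y := y) (fun j => by rw [hT, hωy]) _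
      · exact hF.defect_mem_ker (y := A.constHom.comp τ') (fun j => by rw [hT, hω1]; rfl) _
      · refine ⟨0, ?_⟩
        rw [map_zero]
        exact Eq.symm (hF.defect_mem_ker (g := A.forms.evHom 0) (y := A.constHom.comp τ)
          (fun j => by rw [hT, hω0]; rfl) _))
  have hW' : ∀ j, ∃ a, A.vform a = A.forms.evHom 0 (W (t j) - T (t j)) :=
    fun j => (hW j).2.2.2.2
  choose θ hθ using hW'
  refine ⟨W, θ, fun j => ?_, fun j => (hWI j).1, fun j => ?_, fun j => ?_, fun j => ?_, fun j => ?_⟩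
  · rw [← vform_mem_formsSub, hθ]
    have h := (hW j).1
    rw [zero_add, pow_one] at h
    exact ev_formsSub 0 h
  · rw [← hωx j, ← hT]
    exact sub_eq_zero.1 ((map_sub _ _ _).symm.trans (hW j).2.1)
  · rw [← hωy j, ← hT]
    exact sub_eq_zero.1 ((map_sub _ _ _).symm.trans (hW j).2.2.1)
  · rw [← hω1 j, ← hT]
    exact sub_eq_zero.1 ((map_sub _ _ _).symm.trans (hW j).2.2.2.1)
  · rw [hθ, map_sub, hT, hω0, add_sub_cancel]

/-- Lifting of algebra maps on a free model to morphisms, modulo an ideal `K` with a contraction. -/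
theorem IsFree.exists_lift_of_contraction (hF : IsFree deg n S t)
    (hmin : ∀ j, S.d (t j) ∈ genIdeal k t ^ 2) {J : ℕ → Submodule (Lam k) A} {N : ℕ}
    (hJ : Filt A I n J N) (hJ0 : J 0 = I) {K : Submodule (Lam k) A} (hK : Stable A I K)
    (s : A →ₗ[Lam k] A) (hsg : ∀ {i x}, x ∈ A.gr i → s x ∈ A.gr (i - 1))
    (hsJ : ∀ m, ∀ x ∈ J m, s x ∈ J m) (hsK : ∀ x ∈ K, s x ∈ K)
    (hs : ∀ x ∈ K, A.d (s x) + s (A.d x) = x) {a : Fin r → A} (haI : ∀ j, a j ∈ I)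
    (hag : ∀ j, a j ∈ A.gr (deg j)) (hdef : ∀ T : S →ₐ[Lam k] A, (∀ j, T (t j) = a j) →
      ∀ x, A.d (T x) - T (S.d x) ∈ K) :
    ∃ V : DGAlg.Hom S A, ∀ j, V (t j) ∈ I ∧ V (t j) - a j ∈ K := by
  obtain ⟨T, hT⟩ := hF.exists_algHom hJ.mul_self hJ.hbar_mem hJ.pow_eq_bot a haI hag
  have hTI : ∀ j, T (t j) ∈ I := fun j => by rw [hT]; exact haI j
  obtain ⟨V, hVI, hV⟩ := hF.exists_lift hmin
    (hJ.inf le_rfl hJ.mul_self hJ.hbar_mem hK (inf_le_left.trans hJ0.le))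
    (fun m i x hx hxi hdx => ⟨s x, ⟨hsJ m x hx.1, hsK x hx.2⟩, hsg hxi, by
      rw [sub_eq_of_eq_add' (hs x hx.2).symm]
      exact ⟨hsJ _ _ hdx.1, hsK _ hdx.2⟩⟩) T hTI (fun j => by rw [hT]; exact hag j)
    (fun j => ⟨by
      rw [hJ0]
      exact hF.defect_mem_of_mem hJ.mul_self hJ.hbar_mem (hJ0 ▸ hJ.d_mem 0) hmin hTI j,
      hdef T hT _⟩)
  exact ⟨V, fun j => ⟨hVI j, hT j ▸ (hV j).2⟩⟩

theorem IsFree.exists_homotopy_lift (hF : IsFree deg n S t)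
    (hmin : ∀ j, S.d (t j) ∈ genIdeal k t ^ 2) (hI : NilIdeal A I n) {f : DGAlg.Hom A C}
    {K : Submodule (Lam k) C} (hlift : ∀ i, ∀ c ∈ K, c ∈ C.gr i → ∃ a ∈ I, a ∈ A.gr i ∧ f a = c)
    {σ : DGAlg.Hom S A} (hσ : ∀ j, σ (t j) ∈ I) {h : DGAlg.Hom S C.forms}
    (hh : ∀ j, h (t j) ∈ C.formsSub K) (h0 : ∀ j, C.evHom 0 (h (t j)) = f (σ (t j))) :
    ∃ V : DGAlg.Hom S A.forms, ∀ j, V (t j) ∈ A.formsSub I ∧ A.evHom 0 (V (t j)) = σ (t j) ∧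
      f.forms (V (t j)) = h (t j) := by
  have hex : ∀ j, ∃ a ∈ A.formsSub I, a ∈ A.forms.gr (deg j) ∧ f.forms a = h (t j) ∧
      A.evHom 0 a = σ (t j) := fun j => by
    obtain ⟨a, ha, hai, hfa⟩ :=
      ParamRing.forms_exists_lift f hlift (hh j) (h.map_gr (hF.mem j))
    refine ⟨a + A.constHom (σ (t j) - A.evHom 0 a),
      add_mem ha (const_formsSub (sub_mem (hσ j) (ev_formsSub 0 ha))), add_mem hai
      (A.constHom.map_gr (sub_mem (σ.map_gr (hF.mem j)) ((A.evHom 0).map_gr hai))), ?_, ?_⟩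
    · rw [map_add, hfa, forms_const, map_sub, ← h0, ← hfa, evHom_forms, sub_self, map_zero,
        add_zero]
    · rw [map_add, evHom_const, add_sub_cancel]
  choose a haI hag hfa ha0 using hex
  have hP := Background.NilIdeal.pow_filt hI
  obtain ⟨V, hV⟩ := hF.exists_lift_of_contraction hmin (hP.forms hI) (by rw [zero_add, pow_one])
    ((Stable.ker f.forms _).inf (Stable.ker (A.evHom 0) _)) (A.sigma 0) (sigma_gr 0)
    (fun m _ h => sigma_formsSub (hP.pr_mem m) 0 h)
    (fun x hx => ⟨(forms_sigma f 0 x).trans ((congrArg _ hx.1).trans (map_zero _)),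
      evHom_sigma 0 x⟩)
    (fun x hx => by
      rw [d_sigma, ← evHom_apply, show A.evHom 0 x = 0 from hx.2, map_zero, sub_zero]) haI hag
    (fun T hT x => ⟨hF.defect_mem_ker (y := h) (fun j => by rw [hT, hfa]) x,
      hF.defect_mem_ker (y := σ) (fun j => by rw [hT, ha0]) x⟩)
  exact ⟨V, fun j => ⟨(hV j).1, (sub_eq_zero.1 ((map_sub _ _ _).symm.trans (hV j).2.2)).trans
    (ha0 j), (sub_eq_zero.1 ((map_sub _ _ _).symm.trans (hV j).2.1)).trans (hfa j)⟩⟩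

/-- Squares lift along surjective morphisms, with prescribed lifts of three of the sides. -/
theorem IsFree.exists_box_lift (hF : IsFree deg n S t) (hmin : ∀ j, S.d (t j) ∈ genIdeal k t ^ 2)
    (hI : NilIdeal A I n) {f : DGAlg.Hom A C} {K : Submodule (Lam k) C}
    (hlift : ∀ i, ∀ c ∈ K, c ∈ C.gr i → ∃ a ∈ I, a ∈ A.gr i ∧ f a = c)
    {φ ψ z : DGAlg.Hom S A.forms} (hφ : ∀ j, φ (t j) ∈ A.formsSub I)
    (hψ : ∀ j, ψ (t j) ∈ A.formsSub I) (hz : ∀ j, z (t j) ∈ A.formsSub I)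
    (hφz : ∀ j, A.evHom 0 (φ (t j)) = A.evHom 0 (z (t j)))
    (hψz : ∀ j, A.evHom 0 (ψ (t j)) = A.evHom 1 (z (t j)))
    {W : DGAlg.Hom S C.forms.forms} (hW : ∀ j, W (t j) ∈ C.forms.formsSub (C.formsSub K))
    (hWφ : ∀ j, C.forms.evHom 0 (W (t j)) = f.forms (φ (t j)))
    (hWψ : ∀ j, C.forms.evHom 1 (W (t j)) = f.forms (ψ (t j)))
    (hWz : ∀ j, (C.evHom 0).forms (W (t j)) = f.forms (z (t j))) :
    ∃ V : DGAlg.Hom S A.forms.forms, (∀ j, V (t j) ∈ A.forms.formsSub (A.formsSub I)) ∧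
      (∀ j, A.forms.evHom 0 (V (t j)) = φ (t j)) ∧ (∀ j, A.forms.evHom 1 (V (t j)) = ψ (t j)) ∧
      ∀ j, f.forms.forms (V (t j)) = W (t j) := by
  have hP := Background.NilIdeal.pow_filt hI
  have hPΩ : Filt A.forms.forms (A.forms.formsSub (A.formsSub I)) n
    (fun m => A.forms.formsSub (A.formsSub (I ^ (m + 1)))) n := (hP.forms hI).forms hI.forms
  have hex : ∀ j, ∃ a ∈ A.forms.formsSub (A.formsSub I), a ∈ A.forms.forms.gr (deg j) ∧
      f.forms.forms a = W (t j) ∧ A.forms.evHom 0 a = φ (t j) ∧ A.forms.evHom 1 a = ψ (t j) ∧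
      (A.evHom 0).forms a = z (t j) := fun j => by
    obtain ⟨L, hL, hLg, hfL⟩ := ParamRing.forms_exists_lift f.forms
      (fun i c hc hci => ParamRing.forms_exists_lift f hlift hc hci) (hW j) (W.map_gr (hF.mem j))
    set a := φ (t j) - A.forms.evHom 0 L with ha
    set b := ψ (t j) - A.forms.evHom 1 L with hb
    have haI : a ∈ A.formsSub I := sub_mem (hφ j) (ev_formsSub 0 hL)
    have hbI : b ∈ A.formsSub I := sub_mem (hψ j) (ev_formsSub 1 hL)
    have hag : a ∈ A.forms.gr (deg j) :=
      sub_mem (φ.map_gr (hF.mem j)) ((A.forms.evHom 0).map_gr hLg)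
    have hbg : b ∈ A.forms.gr (deg j) :=
      sub_mem (ψ.map_gr (hF.mem j)) ((A.forms.evHom 1).map_gr hLg)
    have hfa : f.forms a = 0 := by
      rw [ha, map_sub, ← hWφ, ← hfL, evHom_forms, sub_self]
    have hfb : f.forms b = 0 := by
      rw [hb, map_sub, ← hWψ, ← hfL, evHom_forms, sub_self]
    set M := L + A.forms.affine 1 0 a + A.forms.affine 0 1 b with hM
    have hMI : M ∈ A.forms.formsSub (A.formsSub I) :=
      add_mem (add_mem hL (affine_formsSub 1 0 haI)) (affine_formsSub 0 1 hbI)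
    have hMg : M ∈ A.forms.forms.gr (deg j) :=
      add_mem (add_mem hLg (affine_gr 1 0 hag)) (affine_gr 0 1 hbg)
    have hM0 : A.forms.evHom 0 M = φ (t j) := by
      rw [hM, map_add, map_add, evHom_affine, evHom_affine]
      simp [ha]
    have hM1 : A.forms.evHom 1 M = ψ (t j) := by
      rw [hM, map_add, map_add, evHom_affine, evHom_affine]
      simp [hb]
    have hfM : f.forms.forms M = W (t j) := by
      rw [hM, map_add, map_add, forms_affine, forms_affine, hfa, hfb, map_zero, map_zero, add_zero,
        add_zero, hfL]
    set e := z (t j) - (A.evHom 0).forms M with he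
    have hMe : (A.evHom 0).forms M ∈ A.formsSub I := by
      rw [← toLinearMap_apply, ← mapL_hom]
      exact mapL_formsSub (fun a ha => ev_formsSub 0 ha) hMI
    have hcomm : ∀ s, A.evHom s ((A.evHom 0).forms M) =
        A.evHom 0 (A.forms.evHom s M) := fun s => evHom_forms _ s M
    have he0 : A.evHom 0 e = 0 := by
      rw [he, map_sub, hcomm, hM0, hφz, sub_self]
    have he1 : A.evHom 1 e = 0 := by
      rw [he, map_sub, hcomm, hM1, hψz, sub_self]
    have hfe : f.forms e = 0 := by
      rw [he, map_sub, ← hWz, ← hfM, sub_eq_zero]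
      exact forms_congr (f := f.forms) (g := C.evHom 0) (fun a => evHom_forms f 0 a) M
    refine ⟨M + A.constHom.forms e, add_mem hMI ?_, add_mem hMg ?_, ?_, ?_, ?_, ?_⟩
    · rw [← toLinearMap_apply, ← mapL_hom]
      exact mapL_formsSub (fun a ha => const_formsSub ha) (sub_mem (hz j) hMe)
    · exact A.constHom.forms.map_gr
        (sub_mem (z.map_gr (hF.mem j)) ((A.evHom 0).forms.map_gr hMg))
    · rw [map_add, hfM, forms_congr (f' := f) (g' := C.constHom) (fun a => forms_const f a), hfe,
        map_zero, add_zero]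
    · rw [map_add, hM0, evHom_forms, he0, map_zero, add_zero]
    · rw [map_add, hM1, evHom_forms, he1, map_zero, add_zero]
    · have : (A.evHom 0).forms (A.constHom.forms e) = e := by
        simp only [← toLinearMap_apply, ← mapL_hom, mapL_mapL]
        exact mapL_eq_self (J := ⊤) (by rw [formsSub_top]; trivial) fun a _ => evHom_const 0 a
      rw [map_add, this, he, add_sub_cancel]
  choose a haI hag hfa ha0 ha1 haz using hex
  obtain ⟨V, hV⟩ := hF.exists_lift_of_contraction hmin hPΩ (by rw [zero_add, pow_one])
    ((Stable.ker f.forms.forms _).inf ((Stable.ker (A.forms.evHom 0) _).inf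
      ((Stable.ker (A.forms.evHom 1) _).inf (Stable.ker (A.evHom 0).forms _))))
    (mapL (A.sigma 0)) (mapL_sigma_gr 0)
    (fun m _ => mapL_formsSub (fun a ha => sigma_formsSub (hP.pr_mem m) 0 ha))
    (fun x hx => ⟨(forms_mapL f.forms (fun a => forms_sigma f 0 a) x).trans
        ((congrArg _ hx.1).trans (map_zero _)),
      (evHom_mapL _ _ x).trans ((congrArg _ hx.2.1).trans (map_zero _)),
      (evHom_mapL _ _ x).trans ((congrArg _ hx.2.2.1).trans (map_zero _)),
      evHom_forms_mapL_sigma 0 x⟩)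
    (fun x hx => d_mapL_sigma 0 hx.2.2.2) haI hag
    (fun T hT x => ⟨hF.defect_mem_ker (y := W) (fun j => by rw [hT, hfa]) x,
      hF.defect_mem_ker (y := φ) (fun j => by rw [hT, ha0]) x,
      hF.defect_mem_ker (y := ψ) (fun j => by rw [hT, ha1]) x,
      hF.defect_mem_ker (y := z) (fun j => by rw [hT, haz]) x⟩)
  have h0 : ∀ {D : DGAlg k} (g : DGAlg.Hom A.forms.forms D) x y, g (x - y) = 0 → g x = g y :=
    fun g x y h => sub_eq_zero.1 ((map_sub _ _ _).symm.trans h)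
  exact ⟨V, fun j => (hV j).1, fun j => (h0 (A.forms.evHom 0) _ _ (hV j).2.2.1).trans (ha0 j),
    fun j => (h0 (A.forms.evHom 1) _ _ (hV j).2.2.2.1).trans (ha1 j), fun j => (h0 f.forms.forms _ _ (hV j).2.1).trans (hfa j)⟩

end Box

namespace DGAlg

variable {k : Type u} [Field k] {A A' : DGAlg k}

theorem forms_formsSub (f : Hom A A') {I : Submodule (Lam k) A}
    {I' : Submodule (Lam k) A'} (h : ∀ a ∈ I, f a ∈ I') {x : A.forms}
    (hx : x ∈ A.formsSub I) : f.forms x ∈ A'.formsSub I' := by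
  rw [← toLinearMap_apply, ← PolyForm.mapL_hom]
  exact mapL_formsSub h hx

variable (A) in
/-- The zero-form component of forms on the interval. -/
def fstHom : A.forms →ₐ[Lam k] A[X] :=
  AlgHom.ofLinearMap (LinearMap.fst (Lam k) A[X] A[X]) rfl fun _ _ => rfl

end DGAlg

section MittagLeffler

variable {k : Type u} [Field k] {r : ℕ} {deg : Fin r → ℤ} {n m : ℕ}
  {S S' A A' C : DGAlg k} {t : Fin r → S} {t' : Fin r → S'}
  {I : Submodule (Lam k) A} {I' : Submodule (Lam k) A'}

open DGAlg DGAlg.PolyForm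

theorem IsFree.exists_factor (hS : IsFree deg n S t) (hS' : IsFree deg m S' t')
    {ρ : DGAlg.Hom S S'} (hρ : ∀ j, ρ (t j) = t' j) (hI : NilIdeal A I m)
    {φ : DGAlg.Hom S A} (hφ : ∀ j, φ (t j) ∈ I) :
    ∃ ψ : DGAlg.Hom S' A, ∀ j, ψ (t' j) = φ (t j) := by
  obtain ⟨T, hT⟩ := hS'.exists_algHom hI.mul_self hI.hbar_mem hI.pow_eq_bot _ hφ
    (fun j => φ.map_gr (hS.mem j))
  have h : T.comp ρ.toAlgHom = φ.toAlgHom := hS.algHom_ext fun j => by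
    rw [AlgHom.comp_apply, hρ, hT]
  refine ⟨hS'.toHom T (fun j => by rw [hT]; exact φ.map_gr (hS.mem j)) (fun j => ?_), hT⟩
  rw [hT, ← φ.map_d, ← h, AlgHom.comp_apply, ρ.map_d, hρ]

/-- The values on the generators of the homotopies between `τ` and `τ'`. -/
def homotopySet (t : Fin r → S) (I : Submodule (Lam k) A)
    (τ τ' : DGAlg.Hom S A) : Set (Fin r → A.forms) :=
  {x | ∃ φ : DGAlg.Hom S A.forms, ∀ j, φ (t j) = x j ∧ x j ∈ A.formsSub I ∧
    A.evHom 0 (x j) = τ (t j) ∧ A.evHom 1 (x j) = τ' (t j)}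

theorem IsFree.exists_velocity_smul_add (hS : IsFree deg n S t) {τ : DGAlg.Hom S A}
    {θ θ' : Fin r → A} {φ φ' : DGAlg.Hom S A.forms}
    (h : ∀ j, φ (t j) = A.constHom (τ (t j)) + A.vform (θ j))
    (h' : ∀ j, φ' (t j) = A.constHom (τ (t j)) + A.vform (θ' j))
    (c : Lam k) : ∃ ψ : DGAlg.Hom S A.forms, ∀ j, ψ (t j) =
      A.constHom (τ (t j)) + A.vform (c • θ j + θ' j) := by
  have key : ∀ {φ : DGAlg.Hom S A.forms} {θ : Fin r → A},
      (∀ j, φ (t j) = A.constHom (τ (t j)) + A.vform (θ j)) →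
      ∀ x, (φ x).1 = Polynomial.C (τ x) := fun {φ θ} h x => by
    have : A.fstHom.comp φ.toAlgHom =
        (Polynomial.CAlgHom (R := Lam k) (A := A)).comp τ.toAlgHom :=
      hS.algHom_ext fun j => by
        rw [AlgHom.comp_apply, h]
        exact add_zero _
    exact DFunLike.congr_fun this x
  have h1 := key h
  have h2 := key h'
  set κ := A.constHom.comp τ with hκ
  set L : S →ₗ[Lam k] A.forms :=
    c • (φ.toAlgHom.toLinearMap - κ.toAlgHom.toLinearMap) + φ'.toAlgHom.toLinearMap with hL
  have hL' : ∀ x, L x = c • (φ x - κ x) + φ' x := fun _ => rfl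
  have hL1 : ∀ x, (L x).1 = Polynomial.C (τ x) := fun x => by
    change c • ((φ x).1 - Polynomial.C (τ x)) + (φ' x).1 = _
    rw [h1, h2, sub_self, smul_zero, zero_add]
  have hL2 : ∀ x, (L x).2 = c • (φ x).2 + (φ' x).2 := fun x => by
    change c • ((φ x).2 - 0) + (φ' x).2 = _
    rw [sub_zero]
  refine ⟨⟨AlgHom.ofLinearMap L (by rw [hL']; simp) fun x y => ?_, fun {i x} hx => ?_,
    fun x => ?_⟩, fun j => ?_⟩
  · apply PolyForm.ext
    · change _ = (L x).1 * (L y).1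
      rw [hL1, hL1, hL1, map_mul, Polynomial.C_mul]
    · change _ = (L x).1 * (L y).2 + (L x).2 * parPoly A (L y).1
      rw [hL1, hL1, hL2, hL2, hL2, map_mul, map_mul]
      change c • ((φ x).1 * (φ y).2 + (φ x).2 *
        parPoly A (φ y).1) + ((φ' x).1 * (φ' y).2 + (φ' x).2 * parPoly A (φ' y).1) = _
      rw [h1, h1, h2, h2, mul_add, add_mul, smul_add, mul_smul_comm, smul_mul_assoc]
      abel
  · exact add_mem (Submodule.smul_mem _ _ (sub_mem (φ.map_gr hx) (κ.map_gr hx))) (φ'.map_gr hx)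
  · change L (S.d x) = A.forms.d (L x)
    rw [hL', hL', φ.map_d, φ'.map_d, κ.map_d, map_add, map_smul, map_sub]
  · change L (t j) = _
    rw [hL', h, h', show κ (t j) = A.constHom (τ (t j)) from rfl,
      add_sub_cancel_left, map_add, map_smul]
    abel

/-- The values on the generators of the self-homotopies of `τ` of the form `τ + θ v`. -/
def IsFree.velocitySub (hS : IsFree deg n S t) (I : Submodule (Lam k) A)
    (τ : DGAlg.Hom S A) : Submodule (Lam k) (Fin r → A) where
  carrier := {θ | (∀ j, θ j ∈ I) ∧ ∃ φ : DGAlg.Hom S A.forms, ∀ j, φ (t j) =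
    A.constHom (τ (t j)) + A.vform (θ j)}
  add_mem' := by
    rintro θ θ' ⟨h, φ, hφ⟩ ⟨h', φ', hφ'⟩
    obtain ⟨ψ, hψ⟩ := hS.exists_velocity_smul_add hφ hφ' 1
    exact ⟨fun j => add_mem (h j) (h' j), ψ, fun j => by rw [hψ, one_smul]; rfl⟩
  zero_mem' := ⟨fun _ => zero_mem _, A.constHom.comp τ, fun j => by
    rw [Pi.zero_apply, map_zero, add_zero]; rfl⟩
  smul_mem' := by
    rintro c θ ⟨h, φ, hφ⟩
    obtain ⟨ψ, hψ⟩ := hS.exists_velocity_smul_add hφ (φ' := A.constHom.comp τ) (θ' := 0)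
      (fun j => by rw [Pi.zero_apply, map_zero, add_zero]; rfl) c
    exact ⟨fun j => Submodule.smul_mem _ c (h j), ψ, fun j => by
      rw [hψ, Pi.zero_apply, add_zero]; rfl⟩

theorem IsFree.map_velocity (hS : IsFree deg n S t) (hS' : IsFree deg m S' t')
    {ρ : DGAlg.Hom S S'} (hρ : ∀ j, ρ (t j) = t' j) (hI' : NilIdeal A' I' m)
    {g : DGAlg.Hom A A'} (hg : ∀ a ∈ I, g a ∈ I') {τ : DGAlg.Hom S A}
    {τ' : DGAlg.Hom S' A'} (hτI : ∀ j, τ (t j) ∈ I)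
    (hτ : ∀ j, g (τ (t j)) = τ' (t' j))
    {θ : Fin r → A} (hθ : θ ∈ hS.velocitySub I τ) :
    (fun j => g (θ j)) ∈ hS'.velocitySub I' τ' := by
  obtain ⟨h, φ, hφ⟩ := hθ
  have hφ' : ∀ j, (g.forms.comp φ) (t j) =
      A'.constHom (τ' (t' j)) + A'.vform (g (θ j)) := fun j => by
    change g.forms (φ (t j)) = _
    rw [hφ, map_add, forms_const, forms_vform, hτ]
  obtain ⟨ψ, hψ⟩ := hS.exists_factor hS' hρ hI'.forms (φ := g.forms.comp φ) (fun j => by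
    rw [hφ', ← hτ]
    exact add_mem (const_formsSub (hg _ (hτI j))) (vform_mem_formsSub.2 (hg _ (h j))))
  exact ⟨fun j => hg _ (h j), ψ, fun j => by rw [hψ, hφ']⟩

/-- A homotopy at a finite level extends to a homotopy at a higher level, after restriction to a
level at which the velocities extend. -/
theorem IsFree.exists_extension [CharZero k] (hS : IsFree deg n S t) (hS' : IsFree deg m S' t')
    (hmin : ∀ j, S.d (t j) ∈ genIdeal k t ^ 2) (hmin' : ∀ j, S'.d (t' j) ∈ genIdeal k t' ^ 2)
    {ρ : DGAlg.Hom S S'} (hρ : ∀ j, ρ (t j) = t' j)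
    (hI : NilIdeal A I n) (hI' : NilIdeal A' I' m)
    {g : DGAlg.Hom A A'} (hg : ∀ a ∈ I, g a ∈ I')
    {f : DGAlg.Hom A' C} {K : Submodule (Lam k) C} (hf : ∀ a ∈ I', f a ∈ K)
    (hlift : ∀ i, ∀ c ∈ K, c ∈ C.gr i → ∃ a ∈ I, a ∈ A.gr i ∧ f (g a) = c)
    {τ₀ τ₁ : DGAlg.Hom S A} {σ₀ σ₁ : DGAlg.Hom S' A'}
    (h₀ : ∀ j, g (τ₀ (t j)) = σ₀ (t' j))
    (h₁ : ∀ j, g (τ₁ (t j)) = σ₁ (t' j))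
    (hτ₀ : ∀ j, τ₀ (t j) ∈ I) (hτ₁ : ∀ j, τ₁ (t j) ∈ I)
    (hvel : ∀ θ ∈ hS'.velocitySub I' σ₀, ∃ η ∈ hS.velocitySub I τ₀, ∀ j, f (g (η j)) = f (θ j))
    {z : Fin r → A.forms} (hz : z ∈ homotopySet t I τ₀ τ₁)
    {x : Fin r → A'.forms} (hx : x ∈ homotopySet t' I' σ₀ σ₁) : ∃ y ∈ homotopySet t I τ₀ τ₁,
      ∀ j, f.forms (g.forms (y j)) = f.forms (x j) := by
  obtain ⟨φz, hφz⟩ := hz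
  obtain ⟨φx, hφx⟩ := hx
  have hfg : ∀ a : A.forms, (f.comp g).forms a = f.forms (g.forms a) := fun a => by
    simp only [← toLinearMap_apply, ← mapL_hom, mapL_mapL]
    rfl
  have hgz : ∀ j, (g.forms.comp φz) (t j) = g.forms (z j) := fun j =>
    congrArg g.forms.toAlgHom (hφz j).1
  obtain ⟨ψz, hψz⟩ := hS.exists_factor hS' hρ hI'.forms (φ := g.forms.comp φz) (fun j => by
    rw [hgz]
    exact forms_formsSub g hg (hφz j).2.1)
  simp only [hgz] at hψz
  obtain ⟨W, θ, hθ, hWI, hW1, hW2, hW3, hW4⟩ := hS'.exists_box hmin' hI' (τ := σ₀) (τ' := σ₁)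
    (x := ψz) (y := φx) (fun j => by rw [hψz]; exact forms_formsSub g hg (hφz j).2.1)
    (fun j => by rw [(hφx j).1]; exact (hφx j).2.1)
    (fun j => by rw [hψz, evHom_forms, (hφz j).2.2.1, h₀])
    (fun j => by rw [hψz, evHom_forms, (hφz j).2.2.2, h₁])
    (fun j => by rw [(hφx j).1, (hφx j).2.2.1]) (fun j => by rw [(hφx j).1, (hφx j).2.2.2])
  obtain ⟨η, ⟨hηI, φ, hφ⟩, hη⟩ := hvel θ ⟨hθ, (A'.forms.evHom 0).comp W, hW4⟩
  have hWt : ∀ j, ((f.forms.forms.comp W).comp ρ) (t j) =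
      f.forms.forms (W (t' j)) := fun j => by
    rw [← hρ]; rfl
  have hev : ∀ s (w : A'.forms.forms), (C.evHom s).forms.toAlgHom
      (f.forms.forms w) = f.forms ((A'.evHom s).forms w) := fun s w =>
    (forms_congr (f := A'.evHom s) (g := f) (f' := f.forms) (g' := C.evHom s)
      (fun a => (evHom_forms f s a).symm) w).symm
  obtain ⟨V, hVI, hV0, hV1, hfV⟩ := hS.exists_box_lift hmin hI (f := f.comp g) hlift (φ := φ)
    (ψ := A.constHom.comp τ₁) (z := φz) (W := (f.forms.forms.comp W).comp ρ)
    (fun j => by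
      rw [hφ]
      exact add_mem (const_formsSub (hτ₀ j)) (vform_mem_formsSub.2 (hηI j)))
    (fun j => const_formsSub (hτ₁ j)) (fun j => by rw [(hφz j).1]; exact (hφz j).2.1)
    (fun j => by rw [hφ, map_add, evHom_const, evHom_vform, add_zero, (hφz j).1, (hφz j).2.2.1])
    (fun j => by
      rw [(hφz j).1, (hφz j).2.2.2]
      exact evHom_const 0 _)
    (fun j => by
      rw [hWt]
      exact forms_formsSub f.forms (fun a ha => forms_formsSub f hf ha) (hWI j))
    (fun j => by
      rw [hWt, evHom_forms, hW4, hφ, hfg, map_add, map_add, map_add, forms_const, forms_vform,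
        forms_const, forms_const, forms_vform, forms_vform, h₀, hη])
    (fun j => by
      rw [hWt, evHom_forms, hW3, hfg, forms_const, ← h₁, ← forms_const, ← forms_const]
      rfl)
    (fun j => by rw [hWt, hev, hW1, hψz, hfg, (hφz j).1])
  have hcomm : ∀ s (w : A.forms.forms), (A.evHom s).toAlgHom
      ((A.evHom 1).forms w) = A.evHom 1 (A.forms.evHom s w) :=
    fun s w => evHom_forms _ s w
  refine ⟨fun j => (A.evHom 1).forms (V (t j)),
    ⟨(A.evHom 1).forms.comp V, fun j => ⟨rfl, ?_, ?_, ?_⟩⟩, fun j => ?_⟩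
  · exact forms_formsSub _ (fun a ha => ev_formsSub 1 ha) (hVI j)
  · rw [hcomm, hV0, hφ, map_add, evHom_const, evHom_vform, add_zero]
  · rw [hcomm, hV1]
    exact evHom_const 1 _
  · have h2 : (C.evHom 1).forms ((f.comp g).forms.forms (V (t j))) =
        (f.comp g).forms ((A.evHom 1).forms (V (t j))) :=
      (forms_congr (f := A.evHom 1) (g := f.comp g) (f' := (f.comp g).forms) (g' := C.evHom 1)
        (fun a => (evHom_forms _ 1 a).symm) _).symm
    rw [← hfg, ← h2, hfV, hWt, hev, hW2, (hφx j).1]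

/-- The inverse limit of a sequence of non-empty sets is not empty under the Mittag-Leffler
condition. -/
theorem exists_compatible {Y : ℕ → Type*} (res : ∀ {n m}, n ≤ m → Y m → Y n)
    (res_trans : ∀ {l n m} (h : l ≤ n) (h' : n ≤ m) (y : Y m),
      res h (res h' y) = res (h.trans h') y) (X : ∀ n, Set (Y n))
    (hres : ∀ {n m} (h : n ≤ m), ∀ y ∈ X m, res h y ∈ X n) (hne : ∀ n, (X n).Nonempty)
    (hML : ∀ n, ∃ m, ∃ h : n ≤ m, ∀ x ∈ X m, ∀ l, ∀ h' : m ≤ l,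
      ∃ y ∈ X l, res (h.trans h') y = res h x) :
    ∃ x : ∀ n, Y n, (∀ n, x n ∈ X n) ∧ ∀ n, res n.le_succ (x (n + 1)) = x n := by
  choose M hM hML using hML
  have hstep : ∀ n (e : {e : Y n // ∃ x ∈ X (M n), res (hM n) x = e}),
      ∃ e' : {e : Y (n + 1) // ∃ x ∈ X (M (n + 1)), res (hM (n + 1)) x = e},
        res n.le_succ e'.1 = e.1 := by
    rintro n ⟨_, x, hx, rfl⟩
    obtain ⟨y, hy, hyx⟩ := hML n x hx (max (M n) (M (n + 1))) (le_max_left _ _)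
    refine ⟨⟨_, res (le_max_right _ _) y, hres _ _ hy, rfl⟩, ?_⟩
    exact (res_trans _ _ _).trans ((res_trans _ _ _).trans hyx)
  choose s hs using hstep
  obtain ⟨x0, hx0⟩ := hne (M 0)
  let e : ∀ n, {e : Y n // ∃ x ∈ X (M n), res (hM n) x = e} := fun n =>
    Nat.rec ⟨_, x0, hx0, rfl⟩ s n
  refine ⟨fun n => (e n).1, fun n => ?_, fun n => hs n (e n)⟩
  obtain ⟨x, hx, h⟩ := (e n).2
  change (e n).1 ∈ X n
  rw [← h]
  exact hres _ _ hx

end MittagLeffler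

namespace ParamRing

variable {k : Type u} [Field k]

/-- The identity. -/
def Hom.id (A : ParamRing k) : Hom A A where
  toAlgHom := AlgHom.id _ _
  map_gr h := h
  map_d _ := rfl
  map_max h := h

theorem isArtinian (A : ParamRing k) : IsArtinian (Lam k) A := by
  obtain ⟨n, hn⟩ := A.nilpotent
  have hn' : A.maxIdeal ^ (n + 1) = ⊥ := by rw [pow_succ, hn, Submodule.bot_mul]
  have htor : Module.IsTorsionBySet (Lam k) A (Ideal.span {hbar k ^ (n + 1)}) := by
    rw [Module.isTorsionBySet_span_singleton_iff]
    intro a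
    have h := Submodule.pow_mem_pow A.maxIdeal A.hbar_mem (n + 1)
    rw [hn', mem_bot, ← map_pow] at h
    rw [Algebra.smul_def, h, zero_mul]
  let := htor.module
  have : IsScalarTower (Lam k) (Lam k ⧸ Ideal.span {hbar k ^ (n + 1)}) A :=
    Module.IsTorsionBySet.isScalarTower htor
  have h1 : IsArtinian (Lam k) (Lam k ⧸ Ideal.span {hbar k ^ (n + 1)}) :=
    (isFiniteLength_iff_isNoetherian_isArtinian.1 (isFiniteLength_quotient_span_singleton (Lam k)
      (mem_nonZeroDivisors_of_ne_zero (pow_ne_zero _ PowerSeries.X_ne_zero)))).2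
  have : IsArtinianRing (Lam k ⧸ Ideal.span {hbar k ^ (n + 1)}) := isArtinian_of_tower (Lam k) h1
  have := A.finite
  have : Module.Finite (Lam k ⧸ Ideal.span {hbar k ^ (n + 1)}) A :=
    Module.Finite.of_restrictScalars_finite (Lam k) _ _
  exact isArtinian_of_surjective_algebraMap
    (Ideal.Quotient.mk_surjective (I := Ideal.span {hbar k ^ (n + 1)}))

end ParamRing

namespace CompleteRing

variable {k : Type u} [Field k]

/-- The projections in the tower of a complete parameter ring. -/
def proj (A : CompleteRing k) {n m : ℕ} (h : n ≤ m) : ParamRing.Hom (A.obj m) (A.obj n) :=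
  Nat.leRec (motive := fun m _ => ParamRing.Hom (A.obj m) (A.obj n)) (ParamRing.Hom.id _)
    (fun m _ f => f.comp (A.map m)) h

theorem proj_self (A : CompleteRing k) (n : ℕ) : A.proj (le_refl n) = ParamRing.Hom.id _ :=
  Nat.leRec_self _ _

theorem proj_succ (A : CompleteRing k) {n m : ℕ} (h : n ≤ m) :
    A.proj (h.trans m.le_succ) = (A.proj h).comp (A.map m) :=
  Nat.leRec_succ _ _ h

theorem proj_trans (A : CompleteRing k) {l n m : ℕ} (h : l ≤ n) (h' : n ≤ m) (x : (A.obj m)) :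
    (A.proj h) ((A.proj h') x) = (A.proj (h.trans h')) x := by
  induction m, h' using Nat.le_induction with
  | base => rw [proj_self]; rfl
  | succ m hm ih =>
    rw [proj_succ A hm, proj_succ A (h.trans hm)]
    exact ih _

theorem proj_surjective (A : CompleteRing k) {n m : ℕ} (h : n ≤ m) :
    Function.Surjective (A.proj h).toAlgHom := by
  induction m, h using Nat.le_induction with
  | base => rw [proj_self]; exact Function.surjective_id
  | succ m hm ih =>
    rw [proj_succ A hm]
    exact ih.comp (A.surjective m)

theorem proj_le_succ (A : CompleteRing k) (n : ℕ) (x : (A.obj (n + 1))) :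
    (A.proj n.le_succ) x = A.map n x := by
  rw [proj_succ A le_rfl, proj_self]
  rfl

theorem Hom.app_proj {R A : CompleteRing k} (f : Hom R A) {n m : ℕ} (h : n ≤ m)
    (x : (R.obj m)) : (f.app n) ((R.proj h) x) =
      (A.proj h) ((f.app m) x) := by
  induction m, h using Nat.le_induction with
  | base => rw [proj_self, proj_self]; rfl
  | succ m hm ih =>
    rw [proj_succ R hm, proj_succ A hm]
    exact (ih _).trans (congrArg _ (f.comm m x).symm)

theorem proj_gen (R : CompleteRing k) {r : ℕ} {t : ∀ n, Fin r → (R.obj n)}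
    (ht : ∀ n j, R.map n (t (n + 1) j) = t n j) {n m : ℕ} (h : n ≤ m) (j : Fin r) :
    (R.proj h) (t m j) = t n j := by
  induction m, h using Nat.le_induction with
  | base => rw [proj_self]; rfl
  | succ m hm ih =>
    rw [proj_succ R hm]
    exact (congrArg _ (ht m j)).trans ih

end CompleteRing

section Unique

variable {k : Type u} [Field k] {r : ℕ}

theorem forms_proj_trans (A : CompleteRing k) {l n m : ℕ} (h : l ≤ n) (h' : n ≤ m)
    (x : (A.obj m).forms) : (A.proj h).forms ((A.proj h').forms x) =
      (A.proj (h.trans h')).forms x := by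
  simp only [← toLinearMap_apply, ← mapL_hom, DGAlg.mapL_mapL]
  exact congrFun (congrArg _ (congrArg _ (LinearMap.ext (A.proj_trans h h')))) x

theorem mem_homotopySet_of_homotopy {S A : ParamRing k}
    {t : Fin r → S} (ht : ∀ j, t j ∈ S.maxIdeal) {τ τ' : ParamRing.Hom S A}
    (H : ParamRing.Homotopy τ τ') :
    (fun j => H (t j)) ∈ homotopySet t A.maxIdeal τ.toHom τ'.toHom := by
  refine ⟨H.toHom, fun j => ⟨rfl, H.map_max (ht j), ?_, ?_⟩⟩
  · rw [evHom_apply, Int.cast_zero, H.ev_zero]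
  · rw [evHom_apply, Int.cast_one, H.ev_one]

theorem IsFree.exists_homotopy_of_mem {deg : Fin r → ℤ} {n : ℕ} {S A : ParamRing k}
    {t : Fin r → S} (hS : IsFree deg n S.toDGAlg t) (ht : S.maxIdeal = genIdeal k t)
    (hA : A.maxIdeal ^ (n + 1) = ⊥) {τ τ' : ParamRing.Hom S A}
    {x : Fin r → A.forms}
    (hx : x ∈ homotopySet t A.maxIdeal τ.toHom τ'.toHom) :
    ∃ H : ParamRing.Homotopy τ τ', ∀ j, H (t j) = x j := by
  obtain ⟨φ, hφ⟩ := hx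
  have hI := (A.nilIdeal hA).forms
  refine ⟨⟨φ, fun ha => hS.hom_mem hI.mul_self hI.hbar_mem
    (fun j => by rw [(hφ j).1]; exact (hφ j).2.1) (ht ▸ ha), fun a => ?_, fun a => ?_⟩,
    fun j => (hφ j).1⟩
  · have h : (A.evHom 0).toAlgHom.comp φ.toAlgHom = τ.toAlgHom := hS.algHom_ext fun j => by
      rw [AlgHom.comp_apply, (hφ j).1, (hφ j).2.2.1]
    have := DFunLike.congr_fun h a
    rwa [AlgHom.comp_apply, evHom_apply, Int.cast_zero] at this
  · have h : (A.evHom 1).toAlgHom.comp φ.toAlgHom = τ'.toAlgHom := hS.algHom_ext fun j => by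
      rw [AlgHom.comp_apply, (hφ j).1, (hφ j).2.2.2]
    have := DFunLike.congr_fun h a
    rwa [AlgHom.comp_apply, evHom_apply, Int.cast_one] at this

/-- A morphism to the quotient lifts along a surjective morphism, within its homotopy class. -/
theorem IsFree.exists_lift_homotopy [CharZero k] {deg : Fin r → ℤ} {n : ℕ} {S D C : ParamRing k}
    {t : Fin r → S} (hF : IsFree deg n S.toDGAlg t) (hS : S.maxIdeal = genIdeal k t)
    (hd : ∀ j, S.d (t j) ∈ genIdeal k t ^ 2) {f : ParamRing.Hom D C}
    (hf : Function.Surjective f.toAlgHom) (hD : D.maxIdeal ^ (n + 1) = ⊥) {σ : ParamRing.Hom S D}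
    {τ : ParamRing.Hom S C} (H : ParamRing.Homotopy (f.comp σ) τ) :
    ∃ τ' : ParamRing.Hom S D, Nonempty (ParamRing.Homotopy σ τ') ∧ ∀ x, f (τ' x) = τ x := by
  have htm : ∀ j, t j ∈ S.maxIdeal := fun j => hS ▸ gen_mem_genIdeal j
  have hI := D.nilIdeal hD
  obtain ⟨V, hV⟩ := hF.exists_homotopy_lift hd hI (f := f.toHom)
    (fun i c hc hci => ParamRing.Hom.exists_lift hf hc hci) (σ := σ.toHom)
    (fun j => σ.map_max (htm j)) (h := H.toHom) (fun j => H.map_max (htm j))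
    (fun j => by rw [evHom_apply, Int.cast_zero]; exact H.ev_zero _)
  let τ' : ParamRing.Hom S D := ⟨(D.evHom 1).comp V, fun h => ev_formsSub 1 (hF.hom_mem
    hI.forms.mul_self hI.forms.hbar_mem (fun j => (hV j).1) (hS ▸ h))⟩
  obtain ⟨G, -⟩ := hF.exists_homotopy_of_mem hS hD (τ := σ) (τ' := τ')
    ⟨V, fun j => ⟨rfl, (hV j).1, (hV j).2.1, rfl⟩⟩
  refine ⟨τ', ⟨G⟩, fun x => ?_⟩
  have h : f.forms.toAlgHom.comp V.toAlgHom = H.toAlgHom := hF.algHom_ext fun j => (hV j).2.2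
  refine (DGAlg.evHom_forms f.toHom 1 (V x)).symm.trans
    ((congrArg _ (DFunLike.congr_fun h x)).trans ?_)
  rw [evHom_apply, Int.cast_one]
  exact H.ev_one x

theorem IsFree.map_homotopySet {deg : Fin r → ℤ} {n m : ℕ} {S S' A A' : ParamRing k}
    {t : Fin r → S} {t' : Fin r → S'} (hS : IsFree deg n S.toDGAlg t)
    (hS' : IsFree deg m S'.toDGAlg t') {ρ : ParamRing.Hom S S'}
    (hρ : ∀ j, ρ (t j) = t' j) (hA' : A'.maxIdeal ^ (m + 1) = ⊥)
    {g : ParamRing.Hom A A'} {τ₀ τ₁ : ParamRing.Hom S A} {σ₀ σ₁ : ParamRing.Hom S' A'}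
    (h₀ : ∀ j, g (τ₀ (t j)) = σ₀ (t' j))
    (h₁ : ∀ j, g (τ₁ (t j)) = σ₁ (t' j))
    {x : Fin r → A.forms}
    (hx : x ∈ homotopySet t A.maxIdeal τ₀.toHom τ₁.toHom) : (fun j => g.forms (x j)) ∈
      homotopySet t' A'.maxIdeal σ₀.toHom σ₁.toHom := by
  obtain ⟨φ, hφ⟩ := hx
  have hg : ∀ j, (g.forms.comp φ) (t j) = g.forms (x j) := fun j =>
    congrArg g.forms.toAlgHom (hφ j).1
  have hm : ∀ j, g.forms (x j) ∈ A'.formsSub A'.maxIdeal := fun j =>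
    DGAlg.forms_formsSub g.toHom (fun a ha => g.map_max ha) (hφ j).2.1
  obtain ⟨ψ, hψ⟩ := hS.exists_factor hS' (ρ := ρ.toHom) hρ (A'.nilIdeal hA').forms
    (φ := g.forms.comp φ) (fun j => by rw [hg]; exact hm j)
  refine ⟨ψ, fun j => ⟨by rw [hψ, hg], hm j, ?_, ?_⟩⟩
  · rw [DGAlg.evHom_forms, (hφ j).2.2.1, h₀]
  · rw [DGAlg.evHom_forms, (hφ j).2.2.2, h₁]

/-- Homotopies at all levels may be replaced by a compatible family of homotopies. -/
theorem CompleteRing.homotopic_of_nonempty [CharZero k] {deg : Fin r → ℤ} {R A : CompleteRing k}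
    {t : ∀ n, Fin r → (R.obj n)} (hfree : ∀ n, IsFree deg n (R.obj n).toDGAlg (t n))
    (hmin : ∀ n j, (R.obj n).d (t n j) ∈ genIdeal k (t n) ^ 2)
    (hmax : ∀ n, (R.obj n).maxIdeal = genIdeal k (t n))
    (ht : ∀ n j, R.map n (t (n + 1) j) = t n j) {τ τ' : CompleteRing.Hom R A}
    (h : ∀ n, Nonempty (ParamRing.Homotopy (τ.app n) (τ'.app n))) :
    CompleteRing.Homotopic τ τ' := by
  have htm : ∀ n j, t n j ∈ (R.obj n).maxIdeal := fun n j => by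
    rw [hmax]; exact gen_mem_genIdeal j
  have hI : ∀ n, NilIdeal (A.obj n).toDGAlg (A.obj n).maxIdeal n := fun n =>
    (A.obj n).nilIdeal (A.maxIdeal_pow n)
  have hcomm : ∀ (σ : CompleteRing.Hom R A) {n m : ℕ} (h : n ≤ m) j, (A.proj h).toAlgHom
      ((σ.app m) (t m j)) = (σ.app n) (t n j) := fun σ n m h j => by
    rw [← σ.app_proj h, R.proj_gen ht h]
  obtain ⟨x, hx, hxc⟩ := exists_compatible
    (Y := fun n => Fin r → (A.obj n).forms)
    (fun h x j => (A.proj h).forms (x j))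
    (fun h h' y => funext fun j => forms_proj_trans A h h' (y j))
    (fun n => homotopySet (t n) (A.obj n).maxIdeal (τ.app n).toHom (τ'.app n).toHom)
    (fun {n m} h y hy => (hfree m).map_homotopySet (hfree n) (fun j => R.proj_gen ht h j)
      (A.maxIdeal_pow n) (hcomm τ h) (hcomm τ' h) hy)
    (fun n => (h n).elim fun H => ⟨_, mem_homotopySet_of_homotopy (htm n) H⟩)
    (fun n => by
      have := (A.obj n).isArtinian
      let U : ℕ → Submodule (Lam k) (Fin r → (A.obj n)) := fun i =>
        ((hfree (n + i)).velocitySub (A.obj (n + i)).maxIdeal (τ.app (n + i)).toHom).map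
          ((A.proj (Nat.le_add_right n i)).toAlgHom.toLinearMap.compLeft (Fin r))
      have hU : ∀ i, U (i + 1) ≤ U i := fun i => by
        rintro _ ⟨θ, hθ, rfl⟩
        refine ⟨_, (hfree (n + i + 1)).map_velocity (hfree (n + i))
          (ρ := (R.map (n + i)).toHom) (ht (n + i)) (hI (n + i)) (g := (A.map (n + i)).toHom)
          (fun a ha => (A.map (n + i)).map_max ha)
          (fun j => (τ.app (n + i + 1)).map_max (htm _ j))
          (fun j => by rw [τ.comm, ht]) hθ, ?_⟩
        funext j
        change (A.proj _) ((A.map (n + i)) (θ j)) = (A.proj _) (θ j)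
        rw [A.proj_succ (Nat.le_add_right n i)]
        rfl
      have hUm : ∀ i m (_ : m = n + i) (hm : n ≤ m), ∀ θ ∈ U i,
          ∃ η ∈ (hfree m).velocitySub (A.obj m).maxIdeal (τ.app m).toHom,
            ∀ j, (A.proj hm) (η j) = θ j := by
        rintro i m rfl hm θ ⟨η, hη, h⟩
        exact ⟨η, hη, fun j => congrFun h j⟩
      obtain ⟨i, hi⟩ := IsArtinian.monotone_stabilizes (R := Lam k)
        (⟨fun i => OrderDual.toDual (U i), monotone_nat_of_le_succ hU⟩ :
          ℕ →o (Submodule (Lam k) (Fin r → (A.obj n)))ᵒᵈ)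
      refine ⟨n + i, Nat.le_add_right n i, fun x hx l hl => ?_⟩
      obtain ⟨c, rfl⟩ := Nat.exists_eq_add_of_le hl
      have hUc : U i = U (i + c) := hi (i + c) (Nat.le_add_right i c)
      have hproj : ∀ a, (A.proj (Nat.le_add_right n i)) ((A.proj hl) a) =
        (A.proj ((Nat.le_add_right n i).trans hl)) a := A.proj_trans _ _
      obtain ⟨z, hz⟩ : (homotopySet (t (n + i + c)) (A.obj (n + i + c)).maxIdeal
          (τ.app (n + i + c)).toHom (τ'.app (n + i + c)).toHom).Nonempty :=
        (h _).elim fun H => ⟨_, mem_homotopySet_of_homotopy (htm _) H⟩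
      obtain ⟨y, hy, hyx⟩ := (hfree (n + i + c)).exists_extension (hfree (n + i)) (hmin _) (hmin _)
        (ρ := (R.proj hl).toHom) (R.proj_gen ht hl) (hI _) (hI _) (g := (A.proj hl).toHom)
        (fun a ha => (A.proj hl).map_max ha) (f := (A.proj (Nat.le_add_right n i)).toHom)
        (K := (A.obj n).maxIdeal) (fun a ha => (A.proj _).map_max ha)
        (fun s a ha has => by
          obtain ⟨b, hb, hbs, hba⟩ := ParamRing.Hom.exists_lift
            (A.proj_surjective ((Nat.le_add_right n i).trans hl)) ha has
          exact ⟨b, hb, hbs, (hproj b).trans hba⟩)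
        (τ₀ := (τ.app _).toHom) (τ₁ := (τ'.app _).toHom) (σ₀ := (τ.app _).toHom)
        (σ₁ := (τ'.app _).toHom) (hcomm τ hl) (hcomm τ' hl)
        (fun j => (τ.app _).map_max (htm _ j)) (fun j => (τ'.app _).map_max (htm _ j))
        (fun θ hθ => by
          have h1 : (A.proj (Nat.le_add_right n i)).toAlgHom.toLinearMap.compLeft (Fin r) θ ∈
              U (i + c) := hUc ▸ ⟨θ, hθ, rfl⟩
          have h2 : ∃ η ∈ (hfree (n + i + c)).velocitySub (A.obj (n + i + c)).maxIdeal
              (τ.app (n + i + c)).toHom, ∀ j, (A.proj ((Nat.le_add_right n i).trans hl)).toAlgHom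
              (η j) = (A.proj (Nat.le_add_right n i)) (θ j) :=
            hUm _ _ (Nat.add_assoc n i c) _ _ h1
          obtain ⟨η, hη, h⟩ := h2
          exact ⟨η, hη, fun j => (hproj _).trans (h j)⟩) hz hx
      exact ⟨y, hy, funext fun j => (forms_proj_trans A _ hl (y j)).symm.trans (hyx j)⟩)
  choose H hH using fun n =>
    (hfree n).exists_homotopy_of_mem (hmax n) (A.maxIdeal_pow n) (hx n)
  refine ⟨H, fun n y => ?_⟩
  have h1 : (A.map n).forms.toAlgHom.comp (H (n + 1)).toAlgHom =
      (H n).toAlgHom.comp (R.map n).toAlgHom := (hfree (n + 1)).algHom_ext fun j => by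
    rw [AlgHom.comp_apply, AlgHom.comp_apply, hH, ht, hH, ← congrFun (hxc n) j]
    simp only [← toLinearMap_apply, ← mapL_hom]
    exact congrFun (congrArg _ (congrArg _ (LinearMap.ext fun a => (A.proj_le_succ n a).symm))) _
  exact DFunLike.congr_fun h1 y

end Unique

namespace Background

section Tower


variable {k : Type u} [Field k] {r : ℕ} {B : Background.{u, v, w} k}

/-- A complete parameter ring with a versal solution, whose truncations are free models. -/
structure VersalTower (B : Background.{u, v, w} k) (degP : Fin r → ℤ) (p : Fin r → B.P)
    (R : CompleteRing k) (t : ∀ n, Fin r → (R.obj n)) (Ξ : B.QMhat R) : Prop where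
  versal : ∀ n, IsVersal B degP p n (R.obj n) (t n) (Ξ.app n).1
  max : ∀ n, (R.obj n).maxIdeal = genIdeal k (t n)
  comm : ∀ n j, R.map n (t (n + 1) j) = t n j

variable {degP : Fin r → ℤ} {p : Fin r → B.P} {R : CompleteRing k}
  {t : ∀ n, Fin r → (R.obj n)} {Ξ : B.QMhat R}

theorem QFThat.ext {A : CompleteRing k} {x y : B.QFThat A} (h : ∀ n, x.app n = y.app n) :
    x = y := by
  obtain ⟨x, _⟩ := x
  obtain ⟨y, _⟩ := y
  cases funext h
  rfl

theorem QFThat.map_eq_of_homotopic {A A' : CompleteRing k} {f g : CompleteRing.Hom A A'}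
    (h : CompleteRing.Homotopic f g) (ξ : B.QFThat A) :
    QFThat.map B f ξ = QFThat.map B g ξ := by
  obtain ⟨H, -⟩ := h
  exact QFThat.ext fun n => QFT.map_eq_of_homotopy (H n) (ξ.app n)

variable [CharZero k]

theorem VersalTower.exists_hom (hB : B.VacuumPure) (hV : VersalTower B degP p R t Ξ)
    (A : CompleteRing k) (ξ : B.QFThat A) :
    ∃ τ : CompleteRing.Hom R A, QFThat.map B τ (QMhat.toQFT B Ξ) = ξ := by
  have h0 := (hV.versal 0).exists_hom_artin hB (hV.max 0) (A.maxIdeal_pow 0) (ξ.app 0)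
  have hstep : ∀ n (τ : ParamRing.Hom (R.obj n) (A.obj n)),
      QFT.map B τ (Quot.mk _ (Ξ.app n)) = ξ.app n →
      ∃ τ' : ParamRing.Hom (R.obj (n + 1)) (A.obj (n + 1)),
        QFT.map B τ' (Quot.mk _ (Ξ.app (n + 1))) = ξ.app (n + 1) ∧
        ∀ x, A.map n (τ' x) = τ (R.map n x) := by
    intro n τ hτ
    obtain ⟨σ, hσ⟩ := (hV.versal (n + 1)).exists_hom_artin hB (hV.max (n + 1))
      (A.maxIdeal_pow (n + 1)) (ξ.app (n + 1))
    have hA : (A.obj n).maxIdeal ^ (n + 1 + 1) = ⊥ := by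
      rw [pow_succ, A.maxIdeal_pow, Submodule.bot_mul]
    have h1 : QFT.map B ((A.map n).comp σ) (Quot.mk _ (Ξ.app (n + 1))) =
        QFT.map B (τ.comp (R.map n)) (Quot.mk _ (Ξ.app (n + 1))) := by
      have h2 : ∀ {A₁ A₂ A₃ : ParamRing k} (g : ParamRing.Hom A₂ A₃) (f : ParamRing.Hom A₁ A₂)
          (x : B.QFT A₁), QFT.map B (g.comp f) x = QFT.map B g (QFT.map B f x) := by
        intro A₁ A₂ A₃ g f x
        induction x using Quot.ind with
        | mk x =>
          refine congrArg (Quot.mk _) (Subtype.ext ?_)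
          change B.push _ x.1 = B.push _ (B.push _ x.1)
          rw [push_push]
          rfl
      refine ((h2 _ _ _).trans ?_).trans (h2 _ _ _).symm
      refine ((congrArg _ hσ).trans (ξ.comm n)).trans (hτ.symm.trans ?_)
      exact congrArg _ (congrArg _ (Ξ.comm n).symm)
    obtain ⟨H⟩ := ((hV.versal (n + 1)).hom_unique_artin hB (hV.max (n + 1)) hA _ _).1 h1
    obtain ⟨τ', ⟨G⟩, hτ'⟩ := (hV.versal (n + 1)).free.exists_lift_homotopy (hV.max (n + 1))
      (hV.versal (n + 1)).d_mem (A.surjective n) (A.maxIdeal_pow (n + 1)) H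
    exact ⟨τ', (QFT.map_eq_of_homotopy G _).symm.trans hσ, hτ'⟩
  let T : ∀ n, {τ : ParamRing.Hom (R.obj n) (A.obj n) //
      QFT.map B τ (Quot.mk _ (Ξ.app n)) = ξ.app n} := fun n =>
    Nat.rec ⟨h0.choose, h0.choose_spec⟩
      (fun n τ => ⟨(hstep n τ.1 τ.2).choose, (hstep n τ.1 τ.2).choose_spec.1⟩) n
  refine ⟨⟨fun n => (T n).1, fun n x => (hstep n (T n).1 (T n).2).choose_spec.2 x⟩, ?_⟩
  exact QFThat.ext fun n => (T n).2

theorem VersalTower.hom_unique (hB : B.VacuumPure) (hV : VersalTower B degP p R t Ξ)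
    (A : CompleteRing k) (τ τ' : CompleteRing.Hom R A) :
    QFThat.map B τ (QMhat.toQFT B Ξ) = QFThat.map B τ' (QMhat.toQFT B Ξ) ↔
      CompleteRing.Homotopic τ τ' := by
  refine ⟨fun h => ?_, fun h => QFThat.map_eq_of_homotopic h _⟩
  refine CompleteRing.homotopic_of_nonempty (fun n => (hV.versal n).free)
    (fun n => (hV.versal n).d_mem) hV.max hV.comm fun n => ?_
  exact ((hV.versal n).hom_unique_artin hB (hV.max n) (A.maxIdeal_pow n) _ _).1
    (congrArg (fun x => x.app n) h)

theorem VersalTower.homotopyRepresents (hB : B.VacuumPure) (hV : VersalTower B degP p R t Ξ) :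
    B.HomotopyRepresents R Ξ where
  homotopy_invariant _ _ _ _ h ξ := QFThat.map_eq_of_homotopic h ξ
  exists_hom := hV.exists_hom hB
  hom_unique := hV.hom_unique hB
  exists_hom_artin _ n hA ξ := (hV.versal n).exists_hom_artin hB (hV.max n) hA ξ
  hom_unique_artin _ n hA τ τ' := (hV.versal n).hom_unique_artin hB (hV.max n) hA τ τ'

end Tower

end Background

section OddFiltration

variable (k : Type u) [Field k] {r : ℕ} (deg : Fin r → ℤ)

/-- The power `q` of the ideal of the exterior algebra which is generated by `ħ` and the odd
variables. -/
def oddFilt (q : ℕ) : Submodule (Lam k) (OddAlgebra k deg) :=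
  Submodule.span (Lam k) {x | ∃ (a : ℕ) (l : List {j : Fin r // Odd (deg j)}),
    q ≤ a + l.length ∧ x = hbar k ^ a • (l.map (oddVar k deg)).prod}

variable {k deg}

theorem prod_mem_oddFilt (l : List {j : Fin r // Odd (deg j)}) {q a : ℕ} (h : q ≤ a + l.length) :
    hbar k ^ a • (l.map (oddVar k deg)).prod ∈ oddFilt k deg q :=
  subset_span ⟨a, l, h, rfl⟩

theorem oddFilt_anti {p q : ℕ} (h : p ≤ q) : oddFilt k deg q ≤ oddFilt k deg p :=
  Submodule.span_mono fun _ ⟨a, l, h', e⟩ => ⟨a, l, h.trans h', e⟩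

theorem oddFilt_mul (p q : ℕ) : oddFilt k deg p * oddFilt k deg q ≤ oddFilt k deg (p + q) := by
  rw [oddFilt, oddFilt, Submodule.span_mul_span, span_le]
  rintro _ ⟨_, ⟨a, l, h, rfl⟩, _, ⟨b, l', h', rfl⟩, rfl⟩
  refine subset_span ⟨a + b, l ++ l', by rw [List.length_append]; omega, ?_⟩
  rw [List.map_append, List.prod_append]
  change _ • _ * _ • _ = _
  rw [smul_mul_smul_comm, pow_add]

theorem ι_eq_sum (x : {j : Fin r // Odd (deg j)} → Lam k) :
    ExteriorAlgebra.ι (Lam k) x = ∑ j, x j • oddVar k deg j := by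
  conv_lhs => rw [← Finset.univ_sum_single x]
  rw [map_sum]
  refine sum_congr rfl fun j _ => ?_
  rw [oddVar, ← map_smul]
  congr 1
  rw [← Pi.single_smul, smul_eq_mul, mul_one]

theorem span_oddVar_eq_top : Submodule.span (Lam k)
    (Set.range fun l : List {j : Fin r // Odd (deg j)} => (l.map (oddVar k deg)).prod) = ⊤ := by
  rw [eq_top_iff]
  rintro x -
  induction x using ExteriorAlgebra.induction with
  | algebraMap c =>
    rw [Algebra.algebraMap_eq_smul_one]
    exact Submodule.smul_mem _ c (subset_span ⟨[], rfl⟩)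
  | ι x =>
    rw [ι_eq_sum]
    refine sum_mem fun j _ => Submodule.smul_mem _ _ (subset_span ⟨[j], ?_⟩)
    simp
  | mul x y hx hy =>
    have := mul_mem_mul hx hy
    rw [Submodule.span_mul_span] at this
    refine Submodule.span_mono ?_ this
    rintro _ ⟨_, ⟨l, rfl⟩, _, ⟨l', rfl⟩, rfl⟩
    exact ⟨l ++ l', by simp⟩
  | add x y hx hy => exact add_mem hx hy

theorem oddFilt_zero : oddFilt k deg 0 = ⊤ := by
  rw [eq_top_iff, ← span_oddVar_eq_top, span_le]
  rintro _ ⟨l, rfl⟩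
  have := prod_mem_oddFilt (k := k) (deg := deg) l (a := 0) (Nat.zero_le _)
  rwa [pow_zero, one_smul] at this

theorem hbar_pow_mem_oddFilt (q : ℕ) (x : OddAlgebra k deg) : hbar k ^ q • x ∈ oddFilt k deg q := by
  have h : x ∈ oddFilt k deg 0 := by rw [oddFilt_zero]; trivial
  have h1 := prod_mem_oddFilt (k := k) (deg := deg) [] (a := q) (q := q) le_self_add
  have := oddFilt_mul q 0 (mul_mem_mul h1 h)
  rwa [smul_mul_assoc, List.map_nil, List.prod_nil, one_mul] at this

theorem prod_oddVar_eq_zero (l : List {j : Fin r // Odd (deg j)})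
    (h : Fintype.card {j : Fin r // Odd (deg j)} < l.length) : (l.map (oddVar k deg)).prod = 0 := by
  obtain ⟨i, j, hij, e⟩ := Fintype.exists_ne_map_eq_of_card_lt l.get (by simpa using h)
  have := (ExteriorAlgebra.ιMulti (Lam k) l.length).map_eq_zero_of_eq
    (fun i => (Pi.single (l.get i) 1 : {j : Fin r // Odd (deg j)} → Lam k)) (by simp only [e]) hij
  rw [ExteriorAlgebra.ιMulti_apply] at this
  rw [← this]
  congr 1
  refine List.ext_get (by simp) fun n h1 h2 => ?_
  simp [oddVar]

theorem exists_hbar_pow_of_mem_oddFilt {q : ℕ} {x : OddAlgebra k deg}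
    (hx : x ∈ oddFilt k deg (q + Fintype.card {j : Fin r // Odd (deg j)})) :
    ∃ y, x = hbar k ^ q • y := by
  change x ∈ oddFilt k deg _ at hx
  suffices h : oddFilt k deg (q + Fintype.card {j : Fin r // Odd (deg j)}) ≤
      range (LinearMap.lsmul (Lam k) (OddAlgebra k deg) (hbar k ^ q)) by
    obtain ⟨y, hy⟩ := h hx
    exact ⟨y, hy.symm⟩
  rw [oddFilt, span_le]
  rintro _ ⟨a, l, h, rfl⟩
  by_cases hl : Fintype.card {j : Fin r // Odd (deg j)} < l.length
  · rw [prod_oddVar_eq_zero l hl, smul_zero]; exact zero_mem _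
  · refine ⟨hbar k ^ (a - q) • (l.map (oddVar k deg)).prod, ?_⟩
    rw [LinearMap.lsmul_apply, smul_smul, ← pow_add, Nat.add_sub_cancel' (by omega)]

theorem exists_hbar_limit {E : Type*} [AddCommGroup E] [Module (Lam k) E] {ι : Type*} [Finite ι]
    (b : Module.Basis ι (Lam k) E) (e : ℕ → E) (h : ∀ n, ∃ y, e (n + 1) - e n = hbar k ^ n • y) :
    ∃ x, ∀ n, ∃ y, x - e n = hbar k ^ n • y := by
  have : Fintype ι := Fintype.ofFinite ι
  have hstep : ∀ n d, ∃ y, e (n + d) - e n = hbar k ^ n • y := fun n d => by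
    induction d with
    | zero => exact ⟨0, by simp⟩
    | succ d ih =>
      obtain ⟨y, hy⟩ := ih
      obtain ⟨z, hz⟩ := h (n + d)
      refine ⟨hbar k ^ d • z + y, ?_⟩
      rw [smul_add, smul_smul, ← pow_add, ← hz, ← hy, ← add_assoc]
      abel
  refine ⟨b.equivFun.symm fun i => PowerSeries.mk fun a =>
    PowerSeries.coeff a (b.equivFun (e (a + 1)) i), fun n => ?_⟩
  have hd : ∀ i, PowerSeries.X ^ n ∣ (PowerSeries.mk fun a =>
      PowerSeries.coeff a (b.equivFun (e (a + 1)) i)) - b.equivFun (e n) i := fun i => by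
    rw [PowerSeries.X_pow_dvd_iff]
    intro m hm
    obtain ⟨d, rfl⟩ : ∃ d, n = m + 1 + d := ⟨n - (m + 1), by omega⟩
    obtain ⟨y, hy⟩ := hstep (m + 1) d
    rw [sub_eq_iff_eq_add.1 hy, map_add, map_smul, Pi.add_apply, Pi.smul_apply, smul_eq_mul,
      map_sub, PowerSeries.coeff_mk, map_add, PowerSeries.coeff_X_pow_mul',
      if_neg (by omega), zero_add, sub_self]
  choose y hy using hd
  refine ⟨b.equivFun.symm y, b.equivFun.injective ?_⟩
  rw [map_sub, LinearEquiv.apply_symm_apply, map_smul, LinearEquiv.apply_symm_apply]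
  funext i
  exact hy i

theorem eq_zero_of_forall_hbar_pow {E : Type*} [AddCommGroup E] [Module (Lam k) E] {ι : Type*}
    [Finite ι] (b : Module.Basis ι (Lam k) E) (e : E) (h : ∀ n, ∃ y, e = hbar k ^ n • y) :
    e = 0 := by
  have : Fintype ι := Fintype.ofFinite ι
  refine b.equivFun.injective ?_
  rw [map_zero]
  funext i
  ext a
  obtain ⟨y, hy⟩ := h (a + 1)
  rw [hy, map_smul, Pi.smul_apply, smul_eq_mul, PowerSeries.coeff_X_pow_mul', if_neg (by omega)]
  rfl

variable (k deg) in
/-- The monomial basis of the exterior algebra. -/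
def oddBasis : Module.Basis (Finset {j : Fin r // Odd (deg j)}) (Lam k) (OddAlgebra k deg) :=
  (Pi.basisFun (Lam k) {j : Fin r // Odd (deg j)}).ExteriorAlgebra

theorem exists_oddFilt_limit (c : ℕ) (e : ℕ → OddAlgebra k deg)
    (h : ∀ n, e (n + 1) - e n ∈ oddFilt k deg (n + 1 - c)) :
    ∃ x, ∀ n, x - e n ∈ oddFilt k deg (n + 1 - c) := by
  set s := Fintype.card {j : Fin r // Odd (deg j)} with hs
  obtain ⟨x, hx⟩ := exists_hbar_limit (oddBasis k deg) (fun n => e (n + c + s)) fun n => by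
    refine exists_hbar_pow_of_mem_oddFilt ?_
    rw [show n + 1 + c + s = n + c + s + 1 by omega]
    exact oddFilt_anti (by omega) (h (n + c + s))
  refine ⟨x, fun n => ?_⟩
  have h1 : ∀ d, e (n + d) - e n ∈ oddFilt k deg (n + 1 - c) := fun d => by
    induction d with
    | zero => rw [add_zero, sub_self]; exact zero_mem _
    | succ d ih =>
      rw [← sub_add_sub_cancel]
      exact add_mem (oddFilt_anti (by omega) (h (n + d))) ih
  obtain ⟨y, hy⟩ := hx (n + 1)
  have h2 := h1 (1 + c + s)
  rw [← sub_add_sub_cancel x (e (n + (1 + c + s))) (e n)]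
  refine add_mem ?_ h2
  rw [show n + (1 + c + s) = n + 1 + c + s by omega, hy]
  exact oddFilt_anti (by omega) (hbar_pow_mem_oddFilt (n + 1) y)

theorem eq_zero_of_forall_oddFilt (c : ℕ) (e : OddAlgebra k deg)
    (h : ∀ n, e ∈ oddFilt k deg (n - c)) : e = 0 :=
  eq_zero_of_forall_hbar_pow (oddBasis k deg) e fun n =>
    exists_hbar_pow_of_mem_oddFilt (oddFilt_anti (by omega)
      (h (n + Fintype.card {j : Fin r // Odd (deg j)} + c)))

end OddFiltration

section SeriesFiltration

variable (k : Type u) [Field k] {r : ℕ} (deg : Fin r → ℤ)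

/-- The two-sided ideal of power series of total order at least `N` in `ħ` and the variables. -/
def seriesFilt (N : ℕ) : Ideal (GradedSeries k deg) where
  carrier := {x | ∀ μ, MvPowerSeries.coeff μ x ∈ oddFilt k deg (N - μ.degree)}
  add_mem' hx hy μ := by rw [map_add]; exact add_mem (hx μ) (hy μ)
  zero_mem' μ := by rw [map_zero]; exact zero_mem _
  smul_mem' c x hx μ := by
    classical
    rw [smul_eq_mul, MvPowerSeries.coeff_mul]
    refine sum_mem fun p hp => ?_
    have h0 : MvPowerSeries.coeff p.1 c ∈ oddFilt k deg 0 := by rw [oddFilt_zero]; trivial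
    have hd := congrArg Finsupp.degree (mem_antidiagonal.1 hp)
    rw [map_add] at hd
    exact oddFilt_anti (by omega) (oddFilt_mul _ _ (mul_mem_mul h0 (hx p.2)))

variable {k deg}

theorem mem_seriesFilt {N : ℕ} {x : GradedSeries k deg} :
    x ∈ seriesFilt k deg N ↔ ∀ μ, MvPowerSeries.coeff μ x ∈ oddFilt k deg (N - μ.degree) := Iff.rfl

theorem mul_mem_seriesFilt {M N : ℕ} {x y : GradedSeries k deg} (hx : x ∈ seriesFilt k deg M)
    (hy : y ∈ seriesFilt k deg N) : x * y ∈ seriesFilt k deg (M + N) := by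
  classical
  intro μ
  rw [MvPowerSeries.coeff_mul]
  refine sum_mem fun p hp => ?_
  have hd := congrArg Finsupp.degree (mem_antidiagonal.1 hp)
  rw [map_add] at hd
  exact oddFilt_anti (by omega) (oddFilt_mul _ _ (mul_mem_mul (hx p.1) (hy p.2)))

theorem seriesFilt_zero : seriesFilt k deg 0 = ⊤ := by
  rw [eq_top_iff]
  intro x _ μ
  rw [Nat.zero_sub, oddFilt_zero]
  trivial

instance (N : ℕ) : (seriesFilt k deg N).IsTwoSided :=
  ⟨fun {a} b ha => by
    have hb : b ∈ seriesFilt k deg 0 := by rw [seriesFilt_zero]; trivial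
    have h := mul_mem_seriesFilt ha hb
    rwa [add_zero] at h⟩

theorem seriesFilt_anti {M N : ℕ} (h : M ≤ N) : seriesFilt k deg N ≤ seriesFilt k deg M :=
  fun _ hx μ => oddFilt_anti (Nat.sub_le_sub_right h _) (mem_seriesFilt.1 hx μ)

theorem exists_series_limit (z : ℕ → GradedSeries k deg)
    (h : ∀ n, z (n + 1) - z n ∈ seriesFilt k deg (n + 1)) :
    ∃ x, ∀ n, x - z n ∈ seriesFilt k deg (n + 1) := by
  have h1 := fun μ => exists_oddFilt_limit μ.degree (fun n => MvPowerSeries.coeff μ (z n))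
    fun n => by rw [← map_sub]; exact h n μ
  choose x hx using h1
  refine ⟨show GradedSeries k deg from x, fun n μ => ?_⟩
  exact hx μ n

theorem eq_of_forall_seriesFilt {x y : GradedSeries k deg}
    (h : ∀ n, x - y ∈ seriesFilt k deg (n + 1)) : x = y := by
  rw [← sub_eq_zero]
  ext μ
  exact eq_zero_of_forall_oddFilt μ.degree _ fun n => seriesFilt_anti (Nat.le_succ n) (h n) μ

theorem seriesMax_eq : seriesMax k deg = genIdeal k (tvar k deg) := by
  rw [seriesMax, genIdeal]
  set s := insert (algebraMap (Lam k) (GradedSeries k deg) (hbar k)) (Set.range (tvar k deg))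
  apply le_antisymm
  · intro x hx
    change x ∈ Ideal.span s at hx
    induction hx using span_induction with
    | mem x h =>
      rw [← one_mul x]
      exact mul_mem_mul trivial (subset_span h)
    | zero => exact zero_mem _
    | add x y _ _ hx hy => exact add_mem hx hy
    | smul c x _ hx =>
      have := mul_mem_mul (show c ∈ (⊤ : Submodule (Lam k) (GradedSeries k deg)) from
        trivial) hx
      rw [← mul_assoc] at this
      exact (mul_le_mul' le_top le_rfl : ⊤ * ⊤ * Submodule.span (Lam k) s ≤ _) this
  · rw [mul_le]
    intro a _ x hx
    refine Ideal.mul_mem_left _ a ?_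
    induction hx using span_induction with
    | mem x h => exact Ideal.subset_span h
    | zero => exact zero_mem _
    | add x y _ _ hx hy => exact add_mem hx hy
    | smul c x _ hx =>
      rw [Algebra.smul_def]
      exact Ideal.mul_mem_left _ _ hx

variable (k deg) in
/-- The inclusion of the exterior algebra as the constant power series. -/
def seriesC : OddAlgebra k deg →ₐ[Lam k] GradedSeries k deg :=
  { MvPowerSeries.C with commutes' := fun _ => MvPowerSeries.algebraMap_apply.symm }

theorem seriesC_apply (e : OddAlgebra k deg) : seriesC k deg e = MvPowerSeries.C e := rfl

theorem seriesC_oddVar (j : {j : Fin r // Odd (deg j)}) :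
    seriesC k deg (oddVar k deg j) = tvar k deg j.1 := by
  rw [tvar, dif_neg (Int.not_even_iff_odd.2 j.2)]
  exact seriesC_apply _

theorem X_eq_tvar (j : {j : Fin r // Even (deg j)}) :
    (MvPowerSeries.X j : GradedSeries k deg) = tvar k deg j.1 := by
  rw [tvar, dif_pos j.2]

theorem seriesMax_le : seriesMax k deg ≤ (seriesFilt k deg 1).restrictScalars (Lam k) := by
  classical
  rw [seriesMax_eq]
  refine genIdeal_le (fun a x hx => Ideal.mul_mem_left _ a hx) (fun μ => ?_) fun j μ => ?_
  · rw [MvPowerSeries.algebraMap_apply, MvPowerSeries.coeff_C]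
    split
    · rw [Algebra.algebraMap_eq_smul_one]
      have := hbar_pow_mem_oddFilt (k := k) (deg := deg) 1 1
      rw [pow_one] at this
      exact oddFilt_anti (Nat.sub_le _ _) this
    · exact zero_mem _
  · rw [tvar]
    split_ifs with h
    · rw [MvPowerSeries.coeff_X]
      split
      · rename_i h'
        rw [h', Finsupp.degree_single, oddFilt_zero]; trivial
      · exact zero_mem _
    · rw [MvPowerSeries.coeff_C]
      split
      · have := prod_mem_oddFilt (k := k) (deg := deg) [⟨j, Int.not_even_iff_odd.1 h⟩]
          (a := 0) (q := 1) le_rfl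
        rw [pow_zero, one_smul, List.map_singleton, List.prod_singleton] at this
        exact oddFilt_anti (Nat.sub_le _ _) this
      · exact zero_mem _

theorem seriesMax_pow_le (N : ℕ) :
    seriesMax k deg ^ N ≤ (seriesFilt k deg N).restrictScalars (Lam k) := by
  induction N with
  | zero => rw [seriesFilt_zero]; exact le_top
  | succ N ih =>
    rw [pow_succ, mul_le]
    exact fun x hx y hy => mul_mem_seriesFilt (ih hx) (seriesMax_le hy)

theorem mul_mem_seriesMax_pow (N : ℕ) (a : GradedSeries k deg) {x : GradedSeries k deg}
    (hx : x ∈ seriesMax k deg ^ (N + 1)) : a * x ∈ seriesMax k deg ^ (N + 1) := by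
  rw [pow_succ'] at hx ⊢
  refine (?_ : ⊤ * (seriesMax k deg * seriesMax k deg ^ N) ≤ _)
    (mul_mem_mul (show a ∈ ⊤ from trivial) hx)
  rw [← mul_assoc, seriesMax_eq]
  exact mul_le_mul' top_mul_genIdeal le_rfl

theorem seriesMax_pow_anti {M N : ℕ} (h : M ≤ N) :
    seriesMax k deg ^ (N + 1) ≤ seriesMax k deg ^ (M + 1) := by
  obtain ⟨d, rfl⟩ := Nat.exists_eq_add_of_le h
  rw [show M + d + 1 = d + (M + 1) by omega, pow_add, mul_le]
  exact fun a _ x hx => mul_mem_seriesMax_pow M a hx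

theorem monomial_eq (μ : {j : Fin r // Even (deg j)} →₀ ℕ) (e : OddAlgebra k deg) :
    MvPowerSeries.monomial μ e =
      seriesC k deg e * MvPowerSeries.monomial μ (1 : OddAlgebra k deg) := by
  rw [seriesC_apply, ← MvPowerSeries.monomial_zero_eq_C_apply,
    MvPowerSeries.monomial_mul_monomial, zero_add, mul_one]

theorem monomial_mem {q N : ℕ} {e : OddAlgebra k deg} (he : e ∈ oddFilt k deg q)
    (μ : {j : Fin r // Even (deg j)} →₀ ℕ) (h : N + 1 ≤ q + μ.degree) :
    MvPowerSeries.monomial μ e ∈ seriesMax k deg ^ (N + 1) := by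
  have hm : ∀ j, tvar k deg j ∈ seriesMax k deg := fun j => by
    rw [seriesMax_eq]; exact gen_mem_genIdeal j
  have hpow : ∀ (x : GradedSeries k deg) a, x ∈ seriesMax k deg → x ^ a ∈ seriesMax k deg ^ a :=
    fun x a hx => Submodule.pow_mem_pow _ hx a
  have hX : ∀ μ : {j : Fin r // Even (deg j)} →₀ ℕ,
      MvPowerSeries.monomial μ (1 : OddAlgebra k deg) ∈ seriesMax k deg ^ μ.degree := fun μ => by
    induction μ using Finsupp.induction_linear with
    | zero => rw [map_zero, pow_zero]; exact Submodule.one_le.1 le_rfl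
    | add μ ν hμ hν =>
      rw [map_add, pow_add, ← one_mul (1 : OddAlgebra k deg), ← MvPowerSeries.monomial_mul_monomial]
      exact mul_mem_mul hμ hν
    | single i a =>
      rw [Finsupp.degree_single, ← MvPowerSeries.X_pow_eq, X_eq_tvar]
      exact hpow _ a (hm _)
  have hl : ∀ l : List {j : Fin r // Odd (deg j)},
      seriesC k deg (l.map (oddVar k deg)).prod ∈ seriesMax k deg ^ l.length := fun l => by
    induction l with
    | nil =>
      rw [List.map_nil, List.prod_nil, map_one, List.length_nil, pow_zero]
      exact Submodule.one_le.1 le_rfl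
    | cons j l ih =>
      rw [List.map_cons, List.prod_cons, map_mul, List.length_cons, pow_succ', seriesC_oddVar]
      exact mul_mem_mul (hm _) ih
  rw [monomial_eq]
  induction he using span_induction with
  | mem x hx =>
    obtain ⟨a, l, hq, rfl⟩ := hx
    refine seriesMax_pow_anti (N := a + l.length + μ.degree - 1) (by omega) ?_
    rw [show a + l.length + μ.degree - 1 + 1 = a + l.length + μ.degree by omega, pow_add, pow_add]
    refine mul_mem_mul ?_ (hX μ)
    rw [Algebra.smul_def, map_mul, map_pow, map_pow, AlgHom.commutes]
    refine mul_mem_mul (hpow _ a ?_) (hl l)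
    rw [seriesMax_eq]
    exact hbar_mem_genIdeal
  | zero => rw [map_zero, zero_mul]; exact zero_mem _
  | add x y _ _ hx hy =>
    rw [map_add, add_mul]
    exact add_mem hx hy
  | smul c x _ hx =>
    rw [map_smul, smul_mul_assoc]
    exact Submodule.smul_mem _ c hx

theorem seriesFilt_le (N : ℕ) :
    (seriesFilt k deg (N + 1)).restrictScalars (Lam k) ≤ seriesMax k deg ^ (N + 1) := by
  classical
  intro x hx
  change x ∈ seriesFilt k deg (N + 1) at hx
  have h1 : ∀ ν : {j : Fin r // Even (deg j)} →₀ ℕ, ∃ μ ≤ ν, μ.degree = min (N + 1) ν.degree :=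
    fun ν => Finsupp.exists_le_degree_eq ν _ (min_le_right _ _)
  choose g hg hgd using h1
  set T := (Finsupp.finite_of_degree_le (σ := {j : Fin r // Even (deg j)}) (N + 1)).toFinset
  let y : ({j : Fin r // Even (deg j)} →₀ ℕ) → GradedSeries k deg := fun μ ρ =>
    if g (μ + ρ) = μ then MvPowerSeries.coeff (μ + ρ) x else 0
  have hy : ∀ μ ρ, MvPowerSeries.coeff ρ (y μ) =
    if g (μ + ρ) = μ then MvPowerSeries.coeff (μ + ρ) x else 0 := fun μ ρ => rfl
  have hsum : x = ∑ μ ∈ T, y μ * MvPowerSeries.monomial μ 1 := by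
    ext ν
    rw [map_sum, sum_eq_single (g ν)]
    · rw [MvPowerSeries.coeff_mul_monomial, if_pos (hg ν), mul_one, hy, add_tsub_cancel_of_le (hg ν),
        if_pos rfl]
    · intro μ _ hμ
      rw [MvPowerSeries.coeff_mul_monomial]
      split
      · rename_i h
        rw [hy, add_tsub_cancel_of_le h, if_neg (Ne.symm hμ), zero_mul]
      · rfl
    · intro h
      refine absurd ?_ h
      rw [Set.Finite.mem_toFinset, Set.mem_ofPred_eq, hgd]
      exact min_le_left _ _
  rw [hsum]
  refine sum_mem fun μ hμ => ?_
  rw [Set.Finite.mem_toFinset, Set.mem_ofPred_eq] at hμ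
  rcases hμ.lt_or_eq with h | h
  · have : y μ * MvPowerSeries.monomial μ 1 = MvPowerSeries.monomial μ
        (MvPowerSeries.coeff 0 (y μ)) := by
      ext ν
      rw [MvPowerSeries.coeff_mul_monomial, MvPowerSeries.coeff_monomial]
      by_cases hν : ν = μ
      · subst hν
        rw [if_pos le_rfl, if_pos rfl, mul_one, tsub_self]
      · rw [if_neg hν]
        split
        · rename_i hle
          rw [mul_one, hy, if_neg]
          intro hc
          have h2 := hgd (μ + (ν - μ))
          rw [hc, add_tsub_cancel_of_le hle] at h2
          obtain ⟨ρ, rfl⟩ := le_iff_exists_add.1 hle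
          rw [map_add] at h2
          have : ρ.degree = 0 := by omega
          rw [Finsupp.degree_eq_zero_iff] at this
          exact hν (by rw [this, add_zero])
        · rfl
    rw [this]
    refine monomial_mem (q := N + 1 - μ.degree) ?_ μ (by omega)
    rw [hy, add_zero]
    split
    · exact hx μ
    · exact zero_mem _
  · exact mul_mem_seriesMax_pow N _ (monomial_mem (q := 0) (by rw [oddFilt_zero]; trivial) μ
      (by omega))

theorem mem_seriesFilt_iff {N : ℕ} {x : GradedSeries k deg} :
    x ∈ seriesFilt k deg (N + 1) ↔ x ∈ seriesMax k deg ^ (N + 1) :=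
  ⟨fun h => seriesFilt_le N h, fun h => seriesMax_pow_le (N + 1) h⟩

end SeriesFiltration

section Evaluation

variable {k : Type u} [Field k]

theorem exists_monomialHom {M ι : Type*} [Monoid M] [Finite ι] (a : ι → M)
    (ha : ∀ i j, Commute (a i) (a j)) : ∃ g : Multiplicative (ι →₀ ℕ) →* M,
      ∀ i e, g (Multiplicative.ofAdd (Finsupp.single i e)) = a i ^ e := by
  classical
  have : Fintype ι := Fintype.ofFinite ι
  have hc : Pairwise fun i j => ∀ x y, Commute (powersHom M (a i) x) (powersHom M (a j) y) :=
    fun i j _ x y => by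
      rw [powersHom_apply, powersHom_apply]
      exact ((ha i j).pow_pow _ _)
  let G := MonoidHom.noncommPiCoprod (fun i => powersHom M (a i)) hc
  refine ⟨G.comp
    { toFun := fun μ i => Multiplicative.ofAdd (Multiplicative.toAdd μ i)
      map_one' := rfl
      map_mul' := fun _ _ => rfl }, fun i e => ?_⟩
  have : (fun j => Multiplicative.ofAdd (Finsupp.single i e j)) =
      (Pi.mulSingle i (Multiplicative.ofAdd e) : ι → Multiplicative ℕ) := by
    funext j
    by_cases h : j = i
    · subst h; simp
    · rw [Pi.mulSingle_eq_of_ne h, Finsupp.single_eq_of_ne h]; rfl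
  change G (fun j => Multiplicative.ofAdd (Finsupp.single i e j)) = _
  rw [this]
  change MonoidHom.noncommPiCoprod _ hc _ = _
  rw [MonoidHom.noncommPiCoprod_mulSingle, powersHom_apply, toAdd_ofAdd]

variable {r : ℕ} {deg : Fin r → ℤ}

theorem sgn_of_even {i : ℤ} (h : Even i) : sgn i = 1 := by
  rw [sgn, Int.negOnePow_even i h, Units.val_one]

theorem sgn_of_odd {i : ℤ} (h : Odd i) : sgn i = -1 := by
  rw [sgn, Int.negOnePow_odd i h, Units.val_neg, Units.val_one]

/-- Evaluation of graded commutative power series in a nilpotent ideal. -/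
theorem exists_eval [CharZero k] {n : ℕ} {D : Type u} [Ring D] [Algebra (Lam k) D]
    (I : Submodule (Lam k) D) (a : Fin r → D) (hI : I * I ≤ I)
    (hħ : algebraMap (Lam k) D (hbar k) ∈ I) (hn : I ^ (n + 1) = ⊥) (ha : ∀ j, a j ∈ I)
    (hs : ∀ i j, a i * a j = sgn (deg i * deg j) • (a j * a i)) :
    ∃ T : GradedSeries k deg →ₐ[Lam k] D, (∀ j, T (tvar k deg j) = a j) ∧
      seriesMax k deg ≤ I.comap T.toLinearMap := by
  classical
  have hev : ∀ i j, Even (deg i) → Commute (a i) (a j) := fun i j h => by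
    rw [Commute, SemiconjBy, hs, sgn_of_even (h.mul_right _), one_smul]
  obtain ⟨g, hg⟩ := exists_monomialHom (fun i : {j : Fin r // Even (deg j)} => a i.1)
    fun i j => hev _ _ i.2
  have hsq : ∀ v : {j : Fin r // Odd (deg j)} → Lam k,
      (∑ j, v j • a j.1) * (∑ j, v j • a j.1) = 0 := fun v => by
    have h : (∑ j, v j • a j.1) * (∑ j, v j • a j.1) =
        -((∑ j, v j • a j.1) * (∑ j, v j • a j.1)) := by
      conv_lhs => rw [Finset.sum_mul_sum, Finset.sum_comm]
      rw [Finset.sum_mul_sum, ← Finset.sum_neg_distrib]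
      refine sum_congr rfl fun i _ => ?_
      rw [← Finset.sum_neg_distrib]
      refine sum_congr rfl fun j _ => ?_
      rw [smul_mul_smul_comm, smul_mul_smul_comm, hs, sgn_of_odd (j.2.mul i.2), neg_smul, one_smul,
        smul_neg, mul_comm (v i)]
    have h2 : (2 : Lam k) • ((∑ j, v j • a j.1) * (∑ j, v j • a j.1)) = 0 := by
      rw [two_smul]; nth_rewrite 1 [h]; exact neg_add_cancel _
    have hu : IsUnit (2 : Lam k) := by
      rw [PowerSeries.isUnit_iff_constantCoeff, map_ofNat]
      exact isUnit_iff_ne_zero.2 two_ne_zero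
    exact hu.smul_eq_zero.1 h2
  let f : OddAlgebra k deg →ₐ[Lam k] D := ExteriorAlgebra.lift (Lam k)
    ⟨Fintype.linearCombination (Lam k) fun j : {j : Fin r // Odd (deg j)} => a j.1, fun v => by
      rw [Fintype.linearCombination_apply]; exact hsq v⟩
  have hf : ∀ j, f (oddVar k deg j) = a j.1 := fun j => by
    change ExteriorAlgebra.lift (Lam k) _ (ExteriorAlgebra.ι (Lam k) _) = _
    rw [ExteriorAlgebra.lift_ι_apply, Fintype.linearCombination_apply_single, one_smul]
  have hfind : ∀ {p : D → Prop}, (∀ l : List {j : Fin r // Odd (deg j)},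
      p (l.map fun j => a j.1).prod) → p 0 → (∀ x y, p x → p y → p (x + y)) →
      (∀ (c : Lam k) x, p x → p (c • x)) → ∀ e, p (f e) := fun {p} h h0 hadd hsmul e => by
    have he : e ∈ Submodule.span (Lam k) (Set.range fun l : List {j : Fin r // Odd (deg j)} =>
      (l.map (oddVar k deg)).prod) := by rw [span_oddVar_eq_top]; trivial
    induction he using span_induction with
    | mem x hx =>
      obtain ⟨l, rfl⟩ := hx
      dsimp only
      rw [map_list_prod, List.map_map, show f ∘ oddVar k deg = fun j => a j.1 from funext hf]
      exact h l
    | zero => rw [map_zero]; exact h0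
    | add x y _ _ hx hy => rw [map_add]; exact hadd _ _ hx hy
    | smul c x _ hx => rw [map_smul]; exact hsmul _ _ hx
  have hgi : ∀ {p : D → ℕ → Prop}, p 1 0 → (∀ i : {j : Fin r // Even (deg j)}, p (a i.1) 1) →
      (∀ x y m m', p x m → p y m' → p (x * y) (m + m')) →
      ∀ μ, p (g (Multiplicative.ofAdd μ)) μ.degree := fun {p} h1 h hmul μ => by
    induction μ using Finsupp.induction_linear with
    | zero => rw [ofAdd_zero, map_one, map_zero]; exact h1
    | add μ ν hμ hν => rw [ofAdd_add, map_mul, map_add]; exact hmul _ _ _ _ hμ hν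
    | single i e =>
      rw [hg, Finsupp.degree_single]
      induction e with
      | zero => rw [pow_zero]; exact h1
      | succ e ih => rw [pow_succ]; exact hmul _ _ _ _ ih (h i)
  have hcomm : ∀ e μ, Commute (f e) (g (Multiplicative.ofAdd μ)) := fun e μ => by
    refine hgi (p := fun x _ => Commute (f e) x) (Commute.one_right _) (fun i => ?_)
      (fun x y _ _ hx hy => hx.mul_right hy) μ
    refine hfind (p := fun y => Commute y (a i.1)) (fun l => ?_) (Commute.zero_left _)
      (fun x y hx hy => hx.add_left hy) (fun c x hx => hx.smul_left c) e
    exact Commute.list_prod_left _ _ fun x hx => by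
      obtain ⟨j, -, rfl⟩ := List.mem_map.1 hx
      exact (hev _ _ i.2).symm
  have hgI : ∀ μ, g (Multiplicative.ofAdd μ) ∈ I ^ μ.degree :=
    hgi (p := fun x m => x ∈ I ^ m) (by rw [pow_zero]; exact Submodule.one_le.1 le_rfl)
      (fun i => by rw [pow_one]; exact ha _)
      fun x y m m' hx hy => by rw [pow_add]; exact mul_mem_mul hx hy
  have hg0 : ∀ μ : {j : Fin r // Even (deg j)} →₀ ℕ, n < μ.degree →
      g (Multiplicative.ofAdd μ) = 0 := fun μ h => by
    have := hgI μ
    rw [← Nat.add_sub_cancel' (Nat.succ_le_of_lt h), pow_add, Nat.succ_eq_add_one, hn, Submodule.bot_mul] at this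
    exact (mem_bot _).1 this
  have hUf : ∀ e, ∀ x ∈ I, f e * x ∈ I := fun e => by
    refine hfind (p := fun y => ∀ x ∈ I, y * x ∈ I) (fun l => ?_) (fun x _ => by simp)
      (fun x y hx hy z hz => by rw [add_mul]; exact add_mem (hx z hz) (hy z hz))
      (fun c x hx z hz => by rw [smul_mul_assoc]; exact Submodule.smul_mem _ c (hx z hz)) e
    intro x hx
    induction l with
    | nil => rwa [List.map_nil, List.prod_nil, one_mul]
    | cons j l ih =>
      rw [List.map_cons, List.prod_cons, mul_assoc]
      exact hI (mul_mem_mul (ha _) ih)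
  have hUg : ∀ μ, ∀ x ∈ I, g (Multiplicative.ofAdd μ) * x ∈ I :=
    hgi (p := fun y _ => ∀ x ∈ I, y * x ∈ I) (fun x hx => by rwa [one_mul])
      (fun i x hx => hI (mul_mem_mul (ha _) hx))
      fun x y _ _ hx hy z hz => by rw [mul_assoc]; exact hx _ (hy z hz)
  set S := (Finsupp.finite_of_degree_le (σ := {j : Fin r // Even (deg j)}) n).toFinset with hS
  have hmemS : ∀ μ : {j : Fin r // Even (deg j)} →₀ ℕ, μ ∈ S ↔ μ.degree ≤ n := fun μ => by
    rw [hS, Set.Finite.mem_toFinset, Set.mem_ofPred_eq]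
  let L : GradedSeries k deg →ₗ[Lam k] D := ∑ μ ∈ S,
    LinearMap.mulRight (Lam k) (g (Multiplicative.ofAdd μ)) ∘ₗ f.toLinearMap ∘ₗ
      (MvPowerSeries.coeff μ).restrictScalars (Lam k)
  have hL : ∀ x, L x = ∑ μ ∈ S, f (MvPowerSeries.coeff μ x) * g (Multiplicative.ofAdd μ) :=
    fun x => by rw [LinearMap.sum_apply]; rfl
  have hLm : ∀ μ e, L (MvPowerSeries.monomial μ e) = f e * g (Multiplicative.ofAdd μ) :=
    fun μ e => by
      rw [hL]
      by_cases h : μ ∈ S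
      · rw [Finset.sum_eq_single_of_mem μ h, MvPowerSeries.coeff_monomial_same]
        intro ν _ hν
        rw [MvPowerSeries.coeff_monomial, if_neg hν, map_zero, zero_mul]
      · rw [hg0 μ (by rwa [hmemS, not_le] at h), mul_zero]
        refine Finset.sum_eq_zero fun ν hν => ?_
        rw [MvPowerSeries.coeff_monomial, if_neg (by rintro rfl; exact h hν), map_zero, zero_mul]
  have hL1 : L 1 = 1 := by
    rw [← map_one (MvPowerSeries.C (σ := {j : Fin r // Even (deg j)}) (R := OddAlgebra k deg)),
      ← MvPowerSeries.monomial_zero_eq_C_apply, hLm, map_one, ofAdd_zero, map_one, one_mul]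
  have hLmul : ∀ x y, L (x * y) = L x * L y := fun x y => by
    have h1 : L x * L y = ∑ p ∈ S ×ˢ S, f (MvPowerSeries.coeff p.1 x) *
        f (MvPowerSeries.coeff p.2 y) * g (Multiplicative.ofAdd (p.1 + p.2)) := by
      rw [hL, hL, Finset.sum_mul_sum, Finset.sum_product]
      refine sum_congr rfl fun μ _ => sum_congr rfl fun ν _ => ?_
      rw [ofAdd_add, map_mul, mul_assoc, ← mul_assoc (g _), (hcomm _ μ).eq.symm]
      simp only [mul_assoc]
    have h2 : L (x * y) = ∑ μ ∈ S, ∑ p ∈ antidiagonal μ,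
        f (MvPowerSeries.coeff p.1 x) * f (MvPowerSeries.coeff p.2 y) *
          g (Multiplicative.ofAdd (p.1 + p.2)) := by
      rw [hL]
      refine sum_congr rfl fun μ _ => ?_
      rw [MvPowerSeries.coeff_mul, map_sum, Finset.sum_mul]
      refine sum_congr rfl fun p hp => ?_
      rw [map_mul, mem_antidiagonal.1 hp]
    rw [h1, h2, Finset.sum_sigma']
    refine Finset.sum_of_injOn (fun p => p.2) ?_ ?_ ?_ (fun _ _ => rfl)
    · rintro ⟨μ, p⟩ hp ⟨ν, q⟩ hq h
      dsimp only at h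
      subst h
      rw [Finset.mem_coe, Finset.mem_sigma, mem_antidiagonal] at hp hq
      obtain rfl : μ = ν := hp.2.symm.trans hq.2
      rfl
    · rintro ⟨μ, p⟩ hp
      rw [Finset.mem_coe, Finset.mem_sigma, mem_antidiagonal, hmemS] at hp
      dsimp only at hp
      have := congrArg Finsupp.degree hp.2
      rw [map_add] at this
      rw [Finset.mem_coe, Finset.mem_product, hmemS, hmemS]
      dsimp only
      omega
    · rintro p hp h
      rw [hg0, mul_zero]
      by_contra hc
      refine h ⟨⟨p.1 + p.2, p⟩, ?_, rfl⟩
      rw [Finset.mem_coe, Finset.mem_sigma, mem_antidiagonal, hmemS]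
      exact ⟨not_lt.1 hc, rfl⟩
  let T : GradedSeries k deg →ₐ[Lam k] D := AlgHom.ofLinearMap L hL1 hLmul
  have hT : ∀ j, T (tvar k deg j) = a j := fun j => by
    change L _ = _
    rw [tvar]
    split
    · rename_i h
      rw [MvPowerSeries.X, hLm, map_one, one_mul, hg, pow_one]
    · rw [← MvPowerSeries.monomial_zero_eq_C_apply, hLm, hf, ofAdd_zero, map_one, mul_one]
  refine ⟨T, hT, ?_⟩
  rw [seriesMax_eq]
  refine genIdeal_le (fun c x hx => ?_) ?_ fun j => ?_
  · change T (c * x) ∈ I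
    change T x ∈ I at hx
    rw [map_mul]
    change L c * T x ∈ I
    rw [hL, Finset.sum_mul]
    refine sum_mem fun μ _ => ?_
    rw [mul_assoc]
    exact hUf _ _ (hUg μ _ hx)
  · change T _ ∈ I
    rw [AlgHom.commutes]
    exact hħ
  · change T _ ∈ I
    rw [hT]
    exact ha j

end Evaluation

section SeriesQuotient

variable (k : Type u) [Field k] {r : ℕ} (deg : Fin r → ℤ) (n : ℕ)

/-- The quotient of the graded power series by the power `n + 1` of the maximal ideal. -/
abbrev SeriesQuot : Type u := GradedSeries k deg ⧸ seriesFilt k deg (n + 1)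

/-- The projection from graded power series to their quotient by the power `n + 1` of the maximal
ideal. -/
def seriesProj : GradedSeries k deg →ₐ[Lam k] SeriesQuot k deg n := Ideal.Quotient.mkₐ (Lam k) _

/-- The image of `t_j` in the quotient. -/
def seriesGen (j : Fin r) : SeriesQuot k deg n := seriesProj k deg n (tvar k deg j)

variable {k deg n}

theorem seriesProj_eq_zero {x : GradedSeries k deg} :
    seriesProj k deg n x = 0 ↔ x ∈ seriesMax k deg ^ (n + 1) :=
  Ideal.Quotient.eq_zero_iff_mem.trans mem_seriesFilt_iff

theorem seriesProj_surjective : Function.Surjective (seriesProj k deg n) :=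
  Ideal.Quotient.mkₐ_surjective _ _

theorem map_seriesMax :
    (seriesMax k deg).map (seriesProj k deg n).toLinearMap = genIdeal k (seriesGen k deg n) := by
  rw [seriesMax_eq, genIdeal, genIdeal, Submodule.map_mul, Submodule.map_top, LinearMap.range_eq_top.2
    seriesProj_surjective, Submodule.map_span, Set.image_insert_eq, ← Set.range_comp]
  rw [toLinearMap_apply, AlgHom.commutes]
  rfl

theorem tvar_sign (i j : Fin r) :
    tvar k deg i * tvar k deg j = sgn (deg i * deg j) • (tvar k deg j * tvar k deg i) := by
  have hX : ∀ i : {j : Fin r // Even (deg j)}, ∀ x : GradedSeries k deg,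
      MvPowerSeries.X i * x = x * MvPowerSeries.X i := fun i x => (MvPowerSeries.commute_X x i).symm
  by_cases hi : Even (deg i)
  · rw [sgn_of_even (hi.mul_right _), one_smul, ← X_eq_tvar ⟨i, hi⟩]
    exact (hX _ _)
  · by_cases hj : Even (deg j)
    · rw [sgn_of_even (hj.mul_left _), one_smul, ← X_eq_tvar ⟨j, hj⟩]
      exact (hX _ _).symm
    · rw [Int.not_even_iff_odd] at hi hj
      rw [sgn_of_odd (hi.mul hj), neg_smul, one_smul, ← seriesC_oddVar ⟨i, hi⟩,
        ← seriesC_oddVar ⟨j, hj⟩, ← map_mul, ← map_mul, ← map_neg]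
      congr 1
      exact eq_neg_of_add_eq_zero_left (ExteriorAlgebra.ι_add_mul_swap _ _)

theorem monomial_mem_adjoin (μ : {j : Fin r // Even (deg j)} →₀ ℕ) (e : OddAlgebra k deg) :
    MvPowerSeries.monomial μ e ∈ Algebra.adjoin (Lam k) (Set.range (tvar k deg)) := by
  have ht : ∀ j, tvar k deg j ∈ Algebra.adjoin (Lam k) (Set.range (tvar k deg)) :=
    fun j => Algebra.subset_adjoin ⟨j, rfl⟩
  rw [monomial_eq]
  refine mul_mem ?_ ?_
  · have he : e ∈ Submodule.span (Lam k) (Set.range fun l : List {j : Fin r // Odd (deg j)} =>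
      (l.map (oddVar k deg)).prod) := by rw [span_oddVar_eq_top]; trivial
    induction he using span_induction with
    | mem x hx =>
      obtain ⟨l, rfl⟩ := hx
      dsimp only
      rw [map_list_prod, List.map_map]
      refine Subalgebra.list_prod_mem _ fun x hx => ?_
      obtain ⟨j, -, rfl⟩ := List.mem_map.1 hx
      rw [Function.comp_apply, seriesC_oddVar]
      exact ht _
    | zero => rw [map_zero]; exact zero_mem _
    | add x y _ _ hx hy => rw [map_add]; exact add_mem hx hy
    | smul c x _ hx => rw [map_smul]; exact Subalgebra.smul_mem _ hx c
  · induction μ using Finsupp.induction_linear with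
    | zero => rw [MvPowerSeries.monomial_zero_one]; exact one_mem _
    | add μ ν hμ hν =>
      rw [← one_mul (1 : OddAlgebra k deg), ← MvPowerSeries.monomial_mul_monomial]
      exact mul_mem hμ hν
    | single i a =>
      rw [← MvPowerSeries.X_pow_eq, X_eq_tvar]
      exact pow_mem (ht _) a

/-- The monomials of degree at most `n` in the even variables. -/
def evenMonomials (deg : Fin r → ℤ) (n : ℕ) : Finset ({j : Fin r // Even (deg j)} →₀ ℕ) :=
  (Finsupp.finite_of_degree_le n).toFinset

theorem seriesProj_eq_sum (x : GradedSeries k deg) : seriesProj k deg n x =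
    ∑ μ ∈ evenMonomials deg n,
      seriesProj k deg n (MvPowerSeries.monomial μ (MvPowerSeries.coeff μ x)) := by
  classical
  rw [← map_sum, ← sub_eq_zero, ← map_sub, seriesProj_eq_zero, ← mem_seriesFilt_iff]
  intro ν
  rw [map_sub, map_sum]
  simp only [MvPowerSeries.coeff_monomial]
  rw [Finset.sum_ite_eq]
  split
  · rw [sub_self]; exact zero_mem _
  · rename_i h
    rw [evenMonomials, Set.Finite.mem_toFinset, Set.mem_ofPred_eq, not_le] at h
    rw [Nat.sub_eq_zero_of_le h, oddFilt_zero]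
    trivial

variable (k deg n) in
theorem isFreeModel_series [CharZero k] : IsFreeModel (k := k) deg n (seriesGen k deg n) where
  adjoin_eq_top := by
    have h : Set.range (seriesGen k deg n) = seriesProj k deg n '' Set.range (tvar k deg) := by
      rw [← Set.range_comp]; rfl
    rw [h, ← AlgHom.map_adjoin, eq_top_iff]
    rintro y -
    obtain ⟨x, rfl⟩ := seriesProj_surjective y
    rw [seriesProj_eq_sum]
    exact sum_mem fun μ _ => ⟨_, monomial_mem_adjoin _ _, rfl⟩
  sign i j := by
    rw [seriesGen, seriesGen, ← map_mul, tvar_sign, map_zsmul, map_mul]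
  pow_eq_bot := by
    rw [← map_seriesMax, ← Submodule.map_pow, eq_bot_iff]
    rintro _ ⟨x, hx, rfl⟩
    exact seriesProj_eq_zero.2 hx
  exists_hom D _ _ I a hI hħ hn ha hs := by
    obtain ⟨T, hT, hTI⟩ := exists_eval (deg := deg) I a hI hħ hn ha hs
    refine ⟨Ideal.Quotient.liftₐ _ T fun x hx => ?_, hT⟩
    have h2 : T x ∈ I ^ (n + 1) := by
      have h3 := Submodule.mem_map_of_mem (f := T.toLinearMap) (mem_seriesFilt_iff.1 hx)
      rw [Submodule.map_pow] at h3
      exact pow_le_pow_left' (Submodule.map_le_iff_le_comap.2 hTI) (n + 1) h3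
    rw [hn] at h2
    exact (mem_bot _).1 h2

section Grading

variable {F : DGAlg k} (T : GradedSeries k deg →ₐ[Lam k] F)
  (hT : ∀ j, T (tvar k deg j) ∈ F.gr (deg j))

include hT in
theorem map_monomial_mem_gr {i : ℤ} {e : OddAlgebra k deg} (he : e ∈ oddGr k deg i)
    (μ : {j : Fin r // Even (deg j)} →₀ ℕ) : T (MvPowerSeries.monomial μ e) ∈
      F.gr (i + μ.sum fun j e => (e : ℤ) * deg j.1) := by
  rw [monomial_eq, map_mul]
  refine F.mul_mem ?_ ?_
  · induction he using span_induction with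
    | mem x hx =>
      obtain ⟨l, rfl, rfl⟩ := hx
      induction l with
      | nil =>
        rw [List.map_nil, List.map_nil, List.sum_nil, List.prod_nil, map_one, map_one]
        exact F.one_mem
      | cons j l ih =>
        rw [List.map_cons, List.sum_cons, List.map_cons, List.prod_cons, map_mul, map_mul,
          seriesC_oddVar]
        exact F.mul_mem (hT _) ih
    | zero => rw [map_zero, map_zero]; exact zero_mem _
    | add x y _ _ hx hy => rw [map_add, map_add]; exact add_mem hx hy
    | smul c x _ hx => rw [map_smul, map_smul]; exact Submodule.smul_mem _ c hx
  · induction μ using Finsupp.induction_linear with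
    | zero => rw [MvPowerSeries.monomial_zero_one, map_one]; exact F.one_mem
    | add μ ν hμ hν =>
      rw [← one_mul (1 : OddAlgebra k deg), ← MvPowerSeries.monomial_mul_monomial, map_mul,
        Finsupp.sum_add_index' (by simp) (fun j a b => by push_cast; ring)]
      exact F.mul_mem hμ hν
    | single i a =>
      rw [← MvPowerSeries.X_pow_eq, X_eq_tvar, map_pow, Finsupp.sum_single_index (by simp)]
      induction a with
      | zero => rw [pow_zero, Nat.cast_zero, zero_mul]; exact F.one_mem
      | succ a ih =>
        rw [pow_succ, Nat.cast_succ, add_mul, one_mul]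
        exact F.mul_mem ih (hT _)

theorem iSup_oddGr : ⨆ i, oddGr k deg i = ⊤ := by
  rw [eq_top_iff, ← span_oddVar_eq_top, span_le]
  rintro _ ⟨l, rfl⟩
  exact Submodule.mem_iSup_of_mem _ (subset_span ⟨l, rfl, rfl⟩)

end Grading

theorem exists_seriesGr_part (i : ℤ) (y : GradedSeries k deg) :
    ∃ x ∈ seriesGr k deg i, ∀ (F : DGAlg k) (n : ℕ) (q : SeriesQuot k deg n →ₐ[Lam k] F),
      (∀ j, q (seriesGen k deg n j) ∈ F.gr (deg j)) →
      q (seriesProj k deg n x) = pr F.gr_internal i (q (seriesProj k deg n y)) := by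
  have h1 : ∀ μ : {j : Fin r // Even (deg j)} →₀ ℕ, ∃ f : ℤ →₀ OddAlgebra k deg,
      (∀ i, f i ∈ oddGr k deg i) ∧ (f.sum fun _ x => x) = MvPowerSeries.coeff μ y := fun μ =>
    (Submodule.mem_iSup_iff_exists_finsupp _ _).1 (by rw [iSup_oddGr]; trivial)
  choose f hf hfs using h1
  let x : GradedSeries k deg := fun μ => f μ (i - μ.sum fun j e => (e : ℤ) * deg j.1)
  have hx : ∀ μ, MvPowerSeries.coeff μ x = f μ (i - μ.sum fun j e => (e : ℤ) * deg j.1) :=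
    fun μ => rfl
  refine ⟨x, fun μ => by rw [hx]; exact hf μ _, fun F n q hq => ?_⟩
  rw [seriesProj_eq_sum, seriesProj_eq_sum, map_sum, map_sum, map_sum]
  refine sum_congr rfl fun μ _ => ?_
  have hm : ∀ l, q (seriesProj k deg n (MvPowerSeries.monomial μ (f μ l))) ∈
      F.gr (l + μ.sum fun j e => (e : ℤ) * deg j.1) := fun l =>
    map_monomial_mem_gr (q.comp (seriesProj k deg n)) hq (hf μ l) μ
  rw [hx, ← hfs μ]
  set l := i - μ.sum fun j e => (e : ℤ) * deg j.1 with hl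
  rw [Finsupp.sum, map_sum, map_sum, map_sum, map_sum, sum_eq_single l]
  · have := hm l
    rw [hl, sub_add_cancel] at this
    rw [pr_of_mem _ this]
  · intro b _ hb
    exact pr_of_mem_ne _ (hm b) fun h => hb (by rw [hl, ← h, add_sub_cancel_right])
  · intro h
    rw [Finsupp.notMem_support_iff.1 h]
    simp only [map_zero]

end SeriesQuotient

section FreeDerivations

variable {k : Type u} [Field k] {r : ℕ} {deg : Fin r → ℤ} {n : ℕ} {G : DGAlg k} {s : Fin r → G}

theorem map_genIdeal {X Y : Type u} [Ring X] [Algebra (Lam k) X] [Ring Y] [Algebra (Lam k) Y]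
    {T : X →ₐ[Lam k] Y} (hT : Function.Surjective T) {ι : Type*} {s : ι → X} {t : ι → Y}
    (h : ∀ j, T (s j) = t j) : (genIdeal k s).map T.toLinearMap = genIdeal k t := by
  rw [genIdeal, genIdeal, Submodule.map_mul, Submodule.map_top, LinearMap.range_eq_top.2 hT,
    Submodule.map_span, Set.image_insert_eq, ← Set.range_comp, toLinearMap_apply,
    AlgHom.commutes, show ⇑T.toLinearMap ∘ s = t from funext h]

theorem DGAlg.isDer_zero (A : DGAlg k) : A.IsDer 0 :=
  ⟨fun _ => zero_mem _, fun a b => by simp⟩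

theorem DGAlg.IsDer.sq_mul {d : G →ₗ[Lam k] G} (hd : G.IsDer d) (a b : G) :
    d (d (a * b)) = d (d a) * b + a * d (d b) := by
  rw [hd.leibniz, map_add, hd.leibniz, hd.leibniz, hd.par_map, G.par_par, neg_mul]
  abel

theorem IsFreeModel.sq_eq_zero (hG : IsFreeModel (k := k) deg n s)
    {d : G →ₗ[Lam k] G} (hd : G.IsDer d) (h : ∀ j, d (d (s j)) = 0)
    (x : G) : d (d x) = 0 := by
  have hx : x ∈ Algebra.adjoin (Lam k) (Set.range s) := by rw [hG.adjoin_eq_top]; trivial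
  induction hx using Algebra.adjoin_induction with
  | mem x hx => obtain ⟨j, rfl⟩ := hx; exact h j
  | algebraMap c => rw [Algebra.algebraMap_eq_smul_one, map_smul, hd.map_one, smul_zero, map_zero]
  | add x y _ _ hx hy => rw [map_add, map_add, hx, hy, add_zero]
  | mul x y _ _ hx hy => rw [hd.sq_mul, hx, hy, zero_mul, mul_zero, add_zero]

theorem IsFree.two_sided_pow (hG : IsFree deg n G s) (m : ℕ) :
    genIdeal k s ^ (m + 1) * ⊤ ≤ genIdeal k s ^ (m + 1) := by
  rw [pow_succ, mul_assoc]
  exact mul_le_mul' le_rfl hG.model.two_sided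

theorem IsFree.pow_anti (hG : IsFree deg n G s) {l m : ℕ} (h : l ≤ m) :
    genIdeal k s ^ (m + 1) ≤ genIdeal k s ^ (l + 1) := by
  rw [show m + 1 = (l + 1) + (m - l) by omega, pow_add]
  exact (mul_le_mul' le_rfl le_top).trans (hG.two_sided_pow l)

theorem IsFree.der_mem_sq (hG : IsFree deg n G s) {d : G →ₗ[Lam k] G}
    (hd : G.IsDer d) (h : ∀ j, d (s j) ∈ genIdeal k s ^ 2) (x : G) :
    d x ∈ genIdeal k s ^ 2 := by
  have h2 : genIdeal k s * genIdeal k s ^ 2 ≤ genIdeal k s ^ 2 := by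
    rw [← pow_succ']; exact hG.pow_anti (Nat.le_succ 1)
  have h3 : genIdeal k s ^ 2 * genIdeal k s ≤ genIdeal k s ^ 2 := by
    rw [← pow_succ]; exact hG.pow_anti (Nat.le_succ 1)
  have := hG.defect_mem G.isDer_zero hd (T := AlgHom.id _ _) (fun j => hG.mem j)
    hG.model.genIdeal_mul_self (fun j => gen_mem_genIdeal j) h2 h3
    (fun j => by rw [LinearMap.zero_apply, map_zero, sub_zero]; exact h j) x
  rwa [LinearMap.zero_apply, map_zero, sub_zero] at this

theorem IsFree.der_mem_pow (hG : IsFree deg n G s) {d : G →ₗ[Lam k] G}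
    (hd : G.IsDer d) (h : ∀ j, d (s j) ∈ genIdeal k s ^ 2) (m : ℕ) {x : G}
    (hx : x ∈ genIdeal k s ^ (m + 1)) : d x ∈ genIdeal k s ^ (m + 2) := by
  have h0 := hG.der_mem_sq hd h
  induction m generalizing x with
  | zero => exact h0 x
  | succ m ih =>
    rw [pow_succ] at hx
    refine mul_d_mem hd (pow_pr_mem hG.genIdeal_pr m) (fun a ha b hb => ?_)
      (fun a ha b _ => ?_) x hx
    · rw [pow_succ]
      exact mul_mem_mul (ih ha) hb
    · rw [pow_add]
      exact mul_mem_mul ha (h0 b)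

end FreeDerivations

namespace Background

variable {k : Type u} [Field k] {r : ℕ} {B : Background.{u, v, w} k} {degP : Fin r → ℤ}
  {p : Fin r → B.P}

section Surjection

variable {F G : DGAlg k} {ρ : G →ₐ[Lam k] F}

theorem exists_push_annT (hρ : Function.Surjective ρ) {x : B.P ⊗[Lam k] F}
    (hx : x ∈ B.annT F) : ∃ y ∈ B.annT G, B.push ρ.toLinearMap y = x := by
  suffices h : B.annT F ≤ (B.annT G).map (B.push ρ.toLinearMap) from h hx
  refine annT_le fun p a hp => ?_
  obtain ⟨b, rfl⟩ := hρ a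
  exact ⟨p ⊗ₜ b, tmul_mem_annT hp b, lTensor_tmul _ _ _ _⟩

theorem mem_spanT_of_push_eq_zero (hρ : Function.Surjective ρ) {J : Submodule (Lam k) G}
    (hJ : ∀ x, ρ x = 0 → x ∈ J) {x : B.P ⊗[Lam k] G}
    (hx : B.push ρ.toLinearMap x = 0) : x ∈ B.spanT G J := by
  have he : Function.Exact (ker ρ.toLinearMap).subtype ρ.toLinearMap := fun y =>
    ⟨fun hy => ⟨⟨y, hy⟩, rfl⟩, by rintro ⟨z, rfl⟩; exact z.2⟩
  obtain ⟨y, rfl⟩ := (lTensor_exact B.P he hρ x).1 hx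
  exact spanT_mono (J := ker ρ.toLinearMap) (fun x hx => hJ x hx) (lTensor_subtype_mem y)

theorem exists_push_deg (hρ : ∀ i x, ρ (pr G.gr_internal i x) = pr F.gr_internal i (ρ x))
    {K : Submodule (Lam k) F} {J : Submodule (Lam k) G}
    (hJ : ∀ i, ∀ a ∈ J, pr G.gr_internal i a ∈ J) (hK : ∀ a ∈ K, ∃ b ∈ J, ρ b = a) {i : ℤ}
    {x : B.P ⊗[Lam k] F} (hx : x ∈ B.deg F K i) :
    ∃ y ∈ B.deg G J i, B.push ρ.toLinearMap y = x := by
  suffices h : B.deg F K i ≤ (B.deg G J i).map (B.push ρ.toLinearMap) from h hx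
  refine deg_le fun l p a hp ha haK => ?_
  obtain ⟨b, hb, rfl⟩ := hK a haK
  refine ⟨p ⊗ₜ pr G.gr_internal (i - l) b, B.tmul_mem_deg hp (pr_mem _ _ _) (hJ _ b hb) (by ring), ?_⟩
  rw [push, lTensor_tmul, toLinearMap_apply, hρ, pr_of_mem _ ha]

end Surjection

theorem master_zero {A : DGAlg k} (d : A →ₗ[Lam k] A) (n : ℕ) :
    B.master A d (n + 1) 0 = B.m ⊗ₜ 1 := by
  simp [master_succ]

theorem spanT_bot {A : DGAlg k} : B.spanT A ⊥ = ⊥ := by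
  rw [eq_bot_iff]
  refine spanT_le fun p a ha => ?_
  rw [(mem_bot _).1 ha, tmul_zero]
  exact zero_mem _

theorem push_eq_sum {A X : DGAlg k} {π : B.P ⊗[Lam k] A} {t : Fin r → A}
    {K : Submodule (Lam k) A} (h : π - ∑ j, p j ⊗ₜ t j ∈ B.spanT A K)
    (f : A →ₗ[Lam k] X) (hf : ∀ x ∈ K, f x = 0) :
    B.push f π = ∑ j, p j ⊗ₜ f (t j) := by
  have h1 := push_spanT (A' := X) (J' := ⊥) (fun a ha => (mem_bot _).2 (hf a ha)) h
  rw [spanT_bot, mem_bot, map_sub, sub_eq_zero, map_sum] at h1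
  exact h1

theorem diffP_eq_sum {A X : DGAlg k} (hp : ∀ j, p j ∈ B.grP (degP j))
    {π : B.P ⊗[Lam k] A} {t : Fin r → A}
    {K : Submodule (Lam k) A} (h : π - ∑ j, p j ⊗ₜ t j ∈ B.spanT A K)
    (f : A →ₗ[Lam k] X) (hf : ∀ x ∈ K, f x = 0) :
    B.diffP f π = ∑ j, p j ⊗ₜ (sgn (degP j) • f (t j)) := by
  have h1 := diffP_spanT (A' := X) (J' := ⊥) (fun a ha => (mem_bot _).2 (hf a ha)) h
  rw [spanT_bot, mem_bot, map_sub, sub_eq_zero, map_sum] at h1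
  rw [h1]
  exact sum_congr rfl fun j _ => by rw [diffP_tmul f (hp j), tmul_smul]

/-- A solution of the master equation on a free model, up to decomposable terms the universal
one. -/
structure IsSolution (B : Background.{u, v, w} k) (degP : Fin r → ℤ) (p : Fin r → B.P) (n : ℕ)
    (G : DGAlg k) (s : Fin r → G) (d : G →ₗ[Lam k] G)
    (Ξ : B.P ⊗[Lam k] G) : Prop where
  isDer : G.IsDer d
  d_d : ∀ x, d (d x) = 0
  d_mem : ∀ j, d (s j) ∈ genIdeal k s ^ 2
  mem : Ξ ∈ B.deg G (genIdeal k s) 0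
  master : B.master G d (n + 2) Ξ ∈ B.annT G
  linear : Ξ - ∑ j, p j ⊗ₜ s j ∈ B.spanT G (genIdeal k s ^ 2)

theorem linear_mem_deg {n : ℕ} {G : DGAlg k} {s : Fin r → G}
    (hG : IsFree (fun j => -degP j) n G s) (hp : ∀ j, p j ∈ B.grP (degP j)) :
    ∑ j, p j ⊗ₜ[Lam k] s j ∈ B.deg G (genIdeal k s) 0 :=
  sum_mem fun j _ => B.tmul_mem_deg (hp j) (hG.mem j) (gen_mem_genIdeal j) (add_neg_cancel _)

theorem isSolution_linear {n : ℕ} {G : DGAlg k} {s : Fin r → G}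
    (hG : IsFree (fun j => -degP j) n G s) (hp : B.IsHomologyBasis degP p)
    (hn : genIdeal k s ^ 2 = ⊥) : IsSolution B degP p n G s 0 (∑ j, p j ⊗ₜ s j) where
  isDer := G.isDer_zero
  d_d _ := rfl
  d_mem _ := zero_mem _
  mem := linear_mem_deg hG hp.mem
  master := by
    have hII : genIdeal k s * genIdeal k s ≤ ⊥ := by rw [← pow_two, hn]
    have h1 := master_add (B := B) (I := genIdeal k s) (J := genIdeal k s) (J' := ⊥) (n := n + 2)
      G.isDer_zero hG.model.two_sided (fun _ _ => zero_mem _) le_rfl hG.model.two_sided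
      (fun _ _ => zero_mem _) hII hII bot_le (zero_mem _) (linear_mem_deg hG hp.mem) (by omega)
    rw [spanT_bot, mem_bot, zero_add, master_zero, map_sum] at h1
    have h2 : ∑ j, B.totalD G 0 (p j ⊗ₜ[Lam k] s j) ∈ B.annT G := by
      refine sum_mem fun j _ => ?_
      rw [totalD_tmul _ (hp.mem j), LinearMap.zero_apply, tmul_zero, smul_zero, sub_zero]
      obtain ⟨q, hq⟩ := mem_annBar_iff.1 (hp.cycle j)
      have h3 : hbar k • s j = 0 := by
        have := hII (mul_mem_mul (hbar_mem_genIdeal (t := s)) (gen_mem_genIdeal j))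
        rwa [← Algebra.smul_def, mem_bot] at this
      have h4 := tmul_mem_annT hq (s j)
      rwa [sub_tmul, smul_tmul, h3, tmul_zero, sub_zero] at h4
    have h5 := sub_mem (m_mem_annT (B := B) (A := G)) h2
    convert h5 using 1
    rw [eq_sub_iff_add_eq, ← sub_eq_zero, ← h1]
    abel
  linear := by rw [sub_self]; exact zero_mem _

theorem IsSolution.exists_extension [CharZero k] {n : ℕ} {F G : DGAlg k} {t : Fin r → F}
    {s : Fin r → G} {d : F →ₗ[Lam k] F} {Ξ : B.P ⊗[Lam k] F}
    (hF : IsFree (fun j => -degP j) n F t) (hG : IsFree (fun j => -degP j) (n + 1) G s)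
    (hp : B.IsHomologyBasis degP p) (hS : IsSolution B degP p n F t d Ξ)
    (ρ : G →ₐ[Lam k] F) (hρ : Function.Surjective ρ) (hρt : ∀ j, ρ (s j) = t j)
    (hker : ∀ x, ρ x = 0 ↔ x ∈ genIdeal k s ^ (n + 1)) :
    ∃ (d' : G →ₗ[Lam k] G) (Ξ' : B.P ⊗[Lam k] G),
      IsSolution B degP p (n + 1) G s d' Ξ' ∧ (∀ x, ρ (d' x) = d (ρ x)) ∧
      B.push ρ.toLinearMap Ξ' = Ξ := by
  have hρg : ∀ j, ρ (s j) ∈ F.gr (-degP j) := fun j => by rw [hρt]; exact hF.mem j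
  have hcompat : ∀ d' : G →ₗ[Lam k] G, G.IsDer d' →
      (∀ j, ρ (d' (s j)) = d (t j)) → ∀ x, ρ (d' x) = d (ρ x) := fun d' hd' h x => by
    have := hG.defect_mem hd' hS.isDer hρg (I := ⊤) (J := ⊥) le_top
      (fun _ => trivial) (by simp) (by simp)
      (fun j => by rw [h, hρt, sub_self]; exact zero_mem _) x
    exact (sub_eq_zero.1 ((mem_bot _).1 this)).symm
  have hmapI : (genIdeal k s).map ρ.toLinearMap = genIdeal k t := map_genIdeal hρ hρt
  have hIn := hG.model.pow_eq_bot
  have hpr := hG.genIdeal_pr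
  rcases Nat.eq_zero_or_pos n with rfl | hn
  · have hF0 : genIdeal k t = ⊥ := by have := hF.model.pow_eq_bot; rwa [zero_add, pow_one] at this
    have ht : ∀ j, t j = 0 := fun j => (mem_bot _).1 (hF0 ▸ gen_mem_genIdeal j)
    refine ⟨0, _, isSolution_linear hG hp hIn, hcompat 0 G.isDer_zero fun j => ?_, ?_⟩
    · rw [LinearMap.zero_apply, map_zero, ht, map_zero]
    · have h1 := hS.mem
      rw [deg_eq_bot hF0, mem_bot] at h1
      rw [h1, map_sum]
      refine Finset.sum_eq_zero fun j _ => ?_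
      rw [push, lTensor_tmul, toLinearMap_apply, hρt, ht, tmul_zero]
  set I := genIdeal k s with hIdef
  have hI2 : ∀ a ∈ genIdeal k t ^ 2, ∃ b ∈ I ^ 2, ρ b = a := fun a ha => by
    rw [← hmapI, ← Submodule.map_pow] at ha
    exact ha
  have hJ : ∀ i, ∀ a ∈ I ^ (n + 1), pr G.gr_internal i a ∈ I ^ (n + 1) := pow_pr_mem hpr n
  have hρpr : ∀ i x, ρ (pr G.gr_internal i x) = pr F.gr_internal i (ρ x) := hG.hom_pr ρ hρg
  have hJ2 : I ^ (n + 1) ≤ I ^ 2 := hG.pow_anti hn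
  have hJI : I ^ (n + 1) ≤ I := by simpa using hG.pow_anti (Nat.zero_le n)
  have hI2I : I ^ 2 ≤ I := by simpa using hG.pow_anti (Nat.zero_le 1)
  have hIJ : I * I ^ (n + 1) ≤ ⊥ := by rw [← pow_succ', hIn]
  have hJmI : I ^ (n + 1) * I ≤ ⊥ := by rw [← pow_succ, hIn]
  have h1 : ∀ j, ∃ b ∈ I ^ 2, b ∈ G.gr (-degP j + 1) ∧ ρ b = d (t j) := fun j => by
    obtain ⟨b, hb, hbj⟩ := hI2 _ (hS.d_mem j)
    refine ⟨pr G.gr_internal (-degP j + 1) b, pow_pr_mem hpr 1 _ b hb, pr_mem _ _ _, ?_⟩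
    rw [hρpr, hbj, pr_of_mem _ (hS.isDer.map_gr (hF.mem j))]
  choose b hb hbg hbρ using h1
  obtain ⟨d0, hd0, hd0s⟩ := hG.exists_der b hbg fun j => hI2I (hb j)
  have hd0m : ∀ j, d0 (s j) ∈ I ^ 2 := fun j => by rw [hd0s]; exact hb j
  have hd0ρ := hcompat d0 hd0 fun j => by rw [hd0s, hbρ]
  have hd0J : ∀ a ∈ I ^ (n + 1), d0 a = 0 := fun a ha => by
    have := hG.der_mem_pow hd0 hd0m n ha
    rw [← hIdef] at this
    exact (mem_bot _).1 (hIn ▸ this)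
  have hd0I : ∀ a ∈ I, d0 a ∈ I := fun a ha =>
    hI2I (hG.der_mem_pow hd0 hd0m 0 (by rwa [zero_add, pow_one]))
  obtain ⟨y, hy, hyΞ⟩ := exists_push_deg hρpr (pow_pr_mem hpr 1) hI2
    (mem_deg_of_mem_spanT (pow_pr_mem hF.genIdeal_pr 1) hS.linear (sub_mem
      (deg_mono le_top hS.mem) (deg_mono le_top (linear_mem_deg hF hp.mem))))
  set Ξ0 := ∑ j, p j ⊗ₜ[Lam k] s j + y with hΞ0
  have hΞ0m : Ξ0 ∈ B.deg G I 0 := add_mem (linear_mem_deg hG hp.mem) (deg_mono hI2I hy)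
  have hΞ0l : Ξ0 - ∑ j, p j ⊗ₜ[Lam k] s j ∈ B.spanT G (I ^ 2) := by
    rw [hΞ0, add_sub_cancel_left]; exact deg_le_spanT hy
  have hΞ0ρ : B.push ρ.toLinearMap Ξ0 = Ξ := by
    rw [hΞ0, map_add, hyΞ, map_sum]
    rw [show ∑ j, B.push ρ.toLinearMap (p j ⊗ₜ[Lam k] s j) = ∑ j, p j ⊗ₜ[Lam k] t j from
      sum_congr rfl fun j _ => by
        rw [push, lTensor_tmul, toLinearMap_apply, hρt]]
    exact add_sub_cancel _ _
  have hann : B.master G d0 (n + 1 + 2) Ξ0 ∈ B.annMod G (I ^ (n + 1)) := by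
    have h2 := master_push (B := B) (I := I) (I' := ⊤) (K := ⊥) (K' := ⊥) (n := n + 1 + 2) ρ
      (hG.hom_gr ρ hρg) (fun _ _ => trivial) hd0 hS.isDer (fun a _ => by
        rw [hd0ρ, sub_self]; exact zero_mem _) (by simp) le_rfl hΞ0m (by omega)
    rw [show d ∘ₗ ρ.toLinearMap - ρ.toLinearMap ∘ₗ d0 = 0 from LinearMap.ext fun x => by
      simp only [LinearMap.sub_apply, comp_apply, toLinearMap_apply, hd0ρ,
        sub_self, LinearMap.zero_apply], spanT_bot, mem_bot, hΞ0ρ] at h2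
    have h3 : B.master F d (n + 1 + 2) Ξ = B.master F d (n + 2) Ξ :=
      (master_stable hS.isDer hS.mem hF.model.pow_eq_bot (by omega)).trans
        (master_stable hS.isDer hS.mem hF.model.pow_eq_bot (by omega)).symm
    have h4 : B.push ρ.toLinearMap (B.master G d0 (n + 1 + 2) Ξ0) ∈ B.annT F := by
      have h5 : B.diffP (0 : G →ₗ[Lam k] F) Ξ0 = 0 := by simp [diffP]
      rw [h5, sub_zero, sub_eq_zero, h3] at h2
      rw [← h2]
      exact hS.master
    obtain ⟨z, hz, hze⟩ := exists_push_annT hρ h4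
    have h5 := mem_spanT_of_push_eq_zero (B := B) hρ (fun x hx => (hker x).1 hx)
      (x := B.master G d0 (n + 1 + 2) Ξ0 - z) (by rw [map_sub, hze, sub_self])
    rw [← sub_add_cancel (B.master G d0 (n + 1 + 2) Ξ0) z]
    exact add_mem (mem_sup_right h5) (mem_sup_left hz)
  obtain ⟨o, ho, hoann⟩ := exists_sub_mem_annT hJ hann
    (master_mem_top hd0 hG.model.two_sided hd0I hΞ0m (by omega))
  have hsq : ∀ x ∈ I ^ 2, (d0 ∘ₗ d0) x = 0 := by
    have hJd : ∀ x, d0 (d0 x) ∈ I ^ (n + 1) := fun x => by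
      rw [← hker, hd0ρ, hd0ρ, hS.d_d]
    intro x hx
    rw [pow_two] at hx
    refine Submodule.mul_induction_on hx (fun a ha c hc => ?_) (fun a c ha hc => by
      rw [map_add, ha, hc, add_zero])
    rw [comp_apply, hd0.sq_mul, (mem_bot _).1 (hJmI (mul_mem_mul (hJd a) hc)),
      (mem_bot _).1 (hIJ (mul_mem_mul ha (hJd c))), add_zero]
  have hJd : ∀ x, d0 (d0 x) ∈ I ^ (n + 1) := fun x => by
    rw [← hker, hd0ρ, hd0ρ, hS.d_d]
  have hclosed := obstruction_closed (J' := ⊥) hd0 hG.model.two_sided hd0I hJI hIJ bot_le hΞ0m hIn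
    (show n + 1 + 1 ≤ n + 1 + 2 by omega) (by omega) (by
      rw [diffP_diffP]
      have := push_deg (B := B) (A' := G) (f := d0 ∘ₗ d0) (e := 2) (J' := I ^ (n + 1))
        (fun i a ha _ => by
          have := hd0.map_gr (hd0.map_gr ha)
          rwa [add_assoc, one_add_one_eq_two] at this) (fun a _ => hJd a) hΞ0m
      rwa [zero_add] at this) ho hoann
  rw [diffP_diffP, push_eq_sum hΞ0l _ hsq] at hclosed
  obtain ⟨x, w, hxJ, hxg, hw, hxw, hx0⟩ := hp.contract (J' := ⊥) hd0 bot_le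
    (fun a ha => by
      rw [Algebra.smul_def]
      exact hIJ (mul_mem_mul hbar_mem_genIdeal ha)) hJ
    (fun i a ha => by rw [(mem_bot _).1 ha, map_zero]; exact zero_mem _)
    (fun a ha => by rw [hd0J a ha]; exact zero_mem _)
    (fun a ha => by rw [(mem_bot _).1 ha, map_zero]; exact zero_mem _) ho
    (o := fun j => -d0 (d0 (s j))) (fun j => neg_mem (hJd _)) (fun j => by
      have := hd0.map_gr (hd0.map_gr (hG.mem j))
      rw [show (1 : ℤ) + 1 - degP j = -degP j + 1 + 1 by ring]
      exact neg_mem this) (by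
      convert hclosed using 1
      simp only [TensorProduct.tmul_neg, Finset.sum_neg_distrib, sub_neg_eq_add, comp_apply])
  rw [sub_self] at hw
  have hd0sq : ∀ j, d0 (d0 (s j)) = 0 := fun j => by
    have := hx0 j
    rwa [hd0J _ (hxJ j), smul_zero, neg_zero, zero_sub, neg_neg, mem_bot] at this
  have hcJ : ∀ j, -(sgn (degP j) • x j) ∈ I ^ (n + 1) := fun j => neg_mem (zsmul_mem (hxJ j) _)
  obtain ⟨d', hd', hd's⟩ := hG.exists_der (fun j => b j + -(sgn (degP j) • x j)) (fun j => by
    refine add_mem (hbg j) (neg_mem (zsmul_mem ?_ _))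
    rw [show -degP j + 1 = 1 - degP j by ring]
    exact hxg j) fun j => add_mem (hI2I (hb j)) (hJI (hcJ j))
  have hdiff : ∀ j, d' (s j) - d0 (s j) ∈ I ^ (n + 1) := fun j => by
    rw [hd's, hd0s, add_sub_cancel_left]; exact hcJ j
  have hsub : ∀ a, d' a - d0 a ∈ I ^ (n + 1) :=
    hG.defect_mem hd0 hd' (T := AlgHom.id _ _) (fun j => hG.mem j) hG.model.genIdeal_mul_self
      (fun j => gen_mem_genIdeal j) (hIJ.trans bot_le) (hJmI.trans bot_le) hdiff
  have hsub2 : ∀ a ∈ I ^ 2, d' a = d0 a := fun a ha => by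
    have := hG.defect_mem_sq hd0 hd' (T := AlgHom.id _ _) (fun j => hG.mem j)
      hG.model.genIdeal_mul_self hbar_mem_genIdeal (fun j => gen_mem_genIdeal j) hIJ hJmI bot_le
      hdiff ha
    exact sub_eq_zero.1 ((mem_bot _).1 this)
  have hd'm : ∀ j, d' (s j) ∈ I ^ 2 := fun j => by
    rw [hd's]; exact add_mem (hb j) (hJ2 (hcJ j))
  have hd'J : ∀ a ∈ I ^ (n + 1), d' a = 0 := fun a ha => by rw [hsub2 a (hJ2 ha), hd0J a ha]
  have hΞ'm : Ξ0 + w ∈ B.deg G I 0 := add_mem hΞ0m (deg_mono hJI hw)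
  refine ⟨d', Ξ0 + w, ⟨hd', hG.model.sq_eq_zero hd' fun j => ?_, hd'm, hΞ'm, ?_, ?_⟩,
    hcompat d' hd' fun j => ?_, ?_⟩
  · rw [hd's, map_add, hd'J _ (hcJ j), add_zero, hsub2 _ (hb j), ← hd0s, hd0sq]
  · have h2 := master_push (B := B) (I := I) (I' := I) (K := I ^ (n + 1)) (K' := ⊥)
      (n := n + 1 + 2) (AlgHom.id _ _) (fun {_ _} h => h) (fun _ h => h) hd0 hd'
      (fun a _ => hsub a) hIJ bot_le hΞ0m (by omega)
    have hid : ∀ z : B.P ⊗[Lam k] G, B.push (AlgHom.id (Lam k) G).toLinearMap z = z :=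
      fun z => by rw [AlgHom.toLinearMap_id, push, lTensor_id, id_apply]
    rw [hid, hid, AlgHom.toLinearMap_id, LinearMap.comp_id, LinearMap.id_comp, spanT_bot,
      mem_bot, diffP_eq_sum hp.mem hΞ0l _ (fun a ha => by
        rw [LinearMap.sub_apply, hsub2 a ha, sub_self])] at h2
    have h3 := master_add (B := B) (I := I) (J := I ^ (n + 1)) (J' := ⊥) (n := n + 1 + 2) hd'
      hG.model.two_sided
      (fun a ha => hI2I (hG.der_mem_pow hd' hd'm 0 (by rwa [zero_add, pow_one]))) hJI
      (hG.two_sided_pow n) (fun a ha => by rw [hd'J a ha]; exact zero_mem _) hIJ hJmI bot_le hΞ0m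
      hw (by omega)
    rw [spanT_bot, mem_bot] at h3
    have h4 : B.totalD G d' w = B.totalD G d0 w := by
      have h5 := diffP_spanT (B := B) (A' := G) (f := d' - d0) (J' := ⊥) (fun a ha => by
        rw [LinearMap.sub_apply, hd'J a ha, hd0J a ha, sub_self]; exact zero_mem _)
        (deg_le_spanT hw)
      have h6 : B.diffP d' w = B.diffP (d' - d0) w + B.diffP d0 w := by
        rw [diffP, diffP, diffP, ← LinearMap.add_apply, ← TensorProduct.map_add_right,
          sub_add_cancel]
      rw [spanT_bot, mem_bot] at h5
      rw [totalD_apply, totalD_apply, h6, h5, zero_add]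
    have h5 : ∑ j, p j ⊗ₜ[Lam k] (sgn (degP j) • (d' - d0) (s j)) = -∑ j, p j ⊗ₜ[Lam k] x j := by
      rw [← Finset.sum_neg_distrib]
      refine sum_congr rfl fun j _ => ?_
      rw [LinearMap.sub_apply, hd's, hd0s, add_sub_cancel_left, smul_neg, smul_smul, sgn_mul_self,
        one_smul, TensorProduct.tmul_neg]
    rw [h5] at h2
    rw [h4] at h3
    have h6 : o - ∑ j, p j ⊗ₜ[Lam k] x j - B.totalD G d0 w ∈ B.annT G := by
      change _ ∈ B.annT G ⊔ B.spanT G ⊥ at hxw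
      rwa [spanT_bot, sup_bot_eq] at hxw
    have h7 := add_mem hoann h6
    convert h7 using 1
    rw [← sub_eq_zero]
    have h8 := congrArg₂ (· + ·) h2 h3
    simp only [add_zero] at h8
    rw [← h8]
    abel
  · rw [add_sub_right_comm]
    exact add_mem hΞ0l (spanT_mono hJ2 (deg_le_spanT hw))
  · rw [hd's, map_add, hbρ, (hker _).2 (hcJ j), add_zero]
  · rw [map_add, hΞ0ρ]
    have h2 := push_spanT (B := B) (A' := F) (f := ρ.toLinearMap) (J' := ⊥)
      (fun a ha => (mem_bot _).2 ((hker a).2 ha)) (deg_le_spanT hw)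
    rw [spanT_bot, mem_bot] at h2
    rw [h2, add_zero]

end Background

section ParameterRings

variable {k : Type u} [Field k] {r : ℕ} {deg : Fin r → ℤ} {n : ℕ} {G : DGAlg k} {s : Fin r → G}

/-- The same graded algebra with another differential. -/
def DGAlg.withD (A : DGAlg k) (d : A →ₗ[Lam k] A) (hd : A.IsDer d)
    (hdd : ∀ a, d (d a) = 0) : DGAlg k where
  __ := A
  d := d
  d_mem := hd.map_gr
  leibniz ha b := by rw [hd.leibniz, par_of_mem ha, smul_mul_assoc]
  d_d := hdd

theorem IsFreeModel.exists_sub_mem (h : IsFreeModel (k := k) deg n s) (x : G) :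
    ∃ c : k, x - algebraMap (Lam k) G (C c) ∈ genIdeal k s := by
  have hx : x ∈ Algebra.adjoin (Lam k) (Set.range s) := by rw [h.adjoin_eq_top]; trivial
  induction hx using Algebra.adjoin_induction with
  | mem x hx =>
    obtain ⟨j, rfl⟩ := hx
    exact ⟨0, by rw [map_zero, map_zero, sub_zero]; exact gen_mem_genIdeal j⟩
  | algebraMap c =>
    refine ⟨constantCoeff c, ?_⟩
    obtain ⟨e, he⟩ := PowerSeries.X_dvd_iff.2 (show constantCoeff
      (c - C (constantCoeff c)) = 0 by simp)
    rw [← map_sub, he, mul_comm, map_mul]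
    exact mul_mem_genIdeal _ hbar_mem_genIdeal
  | add x y _ _ hx hy =>
    obtain ⟨c, hc⟩ := hx
    obtain ⟨e, he⟩ := hy
    refine ⟨c + e, ?_⟩
    rw [map_add, map_add, add_sub_add_comm]
    exact add_mem hc he
  | mul x y _ _ hx hy =>
    obtain ⟨c, hc⟩ := hx
    obtain ⟨e, he⟩ := hy
    refine ⟨c * e, ?_⟩
    have h1 := add_mem (mul_mem_genIdeal x he) (mul_mem_genIdeal (algebraMap (Lam k) G (C e)) hc)
    rw [map_mul, map_mul]
    convert h1 using 1
    rw [mul_sub, mul_sub, Algebra.commutes (C e) x, Algebra.commutes (C e) (algebraMap _ _ (C c))]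
    abel

theorem IsFreeModel.algebraMap_mem (h : IsFreeModel (k := k) deg n s) {c : k}
    (hc : algebraMap (Lam k) G (C c) ∈ genIdeal k s) : c = 0 := by
  have hħ : algebraMap (Lam k) (tangentRing k 0) (hbar k) ∈
      (⊥ : Submodule (Lam k) (tangentRing k 0)) := by
    rw [mem_bot, Algebra.algebraMap_eq_smul_one]
    change hbar k • (1 : Eps k) = 0
    ext <;> simp
  obtain ⟨T, hT⟩ := h.exists_hom (tangentRing k 0) ⊥ 0 (by simp) hħ
    (by rw [pow_succ, Submodule.mul_bot]) (fun j => zero_mem _) (fun i j => by simp)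
  have h1 : genIdeal k s ≤ ker T.toLinearMap := by
    refine genIdeal_le (fun a x hx => ?_) ?_ fun j => ?_
    · change T (a * x) = 0
      rw [map_mul, show T x = 0 from hx, mul_zero]
    · change T _ = 0
      rw [AlgHom.commutes]
      exact hħ
    · exact hT j
  by_contra hne
  refine (tangentRing k 0).algebraMap_C_notMem hne ?_
  have h2 : T _ = 0 := h1 hc
  rw [AlgHom.commutes] at h2
  rw [h2]
  exact zero_mem _

/-- A free model with a decomposable differential, as a parameter ring. -/
def IsFree.toParamRing (hG : IsFree deg n G s) (hd : ∀ j, G.d (s j) ∈ genIdeal k s ^ 2)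
    (hfin : Module.Finite (Lam k) G) : ParamRing k where
  toDGAlg := G
  maxIdeal := genIdeal k s
  mul_mem_left a _ hx := mul_mem_genIdeal a hx
  mul_mem_right _ _ hx := hG.model.two_sided (mul_mem_mul hx trivial)
  residue a := by
    obtain ⟨c, hc⟩ := hG.model.exists_sub_mem a
    refine ⟨c, hc, fun e he => ?_⟩
    have h1 := sub_mem hc he
    rw [sub_sub_sub_cancel_left, ← map_sub, ← map_sub] at h1
    exact sub_eq_zero.1 (hG.model.algebraMap_mem h1)
  nilpotent := ⟨n + 1, hG.model.pow_eq_bot⟩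
  finite := hfin
  one_not_exact x hx := by
    have h1 := hG.der_mem_sq G.isDer hd x
    rw [hx, ← map_one (algebraMap (Lam k) G), ← map_one C] at h1
    exact one_ne_zero (hG.model.algebraMap_mem
      ((hG.pow_anti (Nat.zero_le 1)).trans (pow_one _).le h1))

end ParameterRings

section SeriesTower

variable (k : Type u) [Field k] {r : ℕ} (deg : Fin r → ℤ)

/-- The quotients of the graded power series, with zero differential. -/
def seriesAlg [CharZero k] (n : ℕ) : DGAlg k :=
  (isFreeModel_series k deg n).toDGAlg 0 (fun _ => zero_mem _) (fun _ _ => by simp) (fun _ => rfl)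

theorem isFree_series [CharZero k] (n : ℕ) : IsFree deg n (seriesAlg k deg n) (seriesGen k deg n) where
  model := isFreeModel_series k deg n
  mem j := (isFreeModel_series k deg n).gen_mem j

instance (n : ℕ) : Module.Finite (Lam k) (SeriesQuot k deg n) := by
  have : Module.Finite (Lam k) (OddAlgebra k deg) := Module.Finite.of_basis (oddBasis k deg)
  let f : (evenMonomials deg n → OddAlgebra k deg) →ₗ[Lam k] SeriesQuot k deg n :=
    ∑ μ : evenMonomials deg n, (seriesProj k deg n).toLinearMap ∘ₗ
      (MvPowerSeries.monomial μ.1).restrictScalars (Lam k) ∘ₗ LinearMap.proj μ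
  refine Module.Finite.of_surjective f fun y => ?_
  obtain ⟨x, rfl⟩ := seriesProj_surjective y
  refine ⟨fun μ => MvPowerSeries.coeff μ.1 x, ?_⟩
  rw [seriesProj_eq_sum, ← Finset.sum_coe_sort, LinearMap.sum_apply]
  rfl

/-- The projections between the quotients of the graded power series. -/
def seriesRed (n : ℕ) : SeriesQuot k deg (n + 1) →ₐ[Lam k] SeriesQuot k deg n :=
  Ideal.Quotient.factorₐ (Lam k) (seriesFilt_anti (Nat.le_succ _))

variable {k deg}

theorem seriesRed_proj (n : ℕ) (x : GradedSeries k deg) :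
    seriesRed k deg n (seriesProj k deg (n + 1) x) = seriesProj k deg n x := rfl

theorem seriesRed_surjective (n : ℕ) : Function.Surjective (seriesRed k deg n) := fun y => by
  obtain ⟨x, rfl⟩ := seriesProj_surjective y
  exact ⟨_, seriesRed_proj n x⟩

theorem seriesRed_eq_zero (n : ℕ) (x : SeriesQuot k deg (n + 1)) :
    seriesRed k deg n x = 0 ↔ x ∈ genIdeal k (seriesGen k deg (n + 1)) ^ (n + 1) := by
  obtain ⟨y, rfl⟩ := seriesProj_surjective x
  rw [seriesRed_proj, seriesProj_eq_zero, ← map_seriesMax, ← Submodule.map_pow]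
  refine ⟨fun h => ⟨y, h, rfl⟩, fun ⟨z, hz, h⟩ => ?_⟩
  have h1 : seriesProj k deg (n + 1) (y - z) = 0 := by
    rw [map_sub, sub_eq_zero]; exact h.symm
  rw [← sub_add_cancel y z]
  exact add_mem (seriesMax_pow_anti (Nat.le_succ n) (seriesProj_eq_zero.1 h1)) hz

theorem series_ext {x y : GradedSeries k deg} (h : ∀ n, seriesProj k deg n x = seriesProj k deg n y) :
    x = y :=
  eq_of_forall_seriesFilt fun n => by
    rw [mem_seriesFilt_iff, ← seriesProj_eq_zero, map_sub, h, sub_self]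

theorem exists_series (z : ∀ n, SeriesQuot k deg n) (hz : ∀ n, seriesRed k deg n (z (n + 1)) = z n) :
    ∃ x, ∀ n, seriesProj k deg n x = z n := by
  choose y hy using fun n => seriesProj_surjective (z n)
  obtain ⟨x, hx⟩ := exists_series_limit y fun n => by
    rw [mem_seriesFilt_iff, ← seriesProj_eq_zero, map_sub, ← seriesRed_proj, hy, hy, hz, sub_self]
  refine ⟨x, fun n => ?_⟩
  have := hx n
  rwa [mem_seriesFilt_iff, ← seriesProj_eq_zero, map_sub, hy, sub_eq_zero] at this

theorem seriesProj_mem_gr [CharZero k] {i : ℤ} {x : GradedSeries k deg} (hx : x ∈ seriesGr k deg i) (n : ℕ) :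
    seriesProj k deg n x ∈ (seriesAlg k deg n).gr i := by
  rw [seriesProj_eq_sum]
  refine sum_mem fun μ _ => ?_
  have := map_monomial_mem_gr (F := seriesAlg k deg n) (seriesProj k deg n)
    (fun j => (isFree_series k deg n).mem j) (hx μ) μ
  rwa [sub_add_cancel] at this

theorem mem_seriesGr [CharZero k] {i : ℤ} {x : GradedSeries k deg}
    (hx : ∀ n, seriesProj k deg n x ∈ (seriesAlg k deg n).gr i) : x ∈ seriesGr k deg i := by
  obtain ⟨y, hy, h⟩ := exists_seriesGr_part i x
  suffices e : x = y by rwa [e]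
  refine series_ext fun n => ?_
  have := h (seriesAlg k deg n) n (AlgHom.id _ _) fun j => (isFree_series k deg n).mem j
  exact (this.trans (pr_of_mem _ (hx n))).symm

end SeriesTower

namespace Background

variable {k : Type u} [Field k] [CharZero k] {r : ℕ} {B : Background.{u, v, w} k}
  {degP : Fin r → ℤ} {p : Fin r → B.P}

/-- The solutions on the quotients of the power series. -/
structure Stage (B : Background.{u, v, w} k) (degP : Fin r → ℤ) (p : Fin r → B.P) (n : ℕ) where
  d : SeriesQuot k (fun j => -degP j) n →ₗ[Lam k] SeriesQuot k (fun j => -degP j) n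
  elt : B.P ⊗[Lam k] SeriesQuot k (fun j => -degP j) n
  isSolution : IsSolution B degP p n (seriesAlg k _ n) (seriesGen k _ n) d elt

theorem exists_stages (hp : B.IsHomologyBasis degP p) : ∃ X : ∀ n, Stage B degP p n,
      (∀ n x, seriesRed k _ n ((X (n + 1)).d x) = (X n).d (seriesRed k _ n x)) ∧
      ∀ n, B.push (seriesRed k _ n).toLinearMap (X (n + 1)).elt = (X n).elt := by
  have hstep : ∀ n (X : Stage B degP p n), ∃ Y : Stage B degP p (n + 1),
      (∀ x, seriesRed k _ n (Y.d x) = X.d (seriesRed k _ n x)) ∧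
      B.push (seriesRed k _ n).toLinearMap Y.elt = X.elt := fun n X => by
    obtain ⟨d, Ξ, h, h1, h2⟩ := X.isSolution.exists_extension (isFree_series k _ n)
      (isFree_series k _ (n + 1)) hp (seriesRed k _ n) (seriesRed_surjective n) (fun _ => rfl)
      (seriesRed_eq_zero n)
    exact ⟨⟨d, Ξ, h⟩, h1, h2⟩
  choose f hf1 hf2 using hstep
  have h0 := isSolution_linear (isFree_series k (fun j => -degP j) 0) hp (by
    have := (isFree_series k (fun j => -degP j) 0).model.pow_eq_bot
    rw [zero_add, pow_one] at this
    rw [this, pow_two, Submodule.bot_mul])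
  let X : ∀ n, Stage B degP p n := fun n => Nat.rec ⟨_, _, h0⟩ (fun n x => f n x) n
  exact ⟨X, fun n => hf1 n (X n), fun n => hf2 n (X n)⟩

/-- The differential on the power series, the complete parameter ring and the universal
solution. -/
theorem exists_versalTower (hB : B.VacuumPure) (hp : B.IsHomologyBasis degP p) :
    ∃ δ : GradedSeries k (fun j => -degP j) →ₗ[Lam k] GradedSeries k (fun j => -degP j),
      IsDifferential δ ∧
      (∀ x ∈ seriesMax k (fun j => -degP j), δ x ∈ seriesMax k (fun j => -degP j) ^ 2) ∧
      ∃ (R : CompleteRing k) (q : Presentation δ R) (Ξ : B.QMhat R),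
        VersalTower B degP p R (fun n j => q.proj n (tvar k (fun j => -degP j) j)) Ξ := by
  obtain ⟨X, hd, hΞ⟩ := exists_stages hp
  let d := fun n => (X n).d
  let Ξ := fun n => (X n).elt
  have hS := fun n => (X n).isSolution
  have hF := isFree_series k (fun j => -degP j)
  have h1 : ∀ x, ∃ y, ∀ n, seriesProj k (fun j => -degP j) n y = d n (seriesProj k _ n x) :=
    fun x => exists_series _ fun n => by rw [hd, seriesRed_proj]
  choose D hD using h1
  let δ : GradedSeries k (fun j => -degP j) →ₗ[Lam k] GradedSeries k (fun j => -degP j) :=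
    { toFun := D
      map_add' := fun x y => series_ext fun n => by simp only [hD, map_add]
      map_smul' := fun c x => series_ext fun n => by
        simp only [hD, map_smul, RingHom.id_apply] }
  have hδ : ∀ n x, seriesProj k _ n (δ x) = d n (seriesProj k _ n x) := fun n x => hD x n
  let F : ∀ n, DGAlg k := fun n => (seriesAlg k _ n).withD (d n) (hS n).isDer (hS n).d_d
  have hFF : ∀ n, IsFree (fun j => -degP j) n (F n) (seriesGen k _ n) := fun n =>
    ⟨(hF n).model, (hF n).mem⟩
  let R : CompleteRing k :=
    { obj := fun n => (hFF n).toParamRing (hS n).d_mem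
        (inferInstanceAs (Module.Finite (Lam k) (SeriesQuot k (fun j => -degP j) n)))
      map := fun n =>
        { toAlgHom := seriesRed k _ n
          map_gr := fun h => (hF (n + 1)).hom_gr (D := seriesAlg k _ n) (seriesRed k _ n)
            (fun j => (hF n).mem j) h
          map_d := fun a => hd n a
          map_max := fun {a} h => by
            have := map_genIdeal (k := k) (seriesRed_surjective n)
              (s := seriesGen k (fun j => -degP j) (n + 1)) (t := seriesGen k _ n) (fun _ => rfl)
            exact this.le (Submodule.mem_map_of_mem h) }
      surjective := fun n => seriesRed_surjective n
      maxIdeal_pow := fun n => (hF n).model.pow_eq_bot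
      ker_map := fun n x => seriesRed_eq_zero n x }
  have hdiff : IsDifferential δ :=
    { map_gr := fun {i x} hx => mem_seriesGr fun n => by
        rw [hδ]
        exact (hS n).isDer.map_gr (seriesProj_mem_gr hx n)
      leibniz := fun {i x} hx y => series_ext fun n => by
        rw [hδ, map_add, map_zsmul, map_mul (seriesProj k _ n), map_mul (seriesProj k _ n),
          map_mul (seriesProj k _ n), hδ, hδ]
        exact (F n).leibniz (seriesProj_mem_gr hx n) _
      sq_zero := fun x => series_ext fun n => by
        rw [hδ, hδ, map_zero]
        exact (hS n).d_d _ }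
  let q : Presentation δ R :=
    { proj := fun n => seriesProj k _ n
      surjective := fun n => seriesProj_surjective
      ker_proj := fun n x => seriesProj_eq_zero
      comm := fun n x => rfl
      map_gr := fun n {i x} hx => seriesProj_mem_gr hx n
      map_d := fun n x => hδ n x }
  have hV : ∀ n, IsVersal B degP p n (R.obj n).toDGAlg (seriesGen k _ n) (Ξ n) := fun n =>
    { free := hFF n
      basis := hp
      d_mem := (hS n).d_mem
      mem := (hS n).mem
      master := (hS n).master
      linear := (hS n).linear }
  let Θ : B.QMhat R :=
    { app := fun n => ⟨Ξ n, (mem_solutions_iff_isSol hB (R.maxIdeal_pow n)).2 (hV n).isSol⟩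
      comm := fun n => Subtype.ext (hΞ n) }
  refine ⟨δ, hdiff, fun x _ => ?_, R, q, Θ, hV, fun n => rfl, fun n j => rfl⟩
  rw [← seriesProj_eq_zero (n := 1), hδ]
  have h2 := (hF 1).der_mem_sq (hS 1).isDer (hS 1).d_mem (seriesProj k _ 1 x)
  rw [(hF 1).model.pow_eq_bot] at h2
  exact (mem_bot _).1 h2

end Background

namespace Background

variable {k : Type u} [Field k] {B : Background.{u, v, w} k} {i : ℤ}

theorem Eps_eps_fst : Eps.fst (Eps.eps k) = 0 := TrivSqZeroExt.fst_inr k (1 : k)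

theorem Eps_eps_snd : Eps.snd (Eps.eps k) = 1 := TrivSqZeroExt.snd_inr k (1 : k)

variable (k i) in
/-- The generator `ε` of the maximal ideal of `E_i`. -/
def teps : (tangentRing k i).toDGAlg := Eps.eps k

variable (k i) in
theorem teps_mem : teps k i ∈ (tangentRing k i).maxIdeal := Eps_eps_fst

variable (k i) in
theorem teps_gr : teps k i ∈ (tangentRing k i).gr (-i) :=
  ⟨fun _ => Eps_eps_fst, fun h => absurd rfl h⟩

theorem eq_smul_teps {a : (tangentRing k i)} (ha : a ∈ (tangentRing k i).maxIdeal) :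
    a = (C (Eps.snd a) : Lam k) • teps k i := by
  change Eps.fst a = 0 at ha
  refine Eps.ext ?_ ?_
  · rw [ha]
    refine ((Eps.fst_smul _ _).trans ?_).symm
    rw [teps, Eps_eps_fst, mul_zero]
  · refine ((Eps.snd_smul _ _).trans ?_).symm
    rw [teps, Eps_eps_snd, mul_one, PowerSeries.constantCoeff_C]

theorem hbar_smul_tangent (a : (tangentRing k i)) : hbar k • a = 0 := by
  refine Eps.ext ((Eps.fst_smul _ _).trans ?_) ((Eps.snd_smul _ _).trans ?_)
  · simp only [hbar, PowerSeries.constantCoeff_X, zero_mul]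
    rfl
  · simp only [hbar, PowerSeries.constantCoeff_X, zero_mul]
    rfl

theorem exists_tmul_teps {n : ℤ} {x : B.P ⊗[Lam k] (tangentRing k i)}
    (hx : x ∈ B.deg (tangentRing k i) (tangentRing k i).maxIdeal n) :
    ∃ p ∈ B.grP (n + i), p ⊗ₜ teps k i = x := by
  have : B.deg (tangentRing k i) (tangentRing k i).maxIdeal n ≤
      (B.grP (n + i)).map ((TensorProduct.mk (Lam k) B.P _).flip (teps k i)) := by
    refine deg_le fun j p a hp ha haI => ?_
    rw [eq_smul_teps haI, ← smul_tmul]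
    by_cases h : n - j = -i
    · refine ⟨_, Submodule.smul_mem _ _ ?_, rfl⟩
      rwa [show n + i = j by omega]
    · rw [show Eps.snd a = 0 from ha.2 h, map_zero, zero_smul, zero_tmul]
      exact zero_mem _
  exact this hx

variable (B i) in
/-- The coefficient of `ε`, modulo `ħ` and the annihilator of the vacuum. -/
def epsCoeff : B.P ⊗[Lam k] (tangentRing k i) →ₗ[Lam k] B.P ⧸ B.annBar :=
  TensorProduct.lift (LinearMap.mk₂ (Lam k)
    (fun p (a : (tangentRing k i)) =>
      (C (Eps.snd a) : Lam k) • B.annBar.mkQ p)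
    (fun p q a => by rw [map_add, smul_add])
    (fun c p a => by rw [map_smul, smul_comm])
    (fun p a b => by
      rw [show Eps.snd (a + b) = Eps.snd a + Eps.snd b from Eps.snd_add _ _, map_add, add_smul])
    (fun c p a => by
      rw [show Eps.snd (c • a) = constantCoeff c * Eps.snd a from Eps.snd_smul _ _,
        map_mul, mul_smul, ← smul_eq_C_smul (hbar_smul_quotient_annBar _)]))

theorem epsCoeff_tmul_teps (p : B.P) : B.epsCoeff i (p ⊗ₜ teps k i) = B.annBar.mkQ p := by
  change (C (Eps.snd (Eps.eps k)) : Lam k) • B.annBar.mkQ p = _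
  rw [Eps_eps_snd, map_one, one_smul]

theorem tmul_teps_mem_annT {p : B.P} :
    p ⊗ₜ teps k i ∈ B.annT (tangentRing k i) ↔ p ∈ B.annBar := by
  constructor
  · intro h
    have h1 : B.annT (tangentRing k i) ≤ ker (B.epsCoeff i) := by
      refine annT_le fun q a hq => ?_
      change (C (Eps.snd a) : Lam k) • B.annBar.mkQ q = 0
      rw [(B.annBar.mkQ_apply q).trans ((Submodule.Quotient.mk_eq_zero _).2 (ann_le_annBar hq)),
        smul_zero]
    have h2 : B.epsCoeff i (p ⊗ₜ teps k i) = 0 := h1 h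
    rw [epsCoeff_tmul_teps] at h2
    exact (Submodule.Quotient.mk_eq_zero _).1 h2
  · intro h
    obtain ⟨q, hq⟩ := mem_annBar_iff.1 h
    have := tmul_mem_annT (A := (tangentRing k i)) hq (teps k i)
    rwa [sub_tmul, smul_tmul, hbar_smul_tangent, tmul_zero, sub_zero] at this

theorem linearPart_eq {A : DGAlg k} {J : Submodule (Lam k) A} {x : B.P ⊗[Lam k] A}
    (hx : x ∈ B.deg A J 0) : B.linearPart A x = -B.actT A (B.totalD A A.d x) := by
  have h := bracketT_symm (deg_mono le_top hx) (B.m_mem_deg (A := A))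
  rw [zero_mul, sgn_zero, one_smul] at h
  rw [totalD_apply, ← map_neg, neg_sub, sub_eq_add_neg, ← h, add_comm]
  rfl

theorem mem_ker_linearPart (hB : B.VacuumPure) {A : DGAlg k} {J : Submodule (Lam k) A}
    {x : B.P ⊗[Lam k] A} (hx : x ∈ B.deg A J 0) :
    x ∈ ker (B.linearPart A) ↔ B.totalD A A.d x ∈ B.annT A := by
  rw [LinearMap.mem_ker, linearPart_eq hx, neg_eq_zero, actT_eq_zero_iff hB]

theorem totalD_tmul_teps (p : B.P) : B.totalD (tangentRing k i) (tangentRing k i).d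
    (p ⊗ₜ teps k i) = B.bracket B.m p ⊗ₜ teps k i := by
  have h : B.diffP (tangentRing k i).d (p ⊗ₜ[Lam k] teps k i) = 0 := by
    change _ ⊗ₜ (0 : (tangentRing k i)) = _
    exact tmul_zero _ _
  rw [totalD, LinearMap.sub_apply, h, sub_zero]
  rfl

theorem tmul_teps_mem_tangentSolutions (hB : B.VacuumPure) {p : B.P} (hp : p ∈ B.grP i) :
    p ⊗ₜ teps k i ∈ B.tangentSolutions i ↔ B.bracket B.m p ∈ B.annBar := by
  have h : p ⊗ₜ teps k i ∈ B.deg (tangentRing k i) (tangentRing k i).maxIdeal 0 :=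
    B.tmul_mem_deg hp (teps_gr k i) (teps_mem k i) (by omega)
  rw [tangentSolutions, degZero_eq_deg, Submodule.mem_inf, mem_ker_linearPart hB h,
    totalD_tmul_teps, tmul_teps_mem_annT]
  exact and_iff_right h

theorem exists_tmul_eq_of_mem_tangentSolutions (hB : B.VacuumPure)
    {x : B.P ⊗[Lam k] (tangentRing k i)} (hx : x ∈ B.tangentSolutions i) :
    ∃ p ∈ B.grP i, B.bracket B.m p ∈ B.annBar ∧ p ⊗ₜ teps k i = x := by
  obtain ⟨p, hp, rfl⟩ := exists_tmul_teps (B := B) (x := x) (by rw [← degZero_eq_deg]; exact hx.1)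
  rw [zero_add] at hp
  exact ⟨p, hp, (tmul_teps_mem_tangentSolutions hB hp).1 hx, rfl⟩

theorem exists_null_path_iff [CharZero k] {A : DGAlg k} {I : Submodule (Lam k) A}
    (hIp : ∀ j, ∀ a ∈ I, pr A.gr_internal j a ∈ I) (hId : ∀ a ∈ I, A.d a ∈ I)
    {x : B.P ⊗[Lam k] A} (hx : x ∈ B.deg A I 0) :
    (∃ y ∈ B.deg A.forms (A.formsSub I) 0, B.totalD A.forms A.forms.d y ∈ B.annT A.forms ∧
      B.push (A.ev (1 : ℤ)) y = 0 ∧ B.push (A.ev (0 : ℤ)) y = x) ↔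
    ∃ w ∈ B.deg A I (-1), x - B.totalD A A.d w ∈ B.annT A := by
  constructor
  · rintro ⟨y, hy, hyD, hy1, rfl⟩
    have hev := push_ev_deg 0 (sigma_deg hIp 1 hy)
    have key := totalD_sigma 1 y
    rw [hy1, map_zero, sub_zero] at key
    refine ⟨-B.push (A.ev ((0 : ℤ) : A)) (B.diffP (A.sigma 1) y), neg_mem hev, ?_⟩
    rw [map_neg, sub_neg_eq_add, ← push_ev_totalD, ← map_add, key, add_sub_cancel]
    exact push_annT (neg_mem (diffP_annT hyD))
  · rintro ⟨w, hw, hxw⟩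
    have hDw := totalD_deg A.isDer hId hw
    rw [neg_add_cancel] at hDw
    have hdf : ∀ a ∈ A.formsSub I, A.forms.d a ∈ A.formsSub I := fun a ha =>
      formsSub_d hIp hId ha
    have hDf := totalD_deg A.forms.isDer hdf (push_affine_deg 1 0 hw)
    rw [neg_add_cancel] at hDf
    refine ⟨B.totalD A.forms A.forms.d (B.push (A.affine 1 0) w) +
      B.push (A.affine 1 0) (x - B.totalD A A.d w), ?_, ?_, ?_, ?_⟩
    · exact add_mem hDf (push_affine_deg 1 0 (sub_mem hx hDw))
    · rw [map_add, totalD_totalD A.forms.d_d, zero_add, totalD_apply]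
      refine sub_mem (bracketT_annT m_mem_annT (push_annT hxw)) ?_
      exact diffP_annT (push_annT hxw)
    · rw [map_add, push_ev_totalD, push_ev_affine, push_ev_affine]; simp
    · rw [map_add, push_ev_totalD, push_ev_affine, push_ev_affine]; simp

theorem mem_tangentNull_iff [CharZero k] (hB : B.VacuumPure) (x : B.tangentSolutions i) :
    x ∈ B.tangentNull i ↔ ∃ w ∈ B.deg (tangentRing k i) (tangentRing k i).maxIdeal (-1),
        x.1 - B.totalD (tangentRing k i) (tangentRing k i).d w ∈
          B.annT (tangentRing k i).toDGAlg := by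
  obtain ⟨x, hx⟩ := x
  rw [← exists_null_path_iff (x := x) ?_ (fun _ _ => zero_mem _)
    (by rw [← degZero_eq_deg]; exact hx.1), Int.cast_zero, Int.cast_one]
  · constructor
    · rintro ⟨y, ⟨⟨hy, hyD⟩, hy1⟩, hy0⟩
      rw [SetLike.mem_coe, degZero_eq_deg] at hy
      exact ⟨y, hy, (mem_ker_linearPart hB hy).1 hyD, hy1, hy0⟩
    · rintro ⟨y, hy, hyD, hy1, hy0⟩
      refine ⟨y, ⟨⟨?_, (mem_ker_linearPart hB hy).2 hyD⟩, hy1⟩, hy0⟩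
      rw [SetLike.mem_coe, degZero_eq_deg]
      exact hy
  · intro j a ha
    rw [eq_smul_teps ha, map_smul]
    refine Submodule.smul_mem _ _ ?_
    by_cases h : -i = j
    · subst h
      rw [pr_of_mem _ (teps_gr k i)]
      exact teps_mem k i
    · rw [pr_of_mem_ne _ (teps_gr k i) h]
      exact zero_mem _

theorem tmul_teps_mem_tangentNull [CharZero k] (hB : B.VacuumPure) {p : B.P}
    (h : p ⊗ₜ teps k i ∈ B.tangentSolutions i) : (⟨_, h⟩ : B.tangentSolutions i) ∈ B.tangentNull i ↔
      ∃ q ∈ B.grP (i - 1), p - B.bracket B.m q ∈ B.annBar := by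
  rw [mem_tangentNull_iff hB]
  constructor
  · rintro ⟨w, hw, hpw⟩
    obtain ⟨q, hq, rfl⟩ := exists_tmul_teps hw
    rw [totalD_tmul_teps, ← sub_tmul, tmul_teps_mem_annT] at hpw
    exact ⟨q, by rwa [show i - 1 = -1 + i by ring], hpw⟩
  · rintro ⟨q, hq, hpq⟩
    refine ⟨q ⊗ₜ teps k i, B.tmul_mem_deg hq (teps_gr k i) (teps_mem k i) (by omega), ?_⟩
    rw [totalD_tmul_teps, ← sub_tmul, tmul_teps_mem_annT]
    exact hpq

variable (B) in
/-- The boundaries modulo `ħ` and the annihilator of the vacuum. -/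
def boundaries : Submodule (Lam k) B.P := B.annBar ⊔ range (B.bracket B.m)

theorem mem_boundaries {p : B.P} :
    p ∈ B.boundaries ↔ ∃ q, p - B.bracket B.m q ∈ B.annBar := by
  rw [boundaries, mem_sup]
  constructor
  · rintro ⟨a, ha, _, ⟨q, rfl⟩, rfl⟩
    exact ⟨q, by rwa [add_sub_cancel_right]⟩
  · rintro ⟨q, hq⟩
    exact ⟨_, hq, _, ⟨q, rfl⟩, sub_add_cancel _ _⟩

theorem pr_annBar (j : ℤ) {p : B.P} (hp : p ∈ B.annBar) : pr B.grP_internal j p ∈ B.annBar := by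
  obtain ⟨q, hq⟩ := mem_annBar_iff.1 hp
  refine mem_annBar_iff.2 ⟨pr B.grP_internal j q, ?_⟩
  rw [← map_smul, ← map_sub]
  exact B.pr_ann j _ hq

theorem pr_bracket_m (j : ℤ) (p : B.P) : pr B.grP_internal j (B.bracket B.m p) =
    B.bracket B.m (pr B.grP_internal (j - 1) p) := by
  refine graded_ind B.grP_internal (p := fun p => pr B.grP_internal j (B.bracket B.m p) =
    B.bracket B.m (pr B.grP_internal (j - 1) p)) (by simp) (fun x y hx hy => by simp [hx, hy])
    (fun l p hp => ?_) p
  have h := B.bracket_mem B.m_mem hp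
  by_cases hl : l = j - 1
  · subst hl
    rw [pr_of_mem _ hp]
    exact pr_of_mem _ (by rwa [add_sub_cancel] at h)
  · rw [pr_of_mem_ne _ hp hl, pr_of_mem_ne _ h (by omega), map_zero]

theorem pr_boundaries (j : ℤ) {p : B.P} (hp : p ∈ B.boundaries) :
    ∃ q ∈ B.grP (j - 1), pr B.grP_internal j p - B.bracket B.m q ∈ B.annBar := by
  obtain ⟨q, hq⟩ := mem_boundaries.1 hp
  refine ⟨_, pr_mem B.grP_internal (j - 1) q, ?_⟩
  rw [← pr_bracket_m, ← map_sub]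
  exact pr_annBar j hq

variable (B) in
/-- The reduction modulo boundaries. -/
def toBoundaries : B.P ⧸ B.annBar →ₗ[Lam k] B.P ⧸ B.boundaries :=
  B.annBar.mapQ B.boundaries LinearMap.id le_sup_left

variable (B) in
/-- The projection to degree `j` modulo boundaries. -/
def prBoundaries (j : ℤ) : B.P ⧸ B.boundaries →ₗ[Lam k] B.P ⧸ B.boundaries :=
  B.boundaries.mapQ B.boundaries (pr B.grP_internal j) fun _ hp =>
    mem_boundaries.2 ((pr_boundaries j hp).imp fun _ h => h.2)

/-- The class modulo boundaries of an element of the tangent space. -/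
def tangentLift [CharZero k] (hB : B.VacuumPure) (i : ℤ) :
    (B.tangentSolutions i ⧸ B.tangentNull i) →ₗ[Lam k] B.P ⧸ B.boundaries :=
  (B.tangentNull i).liftQ ((B.toBoundaries ∘ₗ B.epsCoeff i) ∘ₗ (B.tangentSolutions i).subtype) (by
    rintro ⟨x, hx⟩ h
    obtain ⟨p, hp, -, rfl⟩ := exists_tmul_eq_of_mem_tangentSolutions hB hx
    obtain ⟨q, -, hq⟩ := (tmul_teps_mem_tangentNull hB hx).1 h
    change B.toBoundaries (B.epsCoeff i (p ⊗ₜ teps k i)) = 0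
    rw [epsCoeff_tmul_teps]
    exact (Submodule.Quotient.mk_eq_zero _).2 (mem_boundaries.2 ⟨q, hq⟩))

variable (B i) in
/-- The tangent space as a quotient of the solutions over `E_i`. -/
def tangentAddEquiv : B.TangentSpace i ≃+ (B.tangentSolutions i ⧸ B.tangentNull i) :=
  { B.tangentEquiv i with map_add' := fun _ _ => (B.tangentEquiv i).apply_symm_apply _ }

theorem tangentAddEquiv_smul (c : k) (x : B.TangentSpace i) :
    B.tangentAddEquiv i (c • x) = (C c : Lam k) • B.tangentAddEquiv i x :=
  (B.tangentEquiv i).apply_symm_apply _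

/-- The element of the tangent space given by a solution `p ⊗ ε`. -/
def tangentMk {p : B.P}
    (h : p ⊗ₜ teps k i ∈ B.solutions (tangentRing k i) (tangentRing k i).maxIdeal) :
    B.TangentSpace i :=
  Quot.mk _ ⟨p ⊗ₜ teps k i, h⟩

theorem exists_tangentMk (hB : B.VacuumPure) (x : B.TangentSpace i) :
    ∃ p ∈ B.grP i, B.bracket B.m p ∈ B.annBar ∧
    ∃ h : p ⊗ₜ teps k i ∈ B.solutions (tangentRing k i) (tangentRing k i).maxIdeal,
      x = tangentMk h := by
  obtain ⟨⟨x, hx⟩⟩ := x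
  obtain ⟨p, hp, hm, rfl⟩ :=
    exists_tmul_eq_of_mem_tangentSolutions hB ((B.mem_tangentSolutions i x).1 hx)
  exact ⟨p, hp, hm, hx, rfl⟩

variable [CharZero k] (hB : B.VacuumPure)

/-- The class modulo boundaries of an element of the tangent space. -/
def tangentClass (i : ℤ) : B.TangentSpace i →+ B.P ⧸ B.boundaries :=
  (tangentLift hB i).toAddMonoidHom.comp (B.tangentAddEquiv i).toAddMonoidHom

theorem tangentClass_mk {p : B.P}
    (h : p ⊗ₜ teps k i ∈ B.solutions (tangentRing k i) (tangentRing k i).maxIdeal) :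
    tangentClass hB i (tangentMk h) = B.boundaries.mkQ p := by
  change B.toBoundaries (B.epsCoeff i (p ⊗ₜ teps k i)) = _
  rw [epsCoeff_tmul_teps]
  rfl

theorem tangentClass_smul (c : k) (x : B.TangentSpace i) :
    tangentClass hB i (c • x) = (C c : Lam k) • tangentClass hB i x :=
  (congrArg (tangentLift hB i) (tangentAddEquiv_smul c x)).trans (map_smul _ _ _)

theorem tangentClass_injective : Function.Injective (tangentClass hB i) := by
  refine (injective_iff_map_eq_zero _).2 fun x hx => ?_
  obtain ⟨p, hp, -, h, rfl⟩ := exists_tangentMk hB x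
  rw [tangentClass_mk] at hx
  obtain ⟨q, hq, hpq⟩ := pr_boundaries i ((Submodule.Quotient.mk_eq_zero _).1 hx)
  rw [pr_of_mem _ hp] at hpq
  refine (B.tangentAddEquiv i).injective (Eq.trans ?_ (map_zero _).symm)
  exact (Submodule.Quotient.mk_eq_zero _).2
    ((tmul_teps_mem_tangentNull hB _).2 ⟨q, hq, hpq⟩)

theorem prBoundaries_tangentClass (j : ℤ) (x : B.TangentSpace i) :
    B.prBoundaries j (tangentClass hB i x) = if i = j then tangentClass hB i x else 0 := by
  obtain ⟨p, hp, -, h, rfl⟩ := exists_tangentMk hB x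
  rw [tangentClass_mk]
  change B.boundaries.mkQ (pr B.grP_internal j p) = _
  split_ifs with hij
  · rw [← hij, pr_of_mem _ hp]
  · rw [pr_of_mem_ne _ hp hij, map_zero]

/-- The class modulo boundaries of an element of the homology. -/
def homologyClass : B.Homology →+ B.P ⧸ B.boundaries :=
  DirectSum.toAddMonoid (tangentClass hB)

theorem homologyClass_lof (x : B.TangentSpace i) :
    homologyClass hB (DirectSum.lof k ℤ B.TangentSpace i x) = tangentClass hB i x :=
  DirectSum.toAddMonoid_of _ _ _

theorem homologyClass_smul (c : k) (x : B.Homology) :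
    homologyClass hB (c • x) = (C c : Lam k) • homologyClass hB x := by
  induction x using DirectSum.induction_on with
  | zero => rw [smul_zero, map_zero, smul_zero]
  | of i x =>
    rw [show c • DirectSum.of B.TangentSpace i x = DirectSum.lof k ℤ B.TangentSpace i (c • x) from
      ((DirectSum.lof k ℤ B.TangentSpace i).map_smul c x).symm, homologyClass_lof,
      tangentClass_smul]
    exact congrArg _ (homologyClass_lof hB x).symm
  | add x y hx hy => rw [smul_add, map_add, map_add, smul_add, hx, hy]

theorem prBoundaries_homologyClass (j : ℤ) (x : B.Homology) :
    B.prBoundaries j (homologyClass hB x) = tangentClass hB j (x j) := by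
  induction x using DirectSum.induction_on with
  | zero => rw [map_zero, map_zero, DirectSum.zero_apply, map_zero]
  | of i x =>
    refine (congrArg _ (homologyClass_lof hB x)).trans ?_
    rw [prBoundaries_tangentClass]
    split_ifs with h
    · subst h
      rw [DirectSum.of_eq_same]
    · rw [DirectSum.of_eq_of_ne _ _ _ (Ne.symm h), map_zero]
  | add x y hx hy => rw [map_add, map_add, hx, hy, DirectSum.add_apply, map_add]

theorem homologyClass_injective : Function.Injective (homologyClass hB) := by
  refine (injective_iff_map_eq_zero _).2 fun x hx => ?_
  ext j
  refine tangentClass_injective hB ?_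
  rw [← prBoundaries_homologyClass, hx, map_zero, DirectSum.zero_apply, map_zero]

theorem exists_homologyClass_eq {p : B.P} (hp : B.bracket B.m p ∈ B.annBar) :
    ∃ x, homologyClass hB x = B.boundaries.mkQ p := by
  classical
  obtain ⟨s, hs⟩ := exists_sum_pr B.grP_internal p
  have h : ∀ j, pr B.grP_internal j p ⊗ₜ teps k j ∈
      B.solutions (tangentRing k j) (tangentRing k j).maxIdeal := fun j => by
    rw [mem_tangentSolutions, tmul_teps_mem_tangentSolutions hB (pr_mem _ j p)]
    have := pr_annBar (j + 1) hp
    rwa [pr_bracket_m, add_sub_cancel_right] at this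
  refine ⟨∑ j ∈ s, DirectSum.lof k ℤ B.TangentSpace j (tangentMk (h j)), ?_⟩
  refine Eq.trans ?_ (congrArg _ (hs s subset_rfl))
  rw [map_sum, map_sum]
  refine sum_congr rfl fun j _ => ?_
  rw [homologyClass_lof, tangentClass_mk]


/-- A homogeneous basis of the homology is represented by a homology basis of cycles. -/
theorem exists_isHomologyBasis (hB : B.VacuumPure) {r : ℕ} (deg : Fin r → ℤ) (ξ : Module.Basis (Fin r) k B.Homology)
    (hξ : ∀ j, ξ j ∈ range (DirectSum.lof k ℤ B.TangentSpace (deg j))) :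
    ∃ p : Fin r → B.P, B.IsHomologyBasis deg p ∧ ∀ j, ∃ h : p j ⊗ₜ teps k (deg j) ∈
        B.solutions (tangentRing k (deg j)) (tangentRing k (deg j)).maxIdeal,
        ξ j = DirectSum.lof k ℤ B.TangentSpace (deg j) (tangentMk h) := by
  choose x hx using hξ
  choose p hp hm h hxp using fun j => exists_tangentMk hB (x j)
  have hc : ∀ j, homologyClass hB (ξ j) = B.boundaries.mkQ (p j) := fun j => by
    rw [← hx, homologyClass_lof, hxp, tangentClass_mk]
  have hsum : ∀ c : Fin r → k, homologyClass hB (∑ j, c j • ξ j) =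
      B.boundaries.mkQ (∑ j, (C (c j) : Lam k) • p j) := fun c => by
    rw [map_sum, map_sum]
    refine sum_congr rfl fun j _ => ?_
    rw [homologyClass_smul, hc, map_smul]
  refine ⟨p, ⟨hp, hm, fun y hy => ?_, fun c y hy => ?_⟩, fun j => ⟨h j, ?_⟩⟩
  · obtain ⟨z, hz⟩ := exists_homologyClass_eq hB hy
    refine ⟨ξ.repr z, mem_boundaries.1 ((Submodule.Quotient.eq _).1 ?_)⟩
    change B.boundaries.mkQ y = B.boundaries.mkQ _
    rw [← hz, ← hsum, ξ.sum_repr]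
  · have h0 : ∑ j, c j • ξ j = 0 := homologyClass_injective hB (by
      rw [hsum, map_zero]
      exact (Submodule.Quotient.mk_eq_zero _).2 (mem_boundaries.2 ⟨y, hy⟩))
    exact funext fun j => Fintype.linearIndependent_iff.1 ξ.linearIndependent c h0 j
  · rw [← hx, hxp]

end Background

end QBackground

end

open QBackground
theorem theorem3p6 {k : Type u} [Field k] [CharZero k] (B : Background.{u, v, w} k)
    (hB : B.VacuumPure) {r : ℕ} (deg : Fin r → ℤ) (ξ : Module.Basis (Fin r) k B.Homology)
    (hξ : ∀ j, ξ j ∈ LinearMap.range (DirectSum.lof k ℤ B.TangentSpace (deg j))) :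
    ∃ δ : GradedSeries k (fun j => -deg j) →ₗ[Lam k] GradedSeries k (fun j => -deg j),
      IsDifferential δ ∧
      (∀ x ∈ seriesMax k (fun j => -deg j), δ x ∈ seriesMax k (fun j => -deg j) ^ 2) ∧
      ∃ (R : CompleteRing k) (q : Presentation δ R) (Ξ : B.QMhat R),
        B.HomotopyRepresents R Ξ ∧
        ∀ (j : Fin r) (θ : ParamRing.Hom (R.obj 1) (tangentRing k (deg j))),
          (∀ l, θ.toAlgHom (q.proj 1 (tvar k (fun j => -deg j) l)) =
            if l = j then Eps.eps k else 0) →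
          DirectSum.lof k ℤ B.TangentSpace (deg j)
            (Background.QFT.map B θ (Quot.mk _ (Ξ.app 1))) = ξ j := by
  obtain ⟨p, hp, hξp⟩ := Background.exists_isHomologyBasis hB deg ξ hξ
  obtain ⟨δ, hδ, hδ2, R, q, Ξ, hV⟩ := Background.exists_versalTower hB hp
  refine ⟨δ, hδ, hδ2, R, q, Ξ, hV.homotopyRepresents hB, fun j θ hθ => ?_⟩
  obtain ⟨h, hj⟩ := hξp j
  rw [hj]
  refine congrArg _ (congrArg (Quot.mk _) (Subtype.ext ?_))
  have hmul : ∀ x ∈ genIdeal k (fun j => q.proj 1 (tvar k (fun j => -deg j) j)) ^ 2,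
      θ.toAlgHom x = 0 := by
    rw [← hV.max 1]
    have hle : (R.obj 1).maxIdeal ^ 2 ≤ LinearMap.ker θ.toAlgHom.toLinearMap := by
      rw [pow_two, Submodule.mul_le]
      intro x hx y hy
      exact (map_mul θ.toAlgHom x y).trans
        (Background.tangent_mul (deg j) (θ.map_max hx) (θ.map_max hy))
    exact fun x hx => hle hx
  refine (Background.push_eq_sum (X := (tangentRing k (deg j)).toDGAlg) (hV.versal 1).linear
    θ.toAlgHom.toLinearMap hmul).trans ?_
  refine (Finset.sum_eq_single j (fun l _ hl => ?_) (fun h => absurd (Finset.mem_univ j) h)).trans ?_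
  · refine (congrArg _ ((hθ l).trans (if_neg hl))).trans ?_
    exact TensorProduct.tmul_zero _ _
  · exact congrArg _ ((hθ j).trans (if_pos rfl))
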